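/- **Setting.** Let $d\ge 2$, $0<\gamma\le 1$, $\langle v\rangle=(1+|v|^2)^{1/2}$, and let $b\ge 0$ be a Borel function such that, for each unit vector $e$, $b(e\cdot\sigma)$ does not vanish for almost every $\sigma\in S^{d-1}$. For $\beta>0$ put $$A_\beta=\int_{S^{d-1}} b(e\cdot\sigma)\,\sin^\beta\theta\,d\sigma ,\qquad \cos\theta=e\cdot\sigma ,$$ which does not depend on the unit vector $e$. Consider the spatially homogeneous Boltzmann equation $\partial_t f=Q(f,f)$ on $\mathbb R^d$ with collision kernel $B(|u|,\hat u\cdot\sigma)=|u|^\gamma\, b(\hat u\cdot\sigma)$, where $u=v-v_*$, $\hat u=u/|u|$, $v'=\frac{v+v_*}{2}+\frac{|u|}{2}\sigma$, $v'_*=\frac{v+v_*}{2}-\frac{|u|}{2}\sigma$. A *solution* is a conservative weak solution: a family $(f_t)_{t\ge0}$ of nonnegative Borel measures on $\mathbb R^d$ (if $f$ is a function, $f_t(dv)=f(t,v)\,dv$) whose initial mass $m=\int f_0(dv)$ and energy $E=\int |v|^2 f_0(dv)$ are finite (that is, $f_0\in L^1_2$), whose mass and energy at every time $t\ge 0$ are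 $m$ and $E$, and which satisfies, for all $\varphi\in C_c^\infty(\mathbb R^d)$ and $t\ge 0$, $$\int\varphi\,df_t=\int\varphi\,df_0+\int_0^t\frac12\iint G_\varphi(v,v_*)\,f_\tau(dv)\,f_\tau(dv_*)\,d\tau ,$$ $$G_\varphi(v,v_*)=\int_{S^{d-1}}\big(\varphi(v')+\varphi(v'_*)-\varphi(v)-\varphi(v_*)\big)\,B(|u|,\hat u\cdot\sigma)\,d\sigma .$$ Here it is part of the definition that $G_\varphi$ is $f_\tau\otimes f_\tau$-integrable for a.e. $\tau>0$ and that its integral is a locally integrable function of $\tau\in[0,\infty)$. The integral defining $G_\varphi$ is understood with the azimuthal cancellation: writing $\sigma=\cos\theta\,\hat u+\sin\theta\,\omega$ with $\omega\perp\hat u$, $|\omega|=1$, the integrand is averaged over $\omega$ and $-\omega$. Let $\mathcal E_a(x)=\sum_{q=0}^\infty \frac{x^q}{\Gamma(aq+1)}$ be the Mittag-Leffler function. **Theorem (generation and propagation of exponential-like moments).** (a) Suppose $A_2<\infty$. Then for all $m,E\ge0$ there are constants $C,\alpha>0$, depending only on $d,b,\gamma,m,E$, such that every solution with initial mass $m$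 and initial energy $E$ satisfies $$\int_{\mathbb R^d} e^{\alpha\min\{t,1\}\,|v|^\gamma}\,f_t(dv)\le C\qquad\text{for all } t\ge0 .$$ (b) Let $s\in(0,2)$ and suppose $A_\beta<\infty$ with $\beta=2$ if $s\in(0,1]$, and with $\beta=\frac4s-2$ if $s\in(1,2)$. Then for all $m,E\ge 0$, $\alpha_0>0$ and $M_0\in\mathbb R$ there are constants $C,\alpha>0$, depending only on $d,b,\gamma,s,m,E,\alpha_0,M_0$, such that every solution with initial mass $m$, initial energy $E$ and $$\int_{\mathbb R^d}\mathcal E_{2/s}\big(\alpha_0^{2/s}\langle v\rangle^2\big)\,f_0(dv)<M_0$$ satisfies $$\int_{\mathbb R^d}\mathcal E_{2/s}\big(\alpha^{2/s}\langle v\rangle^2\big)\,f_t(dv)<C\qquad\text{for all } t\ge0 .$$ -/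

import Mathlib

open MeasureTheory Set
open scoped ENNReal NNReal RealInnerProductSpace

namespace Boltzmann

noncomputable section

/-- Velocity space `ℝ^d` with its Euclidean norm. -/
abbrev Vel (d : ℕ) : Type := EuclideanSpace ℝ (Fin d)

/-- The unit sphere `S^{d-1}` of `ℝ^d`. -/
abbrev Sph (d : ℕ) : Type := Metric.sphere (0 : Vel d) 1

/-- The surface measure `dσ` on `S^{d-1}`. -/
abbrev surf (d : ℕ) : Measure (Sph d) := (volume : Measure (Vel d)).toSphere

/-- The angular kernel: a nonnegative Borel function `b` of `cos θ`, such that `b(e · σ) dσ` is a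
nonzero measure on the sphere (for each axis `e`). -/
structure IsAngularKernel (d : ℕ) (b : ℝ → ℝ) : Prop where
  measurable : Measurable b
  nonneg : ∀ x, 0 ≤ b x
  nontrivial : ∀ e : Vel d, ‖e‖ = 1 → ¬ ∀ᵐ σ : Sph d ∂(surf d), b ⟪e, (σ : Vel d)⟫ = 0

/-- `A_β = ∫_{S^{d-1}} b(e · σ) sin^β θ dσ`, where `cos θ = e · σ`; it does not depend on the
unit vector `e`. -/
def angularMoment {d : ℕ} (b : ℝ → ℝ) (β : ℝ) (e : Vel d) : ℝ≥0∞ :=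
  ∫⁻ σ : Sph d, ENNReal.ofReal
    (b ⟪e, (σ : Vel d)⟫ * Real.sin (Real.arccos ⟪e, (σ : Vel d)⟫) ^ β) ∂(surf d)

/-- The non-cutoff condition `A_β < ∞`. -/
def NonCutoff (d : ℕ) (b : ℝ → ℝ) (β : ℝ) : Prop :=
  ∀ e : Vel d, ‖e‖ = 1 → angularMoment b β e < ∞

/-- The direction `û = u / |u|` of the relative velocity `u = v - v_*` (zero if `v = v_*`). -/
def relDir {d : ℕ} (v w : Vel d) : Vel d := ‖v - w‖⁻¹ • (v - w)

/-- `v' = (v + v_*)/2 + |v - v_*| σ / 2`. -/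
def postVel {d : ℕ} (v w σ : Vel d) : Vel d :=
  (1 / 2 : ℝ) • (v + w) + (‖v - w‖ / 2) • σ

/-- `v'_* = (v + v_*)/2 - |v - v_*| σ / 2`. -/
def postVelStar {d : ℕ} (v w σ : Vel d) : Vel d :=
  (1 / 2 : ℝ) • (v + w) - (‖v - w‖ / 2) • σ

/-- `Δφ = φ(v') + φ(v'_*) - φ(v) - φ(v_*)`. -/
def collDiff {d : ℕ} (φ : Vel d → ℝ) (v w σ : Vel d) : ℝ :=
  φ (postVel v w σ) + φ (postVelStar v w σ) - φ v - φ w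

/-- The collision kernel `B(|u|, û · σ) = |u|^γ b(cos θ)`. -/
def collKernel {d : ℕ} (γ : ℝ) (b : ℝ → ℝ) (v w σ : Vel d) : ℝ :=
  ‖v - w‖ ^ γ * b ⟪relDir v w, σ⟫

/-- Half-turn about the axis `e`: it sends `σ = cos θ e + sin θ ω` (with `ω ⟂ e`) to
`cos θ e - sin θ ω`. -/
def halfTurn {d : ℕ} (e σ : Vel d) : Vel d := (2 * ⟪e, σ⟫) • e - σ

/-- The weight `G_φ(v, v_*) = ∫_{S^{d-1}} Δφ B(|u|, û · σ) dσ` of the weak formulation.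

For `b(cos θ) sin^2 θ` integrable but `b(cos θ) sin θ` not, this integral has to be read with
the azimuthal cancellation: in `σ = cos θ û + sin θ ω` one integrates first over the unit
vectors `ω ⟂ û` and then over `θ`. The integral over `ω` is unchanged if `ω` is replaced by `-ω`,
so the integrand is averaged here over `ω` and `-ω`; for `φ` of class `C^2` the average is
`O(sin^2 θ)` and the integral converges absolutely. Where the plain integral converges
absolutely, it has the same value: see `collWeight_eq_integral` below. (Applied to truncations
of `b`, that also identifies `G_φ` with the principal value of the plain integral.) -/
def collWeight {d : ℕ} (γ : ℝ) (b : ℝ → ℝ) (φ : Vel d → ℝ) (v w : Vel d) : ℝ :=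
  ∫ σ : Sph d, (collDiff φ v w (σ : Vel d) + collDiff φ v w (halfTurn (relDir v w) (σ : Vel d))) / 2 *
    collKernel γ b v w (σ : Vel d) ∂(surf d)

/-- Mass `∫ f dv`. -/
def mass {d : ℕ} (μ : Measure (Vel d)) : ℝ≥0∞ := μ univ

/-- Energy `∫ f |v|^2 dv`. -/
def energy {d : ℕ} (μ : Measure (Vel d)) : ℝ≥0∞ := ∫⁻ v, ENNReal.ofReal (‖v‖ ^ 2) ∂μ

/-- Conservative weak solutions of the homogeneous Boltzmann equation `∂_t f = Q(f, f)` with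
kernel `|u|^γ b(cos θ)`, on `[0, ∞)`. The state at time `t` is a nonnegative measure `F t` on
velocity space; for a solution that is a function, `F t` is the measure `f(t, v) dv`.
Initial mass and energy are finite (the initial datum is in `L^1_2`) and conserved,
and the time-integrated weak form
`∫ φ dF_t = ∫ φ dF_0 + ∫_0^t (1/2) ∬ G_φ dF_τ dF_τ dτ`
holds, with convergent integrals, for all smooth compactly supported `φ`. -/
structure IsWeakSolution {d : ℕ} (γ : ℝ) (b : ℝ → ℝ) (F : ℝ → Measure (Vel d)) : Prop where
  mass_lt_top : mass (F 0) < ∞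
  energy_lt_top : energy (F 0) < ∞
  mass_eq : ∀ t, 0 ≤ t → mass (F t) = mass (F 0)
  energy_eq : ∀ t, 0 ≤ t → energy (F t) = energy (F 0)
  integrable_weight : ∀ φ : Vel d → ℝ, ContDiff ℝ (⊤ : ℕ∞) φ → HasCompactSupport φ →
    ∀ᵐ τ ∂(volume.restrict (Ioi (0 : ℝ))),
      Integrable (fun p : Vel d × Vel d => collWeight γ b φ p.1 p.2) ((F τ).prod (F τ))
  integrable_time : ∀ φ : Vel d → ℝ, ContDiff ℝ (⊤ : ℕ∞) φ → HasCompactSupport φ →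
    ∀ t, 0 ≤ t → IntervalIntegrable
      (fun τ => ∫ p : Vel d × Vel d, collWeight γ b φ p.1 p.2 ∂((F τ).prod (F τ))) volume 0 t
  weak_form : ∀ φ : Vel d → ℝ, ContDiff ℝ (⊤ : ℕ∞) φ → HasCompactSupport φ → ∀ t, 0 ≤ t →
    ∫ v, φ v ∂(F t) = ∫ v, φ v ∂(F 0) +
      ∫ τ in (0 : ℝ)..t,
        (1 / 2) * ∫ p : Vel d × Vel d, collWeight γ b φ p.1 p.2 ∂((F τ).prod (F τ))

/-- `⟨v⟩ = (1 + |v|^2)^{1/2}`. -/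
def bracket {d : ℕ} (v : Vel d) : ℝ := Real.sqrt (1 + ‖v‖ ^ 2)

/-- The Mittag-Leffler function `E_a(x) = ∑_{q ≥ 0} x^q / Γ(a q + 1)`, `a > 0`. -/
def mittagLeffler (a x : ℝ) : ℝ := ∑' q : ℕ, x ^ q / Real.Gamma (a * q + 1)

/-- The Mittag-Leffler moment of order `s` and rate `α`:
`∫ f(v) E_{2/s}(α^{2/s} ⟨v⟩^2) dv`. -/
def mlMoment {d : ℕ} (s α : ℝ) (μ : Measure (Vel d)) : ℝ≥0∞ :=
  ∫⁻ v, ENNReal.ofReal (mittagLeffler (2 / s) (α ^ (2 / s) * bracket v ^ 2)) ∂μ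

/-! Consistency of `collWeight` with the plain spherical integral. -/

theorem halfTurn_eq_reflection {d : ℕ} (e σ : Vel d) (he : ‖e‖ = 1 ∨ e = 0) :
    halfTurn e σ = (Submodule.span ℝ {e}).reflection σ := by
  rw [Submodule.reflection_singleton_apply]
  rcases he with he | rfl
  · simp [halfTurn, he, mul_smul, two_smul]
  · simp [halfTurn]

theorem relDir_norm {d : ℕ} (v w : Vel d) : ‖relDir v w‖ = 1 ∨ relDir v w = 0 := by
  by_cases h : v - w = 0
  · right; simp [relDir, h]
  · left
    rw [relDir, norm_smul, norm_inv, norm_norm, inv_mul_cancel₀ (norm_ne_zero_iff.2 h)]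

/-- A linear isometry of `ℝ^d`, acting on the unit sphere. -/
def sphereMap {d : ℕ} (L : Vel d ≃ₗᵢ[ℝ] Vel d) (σ : Sph d) : Sph d :=
  ⟨L σ, by simp⟩

open scoped Pointwise in
theorem sphereMap_measurePreserving {d : ℕ} (L : Vel d ≃ₗᵢ[ℝ] Vel d) :
    MeasurePreserving (sphereMap L) (surf d) (surf d) := by
  have hm : Measurable (sphereMap L) :=
    (L.continuous.comp continuous_subtype_val).measurable.subtype_mk
  refine ⟨hm, ?_⟩
  ext s hs
  rw [Measure.map_apply hm hs, Measure.toSphere_apply' _ (hm hs), Measure.toSphere_apply' _ hs]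
  congr 1
  have key : Ioo (0 : ℝ) 1 • ((↑) '' (sphereMap L ⁻¹' s) : Set (Vel d)) =
      L ⁻¹' (Ioo (0 : ℝ) 1 • ((↑) '' s : Set (Vel d))) := by
    ext x
    simp only [Set.mem_smul, mem_image, mem_preimage]
    constructor
    · rintro ⟨r, hr, _, ⟨σ, hσ, rfl⟩, rfl⟩
      exact ⟨r, hr, _, ⟨sphereMap L σ, hσ, rfl⟩, by simp [sphereMap]⟩
    · rintro ⟨r, hr, _, ⟨σ, hσ, rfl⟩, hx⟩
      refine ⟨r, hr, _, ⟨sphereMap L.symm σ, ?_, rfl⟩, ?_⟩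
      · have : sphereMap L (sphereMap L.symm σ) = σ := Subtype.ext (by simp [sphereMap])
        rwa [this]
      · apply L.injective
        rw [← hx]; simp [sphereMap]
  rw [key]
  exact L.measurePreserving.measure_preimage_emb L.toHomeomorph.measurableEmbedding _

/-- If the plain integral `∫ Δφ B dσ` converges absolutely, it equals `collWeight`. -/
theorem collWeight_eq_integral {d : ℕ} (γ : ℝ) (b : ℝ → ℝ) (φ : Vel d → ℝ) (v w : Vel d)
    (h : Integrable (fun σ : Sph d =>
      collDiff φ v w (σ : Vel d) * collKernel γ b v w (σ : Vel d)) (surf d)) :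
    collWeight γ b φ v w =
      ∫ σ : Sph d, collDiff φ v w (σ : Vel d) * collKernel γ b v w (σ : Vel d) ∂(surf d) := by
  set e := relDir v w with he
  set L := (Submodule.span ℝ {e}).reflection with hL
  have hp := sphereMap_measurePreserving L
  have hv : ∀ σ : Sph d, ((sphereMap L σ : Sph d) : Vel d) = halfTurn e (σ : Vel d) :=
    fun σ => (halfTurn_eq_reflection e σ (relDir_norm v w)).symm
  have hk : ∀ σ : Sph d,
      collKernel γ b v w (sphereMap L σ : Sph d) = collKernel γ b v w (σ : Vel d) := by
    intro σ
    rw [hv]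
    have : ⟪e, halfTurn e (σ : Vel d)⟫ = ⟪e, (σ : Vel d)⟫ := by
      rcases relDir_norm v w with h1 | h1
      · rw [halfTurn, inner_sub_right, inner_smul_right, real_inner_self_eq_norm_sq, he, h1]; ring
      · rw [he, h1]; simp
    rw [collKernel, collKernel, ← he, this]
  have hinv : Function.Involutive (sphereMap L) := fun σ => Subtype.ext (by
    change L (L (σ : Vel d)) = σ
    rw [hL, Submodule.reflection_reflection])
  have hemb : MeasurableEmbedding (sphereMap L) :=
    (MeasurableEquiv.ofInvolutive (sphereMap L) hinv hp.measurable).measurableEmbedding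
  have h2 := (hp.integrable_comp_emb hemb).2 h
  have h3 := hp.integral_comp hemb
    (fun σ : Sph d => collDiff φ v w (σ : Vel d) * collKernel γ b v w (σ : Vel d))
  simp only [Function.comp_def, hk] at h2 h3
  simp only [hv] at h2 h3
  rw [collWeight, ← he]
  have : ∀ σ : Sph d, (collDiff φ v w (σ : Vel d) + collDiff φ v w (halfTurn e (σ : Vel d))) / 2 *
      collKernel γ b v w (σ : Vel d) =
      (1 / 2) * (collDiff φ v w (σ : Vel d) * collKernel γ b v w (σ : Vel d)) +
      (1 / 2) * (collDiff φ v w (halfTurn e (σ : Vel d)) * collKernel γ b v w (σ : Vel d)) := by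
    intro σ; ring
  simp only [this]
  rw [integral_add (h.const_mul _) (h2.const_mul _), integral_const_mul, integral_const_mul, h3]
  ring

end

end Boltzmann

open Boltzmann

namespace Boltzmann

/-! Test the equation with radial functions g(|v|²). After averaging over the half-turn the
collision difference is `energyDiff g X Y a h`: the energies X = |v|², Y = |w|² are mixed with
weights a = cos²(θ/2) and 1 − a, and shifted by ±h, where h² ≤ sin²θ · XY (`energyShift_sq_le`). For
convex g the mixing is a loss, and the shift costs a second difference, which carries the factor
sin²θ that makes the angular integral converge.

Polynomial moments come from smooth versions of the tails (|v|² − Z)⁺, which become compactly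
supported after subtraction of conserved quantities. A Povzner inequality gives a loss of order Z
∫_{|v|² ≥ 4Z} |v|^γ against a gain of order Z^{γ/2} f{|v|² ≥ Z/2} (`exists_tail_decay`). Summed over
dyadic Z with weights Z^{a−1}, this bounds the moment of |v|^{2a} and makes that of |v|^{2a+γ}
integrable in time (`IsWeakSolution.normMoment_step`). Finite energy starts the induction
(`IsWeakSolution.lintegral_normMoment_lt_top`). With all moments finite, the weak form extends to
radial functions of polynomial growth (`IsWeakSolution.integral_sub_of_polyBound`).

Exponential moments are approximated by the weights g_n(A) = (1 + A^p/n)^n, A = K + κ|v|², with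
constants independent of n. In a non-grazing collision the concavity of A^p makes the outgoing
weights much smaller than g_n(A) g_n(B), unless A is bounded (`exists_truncExp_nongrazing_le`). In a
grazing one the averaged difference is O(sin^{2q}θ) g_n(A) g_n(B), provided (1 + q)p ≤ 1
(`exists_truncExp_grazing_le`). With p = s/2 this condition is the origin of β = 2q = 4/s − 2 for s
> 1, and it allows q = 1 for s ≤ 1. A small enough grazing zone contributes little, and one obtains,
for M = ∫ g_n f and Λ = ∫ ⟨v⟩^γ g_n f, an inequality M' ≤ −cΛ + CM + ηΛM with η as small as desired
and c independent of η.

Taking η = c/(2N) below a barrier N for M makes the quadratic term harmless. For generation p = γ/2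
and the rate grows linearly in time, which costs at most αΛ. For propagation the rate is fixed and
so small that M starts below the barrier. Fatou's lemma removes n. Mittag-Leffler functions are
exponentials up to constants, also in the rate (`mittagLeffler_le_exp`,
`exists_exp_le_mittagLeffler`). -/

/-! ### Second differences in the energy variable -/

/-- The collision difference of `v ↦ g (‖v‖ ^ 2)`, averaged over a half-turn, in the energies `X`, `Y` of
the colliding particles; `a = cos² (θ / 2)`. -/
noncomputable def energyDiff (g : ℝ → ℝ) (X Y a h : ℝ) : ℝ :=
  (g (a * X + (1 - a) * Y + h) + g (a * X + (1 - a) * Y - h)) / 2 +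
    (g ((1 - a) * X + a * Y + h) + g ((1 - a) * X + a * Y - h)) / 2 - g X - g Y

theorem energyDiff_one_sub (g : ℝ → ℝ) (X Y a h : ℝ) :
    energyDiff g X Y (1 - a) h = energyDiff g X Y a h := by
  simp only [energyDiff, sub_sub_cancel]
  ring

theorem energyDiff_neg (g : ℝ → ℝ) (X Y a h : ℝ) :
    energyDiff g X Y a (-h) = energyDiff g X Y a h := by
  simp only [energyDiff, sub_neg_eq_add, ← sub_eq_add_neg]
  ring

/-- Midpoint concavity of g(ξ) − Mξ²/2. Only an upper bound on the second derivative is required. -/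
theorem second_diff_le {g g' g'' : ℝ → ℝ} {x h M : ℝ} (h0 : 0 ≤ h)
    (hg : ∀ ξ ∈ Icc (x - h) (x + h), HasDerivAt g (g' ξ) ξ)
    (hg' : ∀ ξ ∈ Icc (x - h) (x + h), HasDerivAt g' (g'' ξ) ξ)
    (hM : ∀ ξ ∈ Icc (x - h) (x + h), g'' ξ ≤ M) :
    (g (x + h) + g (x - h)) / 2 - g x ≤ h ^ 2 / 2 * M := by
  have hc : ConcaveOn ℝ (Icc (x - h) (x + h)) (fun ξ => g ξ - M / 2 * ξ ^ 2) := by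
    refine concaveOn_of_hasDerivWithinAt2_nonpos (f' := fun ξ => g' ξ - M / 2 * (2 * ξ))
      (f'' := fun ξ => g'' ξ - M / 2 * 2) (convex_Icc _ _) ?_ ?_ ?_ ?_
    · intro ξ hξ
      exact ((hg ξ hξ).continuousAt.sub (by fun_prop)).continuousWithinAt
    · intro ξ hξ
      have := (hg ξ (interior_subset hξ)).fun_sub (((hasDerivAt_pow 2 ξ)).const_mul (M / 2))
      simpa using this.hasDerivWithinAt
    · intro ξ hξ
      have := (hg' ξ (interior_subset hξ)).fun_sub (((hasDerivAt_id ξ).const_mul 2).const_mul (M / 2))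
      simpa using this.hasDerivWithinAt
    · intro ξ hξ
      linarith [hM ξ (interior_subset hξ)]
  have := hc.2 (left_mem_Icc.2 (by linarith)) (right_mem_Icc.2 (by linarith))
    (by norm_num : (0 : ℝ) ≤ 1 / 2) (by norm_num : (0 : ℝ) ≤ 1 / 2) (by norm_num)
  simp only [smul_eq_mul] at this
  have e : 1 / 2 * (x - h) + 1 / 2 * (x + h) = x := by ring
  rw [e] at this
  nlinarith

/-! ### The functions `y ↦ (1 + y / n) ^ n` -/

/-- `(1 + y / n) ^ n`, a polynomial approximation of `exp y`. -/
noncomputable def expPow (n : ℕ) (y : ℝ) : ℝ := (1 + y / n) ^ n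

/-- `y / (1 + y / n)`, the logarithmic derivative of `expPow n` with respect to `log y`. -/
noncomputable def expRate (n : ℕ) (y : ℝ) : ℝ := y / (1 + y / n)

section expPow
variable {n : ℕ} {y z l : ℝ}

theorem one_le_expPow (hy : 0 ≤ y) : 1 ≤ expPow n y := by
  unfold expPow
  exact one_le_pow₀ (by linarith [div_nonneg hy n.cast_nonneg])

theorem expPow_pos (hy : 0 ≤ y) : 0 < expPow n y := one_pos.trans_le (one_le_expPow hy)

theorem expPow_mono (hy : 0 ≤ y) (hyz : y ≤ z) : expPow n y ≤ expPow n z := by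
  unfold expPow
  have := div_nonneg hy (n.cast_nonneg (α := ℝ))
  gcongr

theorem expPow_le_exp (hy : 0 ≤ y) : expPow n y ≤ Real.exp y := by
  rcases Nat.eq_zero_or_pos n with rfl | hn
  · simpa [expPow] using hy
  have hn' : (0 : ℝ) < n := by exact_mod_cast hn
  have h0 := div_nonneg hy hn'.le
  calc expPow n y ≤ (Real.exp (y / n)) ^ n := by
        unfold expPow
        gcongr
        linarith [Real.add_one_le_exp (y / n)]
    _ = Real.exp y := by
        rw [← Real.exp_nat_mul]; congr 1; field_simp

/-- 1 + a + b ≤ (1 + a)(1 + b). The truncation keeps this half of the exponential law, by which an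
exponent A^p + B^p produces the product of two weights. -/
theorem expPow_add_le (hy : 0 ≤ y) (hz : 0 ≤ z) : expPow n (y + z) ≤ expPow n y * expPow n z := by
  unfold expPow
  have h1 := div_nonneg hy (n.cast_nonneg (α := ℝ))
  have h2 := div_nonneg hz (n.cast_nonneg (α := ℝ))
  rw [← mul_pow]
  gcongr
  rw [add_div]
  nlinarith [mul_nonneg h1 h2]

theorem expRate_nonneg (hy : 0 ≤ y) : 0 ≤ expRate n y := by
  unfold expRate; positivity

theorem expRate_le (hy : 0 ≤ y) : expRate n y ≤ y := by
  unfold expRate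
  exact div_le_self hy (by linarith [div_nonneg hy (n.cast_nonneg (α := ℝ))])

theorem expRate_mono (hy : 0 ≤ y) (hyz : y ≤ z) : expRate n y ≤ expRate n z := by
  unfold expRate
  have h1 := div_nonneg hy (n.cast_nonneg (α := ℝ))
  have h2 := div_nonneg (hy.trans hyz) (n.cast_nonneg (α := ℝ))
  rw [div_le_div_iff₀ (by linarith) (by linarith)]
  have : y * (z / n) = z * (y / n) := by ring
  nlinarith

/-- With r = `expRate n y` one has exactly 1 + ly/n = (1 − (1 − l)r/n)(1 + y/n); then use 1 + x ≤
exp x and take the n-th power. It replaces e^{ly} = e^{−(1−l)y} e^y, with r instead of y in the gain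
because the truncation grows only polynomially. -/
theorem expPow_mul_le (hn : n ≠ 0) (hy : 0 ≤ y) (hl : 0 ≤ l) :
    expPow n (l * y) ≤ Real.exp (-(1 - l) * expRate n y) * expPow n y := by
  have hn' : (0 : ℝ) < n := by positivity
  have h1 := div_nonneg hy hn'.le
  have key : 1 + l * y / n ≤ Real.exp (-(1 - l) * expRate n y / n) * (1 + y / n) := by
    have h2 : -(1 - l) * expRate n y / n + 1 ≤ Real.exp (-(1 - l) * expRate n y / n) :=
      Real.add_one_le_exp _
    have h3 : (-(1 - l) * expRate n y / n + 1) * (1 + y / n) = 1 + l * y / n := by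
      unfold expRate
      have : (1 + y / n) ≠ 0 := by linarith
      field_simp
      ring
    rw [← h3]
    gcongr
  calc expPow n (l * y) ≤ (Real.exp (-(1 - l) * expRate n y / n) * (1 + y / n)) ^ n := by
        unfold expPow
        have : 0 ≤ l * y / n := by positivity
        gcongr
    _ = _ := by
        rw [mul_pow, ← Real.exp_nat_mul]
        unfold expPow
        congr 2
        field_simp

/-- For `n` large, `expRate n y` can only be small if `y` is. -/
theorem le_of_expRate_le {T : ℝ} (hy : 0 ≤ y) (hT : expRate n y ≤ T) (hn : 2 * T ≤ n) (hn0 : n ≠ 0) :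
    y ≤ 2 * T := by
  have hn' : (0 : ℝ) < n := by positivity
  have h1 := div_nonneg hy hn'.le
  unfold expRate at hT
  rw [div_le_iff₀ (by linarith)] at hT
  have hT0 : 0 ≤ T := by
    by_contra h
    push Not at h
    nlinarith
  have : T * (y / n) ≤ y / 2 := by
    have : T / n ≤ 1 / 2 := by
      rw [div_le_iff₀ hn']; linarith
    calc T * (y / n) = T / n * y := by ring
      _ ≤ 1 / 2 * y := by gcongr
      _ = y / 2 := by ring
  linarith

/-- Bernoulli's inequality with exponent n/m ≥ 1. A lower bound for one truncation thereby holds for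
all later ones. -/
theorem expPow_mono_left {m : ℕ} (hm : m ≠ 0) (hmn : m ≤ n) (hy : 0 ≤ y) :
    expPow m y ≤ expPow n y := by
  have hm' : (0 : ℝ) < m := by positivity
  have hn' : (0 : ℝ) < n := hm'.trans_le (by exact_mod_cast hmn)
  have hb : 1 + (n / m : ℝ) * (y / n) ≤ (1 + y / n) ^ (n / m : ℝ) :=
    one_add_mul_self_le_rpow_one_add (by linarith [div_nonneg hy hn'.le])
      ((one_le_div hm').2 (by exact_mod_cast hmn))
  have h0 : 0 ≤ 1 + y / n := by linarith [div_nonneg hy hn'.le]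
  calc expPow m y = (1 + (n / m : ℝ) * (y / n)) ^ m := by
        unfold expPow; congr 2; field_simp
    _ ≤ ((1 + y / n) ^ (n / m : ℝ)) ^ m := by
        have := div_nonneg hy hn'.le
        gcongr
    _ = expPow n y := by
        rw [← Real.rpow_natCast, ← Real.rpow_mul h0, div_mul_cancel₀ _ hm'.ne', Real.rpow_natCast]
        rfl

end expPow

/-- `t ^ q * exp (-c t)` is bounded on `[0, ∞)`. -/
theorem exists_rpow_mul_exp_neg_le (q c : ℝ) (hq : 0 ≤ q) (hc : 0 < c) :
    ∃ C : ℝ, 0 < C ∧ ∀ t : ℝ, 0 ≤ t → t ^ q * Real.exp (-c * t) ≤ C := by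
  have ht := tendsto_rpow_mul_exp_neg_mul_atTop_nhds_zero q c hc
  obtain ⟨T, hT⟩ := Filter.eventually_atTop.1 (ht.eventually (gt_mem_nhds (zero_lt_one)))
  refine ⟨max T 1 ^ q + 1, by positivity, fun t h0 => ?_⟩
  rcases le_total T t with h | h
  · have := (hT t h).le
    have : (0 : ℝ) ≤ max T 1 ^ q := by positivity
    linarith
  · have h1 : t ^ q ≤ max T 1 ^ q := Real.rpow_le_rpow h0 (h.trans (le_max_left _ _)) hq
    have h2 : Real.exp (-c * t) ≤ 1 := Real.exp_le_one_iff.2 (by nlinarith)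
    have h3 : 0 ≤ t ^ q := Real.rpow_nonneg h0 q
    nlinarith [Real.exp_pos (-c * t)]

/-! ### Truncated stretched exponentials -/

/-- A polynomially growing approximation of `A ↦ exp (A ^ p)`. -/
noncomputable def truncExp (p : ℝ) (n : ℕ) (A : ℝ) : ℝ := expPow n (A ^ p)

/-- The derivative of `truncExp p n`. -/
noncomputable def truncExpDeriv (p : ℝ) (n : ℕ) (A : ℝ) : ℝ :=
  p * A ^ (p - 1) * (1 + A ^ p / n) ^ (n - 1)

/-- The second derivative of `truncExp p n`. -/
noncomputable def truncExpDeriv2 (p : ℝ) (n : ℕ) (A : ℝ) : ℝ :=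
  p * A ^ (p - 2) * (1 + A ^ p / n) ^ (n - 2) * ((p - 1) + A ^ p * (p - 1 / n))

section truncExp
variable {p : ℝ} {n : ℕ} {A B : ℝ}

theorem hasDerivAt_truncExp (hn : n ≠ 0) (hA : 0 < A) :
    HasDerivAt (truncExp p n) (truncExpDeriv p n A) A := by
  have hn' : (n : ℝ) ≠ 0 := by exact_mod_cast hn
  have h1 : HasDerivAt (fun x : ℝ => x ^ p) (p * A ^ (p - 1)) A :=
    Real.hasDerivAt_rpow_const (Or.inl hA.ne')
  have h2 := (((h1.div_const (n : ℝ)).const_add 1).fun_pow n)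
  refine h2.congr_deriv ?_
  unfold truncExpDeriv
  field_simp

theorem hasDerivAt_truncExpDeriv (hn : 2 ≤ n) (hA : 0 < A) :
    HasDerivAt (truncExpDeriv p n) (truncExpDeriv2 p n A) A := by
  have hn' : (n : ℝ) ≠ 0 := by positivity
  have h1 : HasDerivAt (fun x : ℝ => x ^ p) (p * A ^ (p - 1)) A :=
    Real.hasDerivAt_rpow_const (Or.inl hA.ne')
  have h0 : HasDerivAt (fun x : ℝ => x ^ (p - 1)) ((p - 1) * A ^ (p - 1 - 1)) A :=
    Real.hasDerivAt_rpow_const (Or.inl hA.ne')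
  have h2 := ((h0.const_mul p).fun_mul (((h1.div_const (n : ℝ)).const_add 1).fun_pow (n - 1)))
  refine h2.congr_deriv ?_
  unfold truncExpDeriv2
  obtain ⟨k, rfl⟩ := Nat.exists_eq_add_of_le hn
  have e1 : 2 + k - 1 = k + 1 := by omega
  have e2 : 2 + k - 2 = k := by omega
  rw [e1, e2]
  have e3 : A ^ (p - 1 - 1) = A ^ (p - 2) := by congr 1; ring
  have e4 : A ^ (p - 1) = A ^ (p - 2) * A := by
    rw [← Real.rpow_add_one hA.ne']; congr 1; ring
  have e5 : A ^ p = A ^ (p - 2) * A * A := by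
    rw [← Real.rpow_add_one hA.ne', ← Real.rpow_add_one hA.ne']; congr 1; ring
  rw [e3, e4, e5, pow_succ]
  push_cast at hn' ⊢
  field_simp
  ring

theorem one_le_truncExp (hA : 0 ≤ A) : 1 ≤ truncExp p n A :=
  one_le_expPow (Real.rpow_nonneg hA p)

theorem truncExp_pos (hA : 0 ≤ A) : 0 < truncExp p n A :=
  expPow_pos (Real.rpow_nonneg hA p)

theorem truncExp_mono (hp : 0 ≤ p) (hA : 0 ≤ A) (hAB : A ≤ B) : truncExp p n A ≤ truncExp p n B :=
  expPow_mono (Real.rpow_nonneg hA p) (Real.rpow_le_rpow hA hAB hp)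

theorem truncExp_le_exp (hA : 0 ≤ A) : truncExp p n A ≤ Real.exp (A ^ p) :=
  expPow_le_exp (Real.rpow_nonneg hA p)

theorem truncExpDeriv_nonneg (hp : 0 ≤ p) (hA : 0 ≤ A) : 0 ≤ truncExpDeriv p n A := by
  unfold truncExpDeriv
  have := Real.rpow_nonneg hA p
  have := Real.rpow_nonneg hA (p - 1)
  positivity

/-- The two thresholds give p − 1/n ≥ p/2 and then A^p(p − 1/n) ≥ 1, which outweighs p − 1 > −1. -/
theorem truncExpDeriv2_nonneg (hp : 0 < p) (hA : 0 < A) (hn : 2 / p ≤ n) (hAp : 2 / p ≤ A ^ p) :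
    0 ≤ truncExpDeriv2 p n A := by
  unfold truncExpDeriv2
  have h1 : 1 / (n : ℝ) ≤ p / 2 := by
    have : (0 : ℝ) < 2 / p := by positivity
    calc 1 / (n : ℝ) ≤ 1 / (2 / p) := one_div_le_one_div_of_le this hn
      _ = p / 2 := by field_simp
  have h2 : 1 ≤ A ^ p * (p - 1 / n) := by
    calc (1 : ℝ) = 2 / p * (p / 2) := by field_simp
      _ ≤ A ^ p * (p - 1 / n) := by gcongr; linarith
  have h3 := Real.rpow_nonneg hA.le p
  have h4 := Real.rpow_nonneg hA.le (p - 2)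
  have h5 : 0 ≤ (p - 1) + A ^ p * (p - 1 / n) := by linarith
  positivity

/-- The right side equals A^{p−2}(1 + A^p/n)^{n−2} A^p, so what remains is p((p − 1) + A^p(p − 1/n))
≤ A^p, clear for p ≤ 1. -/
theorem truncExpDeriv2_le (hp : 0 < p) (hp1 : p ≤ 1) (hn : 2 ≤ n) (hA : 0 < A) :
    truncExpDeriv2 p n A ≤ (expRate n (A ^ p) / A) ^ 2 * truncExp p n A := by
  have h3 := Real.rpow_pos_of_pos hA p
  have h4 := Real.rpow_pos_of_pos hA (p - 2)
  have hn' : (0 : ℝ) < n := by positivity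
  have e5 : A ^ p = A ^ (p - 2) * A ^ 2 := by
    rw [← Real.rpow_natCast, ← Real.rpow_add hA]; congr 1; push_cast; ring
  have hu : 0 < 1 + A ^ p / n := by positivity
  have hR : (expRate n (A ^ p) / A) ^ 2 * truncExp p n A =
      A ^ (p - 2) * (1 + A ^ p / n) ^ (n - 2) * A ^ p := by
    obtain ⟨k, rfl⟩ := Nat.exists_eq_add_of_le hn
    have e2 : 2 + k - 2 = k := by omega
    rw [e2]
    unfold truncExp expPow expRate
    rw [pow_add, div_div, div_pow, mul_pow]
    have : (A ^ p) ^ 2 = A ^ p * (A ^ (p - 2) * A ^ 2) := by rw [← e5]; ring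
    rw [this]
    field_simp
  rw [hR]
  unfold truncExpDeriv2
  have h6 : p * ((p - 1) + A ^ p * (p - 1 / n)) ≤ A ^ p := by
    have h7 : A ^ p * (p - 1 / n) ≤ A ^ p := by
      have : 0 ≤ 1 / (n : ℝ) := by positivity
      nlinarith
    have h8 : p * ((p - 1) + A ^ p * (p - 1 / n)) ≤ p * A ^ p := by
      gcongr; linarith
    nlinarith
  calc p * A ^ (p - 2) * (1 + A ^ p / n) ^ (n - 2) * ((p - 1) + A ^ p * (p - 1 / n))
      = A ^ (p - 2) * (1 + A ^ p / n) ^ (n - 2) * (p * ((p - 1) + A ^ p * (p - 1 / n))) := by ring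
    _ ≤ _ := by gcongr

/-- The quotient is A^{p−1}/(1 + A^p/n), a product of decreasing factors; on an interval it may be
evaluated at the left endpoint. -/
theorem expRate_div_anti (hp : 0 < p) (hp1 : p ≤ 1) (hA : 0 < A) (hAB : A ≤ B) :
    expRate n (B ^ p) / B ≤ expRate n (A ^ p) / A := by
  have key : ∀ C : ℝ, 0 < C → expRate n (C ^ p) / C = C ^ (p - 1) / (1 + C ^ p / n) := by
    intro C hC
    unfold expRate
    rw [Real.rpow_sub_one hC.ne', div_right_comm]
  rw [key A hA, key B (hA.trans_le hAB)]
  have h1 : B ^ (p - 1) ≤ A ^ (p - 1) := Real.rpow_le_rpow_of_nonpos hA hAB (by linarith)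
  have h2 : A ^ p ≤ B ^ p := Real.rpow_le_rpow hA.le hAB hp.le
  have h3 := Real.rpow_pos_of_pos hA p
  have h4 := Real.rpow_pos_of_pos hA (p - 1)
  gcongr

/-- Taylor bound for the second difference of `truncExp`. -/
theorem second_diff_truncExp_le {x h L : ℝ} (hp : 0 < p) (hp1 : p ≤ 1) (hn : 2 ≤ n) (hL : 0 < L)
    (hLx : L ≤ x - h) (h0 : 0 ≤ h) :
    (truncExp p n (x + h) + truncExp p n (x - h)) / 2 - truncExp p n x ≤
      h ^ 2 / 2 * ((expRate n (L ^ p) / L) ^ 2 * truncExp p n (x + h)) := by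
  refine second_diff_le h0 (fun ξ hξ => hasDerivAt_truncExp (by omega) (hL.trans_le (hLx.trans hξ.1)))
    (fun ξ hξ => hasDerivAt_truncExpDeriv hn (hL.trans_le (hLx.trans hξ.1))) (fun ξ hξ => ?_)
  have hξ0 := hL.trans_le (hLx.trans hξ.1)
  refine (truncExpDeriv2_le hp hp1 hn hξ0).trans ?_
  have h1 := expRate_div_anti (n := n) hp hp1 hL (hLx.trans hξ.1)
  have h2 := truncExp_mono (n := n) hp.le hξ0.le hξ.2
  have h3 : 0 ≤ expRate n (ξ ^ p) / ξ :=
    div_nonneg (expRate_nonneg (Real.rpow_nonneg hξ0.le p)) hξ0.le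
  have h4 : 0 ≤ truncExp p n ξ := (truncExp_pos hξ0.le).le
  gcongr

/-- For p < 1 convexity fails near 0. The shift K puts all energies K + κ|v|² into a half-line where
it holds, for all large n at once. -/
theorem convexOn_truncExp {K : ℝ} (hp : 0 < p) (hn2 : 2 ≤ n) (hK : 0 < K) (hn : 2 / p ≤ n)
    (hKp : 2 / p ≤ K ^ p) : ConvexOn ℝ (Ici K) (truncExp p n) := by
  refine convexOn_of_hasDerivWithinAt2_nonneg (f' := truncExpDeriv p n) (f'' := truncExpDeriv2 p n)
    (convex_Ici K) ?_ ?_ ?_ ?_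
  · intro ξ hξ
    exact (hasDerivAt_truncExp (by omega) (hK.trans_le hξ)).continuousAt.continuousWithinAt
  · intro ξ hξ
    exact (hasDerivAt_truncExp (by omega) (hK.trans_le (interior_subset hξ))).hasDerivWithinAt
  · intro ξ hξ
    exact (hasDerivAt_truncExpDeriv hn2 (hK.trans_le (interior_subset hξ))).hasDerivWithinAt
  · intro ξ hξ
    have h : K ≤ ξ := interior_subset hξ
    exact truncExpDeriv2_nonneg hp (hK.trans_le h) hn
      (hKp.trans (Real.rpow_le_rpow hK.le h hp.le))

/-- Strict subadditivity of `A ↦ A ^ p` for comparable arguments. -/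
theorem add_rpow_le_of_comparable {k : ℝ} (hp1 : p ≤ 1) (hk : 0 < k) (hA : 0 < A)
    (hB : 0 < B) (hBA : B ≤ A) (hkB : k * A ≤ B) :
    (A + B) ^ p ≤ (1 + k) ^ (p - 1) * (A ^ p + B ^ p) := by
  have hs : 0 < A + B := by linarith
  -- Both A and B are at most (A + B)/(1 + k), and C ↦ C^{p−1} is nonincreasing; this gives the
  -- factor (1 + k)^{p−1} for each summand of (A + B)(A + B)^{p−1}.
  have key : ∀ C : ℝ, 0 < C → (1 + k) * C ≤ A + B →
      C * (A + B) ^ (p - 1) ≤ (1 + k) ^ (p - 1) * C ^ p := by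
    intro C hC hCs
    calc C * (A + B) ^ (p - 1) ≤ C * ((1 + k) * C) ^ (p - 1) := by
          gcongr 1
          exact Real.rpow_le_rpow_of_nonpos (by positivity) hCs (by linarith)
      _ = (1 + k) ^ (p - 1) * (C ^ (p - 1) * C) := by
          rw [Real.mul_rpow (by linarith) hC.le]; ring
      _ = _ := by rw [← Real.rpow_add_one hC.ne']; congr 2; ring
  have e : (A + B) ^ p = A * (A + B) ^ (p - 1) + B * (A + B) ^ (p - 1) := by
    rw [← add_mul, mul_comm, ← Real.rpow_add_one hs.ne']; congr 1; ring
  rw [e, mul_add]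
  have h1 := key A hA (by linarith)
  have h2 := key B hB (by nlinarith)
  linarith

/-- The factor μ = (1 + k)^{p−1} is spent on A^p alone, so the gain is expressed by the rate of the
larger energy. -/
theorem truncExp_add_le_of_comparable {k : ℝ} (hp : 0 < p) (hp1 : p ≤ 1) (hn : n ≠ 0) (hk : 0 < k)
    (hA : 0 < A) (hB : 0 < B) (hBA : B ≤ A) (hkB : k * A ≤ B) {r : ℝ} (hr : 0 ≤ r)
    (hrA : r ≤ A + B) :
    truncExp p n r ≤ Real.exp (-(1 - (1 + k) ^ (p - 1)) * expRate n (A ^ p)) *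
      (truncExp p n A * truncExp p n B) := by
  have h1 := add_rpow_le_of_comparable hp1 hk hA hB hBA hkB
  set μ := (1 + k) ^ (p - 1)
  have hμ0 : 0 < μ := Real.rpow_pos_of_pos (by linarith) _
  have hμ1 : μ ≤ 1 := Real.rpow_le_one_of_one_le_of_nonpos (by linarith) (by linarith)
  have hA' := Real.rpow_pos_of_pos hA p
  have hB' := Real.rpow_pos_of_pos hB p
  have h2 : r ^ p ≤ μ * A ^ p + B ^ p := by
    have : r ^ p ≤ (A + B) ^ p := Real.rpow_le_rpow hr hrA hp.le
    nlinarith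
  calc truncExp p n r ≤ expPow n (μ * A ^ p + B ^ p) := expPow_mono (Real.rpow_nonneg hr p) h2
    _ ≤ expPow n (μ * A ^ p) * expPow n (B ^ p) := expPow_add_le (by positivity) hB'.le
    _ ≤ (Real.exp (-(1 - μ) * expRate n (A ^ p)) * expPow n (A ^ p)) * expPow n (B ^ p) := by
        have := expPow_pos (n := n) hB'.le
        gcongr
        exact expPow_mul_le hn hA'.le hμ0.le
    _ = _ := by rw [truncExp, truncExp]; ring

/-- Non-grazing collisions: both outgoing particles have an energy weight smaller than the product
of the incoming ones. -/
theorem exists_truncExp_nongrazing_le (hp : 0 < p) (hp1 : p < 1) {s : ℝ} (hs : 0 < s) (hs1 : s ≤ 1 / 2) :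
    ∃ θ : ℝ, 0 < θ ∧ ∀ (n : ℕ) (A B a h : ℝ), n ≠ 0 → 0 < B → B ≤ A → s ≤ a → a ≤ 1 - s →
      h ^ 2 ≤ 4 * a * (1 - a) * (A * B) → 0 ≤ a * A + (1 - a) * B + h →
      truncExp p n (a * A + (1 - a) * B + h) ≤
        Real.exp (-θ * expRate n (A ^ p)) * (truncExp p n A * truncExp p n B) := by
  -- k is such that B ≤ kA means (1 + 2/s)B ≤ sA/4: the slow particle cannot make up for the
  -- fraction of A that is lost.
  set k : ℝ := s / 4 / (1 + 2 / s) with hk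
  have hk0 : 0 < k := by positivity
  set l : ℝ := (1 - s / 4) ^ p with hl
  have hl0 : 0 < l := Real.rpow_pos_of_pos (by linarith) p
  have hl1 : l < 1 := Real.rpow_lt_one (by linarith) (by linarith) hp
  have hμ1 : (1 + k) ^ (p - 1) < 1 := Real.rpow_lt_one_of_one_lt_of_neg (by linarith) (by linarith)
  refine ⟨min (1 - l) (1 - (1 + k) ^ (p - 1)), lt_min (by linarith) (by linarith), ?_⟩
  intro n A B a h hn hB hBA hsa has hh hr
  have hA : 0 < A := hB.trans_le hBA
  have hA' := Real.rpow_pos_of_pos hA p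
  have hB' := Real.rpow_pos_of_pos hB p
  have he := expRate_nonneg (n := n) hA'.le
  have hgA := truncExp_pos (n := n) (p := p) hA.le
  have hgB := one_le_truncExp (n := n) (p := p) hB.le
  rcases le_total B (k * A) with hBk | hBk
  -- h² ≤ AB, and AM–GM splits √(AB) with the weights s/2 and 2/s. The outgoing energy is then at
  -- most (1 − s/2)A + (1 + 2/s)B ≤ (1 − s/4)A.
  · have h1 : h ≤ s / 2 * A + 2 / s * B := by
      refine abs_le_of_sq_le_sq' (a := h) ?_ (by positivity) |>.2
      have : 4 * a * (1 - a) ≤ 1 := by nlinarith [sq_nonneg (2 * a - 1)]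
      have h2 : (s / 2 * A + 2 / s * B) ^ 2 = (s / 2 * A - 2 / s * B) ^ 2 + 4 * (A * B) := by
        field_simp; ring
      have h3 : 0 < A * B := by positivity
      nlinarith [sq_nonneg (s / 2 * A - 2 / s * B)]
    have h4 : a * A + (1 - a) * B + h ≤ (1 - s / 4) * A := by
      have h5 : (1 + 2 / s) * B ≤ s / 4 * A := by
        have h7 : 0 < 1 + 2 / s := by positivity
        calc (1 + 2 / s) * B ≤ (1 + 2 / s) * (k * A) := by gcongr
          _ = s / 4 * A := by rw [hk]; field_simp
      nlinarith
    calc truncExp p n (a * A + (1 - a) * B + h) ≤ truncExp p n ((1 - s / 4) * A) :=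
          truncExp_mono hp.le hr h4
      _ = expPow n (l * A ^ p) := by
          rw [truncExp, Real.mul_rpow (by linarith) hA.le]
      _ ≤ Real.exp (-(1 - l) * expRate n (A ^ p)) * expPow n (A ^ p) :=
          expPow_mul_le hn hA'.le hl0.le
      _ ≤ _ := by
          have : expPow n (A ^ p) ≤ truncExp p n A * truncExp p n B := by
            rw [← truncExp]; nlinarith
          have h9 := expPow_pos (n := n) hA'.le
          gcongr
          exact min_le_left _ _
  -- Comparable energies: the outgoing energy is at most A + B, and strict subadditivity of A^p
  -- gives the gain.
  · refine (truncExp_add_le_of_comparable hp hp1.le hn hk0 hA hB hBA hBk hr ?_).trans ?_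
    · have : h ≤ (1 - a) * A + a * B := by
        have : 0 ≤ a := by linarith
        have : 0 ≤ 1 - a := by linarith
        refine abs_le_of_sq_le_sq' (a := h) ?_ (by positivity) |>.2
        nlinarith [sq_nonneg ((1 - a) * A - a * B)]
      linarith
    · have : 0 < truncExp p n A * truncExp p n B := by positivity
      gcongr
      exact min_le_right _ _

end truncExp

/-! ### Grazing collisions -/

theorem le_of_sq_le_sq_of_nonneg {a b c : ℝ} (hb : 0 ≤ b) (h : a ^ 2 ≤ c) (hc : c ≤ b ^ 2) : a ≤ b :=
  (abs_le_of_sq_le_sq' (h.trans hc) hb).2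

/-- A convex function satisfies `energyDiff ≤` the sum of its two second differences. -/
theorem energyDiff_le_second_diff {g : ℝ → ℝ} {K A B a h : ℝ} (hg : ConvexOn ℝ (Ici K) g) (hA : K ≤ A)
    (hB : K ≤ B) (ha : 0 ≤ a) (ha1 : a ≤ 1) :
    energyDiff g A B a h ≤
      ((g (a * A + (1 - a) * B + h) + g (a * A + (1 - a) * B - h)) / 2 - g (a * A + (1 - a) * B)) +
      ((g ((1 - a) * A + a * B + h) + g ((1 - a) * A + a * B - h)) / 2 -
        g ((1 - a) * A + a * B)) := by
  have h1 := hg.2 hA hB ha (by linarith : 0 ≤ 1 - a) (by ring)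
  have h2 := hg.2 hA hB (by linarith : 0 ≤ 1 - a) ha (by ring)
  simp only [smul_eq_mul] at h1 h2
  unfold energyDiff
  linarith

section grazing
variable {p : ℝ} {n : ℕ} {A B : ℝ}

/-- `expRate n (A ^ p)` is at most (A/B)^p times `expRate n (B ^ p)`; the power m costs (A/B)^{mp} ≤
A/B, paid by the factor B/A. With m = 1 + q this is where (1 + q)p ≤ 1 enters. -/
theorem expRate_rpow_mul_le {m : ℝ} (hm : 0 ≤ m) (hp : 0 ≤ p) (hmp : m * p ≤ 1) (hB : 0 < B) (hBA : B ≤ A) :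
    B / A * expRate n (A ^ p) ^ m ≤ expRate n (B ^ p) ^ m := by
  have hA : 0 < A := hB.trans_le hBA
  have hA' := Real.rpow_pos_of_pos hA p
  have hB' := Real.rpow_pos_of_pos hB p
  have h1 : expRate n (A ^ p) ≤ expRate n (B ^ p) * (A / B) ^ p := by
    rw [Real.div_rpow hA.le hB.le]
    unfold expRate
    have : B ^ p / (1 + B ^ p / n) * (A ^ p / B ^ p) = A ^ p / (1 + B ^ p / n) := by field_simp
    rw [this]
    have := Real.rpow_le_rpow hB.le hBA hp
    gcongr
  have hAB1 : 1 ≤ A / B := (one_le_div hB).2 hBA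
  have h0 := expRate_nonneg (n := n) hA'.le
  have h0B := expRate_nonneg (n := n) hB'.le
  calc B / A * expRate n (A ^ p) ^ m ≤ B / A * (expRate n (B ^ p) * (A / B) ^ p) ^ m := by
        gcongr
    _ = B / A * (expRate n (B ^ p) ^ m * (A / B) ^ (m * p)) := by
        rw [Real.mul_rpow h0B (by positivity), ← Real.rpow_mul (by positivity), mul_comm p m]
    _ ≤ B / A * (expRate n (B ^ p) ^ m * (A / B) ^ (1 : ℝ)) := by
        gcongr
    _ = _ := by rw [Real.rpow_one]; field_simp

/-- Second differences when the energies are comparable. -/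
theorem exists_second_diff_comparable_le (hp : 0 < p) (hp1 : p < 1) {k : ℝ} (hk : 0 < k) (hk1 : k ≤ 1) :
    ∃ C : ℝ, 0 < C ∧ ∀ (n : ℕ) (A B s h : ℝ), 2 ≤ n → 0 < B → B ≤ A → k * A ≤ B → 0 ≤ s → s ≤ k / 64 →
      0 ≤ h → h ^ 2 ≤ 4 * s * (1 - s) * (A * B) →
      ((truncExp p n ((1 - s) * A + s * B + h) + truncExp p n ((1 - s) * A + s * B - h)) / 2 -
          truncExp p n ((1 - s) * A + s * B)) +
        ((truncExp p n (s * A + (1 - s) * B + h) + truncExp p n (s * A + (1 - s) * B - h)) / 2 -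
          truncExp p n (s * A + (1 - s) * B)) ≤ C * s * (truncExp p n A * truncExp p n B) := by
  have hμ1 : (1 + k) ^ (p - 1) < 1 := Real.rpow_lt_one_of_one_lt_of_neg (by linarith) (by linarith)
  -- The Taylor bound carries the square of the rate, and the exponential gain for comparable
  -- energies absorbs it.
  obtain ⟨C, hC, hCb⟩ := exists_rpow_mul_exp_neg_le 2 (1 - (1 + k) ^ (p - 1)) (by norm_num) (by linarith)
  refine ⟨64 / k * C, by positivity, ?_⟩
  intro n A B s h hn hB hBA hkB hs hsk h0 hh
  have hA : 0 < A := hB.trans_le hBA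
  have hA' := Real.rpow_pos_of_pos hA p
  have he := expRate_nonneg (n := n) hA'.le
  have hgA := truncExp_pos (n := n) (p := p) hA.le
  have hgB := truncExp_pos (n := n) (p := p) hB.le
  have hAB : 0 < A * B := by positivity
  have hh2 : h ^ 2 ≤ 4 * s * (A * B) := by nlinarith [mul_nonneg (mul_nonneg hs hs) hAB.le]
  -- s ≤ k/64 keeps h below B/4, hence the shifted energies above A/4 and B/4, where the Taylor
  -- bound is applied.
  have hhB : h ≤ B / 4 := by
    refine le_of_sq_le_sq_of_nonneg (by positivity) hh2 ?_
    calc 4 * s * (A * B) ≤ 4 * (k / 64) * (A * B) := by gcongr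
      _ = 4 / 64 * ((k * A) * B) := by ring
      _ ≤ 4 / 64 * (B * B) := by gcongr
      _ = _ := by ring
  have hhs : h ≤ s * A + (1 - s) * B := by
    have : 0 ≤ 1 - s := by linarith
    refine le_of_sq_le_sq_of_nonneg (by positivity) hh ?_
    nlinarith [sq_nonneg (s * A - (1 - s) * B)]
  have hhs' : h ≤ (1 - s) * A + s * B := by nlinarith
  have step : ∀ x L : ℝ, 0 < L → L ≤ x - h → L ≤ A → x + h ≤ A + B →
      (truncExp p n (x + h) + truncExp p n (x - h)) / 2 - truncExp p n x ≤
        h ^ 2 / 2 * (1 / L ^ 2) * (C * (truncExp p n A * truncExp p n B)) := by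
    intro x L hL hLx hLA hx
    refine (second_diff_truncExp_le hp hp1.le hn hL hLx h0).trans ?_
    have h1 : expRate n (L ^ p) ≤ expRate n (A ^ p) :=
      expRate_mono (Real.rpow_nonneg hL.le p) (Real.rpow_le_rpow hL.le hLA hp.le)
    have h2 := truncExp_add_le_of_comparable (n := n) hp hp1.le (by omega) hk hA hB hBA hkB
      (r := x + h) (by linarith) hx
    have h3 := hCb _ he
    rw [Real.rpow_two] at h3
    have h4 := expRate_nonneg (n := n) (Real.rpow_nonneg hL.le p)
    have h5 : 0 ≤ truncExp p n (x + h) := (truncExp_pos (by linarith)).le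
    calc h ^ 2 / 2 * ((expRate n (L ^ p) / L) ^ 2 * truncExp p n (x + h))
        ≤ h ^ 2 / 2 * ((expRate n (A ^ p) / L) ^ 2 *
          (Real.exp (-(1 - (1 + k) ^ (p - 1)) * expRate n (A ^ p)) *
            (truncExp p n A * truncExp p n B))) := by gcongr
      _ = h ^ 2 / 2 * (1 / L ^ 2) * (expRate n (A ^ p) ^ 2 *
          Real.exp (-(1 - (1 + k) ^ (p - 1)) * expRate n (A ^ p)) *
            (truncExp p n A * truncExp p n B)) := by ring
      _ ≤ _ := by gcongr
  have hx := step ((1 - s) * A + s * B) (A / 4) (by positivity) (by nlinarith) (by linarith) (by linarith)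
  have hy := step (s * A + (1 - s) * B) (B / 4) (by positivity) (by nlinarith) (by linarith) (by linarith)
  have hx2 : h ^ 2 / 2 * (1 / (A / 4) ^ 2) ≤ 32 / k * s := by
    have : 1 ≤ 1 / k := (one_le_div hk).2 hk1
    calc h ^ 2 / 2 * (1 / (A / 4) ^ 2) ≤ 4 * s * (A * A) / 2 * (1 / (A / 4) ^ 2) := by
          gcongr; exact hh2.trans (by gcongr)
      _ = 32 * s * 1 := by field_simp; ring
      _ ≤ 32 * s * (1 / k) := by gcongr
      _ = _ := by ring
  have hy2 : h ^ 2 / 2 * (1 / (B / 4) ^ 2) ≤ 32 / k * s := by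
    have hAk : A ≤ B / k := (le_div_iff₀ hk).2 (by linarith)
    calc h ^ 2 / 2 * (1 / (B / 4) ^ 2) ≤ 4 * s * (B / k * B) / 2 * (1 / (B / 4) ^ 2) := by
          gcongr; exact hh2.trans (by gcongr)
      _ = 32 / k * s := by field_simp; ring
  have hP : 0 ≤ C * (truncExp p n A * truncExp p n B) := by positivity
  calc _ ≤ h ^ 2 / 2 * (1 / (A / 4) ^ 2) * (C * (truncExp p n A * truncExp p n B)) +
        h ^ 2 / 2 * (1 / (B / 4) ^ 2) * (C * (truncExp p n A * truncExp p n B)) := add_le_add hx hy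
    _ ≤ 32 / k * s * (C * (truncExp p n A * truncExp p n B)) +
        32 / k * s * (C * (truncExp p n A * truncExp p n B)) := by gcongr
    _ = _ := by ring

/-- Interpolation between angle and rate: s^q stays as the angular factor, (se)^{1−q} will be
absorbed by an exponential gain in se, and e^{1+q} is passed on to the slow particle. -/
theorem mul_sq_eq_rpow_mul {s e q : ℝ} (hs : 0 ≤ s) (he : 0 ≤ e) (hq : 0 ≤ q) (hq1 : q ≤ 1) :
    s * e ^ 2 = s ^ q * e ^ (1 + q) * (s * e) ^ (1 - q) := by
  rw [Real.mul_rpow hs he]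
  have i1 : s ^ q * s ^ (1 - q) = s := by
    rw [← Real.rpow_add_of_nonneg hs hq (by linarith)]; simp
  have i2 : e ^ (1 + q) * e ^ (1 - q) = e ^ 2 := by
    rw [← Real.rpow_add_of_nonneg he (by linarith) (by linarith), ← Real.rpow_two]; congr 1; ring
  calc s * e ^ 2 = (s ^ q * s ^ (1 - q)) * (e ^ (1 + q) * e ^ (1 - q)) := by rw [i1, i2]
    _ = _ := by ring

/-- Bernoulli gives U^p ≤ (1 − ps/2)A^p for U = (1 − s/2)A, and adding 3B costs at most U^{p−1}·3B,
which is below B^p/2 when B ≤ kA with k small. The outgoing exponent thus gains a fraction ps/2 of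
A^p and half of B^p. -/
theorem rpow_le_of_le_add {k s r : ℝ} (hp : 0 < p) (hp1 : p < 1) (hk : 0 < k) (hkp : 6 * k ^ (1 - p) ≤ 1 / 2)
    (hA : 0 < A) (hB : 0 < B) (hBk : B ≤ k * A) (hs1 : s ≤ 1 / 64) (hr0 : 0 ≤ r)
    (hrle : r ≤ (1 - s / 2) * A + 3 * B) :
    r ^ p ≤ (1 - p * s / 2) * A ^ p + 1 / 2 * B ^ p := by
  set U := (1 - s / 2) * A with hU
  have hU0 : 0 < U := mul_pos (by linarith) hA
  have e1 : U ^ p ≤ (1 - p * s / 2) * A ^ p := by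
    rw [hU, Real.mul_rpow (by linarith) hA.le]
    gcongr
    have := rpow_one_add_le_one_add_mul_self (s := -(s / 2)) (by linarith) hp.le hp1.le
    calc (1 - s / 2) ^ p = (1 + -(s / 2)) ^ p := by ring_nf
      _ ≤ _ := this
      _ = _ := by ring
  have e2 : (U + 3 * B) ^ p ≤ U ^ p + U ^ (p - 1) * (3 * B) := by
    have := rpow_one_add_le_one_add_mul_self (s := 3 * B / U)
      (by have : 0 ≤ 3 * B / U := by positivity
          linarith) hp.le hp1.le
    calc (U + 3 * B) ^ p = U ^ p * (1 + 3 * B / U) ^ p := by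
          rw [← Real.mul_rpow hU0.le (by positivity)]; congr 1; field_simp
      _ ≤ U ^ p * (1 + p * (3 * B / U)) := by gcongr
      _ ≤ U ^ p * (1 + 1 * (3 * B / U)) := by gcongr
      _ = U ^ p + U ^ p / U * (3 * B) := by ring
      _ = _ := by rw [Real.rpow_sub_one hU0.ne']
  have e3 : U ^ (p - 1) * (3 * B) ≤ 1 / 2 * B ^ p := by
    have f1 : U ^ (p - 1) ≤ 2 * A ^ (p - 1) := by
      calc U ^ (p - 1) ≤ (A / 2) ^ (p - 1) :=
            Real.rpow_le_rpow_of_nonpos (by positivity) (by rw [hU]; nlinarith) (by linarith)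
        _ = A ^ (p - 1) * (2 : ℝ) ^ (1 - p) := by
            rw [Real.div_rpow hA.le (by norm_num), div_eq_mul_inv,
              ← Real.rpow_neg (by norm_num)]; congr 2; ring
        _ ≤ A ^ (p - 1) * (2 : ℝ) ^ (1 : ℝ) := by
            gcongr <;> linarith
        _ = _ := by rw [Real.rpow_one]; ring
    have f2 : A ^ (p - 1) ≤ k ^ (1 - p) * B ^ (p - 1) := by
      calc A ^ (p - 1) ≤ (B / k) ^ (p - 1) :=
            Real.rpow_le_rpow_of_nonpos (by positivity) ((div_le_iff₀ hk).2 (by linarith)) (by linarith)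
        _ = _ := by
            rw [Real.div_rpow hB.le hk.le, div_eq_mul_inv, ← Real.rpow_neg hk.le, mul_comm]
            congr 2; ring
    have f3 : B ^ (p - 1) * B = B ^ p := by
      rw [← Real.rpow_add_one hB.ne']; congr 1; ring
    calc U ^ (p - 1) * (3 * B) ≤ 2 * (k ^ (1 - p) * B ^ (p - 1)) * (3 * B) := by
          gcongr; linarith
      _ = 6 * k ^ (1 - p) * (B ^ (p - 1) * B) := by ring
      _ ≤ 1 / 2 * B ^ p := by rw [f3]; gcongr
  calc r ^ p ≤ (U + 3 * B) ^ p := Real.rpow_le_rpow hr0 hrle hp.le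
    _ ≤ _ := by linarith

/-- The second difference at the more energetic outgoing particle, for very different energies. -/
theorem exists_second_diff_fast_le (hp : 0 < p) (hp1 : p < 1) {q k : ℝ} (hq : 0 < q) (hq1 : q ≤ 1)
    (hqp : (1 + q) * p ≤ 1) (hk : 0 < k) (hk1 : k ≤ 1 / 4) (hkp : 6 * k ^ (1 - p) ≤ 1 / 2) :
    ∃ C : ℝ, 0 < C ∧ ∀ (n : ℕ) (A B s h : ℝ), 2 ≤ n → 0 < B → B ≤ k * A → 0 ≤ s → s ≤ 1 / 64 →
      0 ≤ h → h ^ 2 ≤ 4 * s * (1 - s) * (A * B) →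
      (truncExp p n ((1 - s) * A + s * B + h) + truncExp p n ((1 - s) * A + s * B - h)) / 2 -
          truncExp p n ((1 - s) * A + s * B) ≤ C * s ^ q * (truncExp p n A * truncExp p n B) := by
  obtain ⟨C₁, hC₁, hCb₁⟩ := exists_rpow_mul_exp_neg_le (1 - q) (p / 2) (by linarith) (by linarith)
  obtain ⟨C₂, hC₂, hCb₂⟩ := exists_rpow_mul_exp_neg_le (1 + q) (1 / 2) (by linarith) (by linarith)
  refine ⟨32 * C₁ * C₂, by positivity, ?_⟩
  intro n A B s h hn hB hBk hs hs1 h0 hh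
  have hA : 0 < A := by
    by_contra hA
    push Not at hA
    nlinarith
  have hBA : B ≤ A := by nlinarith
  have hA' := Real.rpow_pos_of_pos hA p
  have hB' := Real.rpow_pos_of_pos hB p
  have he := expRate_nonneg (n := n) hA'.le
  have heB := expRate_nonneg (n := n) hB'.le
  have hgA := truncExp_pos (n := n) (p := p) hA.le
  have hgB := truncExp_pos (n := n) (p := p) hB.le
  have hAB : 0 < A * B := by positivity
  have hh2 : h ^ 2 ≤ 4 * s * (A * B) := by nlinarith [mul_nonneg (mul_nonneg hs hs) hAB.le]
  have hhA : h ≤ A / 8 := by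
    refine le_of_sq_le_sq_of_nonneg (by positivity) hh2 ?_
    calc 4 * s * (A * B) ≤ 4 * (1 / 64) * (A * (A / 4)) := by gcongr; nlinarith
      _ = _ := by ring
  have hhr : h ≤ s / 2 * A + 2 * B := by
    refine le_of_sq_le_sq_of_nonneg (by positivity) hh2 ?_
    nlinarith [sq_nonneg (s / 2 * A - 2 * B)]
  set r := (1 - s) * A + s * B + h with hr
  have hr0 : 0 ≤ r := by nlinarith
  have hrle : r ≤ (1 - s / 2) * A + 3 * B := by nlinarith
  -- Taylor bound at L = A/4: h²/A² is of order sB/A, and the second derivative brings the square of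
  -- the rate of A.
  have hT : (truncExp p n r + truncExp p n ((1 - s) * A + s * B - h)) / 2 -
      truncExp p n ((1 - s) * A + s * B) ≤ 32 * (s * (B / A) * expRate n (A ^ p) ^ 2) * truncExp p n r := by
    refine (second_diff_truncExp_le hp hp1.le hn (L := A / 4) (by positivity) (by nlinarith) h0).trans ?_
    have h1 : expRate n ((A / 4) ^ p) ≤ expRate n (A ^ p) :=
      expRate_mono (by positivity) (Real.rpow_le_rpow (by positivity) (by linarith) hp.le)
    have h4 := expRate_nonneg (n := n) (Real.rpow_nonneg (by positivity : 0 ≤ A / 4) p)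
    have h5 : 0 ≤ truncExp p n r := (truncExp_pos hr0).le
    calc h ^ 2 / 2 * ((expRate n ((A / 4) ^ p) / (A / 4)) ^ 2 * truncExp p n r)
        ≤ 4 * s * (A * B) / 2 * ((expRate n (A ^ p) / (A / 4)) ^ 2 * truncExp p n r) := by gcongr
      _ = _ := by field_simp; ring
  have hrp := rpow_le_of_le_add hp hp1 hk hkp hA hB hBk hs1 hr0 hrle
  have hps : 0 ≤ 1 - p * s / 2 := by nlinarith
  have hgr : truncExp p n r ≤ (Real.exp (-(p / 2) * (s * expRate n (A ^ p))) * truncExp p n A) *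
      (Real.exp (-(1 / 2) * expRate n (B ^ p)) * truncExp p n B) := by
    calc truncExp p n r ≤ expPow n ((1 - p * s / 2) * A ^ p + 1 / 2 * B ^ p) :=
          expPow_mono (Real.rpow_nonneg hr0 p) hrp
      _ ≤ expPow n ((1 - p * s / 2) * A ^ p) * expPow n (1 / 2 * B ^ p) :=
          expPow_add_le (by positivity) (by positivity)
      _ ≤ (Real.exp (-(1 - (1 - p * s / 2)) * expRate n (A ^ p)) * expPow n (A ^ p)) *
          (Real.exp (-(1 - 1 / 2) * expRate n (B ^ p)) * expPow n (B ^ p)) := by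
          have g1 := expPow_mul_le (n := n) (by omega) hA'.le hps
          have g2 := expPow_mul_le (n := n) (l := 1 / 2) (by omega) hB'.le (by norm_num)
          have g3 := expPow_pos (n := n) (y := 1 / 2 * B ^ p) (by positivity)
          have g4 := expPow_pos (n := n) hA'.le
          gcongr
      _ = _ := by rw [truncExp, truncExp]; ring_nf
  have j1 := hCb₁ (s * expRate n (A ^ p)) (by positivity)
  have j2 := hCb₂ (expRate n (B ^ p)) heB
  -- The factor B/A trades the rate of A for that of B, at the power 1 + q; the spare half of B^p in
  -- the exponent then absorbs it.
  have j3 := expRate_rpow_mul_le (n := n) (m := 1 + q) (by linarith) hp.le hqp hB hBA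
  have hsq : 0 ≤ s ^ q := Real.rpow_nonneg hs q
  have hsplit := mul_sq_eq_rpow_mul hs he hq.le hq1
  generalize expRate n (A ^ p) = e at *
  generalize expRate n (B ^ p) = f at *
  generalize truncExp p n r = G at *
  generalize truncExp p n A = GA at *
  generalize truncExp p n B = GB at *
  have hP : 0 ≤ GA * GB := by positivity
  have e1 := Real.exp_pos (-(p / 2) * (s * e))
  have e2 := Real.exp_pos (-(1 / 2) * f)
  have f0 : 0 ≤ f ^ (1 + q) := Real.rpow_nonneg heB _
  refine hT.trans ?_
  have hfac : 0 ≤ 32 * (s * (B / A) * e ^ 2) := by positivity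
  refine (mul_le_mul_of_nonneg_left hgr hfac).trans ?_
  have hX : 32 * (s * (B / A) * e ^ 2) * ((Real.exp (-(p / 2) * (s * e)) * GA) *
      (Real.exp (-(1 / 2) * f) * GB)) =
      32 * s ^ q * ((s * e) ^ (1 - q) * Real.exp (-(p / 2) * (s * e))) *
        ((B / A * e ^ (1 + q)) * Real.exp (-(1 / 2) * f)) * (GA * GB) := by
    linear_combination 32 * (B / A) * ((Real.exp (-(p / 2) * (s * e)) * GA) *
      (Real.exp (-(1 / 2) * f) * GB)) * hsplit
  rw [hX]
  refine mul_le_mul_of_nonneg_right ?_ hP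
  have j4 : (B / A * e ^ (1 + q)) * Real.exp (-(1 / 2) * f) ≤ C₂ :=
    (mul_le_mul_of_nonneg_right j3 e2.le).trans j2
  calc 32 * s ^ q * ((s * e) ^ (1 - q) * Real.exp (-(p / 2) * (s * e))) *
        ((B / A * e ^ (1 + q)) * Real.exp (-(1 / 2) * f)) ≤ 32 * s ^ q * C₁ * C₂ := by
        have : 0 ≤ e ^ (1 + q) := Real.rpow_nonneg he _
        gcongr
    _ = _ := by ring

/-- The chord between K and A gives g(r) ≤ (1 − t)g(K) + t g(A) with t = (r − K)/(A − K) ≤ r/A. A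
slow outgoing particle carries only the fraction r/A of the weight of the fast one. -/
theorem truncExp_le_secant {K r : ℝ} (hg : ConvexOn ℝ (Ici K) (truncExp p n)) (hK : 0 ≤ K)
    (hKr : K ≤ r) (hrA : r ≤ A) (hA : 0 < A) :
    truncExp p n r ≤ truncExp p n K + r / A * truncExp p n A := by
  have gK := truncExp_pos (n := n) (p := p) hK
  have gA := truncExp_pos (n := n) (p := p) hA.le
  rcases eq_or_lt_of_le (hKr.trans hrA) with h | h
  · have : r = A := le_antisymm hrA (h ▸ hKr)
    rw [this, div_self hA.ne']; linarith
  · have hd : 0 < A - K := by linarith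
    set t := (r - K) / (A - K) with ht
    have ht0 : 0 ≤ t := div_nonneg (by linarith) hd.le
    have ht1 : t ≤ r / A := by
      rw [ht, div_le_div_iff₀ hd hA]; nlinarith
    have ht2 : t ≤ 1 := by rw [ht, div_le_one hd]; linarith
    have h1 := hg.2 (mem_Ici.2 le_rfl) (mem_Ici.2 h.le) (by linarith : 0 ≤ 1 - t) ht0 (by ring)
    simp only [smul_eq_mul] at h1
    have e : (1 - t) * K + t * A = r := by
      rw [ht]; field_simp; ring
    rw [e] at h1
    nlinarith

/-- m ≥ 2/p makes A² ≤ (A^p)^m, which the m-th truncation dominates up to m^m; later truncations are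
larger. -/
theorem exists_sq_le_truncExp (hp : 0 < p) {m : ℕ} (hm : 2 / p ≤ m) :
    ∃ C : ℝ, 1 ≤ C ∧ ∀ (n : ℕ) (A : ℝ), m ≤ n → 1 ≤ A → A ^ 2 ≤ C * truncExp p n A := by
  have hm0 : (0 : ℝ) < m := lt_of_lt_of_le (by positivity) hm
  have hm1 : m ≠ 0 := by exact_mod_cast hm0.ne'
  refine ⟨(m : ℝ) ^ m, one_le_pow₀ (by exact_mod_cast Nat.one_le_iff_ne_zero.2 hm1), ?_⟩
  intro n A hn hA
  have hA0 : 0 < A := by linarith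
  have h1 : expPow m (A ^ p) ≤ truncExp p n A := expPow_mono_left hm1 hn (Real.rpow_nonneg hA0.le p)
  have h2 : (A ^ p / m) ^ m ≤ expPow m (A ^ p) := by
    have := Real.rpow_nonneg hA0.le p
    unfold expPow
    gcongr
    linarith
  have h3 : A ^ 2 ≤ (A ^ p) ^ m := by
    rw [← Real.rpow_natCast, ← Real.rpow_natCast, ← Real.rpow_mul hA0.le]
    refine Real.rpow_le_rpow_of_exponent_le hA ?_
    rw [div_le_iff₀ hp] at hm
    push_cast; linarith
  calc A ^ 2 ≤ (A ^ p) ^ m := h3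
    _ = (m : ℝ) ^ m * (A ^ p / m) ^ m := by rw [div_pow]; field_simp
    _ ≤ _ := by gcongr; exact h2.trans h1

/-- The second difference at the less energetic outgoing particle, for very different energies. -/
theorem exists_second_diff_slow_le (hp : 0 < p) (hp1 : p < 1) {K : ℝ} (hK : 1 ≤ K)
    (hKp : 2 / p ≤ K ^ p) {m : ℕ} (hm : 2 / p ≤ m) :
    ∃ C : ℝ, 0 < C ∧ ∀ (n : ℕ) (A B s h : ℝ), m ≤ n → K ≤ B → 4 * B ≤ A → 0 ≤ s → s ≤ 1 / 64 →
      0 ≤ h → h ^ 2 ≤ 4 * s * (1 - s) * ((A - K) * (B - K)) →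
      (truncExp p n (s * A + (1 - s) * B + h) + truncExp p n (s * A + (1 - s) * B - h)) / 2 -
          truncExp p n (s * A + (1 - s) * B) ≤ C * s * (truncExp p n A * truncExp p n B) := by
  obtain ⟨C, hC1, hC⟩ := exists_sq_le_truncExp hp hm
  refine ⟨4 + (2 * C ^ 2 * Real.exp (K ^ p) + 8 * C), by positivity, ?_⟩
  intro n A B s h hmn hKB hBA hs hs1 h0 hh
  have hnp : 2 / p ≤ n := hm.trans (by exact_mod_cast hmn)
  have hn2 : 2 ≤ n := by
    have : (2 : ℝ) ≤ 2 / p := by rw [le_div_iff₀ hp]; linarith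
    exact_mod_cast this.trans hnp
  have hconv := convexOn_truncExp (n := n) hp hn2 (by linarith : 0 < K) hnp hKp
  have hB : 1 ≤ B := hK.trans hKB
  have hA : 1 ≤ A := by linarith
  have hA0 : 0 < A := by linarith
  have hgA := one_le_truncExp (n := n) (p := p) hA0.le
  have hgB := one_le_truncExp (n := n) (p := p) (by linarith : 0 ≤ B)
  have hgK := truncExp_pos (n := n) (p := p) (by linarith : 0 ≤ K)
  have hAB : (A - K) * (B - K) ≤ A * B := by nlinarith
  have hKK : 0 ≤ (A - K) * (B - K) := mul_nonneg (by linarith) (by linarith)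
  have hh2 : h ^ 2 ≤ 4 * s * (A * B) := by
    calc h ^ 2 ≤ 4 * s * (1 - s) * ((A - K) * (B - K)) := hh
      _ ≤ 4 * s * 1 * (A * B) := by gcongr; linarith
      _ = _ := by ring
  have hhy : h ≤ s * A + B := by
    refine le_of_sq_le_sq_of_nonneg (by positivity) hh2 ?_
    nlinarith [sq_nonneg (s * A - B)]
  -- Measured from K, the shift does not exceed the mixture of A − K and B − K, so y − h stays in
  -- the half-line of convexity. This is why h is bounded through (A − K)(B − K) and not only
  -- through AB.
  have hyK : K ≤ s * A + (1 - s) * B - h := by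
    have : h ≤ s * (A - K) + (1 - s) * (B - K) := by
      refine le_of_sq_le_sq_of_nonneg ?_ hh ?_
      · exact add_nonneg (mul_nonneg hs (by linarith)) (mul_nonneg (by linarith) (by linarith))
      · nlinarith [sq_nonneg (s * (A - K) - (1 - s) * (B - K))]
    nlinarith
  set y := s * A + (1 - s) * B with hy
  -- If B ≤ sA, the outgoing energies are of order sA and the chord alone gives the factor s, its
  -- constant g(K) being cancelled by g(y). Otherwise they are of order B: the Taylor bound at L = K
  -- gives h² ≤ 4sAB, and the chord at 4B supplies the missing B/A.
  rcases le_total B (s * A) with hc | hc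
  · have hr : y + h ≤ 4 * s * A := by nlinarith
    have h1 := truncExp_le_secant (r := y + h) hconv (by linarith) (by linarith) (by nlinarith) hA0
    have h2 : truncExp p n (y - h) ≤ truncExp p n (y + h) :=
      truncExp_mono hp.le (by linarith) (by linarith)
    have h3 : truncExp p n K ≤ truncExp p n y := truncExp_mono hp.le (by linarith) (by linarith)
    have h4 : (y + h) / A ≤ 4 * s := by rw [div_le_iff₀ hA0]; exact hr
    calc _ ≤ (y + h) / A * truncExp p n A := by linarith
      _ ≤ 4 * s * (truncExp p n A * truncExp p n B) := by
          gcongr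
          nlinarith
      _ ≤ _ := by
          gcongr
          have : 0 ≤ 2 * C ^ 2 * Real.exp (K ^ p) + 8 * C := by positivity
          linarith
  · have hr : y + h ≤ 4 * B := by nlinarith
    have hT := second_diff_truncExp_le (n := n) (x := y) (h := h) hp hp1.le hn2 (L := K) (by linarith)
      hyK h0
    have h5 : (expRate n (K ^ p) / K) ^ 2 ≤ 1 := by
      have i0 : 0 ≤ expRate n (K ^ p) / K :=
        div_nonneg (expRate_nonneg (Real.rpow_nonneg (by linarith) p)) (by linarith)
      have i1 : expRate n (K ^ p) / K ≤ 1 := by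
        rw [div_le_one (by linarith)]
        refine (expRate_le (Real.rpow_nonneg (by linarith) p)).trans ?_
        calc K ^ p ≤ K ^ (1 : ℝ) := Real.rpow_le_rpow_of_exponent_le hK hp1.le
          _ = K := Real.rpow_one K
      exact pow_le_one₀ i0 i1
    have h6 : truncExp p n (y + h) ≤ truncExp p n (4 * B) := truncExp_mono hp.le (by linarith) hr
    have h7 := truncExp_le_secant (r := 4 * B) hconv (by linarith) (by linarith) hBA hA0
    have h8 : truncExp p n K ≤ Real.exp (K ^ p) := truncExp_le_exp (by linarith)
    have h9 := hC n A hmn hA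
    have h10 := hC n B hmn hB
    have hA2 : A ≤ C * truncExp p n A := (le_self_pow₀ hA two_ne_zero).trans h9
    have hB2 : B ≤ C * truncExp p n B := (le_self_pow₀ hB two_ne_zero).trans h10
    have h11 : 0 ≤ truncExp p n (y + h) := (truncExp_pos (by linarith)).le
    calc _ ≤ h ^ 2 / 2 * ((expRate n (K ^ p) / K) ^ 2 * truncExp p n (y + h)) := hT
      _ ≤ 4 * s * (A * B) / 2 * (1 * (truncExp p n K + 4 * B / A * truncExp p n A)) := by
          gcongr; exact h6.trans h7
      _ = 2 * s * (A * B * truncExp p n K) + 8 * s * (B ^ 2 * truncExp p n A) := by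
          field_simp; ring
      _ ≤ 2 * s * ((C * truncExp p n A) * (C * truncExp p n B) * Real.exp (K ^ p)) +
          8 * s * ((C * truncExp p n B) * truncExp p n A) := by gcongr
      _ = (2 * C ^ 2 * Real.exp (K ^ p) + 8 * C) * s * (truncExp p n A * truncExp p n B) := by ring
      _ ≤ _ := by
          have hP : 0 ≤ s * (truncExp p n A * truncExp p n B) := by positivity
          rw [mul_assoc, mul_assoc (_ + _)]
          exact mul_le_mul_of_nonneg_right (by linarith) hP

/-- Grazing collisions: with `q = β / 2`, the averaged collision difference is `O(sin^β θ)`, up to the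
product of the incoming weights. -/
theorem exists_truncExp_grazing_le (hp : 0 < p) (hp1 : p < 1) {q K : ℝ} (hq : 0 < q) (hq1 : q ≤ 1)
    (hqp : (1 + q) * p ≤ 1) (hK : 1 ≤ K) (hKp : 2 / p ≤ K ^ p) {m : ℕ} (hm : 2 / p ≤ m) :
    ∃ C s₀ : ℝ, 0 < C ∧ 0 < s₀ ∧ s₀ ≤ 1 / 64 ∧ ∀ (n : ℕ) (A B s h : ℝ), m ≤ n → K ≤ B → B ≤ A → 0 ≤ s →
      s ≤ s₀ → h ^ 2 ≤ 4 * s * (1 - s) * ((A - K) * (B - K)) →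
      energyDiff (truncExp p n) A B (1 - s) h ≤ C * s ^ q * (truncExp p n A * truncExp p n B) := by
  -- k separates comparable from very different energies; it has to be small enough for
  -- `rpow_le_of_le_add`.
  obtain ⟨k, hk, hk1, hkp⟩ : ∃ k : ℝ, 0 < k ∧ k ≤ 1 / 4 ∧ 6 * k ^ (1 - p) ≤ 1 / 2 := by
    have hz : (0 : ℝ) < (1 / 12 : ℝ) ^ (1 / (1 - p)) := by positivity
    refine ⟨min (1 / 4) ((1 / 12 : ℝ) ^ (1 / (1 - p))), lt_min (by norm_num) hz, min_le_left _ _, ?_⟩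
    have hp' : 0 < 1 - p := by linarith
    have := Real.rpow_le_rpow (z := 1 - p) (lt_min (by norm_num) hz).le
      (min_le_right (1 / 4) ((1 / 12 : ℝ) ^ (1 / (1 - p)))) hp'.le
    rw [← Real.rpow_mul (by norm_num : (0 : ℝ) ≤ 1 / 12), one_div_mul_cancel hp'.ne', Real.rpow_one] at this
    linarith
  obtain ⟨C₁, hC₁, h₁⟩ := exists_second_diff_comparable_le hp hp1 hk (by linarith)
  obtain ⟨C₂, hC₂, h₂⟩ := exists_second_diff_fast_le hp hp1 hq hq1 hqp hk hk1 hkp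
  obtain ⟨C₃, hC₃, h₃⟩ := exists_second_diff_slow_le hp hp1 hK hKp hm
  refine ⟨C₁ + C₂ + C₃, k / 64, by positivity, by positivity, by linarith, ?_⟩
  intro n A B s h hmn hKB hBA hs hsk hh
  wlog h0 : 0 ≤ h generalizing h
  · rw [← energyDiff_neg]
    exact this (-h) (by simpa using hh) (by linarith)
  have hnp : 2 / p ≤ n := hm.trans (by exact_mod_cast hmn)
  have hn2 : 2 ≤ n := by
    have : (2 : ℝ) ≤ 2 / p := by rw [le_div_iff₀ hp]; linarith
    exact_mod_cast this.trans hnp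
  have hconv := convexOn_truncExp (n := n) hp hn2 (by linarith : 0 < K) hnp hKp
  have hgA := truncExp_pos (n := n) (p := p) (by linarith : 0 ≤ A)
  have hgB := truncExp_pos (n := n) (p := p) (by linarith : 0 ≤ B)
  have hB0 : 0 < B := by linarith
  have hD := energyDiff_le_second_diff (a := 1 - s) (h := h) hconv (hKB.trans hBA) hKB (by linarith)
    (by linarith)
  simp only [sub_sub_cancel] at hD
  have hh2 : h ^ 2 ≤ 4 * s * (1 - s) * (A * B) := by
    refine hh.trans ?_
    have : 0 ≤ 4 * s * (1 - s) := mul_nonneg (by positivity) (by linarith)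
    gcongr <;> linarith
  have hsq : s ≤ s ^ q := by
    rcases hs.eq_or_lt with h | h
    · rw [← h, Real.zero_rpow hq.ne']
    · calc s = s ^ (1 : ℝ) := (Real.rpow_one s).symm
        _ ≤ s ^ q := Real.rpow_le_rpow_of_exponent_ge h (by linarith) hq1
  have hP : 0 < truncExp p n A * truncExp p n B := by positivity
  have hs0 : 0 ≤ s ^ q := Real.rpow_nonneg hs q
  rcases le_total B (k * A) with hBk | hBk
  · have i1 := h₂ n A B s h hn2 hB0 hBk hs (by linarith) h0 hh2
    have i2 := h₃ n A B s h hmn hKB (by nlinarith) hs (by linarith) h0 hh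
    calc _ ≤ C₂ * s ^ q * (truncExp p n A * truncExp p n B) +
          C₃ * s * (truncExp p n A * truncExp p n B) := hD.trans (add_le_add i1 i2)
      _ ≤ C₂ * s ^ q * (truncExp p n A * truncExp p n B) +
          C₃ * s ^ q * (truncExp p n A * truncExp p n B) := by gcongr
      _ ≤ _ := by nlinarith [mul_nonneg (mul_nonneg hC₁.le hs0) hP.le]
  · have i1 := h₁ n A B s h hn2 hB0 hBA hBk hs hsk h0 hh2
    calc _ ≤ C₁ * s * (truncExp p n A * truncExp p n B) := hD.trans i1
      _ ≤ C₁ * s ^ q * (truncExp p n A * truncExp p n B) := by gcongr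
      _ ≤ _ := by nlinarith [mul_nonneg (mul_nonneg hC₂.le hs0) hP.le,
          mul_nonneg (mul_nonneg hC₃.le hs0) hP.le]

end grazing

/-! ### Energy tails -/

/-- A smooth convex approximation of `r ↦ (r - 1)⁺`. -/
noncomputable def energyTail (r : ℝ) : ℝ := ∫ ρ in (0 : ℝ)..r, Real.smoothTransition (ρ - 1)

/-- The affine part of `energyTail` is `r - energyTailShift`. -/
noncomputable def energyTailShift : ℝ := 2 - energyTail 2

theorem continuous_smoothTransition_sub : Continuous fun ρ : ℝ => Real.smoothTransition (ρ - 1) :=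
  Real.smoothTransition.continuous.comp (by fun_prop)

theorem hasDerivAt_energyTail (r : ℝ) :
    HasDerivAt energyTail (Real.smoothTransition (r - 1)) r :=
  intervalIntegral.integral_hasDerivAt_right
    (continuous_smoothTransition_sub.intervalIntegrable _ _)
    (continuous_smoothTransition_sub.stronglyMeasurableAtFilter _ _)
    continuous_smoothTransition_sub.continuousAt

theorem deriv_energyTail : deriv energyTail = fun r => Real.smoothTransition (r - 1) :=
  funext fun r => (hasDerivAt_energyTail r).deriv

theorem contDiff_energyTail : ContDiff ℝ (⊤ : ℕ∞) energyTail := by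
  rw [contDiff_infty_iff_deriv]
  refine ⟨fun r => (hasDerivAt_energyTail r).differentiableAt, ?_⟩
  rw [deriv_energyTail]
  exact Real.smoothTransition.contDiff.comp (contDiff_id.sub contDiff_const)

theorem energyTail_eq_zero {r : ℝ} (hr : r ≤ 1) : energyTail r = 0 := by
  rw [energyTail]
  refine intervalIntegral.integral_zero_ae (Filter.Eventually.of_forall fun ρ hρ => ?_)
  refine Real.smoothTransition.zero_of_nonpos ?_
  rcases mem_uIoc.1 hρ with h | h
  · linarith [h.2]
  · linarith [h.2]

theorem energyTail_sub {r s : ℝ} : energyTail s - energyTail r =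
    ∫ ρ in r..s, Real.smoothTransition (ρ - 1) := by
  rw [energyTail, energyTail, intervalIntegral.integral_interval_sub_left] <;>
  exact continuous_smoothTransition_sub.intervalIntegrable _ _

theorem energyTail_mono : Monotone energyTail := fun r s hrs => by
  have := energyTail_sub (r := r) (s := s)
  have h2 : 0 ≤ ∫ ρ in r..s, Real.smoothTransition (ρ - 1) :=
    intervalIntegral.integral_nonneg hrs fun _ _ => Real.smoothTransition.nonneg _
  linarith

theorem energyTail_sub_le {r s : ℝ} (hrs : r ≤ s) : energyTail s - energyTail r ≤ s - r := by
  rw [energyTail_sub]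
  calc ∫ ρ in r..s, Real.smoothTransition (ρ - 1) ≤ ∫ _ in r..s, (1 : ℝ) :=
        intervalIntegral.integral_mono_on hrs (continuous_smoothTransition_sub.intervalIntegrable _ _)
          (by simp) fun _ _ => Real.smoothTransition.le_one _
    _ = s - r := by simp

theorem energyTail_eq {r : ℝ} (hr : 2 ≤ r) : energyTail r = r - energyTailShift := by
  have h : energyTail r - energyTail 2 = r - 2 := by
    rw [energyTail_sub]
    calc ∫ ρ in (2 : ℝ)..r, Real.smoothTransition (ρ - 1) = ∫ _ in (2 : ℝ)..r, (1 : ℝ) :=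
          intervalIntegral.integral_congr fun ρ hρ => by
            rw [uIcc_of_le hr] at hρ
            exact Real.smoothTransition.one_of_one_le (by linarith [hρ.1])
      _ = r - 2 := by simp
  rw [energyTailShift]; linarith

theorem energyTail_nonneg (r : ℝ) : 0 ≤ energyTail r := by
  rcases le_total r 1 with h | h
  · rw [energyTail_eq_zero h]
  · rw [← energyTail_eq_zero le_rfl]; exact energyTail_mono h

theorem energyTail_le_sub_one {r : ℝ} (hr : 1 ≤ r) : energyTail r ≤ r - 1 := by
  have := energyTail_sub_le hr
  rw [energyTail_eq_zero le_rfl] at this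
  linarith

theorem energyTail_le {r : ℝ} (hr : 0 ≤ r) : energyTail r ≤ r := by
  have := energyTail_sub_le hr
  rw [energyTail_eq_zero zero_le_one] at this
  linarith

theorem energyTailShift_mem : 1 ≤ energyTailShift ∧ energyTailShift ≤ 2 := by
  have h1 := energyTail_le_sub_one one_le_two
  have h2 := energyTail_nonneg 2
  unfold energyTailShift
  constructor <;> linarith

theorem sub_two_le_energyTail (r : ℝ) : r - 2 ≤ energyTail r := by
  rcases le_total r 2 with h | h
  · linarith [energyTail_nonneg r]
  · rw [energyTail_eq h]; linarith [energyTailShift_mem.2]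

theorem convexOn_energyTail : ConvexOn ℝ univ energyTail := by
  refine Monotone.convexOn_univ_of_deriv (fun r => (hasDerivAt_energyTail r).differentiableAt) ?_
  rw [deriv_energyTail]
  exact fun r s hrs => Real.smoothTransition.monotone (by linarith)

/-- The second derivative of `energyTail` is bounded. -/
theorem exists_deriv_smoothTransition_le :
    ∃ M : ℝ, 0 ≤ M ∧ ∀ r : ℝ, HasDerivAt (fun ρ => Real.smoothTransition (ρ - 1))
      (deriv Real.smoothTransition (r - 1)) r ∧ |deriv Real.smoothTransition (r - 1)| ≤ M := by
  have hd : Continuous (deriv Real.smoothTransition) :=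
    (Real.smoothTransition.contDiff (n := 1)).continuous_deriv le_rfl
  obtain ⟨M, hM⟩ := (isCompact_Icc (a := (0 : ℝ)) (b := 1)).exists_bound_of_continuousOn hd.continuousOn
  have hM0 : 0 ≤ M := (norm_nonneg _).trans (hM 0 (by simp))
  refine ⟨M, hM0, fun r => ⟨?_, ?_⟩⟩
  · have h := ((Real.smoothTransition.contDiff (n := 1)).differentiable (by simp) (r - 1)).hasDerivAt
    simpa [Function.comp_def] using h.comp r ((hasDerivAt_id r).sub_const 1)
  · by_cases hr : r - 1 ∈ Icc (0 : ℝ) 1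
    · exact hM _ hr
    · have : deriv Real.smoothTransition (r - 1) = 0 := by
        rw [mem_Icc, not_and_or, not_le, not_le] at hr
        rcases hr with hr | hr
        · have : Real.smoothTransition =ᶠ[nhds (r - 1)] fun _ => 0 :=
            Filter.eventually_of_mem (Iio_mem_nhds hr) fun x hx =>
              Real.smoothTransition.zero_of_nonpos (le_of_lt hx)
          rw [this.deriv_eq]; simp
        · have : Real.smoothTransition =ᶠ[nhds (r - 1)] fun _ => 1 :=
            Filter.eventually_of_mem (Ioi_mem_nhds hr) fun x hx =>
              Real.smoothTransition.one_of_one_le (le_of_lt hx)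
          rw [this.deriv_eq]; simp
      rw [this]; simpa using hM0

/-- Povzner-type inequality for the energy tail. -/
theorem exists_energyDiff_energyTail_le :
    ∃ C : ℝ, 0 < C ∧ ∀ X Y s h : ℝ, 0 ≤ Y → Y ≤ X → 1 / 2 ≤ X → 0 ≤ s → s ≤ 1 / 2 →
      h ^ 2 ≤ 4 * s * (1 - s) * (X * Y) →
      energyDiff energyTail X Y (1 - s) h ≤
        min (s * X) 1 * (C * Y - if 4 ≤ X ∧ Y ≤ 1 then 1 / 2 else 0) := by
  obtain ⟨M, hM0, hM⟩ := exists_deriv_smoothTransition_le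
  refine ⟨2 * (16 * M + 2) + 1, by positivity, ?_⟩
  intro X Y s h hY hYX hX hs hs1 hh
  wlog h0 : 0 ≤ h generalizing h
  · rw [← energyDiff_neg]
    exact this (-h) (by simpa using hh) (by linarith)
  have hX0 : 0 < X := by linarith
  have hXY : 0 ≤ X * Y := by positivity
  have hh2 : h ^ 2 ≤ 4 * s * (X * Y) := by
    refine hh.trans ?_
    have : 4 * s * (1 - s) ≤ 4 * s := by nlinarith
    gcongr
  have hm0 : 0 ≤ min (s * X) 1 := le_min (by positivity) zero_le_one
  have hhx : h ≤ (1 - s) * X + s * Y := by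
    have : 0 ≤ 1 - s := by linarith
    refine le_of_sq_le_sq_of_nonneg (by positivity) hh ?_
    nlinarith [sq_nonneg ((1 - s) * X - s * Y)]
  have hhy : h ≤ s * X + (1 - s) * Y := by
    have : 0 ≤ 1 - s := by linarith
    refine le_of_sq_le_sq_of_nonneg (by positivity) hh ?_
    nlinarith [sq_nonneg (s * X - (1 - s) * Y)]
  have hh3 : h ≤ s * X / 2 + 2 * Y := by
    refine le_of_sq_le_sq_of_nonneg (by positivity) hh2 ?_
    nlinarith [sq_nonneg (s * X / 2 - 2 * Y)]
  -- second differences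
  have hT : ∀ x : ℝ, h ≤ x → s * X ≤ x →
      (energyTail (x + h) + energyTail (x - h)) / 2 - energyTail x ≤
        (16 * M + 2) * (min (s * X) 1 * Y) := by
    intro x hx hsx
    have t1 : (energyTail (x + h) + energyTail (x - h)) / 2 - energyTail x ≤ h ^ 2 / 2 * M :=
      second_diff_le h0 (fun ξ _ => hasDerivAt_energyTail ξ) (fun ξ _ => (hM ξ).1)
        (fun ξ _ => (le_abs_self _).trans (hM ξ).2)
    have t2 : (energyTail (x + h) + energyTail (x - h)) / 2 - energyTail x ≤ 2 := by
      have := energyTail_le (r := x + h) (by linarith)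
      have := energyTail_le (r := x - h) (by linarith)
      have := sub_two_le_energyTail x
      linarith
    have t3 : h ^ 2 / 2 * M ≤ 2 * M * (s * X * Y) := by
      calc h ^ 2 / 2 * M ≤ 4 * s * (X * Y) / 2 * M := by gcongr
        _ = _ := by ring
    rcases le_total (s * X) 1 with h1 | h1
    · rw [min_eq_left h1]
      have : 0 ≤ s * X * Y := by positivity
      nlinarith
    · rw [min_eq_right h1]
      rcases le_total 1 Y with hY1 | hY1
      · nlinarith
      · rcases le_total 8 (s * X) with h8 | h8
        · have e1 := energyTail_eq (r := x + h) (by linarith)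
          have e2 := energyTail_eq (r := x - h) (by linarith)
          have e3 := energyTail_eq (r := x) (by linarith)
          have : 0 ≤ (16 * M + 2) * (1 * Y) := by positivity
          rw [e1, e2, e3]; linarith
        · calc _ ≤ 2 * M * (s * X * Y) := t1.trans t3
            _ ≤ 2 * M * (8 * Y) := by gcongr
            _ ≤ _ := by nlinarith
  have hx := hT ((1 - s) * X + s * Y) hhx (by nlinarith)
  have hy := hT (s * X + (1 - s) * Y) hhy (by nlinarith)
  -- loss
  have hS : energyTail ((1 - s) * X + s * Y) + energyTail (s * X + (1 - s) * Y) - energyTail X -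
      energyTail Y ≤ min (s * X) 1 * (Y - if 4 ≤ X ∧ Y ≤ 1 then 1 / 2 else 0) := by
    have hS0 : energyTail ((1 - s) * X + s * Y) + energyTail (s * X + (1 - s) * Y) - energyTail X -
        energyTail Y ≤ 0 := by
      have h1 := convexOn_energyTail.2 (mem_univ X) (mem_univ Y) (by linarith : 0 ≤ 1 - s) hs (by ring)
      have h2 := convexOn_energyTail.2 (mem_univ X) (mem_univ Y) hs (by linarith : 0 ≤ 1 - s) (by ring)
      simp only [smul_eq_mul] at h1 h2
      linarith
    split_ifs with hc
    -- For Y ≥ 1/2 convexity is enough. For Y ≤ 1/2 the tail of Y vanishes and the fast particle,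
    -- still in the affine range, loses s(X − Y), while the slow one recovers at most its excess
    -- over the threshold 1.
    · rcases le_total (1 / 2) Y with hY2 | hY2
      · exact hS0.trans (mul_nonneg hm0 (by linarith))
      · have e1 := energyTail_eq (r := X) (by linarith)
        have e2 := energyTail_eq (r := (1 - s) * X + s * Y) (by nlinarith)
        have e3 := energyTail_eq_zero (r := Y) (by linarith)
        have m1 := min_le_left (s * X) 1
        have m2 := min_le_right (s * X) 1
        rw [e1, e2, e3]
        rcases le_total (s * X + (1 - s) * Y) 1 with hy1 | hy1
        · rw [energyTail_eq_zero hy1]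
          nlinarith
        · have := energyTail_le_sub_one hy1
          nlinarith
    · refine hS0.trans (mul_nonneg hm0 (by linarith))
  have : energyDiff energyTail X Y (1 - s) h =
      ((energyTail ((1 - s) * X + s * Y + h) + energyTail ((1 - s) * X + s * Y - h)) / 2 -
        energyTail ((1 - s) * X + s * Y)) +
      ((energyTail (s * X + (1 - s) * Y + h) + energyTail (s * X + (1 - s) * Y - h)) / 2 -
        energyTail (s * X + (1 - s) * Y)) +
      (energyTail ((1 - s) * X + s * Y) + energyTail (s * X + (1 - s) * Y) - energyTail X -
      energyTail Y) := by
    unfold energyDiff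
    simp only [sub_sub_cancel]
    ring
  rw [this]
  calc _ ≤ (16 * M + 2) * (min (s * X) 1 * Y) + (16 * M + 2) * (min (s * X) 1 * Y) +
        min (s * X) 1 * (Y - if 4 ≤ X ∧ Y ≤ 1 then 1 / 2 else 0) := add_le_add (add_le_add hx hy) hS
    _ = _ := by ring

/-- The rescaled energy tail, approximating `r ↦ (r - Z)⁺`. -/
noncomputable def energyTailAt (Z r : ℝ) : ℝ := Z * energyTail (r / Z)

theorem energyDiff_energyTailAt {Z : ℝ} (hZ : 0 < Z) (X Y a h : ℝ) :
    energyDiff (energyTailAt Z) X Y a h = Z * energyDiff energyTail (X / Z) (Y / Z) a (h / Z) := by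
  have e : ∀ c d : ℝ, c * X + d * Y = Z * (c * (X / Z) + d * (Y / Z)) := by
    intro c d; field_simp
  have e2 : ∀ c d : ℝ, (c * X + d * Y + h) / Z = c * (X / Z) + d * (Y / Z) + h / Z := by
    intro c d; field_simp
  have e3 : ∀ c d : ℝ, (c * X + d * Y - h) / Z = c * (X / Z) + d * (Y / Z) - h / Z := by
    intro c d; field_simp
  unfold energyDiff energyTailAt
  simp only [e2, e3]
  ring

/-- Homogeneity reduces to Z = 1. For X < Z/2 every energy in the collision is at most X + Y < Z,
where the tail vanishes; hence the indicator on the gain. -/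
theorem exists_energyDiff_energyTailAt_le :
    ∃ C : ℝ, 0 < C ∧ ∀ Z X Y s h : ℝ, 0 < Z → 0 ≤ Y → Y ≤ X → 0 ≤ s → s ≤ 1 / 2 →
      h ^ 2 ≤ 4 * s * (1 - s) * (X * Y) →
      energyDiff (energyTailAt Z) X Y (1 - s) h ≤ min (s * X) Z *
        ((if Z / 2 ≤ X then C * (Y / Z) else 0) - if 4 * Z ≤ X ∧ Y ≤ Z then 1 / 2 else 0) := by
  obtain ⟨C, hC, H⟩ := exists_energyDiff_energyTail_le
  refine ⟨C, hC, fun Z X Y s h hZ hY hYX hs hs1 hh => ?_⟩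
  rw [energyDiff_energyTailAt hZ]
  split_ifs with h1 h2 h2
  · have := H (X / Z) (Y / Z) s (h / Z) (by positivity) (by gcongr)
      (by rw [le_div_iff₀ hZ]; linarith) hs hs1 (by
        rw [div_pow, div_le_iff₀ (by positivity)]
        refine hh.trans_eq ?_
        field_simp)
    have e : min (s * X) Z = Z * min (s * (X / Z)) 1 := by
      rw [mul_min_of_nonneg _ _ hZ.le]; congr 1 <;> field_simp
    rw [e, mul_assoc]
    refine mul_le_mul_of_nonneg_left ?_ hZ.le
    have hc : (4 ≤ X / Z ∧ Y / Z ≤ 1) := ⟨(le_div_iff₀ hZ).2 h2.1, (div_le_one hZ).2 h2.2⟩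
    rwa [if_pos hc] at this
  · have := H (X / Z) (Y / Z) s (h / Z) (by positivity) (by gcongr)
      (by rw [le_div_iff₀ hZ]; linarith) hs hs1 (by
        rw [div_pow, div_le_iff₀ (by positivity)]
        refine hh.trans_eq ?_
        field_simp)
    have e : min (s * X) Z = Z * min (s * (X / Z)) 1 := by
      rw [mul_min_of_nonneg _ _ hZ.le]; congr 1 <;> field_simp
    rw [e, mul_assoc]
    refine mul_le_mul_of_nonneg_left ?_ hZ.le
    have hc : ¬ (4 ≤ X / Z ∧ Y / Z ≤ 1) := by
      rwa [le_div_iff₀ hZ, div_le_one hZ]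
    rwa [if_neg hc] at this
  · have := h2.1
    linarith
  · have hX0 : 0 ≤ X := hY.trans hYX
    have hs1' : 0 ≤ 1 - s := by linarith
    have hsum : X / Z + Y / Z < 1 := by
      rw [← add_div, div_lt_one hZ]; linarith
    have hh1 : h / Z ≤ s * (X / Z) + (1 - s) * (Y / Z) := by
      rw [div_le_iff₀ hZ]
      have : (s * (X / Z) + (1 - s) * (Y / Z)) * Z = s * X + (1 - s) * Y := by field_simp
      rw [this]
      refine le_of_sq_le_sq_of_nonneg (by positivity) hh ?_
      nlinarith [sq_nonneg (s * X - (1 - s) * Y)]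
    have hh2 : -(h / Z) ≤ s * (X / Z) + (1 - s) * (Y / Z) := by
      rw [← neg_div, div_le_iff₀ hZ]
      have : (s * (X / Z) + (1 - s) * (Y / Z)) * Z = s * X + (1 - s) * Y := by field_simp
      rw [this]
      refine le_of_sq_le_sq_of_nonneg (a := -h) (by positivity) (by simpa using hh) ?_
      nlinarith [sq_nonneg (s * X - (1 - s) * Y)]
    have hXZ : 0 ≤ X / Z := by positivity
    have hYZ : Y / Z ≤ X / Z := by gcongr
    have hYZ0 : 0 ≤ Y / Z := by positivity
    have hh3 : s * (X / Z) + (1 - s) * (Y / Z) ≤ (1 - s) * (X / Z) + s * (Y / Z) := by nlinarith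
    have z : ∀ r, r ≤ 1 → energyTail r = 0 := fun r hr => energyTail_eq_zero hr
    unfold energyDiff
    simp only [sub_sub_cancel]
    rw [z _ (by linarith), z _ (by linarith), z _ (by linarith), z _ (by linarith), z _ (by linarith),
      z _ (by linarith)]
    simp

/-! ### Crude bound for the collision difference -/

/-- The shift ±h is estimated by Taylor and the mixing by a Lipschitz bound; both carry the factor
4a(1 − a) = sin²θ. So the collision weight converges absolutely when A_2 < ∞. -/
theorem abs_energyDiff_le {g g' g'' : ℝ → ℝ} {X Y a h M₁ M₂ : ℝ} (hX : 0 ≤ X) (hY : 0 ≤ Y) (ha : 0 ≤ a)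
    (ha1 : a ≤ 1) (hh : h ^ 2 ≤ 4 * a * (1 - a) * (X * Y))
    (hg : ∀ ξ ∈ Icc 0 (X + Y), HasDerivAt g (g' ξ) ξ) (hg' : ∀ ξ ∈ Icc 0 (X + Y), HasDerivAt g' (g'' ξ) ξ)
    (h₁ : ∀ ξ ∈ Icc 0 (X + Y), |g' ξ| ≤ M₁) (h₂ : ∀ ξ ∈ Icc 0 (X + Y), |g'' ξ| ≤ M₂) :
    |energyDiff g X Y a h| ≤ 4 * a * (1 - a) * (X * Y * M₂ + (X + Y) * M₁) := by
  wlog h0 : 0 ≤ h generalizing h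
  · rw [← energyDiff_neg]
    exact this (by simpa using hh) (by linarith)
  have ha' : 0 ≤ 1 - a := by linarith
  have hM₁ : 0 ≤ M₁ := (abs_nonneg _).trans (h₁ 0 ⟨le_rfl, by linarith⟩)
  have hM₂ : 0 ≤ M₂ := (abs_nonneg _).trans (h₂ 0 ⟨le_rfl, by linarith⟩)
  have hhx : h ≤ a * X + (1 - a) * Y := by
    refine le_of_sq_le_sq_of_nonneg (by positivity) hh ?_
    nlinarith [sq_nonneg (a * X - (1 - a) * Y)]
  have hhy : h ≤ (1 - a) * X + a * Y := by
    refine le_of_sq_le_sq_of_nonneg (by positivity) hh ?_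
    nlinarith [sq_nonneg ((1 - a) * X - a * Y)]
  set x := a * X + (1 - a) * Y with hx
  set y := (1 - a) * X + a * Y with hy
  have hxy : x + y = X + Y := by rw [hx, hy]; ring
  have hT : ∀ z, h ≤ z → z + h ≤ X + Y →
      |(g (z + h) + g (z - h)) / 2 - g z| ≤ 2 * a * (1 - a) * (X * Y) * M₂ := by
    intro z hz hz'
    have sub : ∀ ξ ∈ Icc (z - h) (z + h), ξ ∈ Icc 0 (X + Y) := fun ξ hξ =>
      ⟨by linarith [hξ.1], hξ.2.trans hz'⟩
    have t1 := second_diff_le (x := z) h0 (fun ξ hξ => hg ξ (sub ξ hξ)) (fun ξ hξ => hg' ξ (sub ξ hξ))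
      (fun ξ hξ => (le_abs_self _).trans (h₂ ξ (sub ξ hξ)))
    have t2 := second_diff_le (g := fun ξ => -g ξ) (g' := fun ξ => -g' ξ) (g'' := fun ξ => -g'' ξ) (x := z)
      h0 (fun ξ hξ => (hg ξ (sub ξ hξ)).fun_neg) (fun ξ hξ => (hg' ξ (sub ξ hξ)).fun_neg)
      (fun ξ hξ => (neg_le_abs _).trans (h₂ ξ (sub ξ hξ)))
    have t3 : h ^ 2 / 2 * M₂ ≤ 2 * a * (1 - a) * (X * Y) * M₂ := by
      gcongr; linarith
    rw [abs_le]
    constructor <;> linarith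
  have hLip : ∀ r ∈ Icc 0 (X + Y), ∀ s ∈ Icc 0 (X + Y), |g r - g s| ≤ M₁ * |r - s| := by
    intro r hr s hs
    have := (convex_Icc 0 (X + Y)).norm_image_sub_le_of_norm_hasDerivWithin_le
      (fun ξ hξ => (hg ξ hξ).hasDerivWithinAt) (fun ξ hξ => h₁ ξ hξ) hs hr
    simpa using this
  have m : ∀ c, 0 ≤ c → c ≤ X + Y → c ∈ Icc 0 (X + Y) := fun c h1 h2 => ⟨h1, h2⟩
  have hx0 : 0 ≤ x := h0.trans hhx
  have hy0 : 0 ≤ y := h0.trans hhy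
  have hXYd : |X - Y| ≤ X + Y := by rw [abs_le]; constructor <;> linarith
  have hS : |g x + g y - g X - g Y| ≤ 4 * a * (1 - a) * ((X + Y) * M₁) := by
    -- For a ≤ 1/2 the outgoing particles have exchanged roles: x is compared with Y, and y with X.
    rcases le_total a (1 / 2) with h2 | h2
    · have l1 := hLip x (m _ hx0 (by linarith)) Y (m _ hY (by linarith))
      have l2 := hLip y (m _ hy0 (by linarith)) X (m _ hX (by linarith))
      have e1 : x - Y = a * (X - Y) := by rw [hx]; ring
      have e2 : y - X = -(a * (X - Y)) := by rw [hy]; ring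
      rw [e1, abs_mul, abs_of_nonneg ha] at l1
      rw [e2, abs_neg, abs_mul, abs_of_nonneg ha] at l2
      calc |g x + g y - g X - g Y| = |(g x - g Y) + (g y - g X)| := by congr 1; ring
        _ ≤ |g x - g Y| + |g y - g X| := abs_add_le _ _
        _ ≤ M₁ * (a * |X - Y|) + M₁ * (a * |X - Y|) := add_le_add l1 l2
        _ ≤ M₁ * (a * (X + Y)) + M₁ * (a * (X + Y)) := by gcongr
        _ = 4 * a * (1 / 2) * ((X + Y) * M₁) := by ring
        _ ≤ _ := by gcongr; linarith
    · have l1 := hLip x (m _ hx0 (by linarith)) X (m _ hX (by linarith))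
      have l2 := hLip y (m _ hy0 (by linarith)) Y (m _ hY (by linarith))
      have e1 : x - X = -((1 - a) * (X - Y)) := by rw [hx]; ring
      have e2 : y - Y = (1 - a) * (X - Y) := by rw [hy]; ring
      rw [e1, abs_neg, abs_mul, abs_of_nonneg ha'] at l1
      rw [e2, abs_mul, abs_of_nonneg ha'] at l2
      calc |g x + g y - g X - g Y| = |(g x - g X) + (g y - g Y)| := by congr 1; ring
        _ ≤ |g x - g X| + |g y - g Y| := abs_add_le _ _
        _ ≤ M₁ * ((1 - a) * |X - Y|) + M₁ * ((1 - a) * |X - Y|) := add_le_add l1 l2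
        _ ≤ M₁ * ((1 - a) * (X + Y)) + M₁ * ((1 - a) * (X + Y)) := by gcongr
        _ = 4 * (1 / 2) * (1 - a) * ((X + Y) * M₁) := by ring
        _ ≤ _ := by gcongr
  have t1 := hT x hhx (by linarith)
  have t2 := hT y hhy (by linarith)
  have e : energyDiff g X Y a h = ((g (x + h) + g (x - h)) / 2 - g x) +
      ((g (y + h) + g (y - h)) / 2 - g y) + (g x + g y - g X - g Y) := by
    unfold energyDiff; ring
  rw [e]
  calc _ ≤ |(g (x + h) + g (x - h)) / 2 - g x| + |(g (y + h) + g (y - h)) / 2 - g y| +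
        |g x + g y - g X - g Y| := abs_add_three _ _ _
    _ ≤ 2 * a * (1 - a) * (X * Y) * M₂ + 2 * a * (1 - a) * (X * Y) * M₂ +
        4 * a * (1 - a) * ((X + Y) * M₁) := by gcongr
    _ = _ := by ring

/-! ### Energies of the outgoing particles -/

section geometry
variable {d : ℕ} {v w σ : Vel d}

theorem norm_relDir (h : v ≠ w) : ‖relDir v w‖ = 1 := by
  rw [relDir, norm_smul, norm_inv, norm_norm, inv_mul_cancel₀ (norm_ne_zero_iff.2 (sub_ne_zero.2 h))]

theorem norm_smul_relDir (v w : Vel d) : ‖v - w‖ • relDir v w = v - w := by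
  by_cases h : v = w
  · simp [h, relDir]
  · rw [relDir, smul_smul, mul_inv_cancel₀ (norm_ne_zero_iff.2 (sub_ne_zero.2 h)), one_smul]

/-- The part of the outgoing energy that is odd under half-turns about the relative velocity. -/
noncomputable def energyShift (v w σ : Vel d) : ℝ :=
  ‖v - w‖ / 2 * ⟪v + w, σ - ⟪relDir v w, σ⟫ • relDir v w⟫

theorem norm_mul_inner_relDir (v w : Vel d) :
    ‖v - w‖ * ⟪v + w, relDir v w⟫ = ‖v‖ ^ 2 - ‖w‖ ^ 2 := by
  rw [← inner_smul_right, norm_smul_relDir, inner_add_left,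
    inner_sub_right, inner_sub_right, real_inner_self_eq_norm_sq, real_inner_self_eq_norm_sq,
    real_inner_comm v w]
  ring

theorem norm_mul_inner_eq (v w σ : Vel d) :
    ‖v - w‖ / 2 * ⟪v + w, σ⟫ = ⟪relDir v w, σ⟫ / 2 * (‖v‖ ^ 2 - ‖w‖ ^ 2) + energyShift v w σ := by
  rw [energyShift, inner_sub_right, inner_smul_right, ← norm_mul_inner_relDir]
  ring

theorem norm_add_sq_add_norm_sub_sq (v w : Vel d) :
    ‖v + w‖ ^ 2 + ‖v - w‖ ^ 2 = 2 * (‖v‖ ^ 2 + ‖w‖ ^ 2) := by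
  have := parallelogram_law_with_norm ℝ v w
  nlinarith

theorem norm_postVel_sq (hσ : ‖σ‖ = 1) :
    ‖postVel v w σ‖ ^ 2 = (1 + ⟪relDir v w, σ⟫) / 2 * ‖v‖ ^ 2 +
      (1 - (1 + ⟪relDir v w, σ⟫) / 2) * ‖w‖ ^ 2 + energyShift v w σ := by
  have h1 := norm_mul_inner_eq v w σ
  have h2 := norm_add_sq_add_norm_sub_sq v w
  rw [postVel, norm_add_sq_real, norm_smul, norm_smul, inner_smul_left, inner_smul_right, hσ]
  simp only [Real.norm_eq_abs, mul_pow, sq_abs, RCLike.conj_to_real]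
  linear_combination h1 + h2 / 4

theorem norm_postVelStar_sq (hσ : ‖σ‖ = 1) :
    ‖postVelStar v w σ‖ ^ 2 = (1 - (1 + ⟪relDir v w, σ⟫) / 2) * ‖v‖ ^ 2 +
      (1 + ⟪relDir v w, σ⟫) / 2 * ‖w‖ ^ 2 - energyShift v w σ := by
  have h1 := norm_mul_inner_eq v w σ
  have h2 := norm_add_sq_add_norm_sub_sq v w
  rw [postVelStar, norm_sub_sq_real, norm_smul, norm_smul, inner_smul_left, inner_smul_right, hσ]
  simp only [Real.norm_eq_abs, mul_pow, sq_abs, RCLike.conj_to_real]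
  linear_combination -h1 + h2 / 4

theorem inner_halfTurn {e : Vel d} (he : ‖e‖ = 1) : ⟪e, halfTurn e σ⟫ = ⟪e, σ⟫ := by
  rw [halfTurn, inner_sub_right, inner_smul_right, real_inner_self_eq_norm_sq, he]; ring

theorem norm_halfTurn {e : Vel d} (he : ‖e‖ = 1) : ‖halfTurn e σ‖ = ‖σ‖ := by
  rw [halfTurn_eq_reflection e σ (Or.inl he), LinearIsometryEquiv.norm_map]

theorem energyShift_halfTurn (h : v ≠ w) :
    energyShift v w (halfTurn (relDir v w) σ) = -energyShift v w σ := by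
  rw [energyShift, energyShift, inner_halfTurn (norm_relDir h), ← mul_neg, ← inner_neg_right]
  congr 2
  rw [halfTurn, two_mul, add_smul]
  abel

/-- Write σ = cos θ û + ζ with |ζ| = sin θ. As v − w is orthogonal to ζ, v and w have the same
component along ζ. With m the square of that component and a, b the lengths of the remainders, |v −
w| ≤ a + b, and the claim becomes (a + b)²m ≤ (a² + m)(b² + m), that is 0 ≤ (ab − m)². -/
theorem energyShift_sq_le (h : v ≠ w) (hσ : ‖σ‖ = 1) :
    energyShift v w σ ^ 2 ≤ (1 - ⟪relDir v w, σ⟫ ^ 2) * (‖v‖ ^ 2 * ‖w‖ ^ 2) := by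
  set e := relDir v w with he
  have he1 : ‖e‖ = 1 := norm_relDir h
  set ζ := σ - ⟪e, σ⟫ • e with hζ
  have hN : ‖ζ‖ ^ 2 = 1 - ⟪e, σ⟫ ^ 2 := by
    rw [hζ, norm_sub_sq_real, hσ, norm_smul, he1, inner_smul_right, real_inner_comm]
    simp only [Real.norm_eq_abs, mul_one, sq_abs]
    ring
  have heζ : ⟪e, ζ⟫ = 0 := by
    rw [hζ, inner_sub_right, inner_smul_right, real_inner_self_eq_norm_sq, he1]; ring
  have hu : ⟪v - w, ζ⟫ = 0 := by
    rw [← norm_smul_relDir v w, ← he, inner_smul_left, heζ]; simp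
  have hvw : ⟪v, ζ⟫ = ⟪w, ζ⟫ := by
    rw [inner_sub_left] at hu; linarith
  set k := ⟪v, ζ⟫ with hk
  have hsh : energyShift v w σ = ‖v - w‖ * k := by
    rw [energyShift, ← he, ← hζ, inner_add_left, ← hvw]; ring
  rw [hsh, ← hN]
  rcases eq_or_ne ζ 0 with h0 | h0
  · have : k = 0 := by rw [hk, h0, inner_zero_right]
    rw [this]; simp [h0]
  have hNpos : 0 < ‖ζ‖ ^ 2 := by positivity
  set N := ‖ζ‖ ^ 2 with hNdef
  set c := k / N with hc
  have n1 : ‖v - c • ζ‖ ^ 2 = ‖v‖ ^ 2 - k ^ 2 / N := by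
    rw [norm_sub_sq_real, inner_smul_right, norm_smul, mul_pow, ← hNdef, Real.norm_eq_abs, sq_abs, ← hk, hc]
    field_simp; ring
  have n2 : ‖w - c • ζ‖ ^ 2 = ‖w‖ ^ 2 - k ^ 2 / N := by
    rw [norm_sub_sq_real, inner_smul_right, norm_smul, mul_pow, ← hNdef, Real.norm_eq_abs, sq_abs, ← hvw, hc]
    field_simp; ring
  have hle : ‖v - w‖ ≤ ‖v - c • ζ‖ + ‖w - c • ζ‖ := by
    have : v - w = (v - c • ζ) - (w - c • ζ) := by abel
    rw [this]; exact norm_sub_le _ _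
  set a := ‖v - c • ζ‖
  set b := ‖w - c • ζ‖
  have ha : 0 ≤ a := norm_nonneg _
  have hb : 0 ≤ b := norm_nonneg _
  set m := k ^ 2 / N with hm
  have hkm : k ^ 2 = N * m := by rw [hm]; field_simp
  have hm0 : 0 ≤ m := by positivity
  have e1 : ‖v‖ ^ 2 = a ^ 2 + m := by linarith
  have e2 : ‖w‖ ^ 2 = b ^ 2 + m := by linarith
  rw [e1, e2, mul_pow, hkm]
  calc ‖v - w‖ ^ 2 * (N * m) ≤ (a + b) ^ 2 * (N * m) := by gcongr
    _ = N * ((a + b) ^ 2 * m) := by ring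
    _ ≤ N * ((a ^ 2 + m) * (b ^ 2 + m)) := by
        refine mul_le_mul_of_nonneg_left ?_ hNpos.le
        nlinarith [sq_nonneg (a * b - m)]

/-- For radial test functions the averaged collision difference is an `energyDiff`. -/
theorem collDiff_avg_radial (g : ℝ → ℝ) (h : v ≠ w) (hσ : ‖σ‖ = 1) :
    (collDiff (fun x => g (‖x‖ ^ 2)) v w σ +
      collDiff (fun x => g (‖x‖ ^ 2)) v w (halfTurn (relDir v w) σ)) / 2 =
      energyDiff g (‖v‖ ^ 2) (‖w‖ ^ 2) ((1 + ⟪relDir v w, σ⟫) / 2) (energyShift v w σ) := by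
  have he := norm_relDir h
  have hσ' : ‖halfTurn (relDir v w) σ‖ = 1 := by rw [norm_halfTurn he, hσ]
  unfold collDiff energyDiff
  simp only [norm_postVel_sq hσ, norm_postVelStar_sq hσ, norm_postVel_sq hσ', norm_postVelStar_sq hσ',
    energyShift_halfTurn h, inner_halfTurn he, sub_neg_eq_add, ← sub_eq_add_neg]
  ring

theorem abs_inner_le_one {e : Vel d} (he : ‖e‖ = 1) (hσ : ‖σ‖ = 1) : |⟪e, σ⟫| ≤ 1 := by
  simpa [he, hσ] using abs_real_inner_le_norm e σ

end geometry

/-! ### The angular measure -/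

section angular
variable {d : ℕ} {b : ℝ → ℝ}

/-- The image of `b (e · σ) dσ` under `σ ↦ e · σ = cos θ`. -/
noncomputable def angMeasure (b : ℝ → ℝ) (e : Vel d) : Measure ℝ :=
  ((surf d).map fun σ : Sph d => ⟪e, (σ : Vel d)⟫).withDensity fun t => ENNReal.ofReal (b t)

theorem measurable_inner_sphere (e : Vel d) : Measurable fun σ : Sph d => ⟪e, (σ : Vel d)⟫ :=
  (continuous_const.inner continuous_subtype_val).measurable

/-- The reflection exchanging e and e' preserves the surface measure. One angular measure on the
line therefore serves all relative velocities. -/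
theorem map_inner_eq {e e' : Vel d} (he : ‖e‖ = 1) (he' : ‖e'‖ = 1) :
    (surf d).map (fun σ : Sph d => ⟪e, (σ : Vel d)⟫) = (surf d).map fun σ : Sph d => ⟪e', (σ : Vel d)⟫ := by
  set L := (ℝ ∙ (e - e'))ᗮ.reflection with hL
  have hLe : L e = e' := Submodule.reflection_sub (by rw [he, he'])
  have hp := sphereMap_measurePreserving L
  have h : (fun σ : Sph d => ⟪e, (σ : Vel d)⟫) =
      (fun σ : Sph d => ⟪e', (σ : Vel d)⟫) ∘ sphereMap L := by
    funext σ
    rw [← hLe]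
    exact (L.inner_map_map e σ).symm
  rw [h, ← Measure.map_map (measurable_inner_sphere e') hp.measurable, hp.map_eq]

theorem angMeasure_eq {e e' : Vel d} (he : ‖e‖ = 1) (he' : ‖e'‖ = 1) :
    angMeasure b e = angMeasure b e' := by
  rw [angMeasure, map_inner_eq he he', angMeasure]

theorem lintegral_angMeasure (hb : Measurable b) (e : Vel d) {f : ℝ → ℝ≥0∞} (hf : Measurable f) :
    ∫⁻ t, f t ∂(angMeasure b e) =
      ∫⁻ σ : Sph d, ENNReal.ofReal (b ⟪e, (σ : Vel d)⟫) * f ⟪e, (σ : Vel d)⟫ ∂(surf d) := by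
  rw [angMeasure, lintegral_withDensity_eq_lintegral_mul _ hb.ennreal_ofReal hf,
    lintegral_map (hb.ennreal_ofReal.mul hf) (measurable_inner_sphere e)]
  rfl

theorem integrable_angMeasure_iff (hb : Measurable b) (hb0 : ∀ x, 0 ≤ b x) (e : Vel d) {f : ℝ → ℝ}
    (hf : Measurable f) : Integrable f (angMeasure b e) ↔
      Integrable (fun σ : Sph d => b ⟪e, (σ : Vel d)⟫ * f ⟪e, (σ : Vel d)⟫) (surf d) := by
  have h1 := integrable_withDensity_iff_integrable_smul₀'
    (μ := (surf d).map fun σ : Sph d => ⟪e, (σ : Vel d)⟫) (g := f) (f := fun t => ENNReal.ofReal (b t))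
    hb.ennreal_ofReal.aemeasurable (by simp)
  rw [angMeasure, h1, integrable_map_measure
    (by fun_prop : Measurable fun t => (ENNReal.ofReal (b t)).toReal • f t).aestronglyMeasurable (measurable_inner_sphere e).aemeasurable]
  simp only [Function.comp_def, ENNReal.toReal_ofReal (hb0 _), smul_eq_mul]

theorem integral_angMeasure (hb : Measurable b) (hb0 : ∀ x, 0 ≤ b x) (e : Vel d) {f : ℝ → ℝ}
    (hf : Measurable f) : ∫ t, f t ∂(angMeasure b e) =
      ∫ σ : Sph d, b ⟪e, (σ : Vel d)⟫ * f ⟪e, (σ : Vel d)⟫ ∂(surf d) := by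
  rw [angMeasure, integral_withDensity_eq_integral_toReal_smul₀ hb.ennreal_ofReal.aemeasurable (by simp),
    integral_map (measurable_inner_sphere e).aemeasurable
    (by fun_prop : Measurable fun t => (ENNReal.ofReal (b t)).toReal • f t).aestronglyMeasurable]
  simp only [ENNReal.toReal_ofReal (hb0 _), smul_eq_mul]

theorem ae_angMeasure_of_forall (hb : Measurable b) {e : Vel d} {P : ℝ → Prop} (hP : MeasurableSet {t | P t})
    (h : ∀ᵐ σ : Sph d ∂(surf d), P ⟪e, (σ : Vel d)⟫) : ∀ᵐ t ∂(angMeasure b e), P t := by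
  rw [angMeasure, ae_withDensity_iff hb.ennreal_ofReal]
  have := (ae_map_iff (measurable_inner_sphere e).aemeasurable hP).2 h
  filter_upwards [this] with t ht _ using ht

open scoped Pointwise in
-- The cone over the poles lies in a line, which is null for d ≥ 2. Deflections by 0 and π are
-- thereby negligible.
theorem surf_poles (hd : 2 ≤ d) (e : Vel d) : ∀ᵐ σ : Sph d ∂(surf d), (σ : Vel d) ∉ ℝ ∙ e := by
  have hm : MeasurableSet {σ : Sph d | (σ : Vel d) ∈ ℝ ∙ e} :=
    ((ℝ ∙ e).closed_of_finiteDimensional.preimage continuous_subtype_val).measurableSet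
  rw [ae_iff]
  simp only [not_not]
  rw [Measure.toSphere_apply' _ hm]
  have hne : (ℝ ∙ e) ≠ ⊤ := by
    intro h
    have h1 := finrank_span_le_card (R := ℝ) ({e} : Set (Vel d))
    rw [h, finrank_top, finrank_euclideanSpace_fin, Set.toFinset_singleton, Finset.card_singleton] at h1
    omega
  have h0 := Measure.addHaar_submodule (volume : Measure (Vel d)) (ℝ ∙ e) hne
  have : volume (Ioo (0 : ℝ) 1 • ((↑) '' {σ : Sph d | (σ : Vel d) ∈ ℝ ∙ e} : Set (Vel d))) = 0 := by
    refine measure_mono_null ?_ h0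
    intro x hx
    obtain ⟨r, -, _, ⟨σ, hσ, rfl⟩, rfl⟩ := Set.mem_smul.1 hx
    exact (ℝ ∙ e).smul_mem r hσ
  rw [this, mul_zero]

theorem ae_abs_lt_one (hd : 2 ≤ d) (hb : Measurable b) {e : Vel d} (he : ‖e‖ = 1) :
    ∀ᵐ t ∂(angMeasure b e), |t| < 1 := by
  refine ae_angMeasure_of_forall hb (measurableSet_lt measurable_norm measurable_const) ?_
  filter_upwards [surf_poles hd e] with σ hσ
  have hσ1 : ‖(σ : Vel d)‖ = 1 := by simp
  refine lt_of_le_of_ne (abs_inner_le_one he hσ1) fun h => hσ ?_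
  have h2 : ‖⟪e, (σ : Vel d)⟫‖ = ‖e‖ * ‖(σ : Vel d)‖ := by rw [he, hσ1, Real.norm_eq_abs, h, mul_one]
  have h0 : e ≠ 0 := by rintro rfl; simp at he
  have h0' : (σ : Vel d) ≠ 0 := by intro h; rw [h] at hσ1; simp at hσ1
  obtain ⟨r, hr, hr2⟩ := (norm_inner_eq_norm_iff h0 h0').1 h2
  rw [hr2]
  exact Submodule.smul_mem _ _ (Submodule.mem_span_singleton_self e)

theorem angMeasure_ne_zero (hb : IsAngularKernel d b) {e : Vel d} (he : ‖e‖ = 1) : angMeasure b e ≠ 0 := by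
  intro h
  refine hb.nontrivial e he ?_
  have h1 := lintegral_angMeasure hb.measurable e (f := fun _ => 1) measurable_const
  rw [h, lintegral_zero_measure] at h1
  simp only [mul_one] at h1
  have h2 := (lintegral_eq_zero_iff (hb.measurable.comp (measurable_inner_sphere e)).ennreal_ofReal).1 h1.symm
  filter_upwards [h2] with σ hσ
  have := ENNReal.ofReal_eq_zero.1 hσ
  exact le_antisymm this (hb.nonneg _)

/-- The condition `A_β < ∞` in terms of the angular measure. -/
theorem NonCutoff.integrable {β : ℝ} (h : NonCutoff d b β) (hb : IsAngularKernel d b) {e : Vel d}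
    (he : ‖e‖ = 1) : Integrable (fun t => (1 - t ^ 2) ^ (β / 2)) (angMeasure b e) := by
  have hm : Measurable fun t : ℝ => (1 - t ^ 2) ^ (β / 2) := by fun_prop
  rw [integrable_angMeasure_iff hb.measurable hb.nonneg e hm]
  have hle : ∀ σ : Sph d, ⟪e, (σ : Vel d)⟫ ^ 2 ≤ 1 := fun σ => by
    have := abs_inner_le_one he (σ := (σ : Vel d)) (by simp)
    rwa [sq_le_one_iff_abs_le_one]
  have hs : ∀ σ : Sph d, Real.sin (Real.arccos ⟪e, (σ : Vel d)⟫) ^ β = (1 - ⟪e, (σ : Vel d)⟫ ^ 2) ^ (β / 2) := by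
    intro σ
    rw [Real.sin_arccos, Real.sqrt_eq_rpow, ← Real.rpow_mul (by linarith [hle σ])]
    congr 1; ring
  have h1 := h e he
  unfold angularMoment at h1
  simp only [hs] at h1
  refine ⟨((hb.measurable.mul hm).comp (measurable_inner_sphere e)).aestronglyMeasurable, ?_⟩
  rw [hasFiniteIntegral_iff_ofReal]
  · exact h1
  · exact Filter.Eventually.of_forall fun σ => mul_nonneg (hb.nonneg _)
      (Real.rpow_nonneg (by linarith [hle σ]) _)

theorem NonCutoff.mono {β β' : ℝ} (h : NonCutoff d b β) (hb : IsAngularKernel d b) (hβ : 0 < β) (hββ' : β ≤ β') :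
    NonCutoff d b β' := by
  intro e he
  refine (lintegral_mono fun σ => ?_).trans_lt (h e he)
  refine ENNReal.ofReal_le_ofReal (mul_le_mul_of_nonneg_left ?_ (hb.nonneg _))
  have h0 := Real.sin_nonneg_of_nonneg_of_le_pi (Real.arccos_nonneg ⟪e, (σ : Vel d)⟫) (Real.arccos_le_pi _)
  rcases h0.eq_or_lt with h0 | h0
  · rw [← h0, Real.zero_rpow hβ.ne', Real.zero_rpow (by linarith)]
  · exact Real.rpow_le_rpow_of_exponent_ge h0 (Real.sin_le_one _) hββ'

/-- `min (cos² (θ/2)) (sin² (θ/2))` in terms of `t = cos θ`. -/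
noncomputable def minSq (t : ℝ) : ℝ := (1 - |t|) / 2

theorem continuous_minSq : Continuous minSq := by unfold minSq; fun_prop

theorem minSq_nonneg {t : ℝ} (ht : |t| ≤ 1) : 0 ≤ minSq t := by unfold minSq; linarith

theorem minSq_le_half (t : ℝ) : minSq t ≤ 1 / 2 := by unfold minSq; linarith [abs_nonneg t]

theorem four_mul_minSq (t : ℝ) : 4 * minSq t * (1 - minSq t) = 1 - t ^ 2 := by
  unfold minSq
  rw [← sq_abs t]; ring

theorem minSq_le {t : ℝ} (ht : |t| ≤ 1) : minSq t ≤ 1 - t ^ 2 := by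
  rw [← four_mul_minSq]
  nlinarith [minSq_nonneg ht, minSq_le_half t]

/-- Exchanging the outgoing particles replaces a by 1 − a, so only deflections with s ≤ 1/2 need to
be considered, and those near π count as grazing. -/
theorem energyDiff_minSq (g : ℝ → ℝ) (X Y t h : ℝ) :
    energyDiff g X Y ((1 + t) / 2) h = energyDiff g X Y (1 - minSq t) h := by
  rcases le_total 0 t with ht | ht
  · congr 1; rw [minSq, abs_of_nonneg ht]; ring
  · rw [← energyDiff_one_sub]
    congr 1; rw [minSq, abs_of_nonpos ht]; ring

/-! ### Bounds for the collision weight of radial test functions -/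

theorem collWeight_self {γ : ℝ} (hγ : γ ≠ 0) (φ : Vel d → ℝ) (v : Vel d) : collWeight γ b φ v v = 0 := by
  unfold collWeight collKernel
  simp [Real.zero_rpow hγ]

variable {γ C : ℝ} {g : ℝ → ℝ} {v w e : Vel d}

theorem collWeight_radial_eq (h : v ≠ w) : collWeight γ b (fun x => g (‖x‖ ^ 2)) v w =
    ‖v - w‖ ^ γ * ∫ σ : Sph d, b ⟪relDir v w, (σ : Vel d)⟫ *
      energyDiff g (‖v‖ ^ 2) (‖w‖ ^ 2) ((1 + ⟪relDir v w, (σ : Vel d)⟫) / 2) (energyShift v w σ) ∂(surf d) := by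
  rw [← integral_const_mul]
  unfold collWeight
  congr 1
  funext σ
  rw [collDiff_avg_radial g h (by simp), collKernel]
  ring

theorem measurable_energyDiff_sphere (hb : Measurable b) (hg : Measurable g) (v w : Vel d) :
    Measurable fun σ : Sph d => b ⟪relDir v w, (σ : Vel d)⟫ *
      energyDiff g (‖v‖ ^ 2) (‖w‖ ^ 2) ((1 + ⟪relDir v w, (σ : Vel d)⟫) / 2) (energyShift v w σ) := by
  have h1 := measurable_inner_sphere (relDir v w)
  have h2 : Measurable fun σ : Sph d => energyShift v w (σ : Vel d) := by
    have : Continuous fun σ : Sph d => energyShift v w (σ : Vel d) := by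
      unfold energyShift
      fun_prop
    exact this.measurable
  unfold energyDiff
  fun_prop

theorem energyShift_sq_le' (h : v ≠ w) (σ : Sph d) : energyShift v w σ ^ 2 ≤
    4 * ((1 + ⟪relDir v w, (σ : Vel d)⟫) / 2) * (1 - (1 + ⟪relDir v w, (σ : Vel d)⟫) / 2) *
      (‖v‖ ^ 2 * ‖w‖ ^ 2) := by
  refine (energyShift_sq_le h (by simp)).trans_eq ?_
  ring

/-- Bound for `|collWeight|` in terms of a bound for the collision difference. -/
theorem integrable_energyDiff_sphere (hb : IsAngularKernel d b) (hA : NonCutoff d b 2)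
    (hg : Measurable g) (h : v ≠ w)
    (hC : ∀ a k : ℝ, 0 ≤ a → a ≤ 1 → k ^ 2 ≤ 4 * a * (1 - a) * (‖v‖ ^ 2 * ‖w‖ ^ 2) →
      |energyDiff g (‖v‖ ^ 2) (‖w‖ ^ 2) a k| ≤ 4 * a * (1 - a) * C) :
    (∀ σ : Sph d, |b ⟪relDir v w, (σ : Vel d)⟫ *
      energyDiff g (‖v‖ ^ 2) (‖w‖ ^ 2) ((1 + ⟪relDir v w, (σ : Vel d)⟫) / 2) (energyShift v w σ)| ≤
        b ⟪relDir v w, (σ : Vel d)⟫ * (1 - ⟪relDir v w, (σ : Vel d)⟫ ^ 2) * C) ∧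
    Integrable (fun σ : Sph d => b ⟪relDir v w, (σ : Vel d)⟫ * (1 - ⟪relDir v w, (σ : Vel d)⟫ ^ 2)) (surf d) ∧
    Integrable (fun σ : Sph d => b ⟪relDir v w, (σ : Vel d)⟫ *
      energyDiff g (‖v‖ ^ 2) (‖w‖ ^ 2) ((1 + ⟪relDir v w, (σ : Vel d)⟫) / 2) (energyShift v w σ)) (surf d) := by
  have he := norm_relDir h
  have h1 := hA.integrable hb he
  simp only [div_self (two_ne_zero' ℝ), Real.rpow_one] at h1
  rw [integrable_angMeasure_iff hb.measurable hb.nonneg _ (by fun_prop)] at h1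
  have hbd : ∀ σ : Sph d, |b ⟪relDir v w, (σ : Vel d)⟫ *
      energyDiff g (‖v‖ ^ 2) (‖w‖ ^ 2) ((1 + ⟪relDir v w, (σ : Vel d)⟫) / 2) (energyShift v w σ)| ≤
        b ⟪relDir v w, (σ : Vel d)⟫ * (1 - ⟪relDir v w, (σ : Vel d)⟫ ^ 2) * C := by
    intro σ
    have ht := abs_le.1 (abs_inner_le_one he (σ := (σ : Vel d)) (by simp))
    rw [abs_mul, abs_of_nonneg (hb.nonneg _), mul_assoc]
    refine mul_le_mul_of_nonneg_left ?_ (hb.nonneg _)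
    refine (hC _ _ (by linarith [ht.1]) (by linarith [ht.2]) (energyShift_sq_le' h σ)).trans_eq ?_
    ring
  refine ⟨hbd, h1, (h1.mul_const C).mono' (measurable_energyDiff_sphere hb.measurable hg v w).aestronglyMeasurable
    (Filter.Eventually.of_forall fun σ => ?_)⟩
  exact hbd σ

theorem abs_collWeight_le (hb : IsAngularKernel d b) (hA : NonCutoff d b 2) (hγ : γ ≠ 0) (he : ‖e‖ = 1)
    (hg : Measurable g) (hC0 : 0 ≤ C)
    (hC : ∀ a k : ℝ, 0 ≤ a → a ≤ 1 → k ^ 2 ≤ 4 * a * (1 - a) * (‖v‖ ^ 2 * ‖w‖ ^ 2) →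
      |energyDiff g (‖v‖ ^ 2) (‖w‖ ^ 2) a k| ≤ 4 * a * (1 - a) * C) :
    |collWeight γ b (fun x => g (‖x‖ ^ 2)) v w| ≤
      ‖v - w‖ ^ γ * ((∫ t, (1 - t ^ 2) ∂(angMeasure b e)) * C) := by
  have hpos : 0 ≤ ∫ t, (1 - t ^ 2) ∂(angMeasure b e) := by
    rw [integral_angMeasure hb.measurable hb.nonneg _ (by fun_prop)]
    refine integral_nonneg fun σ => mul_nonneg (hb.nonneg _) ?_
    have := abs_inner_le_one he (σ := (σ : Vel d)) (by simp)
    have := (sq_le_one_iff_abs_le_one _).2 this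
    linarith
  by_cases h : v = w
  · subst h
    rw [collWeight_self hγ, abs_zero]
    positivity
  obtain ⟨hbd, hi, -⟩ := integrable_energyDiff_sphere hb hA hg h hC
  rw [collWeight_radial_eq h, abs_mul, abs_of_nonneg (Real.rpow_nonneg (norm_nonneg _) γ)]
  refine mul_le_mul_of_nonneg_left ?_ (Real.rpow_nonneg (norm_nonneg _) γ)
  rw [← Real.norm_eq_abs]
  refine (norm_integral_le_of_norm_le (hi.mul_const C)
    (Filter.Eventually.of_forall fun σ => by rw [Real.norm_eq_abs]; exact hbd σ)).trans_eq ?_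
  rw [integral_mul_const, angMeasure_eq he (norm_relDir h),
    integral_angMeasure hb.measurable hb.nonneg _ (by fun_prop)]

/-- `hC` only provides integrability; the bound itself is the one-sided `hle`, which lets the loss
keep its sign. -/
theorem collWeight_le (hb : IsAngularKernel d b) (hA : NonCutoff d b 2) (hγ : γ ≠ 0) (he : ‖e‖ = 1)
    (hg : Measurable g)
    (hC : ∀ a k : ℝ, 0 ≤ a → a ≤ 1 → k ^ 2 ≤ 4 * a * (1 - a) * (‖v‖ ^ 2 * ‖w‖ ^ 2) →
      |energyDiff g (‖v‖ ^ 2) (‖w‖ ^ 2) a k| ≤ 4 * a * (1 - a) * C)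
    {F : ℝ → ℝ} (hFm : Measurable F) (hF : Integrable F (angMeasure b e))
    (hle : ∀ t k : ℝ, |t| ≤ 1 → k ^ 2 ≤ 4 * minSq t * (1 - minSq t) * (‖v‖ ^ 2 * ‖w‖ ^ 2) →
      energyDiff g (‖v‖ ^ 2) (‖w‖ ^ 2) (1 - minSq t) k ≤ F t) :
    collWeight γ b (fun x => g (‖x‖ ^ 2)) v w ≤ ‖v - w‖ ^ γ * ∫ t, F t ∂(angMeasure b e) := by
  by_cases h : v = w
  · subst h
    rw [collWeight_self hγ, sub_self, norm_zero, Real.zero_rpow hγ, zero_mul]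
  obtain ⟨-, -, hi⟩ := integrable_energyDiff_sphere hb hA hg h hC
  rw [collWeight_radial_eq h, angMeasure_eq he (norm_relDir h),
    integral_angMeasure hb.measurable hb.nonneg _ hFm]
  refine mul_le_mul_of_nonneg_left ?_ (Real.rpow_nonneg (norm_nonneg _) γ)
  rw [angMeasure_eq he (norm_relDir h), integrable_angMeasure_iff hb.measurable hb.nonneg _ hFm] at hF
  refine integral_mono hi hF fun σ => mul_le_mul_of_nonneg_left ?_ (hb.nonneg _)
  rw [energyDiff_minSq]
  refine hle _ _ (abs_inner_le_one (norm_relDir h) (by simp)) ?_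
  rw [four_mul_minSq]
  exact energyShift_sq_le h (by simp)

end angular

/-! ### Basic properties of weak solutions -/

section solution
variable {d : ℕ} {γ : ℝ} {b : ℝ → ℝ} {F : ℝ → Measure (Vel d)}

theorem IsWeakSolution.isFiniteMeasure (h : IsWeakSolution γ b F) {t : ℝ} (ht : 0 ≤ t) :
    IsFiniteMeasure (F t) :=
  ⟨by have := h.mass_eq t ht; rw [mass] at this; rw [this]; exact h.mass_lt_top⟩

theorem IsWeakSolution.integrable_normSq (h : IsWeakSolution γ b F) {t : ℝ} (ht : 0 ≤ t) :
    Integrable (fun v => ‖v‖ ^ 2) (F t) := by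
  refine ⟨by fun_prop, ?_⟩
  rw [hasFiniteIntegral_iff_ofReal (Filter.Eventually.of_forall fun v => by positivity)]
  have := h.energy_eq t ht
  rw [energy] at this
  rw [this]
  exact h.energy_lt_top

theorem IsWeakSolution.integral_normSq (h : IsWeakSolution γ b F) {t : ℝ} (ht : 0 ≤ t) :
    ∫ v, ‖v‖ ^ 2 ∂(F t) = (energy (F 0)).toReal := by
  rw [integral_eq_lintegral_of_nonneg_ae (Filter.Eventually.of_forall fun v => by positivity) (by fun_prop),
    ← h.energy_eq t ht, energy]

theorem IsWeakSolution.real_univ (h : IsWeakSolution γ b F) {t : ℝ} (ht : 0 ≤ t) :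
    (F t).real univ = (mass (F 0)).toReal := by
  rw [← h.mass_eq t ht, mass, Measure.real]

/-- The right-hand side of the weak formulation. -/
noncomputable def collRate (γ : ℝ) (b : ℝ → ℝ) (F : ℝ → Measure (Vel d)) (φ : Vel d → ℝ) (τ : ℝ) : ℝ :=
  (1 / 2) * ∫ p : Vel d × Vel d, collWeight γ b φ p.1 p.2 ∂((F τ).prod (F τ))

theorem IsWeakSolution.intervalIntegrable (h : IsWeakSolution γ b F) {φ : Vel d → ℝ}
    (hφ : ContDiff ℝ (⊤ : ℕ∞) φ) (hc : HasCompactSupport φ) {s t : ℝ} (hs : 0 ≤ s) (ht : 0 ≤ t) :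
    IntervalIntegrable (collRate γ b F φ) volume s t :=
  (((h.integrable_time φ hφ hc s hs).symm.trans (h.integrable_time φ hφ hc t ht))).const_mul _

theorem IsWeakSolution.integral_sub (h : IsWeakSolution γ b F) {φ : Vel d → ℝ}
    (hφ : ContDiff ℝ (⊤ : ℕ∞) φ) (hc : HasCompactSupport φ) {s t : ℝ} (hs : 0 ≤ s) (ht : 0 ≤ t) :
    ∫ v, φ v ∂(F t) - ∫ v, φ v ∂(F s) = ∫ τ in s..t, collRate γ b F φ τ := by
  rw [h.weak_form φ hφ hc t ht, h.weak_form φ hφ hc s hs, add_sub_add_left_eq_sub]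
  exact intervalIntegral.integral_interval_sub_left (h.intervalIntegrable hφ hc le_rfl ht)
    (h.intervalIntegrable hφ hc le_rfl hs)

/-- The equation is autonomous, so short-time estimates can be restarted at any time. -/
theorem IsWeakSolution.shift (h : IsWeakSolution γ b F) {s : ℝ} (hs : 0 ≤ s) :
    IsWeakSolution γ b fun t => F (s + t) where
  mass_lt_top := by rw [h.mass_eq _ (by linarith)]; exact h.mass_lt_top
  energy_lt_top := by rw [h.energy_eq _ (by linarith)]; exact h.energy_lt_top
  mass_eq t ht := by rw [h.mass_eq _ (by linarith), h.mass_eq (s + 0) (by linarith)]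
  energy_eq t ht := by rw [h.energy_eq _ (by linarith), h.energy_eq (s + 0) (by linarith)]
  integrable_weight φ hφ hc := by
    have h1 := h.integrable_weight φ hφ hc
    rw [ae_restrict_iff' measurableSet_Ioi] at h1 ⊢
    have h2 := (measurePreserving_add_left (volume : Measure ℝ) s).quasiMeasurePreserving.ae h1
    filter_upwards [h2] with τ hτ h0
    exact hτ (by simp only [mem_Ioi] at h0 ⊢; linarith)
  integrable_time φ hφ hc t ht := by
    have h1 := (h.integrable_time φ hφ hc s hs).symm.trans (h.integrable_time φ hφ hc (s + t) (by linarith))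
    have h2 := h1.comp_add_left s
    simpa using h2
  weak_form φ hφ hc t ht := by
    have h1 := h.integral_sub hφ hc (s := s + 0) (t := s + t) (by linarith) (by linarith)
    have h2 := intervalIntegral.integral_comp_add_left (a := 0) (b := t) (fun τ => collRate γ b F φ τ) s
    rw [← h2] at h1
    simp only [collRate] at h1
    linarith

theorem IsWeakSolution.continuousOn_integral (h : IsWeakSolution γ b F) {φ : Vel d → ℝ}
    (hφ : ContDiff ℝ (⊤ : ℕ∞) φ) (hc : HasCompactSupport φ) :
    ContinuousOn (fun t => ∫ v, φ v ∂(F t)) (Ici 0) := by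
  intro t ht
  have ht' : (0 : ℝ) ≤ t := ht
  have h1 := intervalIntegral.continuousOn_primitive_interval'
    (h.intervalIntegrable hφ hc le_rfl (by linarith : 0 ≤ t + 1)) (left_mem_uIcc (a := (0 : ℝ)) (b := t + 1))
  rw [uIcc_of_le (by linarith)] at h1
  have h2 : ContinuousWithinAt (fun t => ∫ v, φ v ∂(F t)) (Icc 0 (t + 1)) t := by
    refine ((h1 t ⟨ht', by linarith⟩).const_add (∫ v, φ v ∂(F 0))).congr (fun r hr => ?_) ?_
    · exact h.weak_form φ hφ hc r hr.1
    · exact h.weak_form φ hφ hc t ht'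
  refine h2.mono_of_mem_nhdsWithin ?_
  rw [← Ici_inter_Iic]
  exact Filter.inter_mem self_mem_nhdsWithin (mem_nhdsWithin_of_mem_nhds (Iic_mem_nhds (by linarith)))

/-- Weak solutions are measurable families of measures. -/
theorem IsWeakSolution.measurable (h : IsWeakSolution γ b F) : Measurable fun t => F (max t 0) := by
  have : ∀ t : ℝ, IsFiniteMeasure (F (max t 0)) := fun t => h.isFiniteMeasure (le_max_right _ _)
  refine Measurable.measure_of_isPiSystem (S := {U : Set (Vel d) | IsOpen U})
    (BorelSpace.measurable_eq) isPiSystem_isOpen ?_ ?_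
  · intro U hU
    obtain ⟨f, hfU, hf, hf01⟩ := IsOpen.exists_contDiff_support_eq (n := ⊤) (show IsOpen U from hU)
    have hf0 : ∀ x, 0 ≤ f x ∧ f x ≤ 1 := fun x => hf01 ⟨x, rfl⟩
    let χ : ∀ k : ℕ, ContDiffBump (0 : Vel d) := fun k => ⟨k + 1, k + 2, by positivity, by linarith⟩
    -- 1 − (1 − f)^k tends to the indicator of U = {f ≠ 0}, and the bump makes the support compact;
    -- so t ↦ F_t(U) is a limit of continuous functions.
    set φ : ℕ → Vel d → ℝ := fun k x => (1 - (1 - f x) ^ k) * χ k x with hφ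
    have hφd : ∀ k, ContDiff ℝ (⊤ : ℕ∞) (φ k) := fun k =>
      (contDiff_const.sub ((contDiff_const.sub hf).pow k)).mul (χ k).contDiff
    have hφc : ∀ k, HasCompactSupport (φ k) := fun k => (χ k).hasCompactSupport.mul_left
    have hφ1 : ∀ k x, ‖φ k x‖ ≤ 1 := by
      intro k x
      have h1 : (1 - f x) ^ k ≤ 1 := pow_le_one₀ (by linarith [(hf0 x).2]) (by linarith [(hf0 x).1])
      have h2 : 0 ≤ (1 - f x) ^ k := pow_nonneg (by linarith [(hf0 x).2]) k
      have h3 := (χ k).nonneg (x := x)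
      have h4 := (χ k).le_one (x := x)
      rw [Real.norm_eq_abs, abs_of_nonneg (mul_nonneg (by linarith) h3)]
      exact mul_le_one₀ (by linarith) h3 h4
    have hlim : ∀ x, Filter.Tendsto (fun k => φ k x) Filter.atTop (nhds (U.indicator (fun _ => (1 : ℝ)) x)) := by
      intro x
      have hχ : ∀ᶠ k : ℕ in Filter.atTop, χ k x = 1 := by
        filter_upwards [Filter.eventually_ge_atTop ⌈‖x‖⌉₊] with k hk
        refine (χ k).one_of_mem_closedBall ?_
        rw [mem_closedBall_zero_iff]
        change ‖x‖ ≤ (k : ℝ) + 1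
        have := Nat.ceil_le.1 hk
        linarith
      by_cases hx : x ∈ U
      · rw [indicator_of_mem hx]
        have hfx : 0 < f x := lt_of_le_of_ne (hf0 x).1 (Ne.symm (by rw [← hfU] at hx; exact hx))
        have h1 := tendsto_pow_atTop_nhds_zero_of_lt_one (r := 1 - f x) (by linarith [(hf0 x).2]) (by linarith)
        have h2 := h1.const_sub 1
        rw [sub_zero] at h2
        refine h2.congr' ?_
        filter_upwards [hχ] with k hk
        simp only [hφ, hk, mul_one]
      · rw [indicator_of_notMem hx]
        have hfx : f x = 0 := by
          rw [← hfU] at hx; exact Function.notMem_support.1 hx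
        refine tendsto_const_nhds.congr fun k => ?_
        simp [hφ, hfx]
    have hmeas : Measurable fun t : ℝ => (F (max t 0)).real U := by
      refine measurable_of_tendsto_metrizable (f := fun k t => ∫ v, φ k v ∂(F (max t 0))) (fun k => ?_) ?_
      · have h1 := (h.continuousOn_integral (hφd k) (hφc k)).comp_continuous
          (continuous_id.max (continuous_const (y := (0 : ℝ)))) (fun t => le_max_right t 0)
        exact h1.measurable
      · rw [tendsto_pi_nhds]
        intro t
        have h1 := tendsto_integral_of_dominated_convergence (μ := F (max t 0)) (fun _ => (1 : ℝ))
          (fun k => (hφd k).continuous.aestronglyMeasurable) (integrable_const 1)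
          (fun k => Filter.Eventually.of_forall (hφ1 k)) (Filter.Eventually.of_forall hlim)
        rwa [integral_indicator (show IsOpen U from hU).measurableSet, setIntegral_const, smul_eq_mul, mul_one] at h1
    have : (fun t : ℝ => F (max t 0) U) = fun t => ENNReal.ofReal ((F (max t 0)).real U) := by
      funext t
      rw [Measure.real, ENNReal.ofReal_toReal (measure_ne_top _ _)]
    rw [this]
    exact hmeas.ennreal_ofReal
  · have : (fun t : ℝ => F (max t 0) univ) = fun _ => mass (F 0) := by
      funext t
      exact h.mass_eq _ (le_max_right _ _)
    rw [this]
    exact measurable_const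

end solution

/-- Symmetry of the collision weight. -/
theorem collWeight_comm {d : ℕ} (γ : ℝ) (b : ℝ → ℝ) (φ : Vel d → ℝ) (v w : Vel d) :
    collWeight γ b φ v w = collWeight γ b φ w v := by
  -- The change of variable σ ↦ −σ undoes the exchange of v and w.
  have hp := sphereMap_measurePreserving (LinearIsometryEquiv.neg ℝ : Vel d ≃ₗᵢ[ℝ] Vel d)
  have hinv : Function.Involutive (sphereMap (LinearIsometryEquiv.neg ℝ : Vel d ≃ₗᵢ[ℝ] Vel d)) :=
    fun σ => Subtype.ext (by simp [sphereMap])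
  have hemb : MeasurableEmbedding (sphereMap (LinearIsometryEquiv.neg ℝ : Vel d ≃ₗᵢ[ℝ] Vel d)) :=
    (MeasurableEquiv.ofInvolutive _ hinv hp.measurable).measurableEmbedding
  have hdir : relDir w v = -relDir v w := by
    rw [relDir, relDir, norm_sub_rev, ← smul_neg, neg_sub]
  have hdiff : ∀ σ, collDiff φ w v (-σ) = collDiff φ v w σ := by
    intro σ
    have h1 : postVel w v (-σ) = postVelStar v w σ := by
      rw [postVel, postVelStar, norm_sub_rev, add_comm w v, smul_neg, ← sub_eq_add_neg]
    have h2 : postVelStar w v (-σ) = postVel v w σ := by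
      rw [postVel, postVelStar, norm_sub_rev, add_comm w v, smul_neg, sub_neg_eq_add]
    rw [collDiff, collDiff, h1, h2]
    ring
  have hturn : ∀ σ, halfTurn (relDir w v) (-σ) = -halfTurn (relDir v w) σ := by
    intro σ
    rw [hdir, halfTurn, halfTurn, inner_neg_neg, smul_neg, neg_sub, sub_neg_eq_add]
    abel
  have hker : ∀ σ, collKernel γ b w v (-σ) = collKernel γ b v w σ := by
    intro σ
    rw [collKernel, collKernel, norm_sub_rev, hdir, inner_neg_neg]
  have hco : ∀ σ : Sph d, ((sphereMap (LinearIsometryEquiv.neg ℝ : Vel d ≃ₗᵢ[ℝ] Vel d) σ : Sph d) : Vel d) = -σ :=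
    fun σ => rfl
  rw [collWeight, collWeight, ← hp.integral_comp hemb fun σ : Sph d =>
    (collDiff φ w v (σ : Vel d) + collDiff φ w v (halfTurn (relDir w v) (σ : Vel d))) / 2 *
      collKernel γ b w v (σ : Vel d)]
  simp only [hco, hturn, hdiff, hker]

/-! ### Production of energy tails -/

section tails
variable {d : ℕ} {γ : ℝ} {b : ℝ → ℝ} {e : Vel d}

theorem integrable_minSq (hd : 2 ≤ d) (hb : IsAngularKernel d b) (hA : NonCutoff d b 2) (he : ‖e‖ = 1) :
    Integrable minSq (angMeasure b e) := by
  have h1 := hA.integrable hb he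
  simp only [div_self (two_ne_zero' ℝ), Real.rpow_one] at h1
  refine h1.mono' continuous_minSq.aestronglyMeasurable ?_
  filter_upwards [ae_abs_lt_one hd hb.measurable he] with t ht
  rw [Real.norm_eq_abs, abs_of_nonneg (minSq_nonneg ht.le)]
  exact minSq_le ht.le

/-- The rate at which particles of energy `X` feed the energies up to `Z`. -/
noncomputable def tailWeight (b : ℝ → ℝ) (e : Vel d) (Z X : ℝ) : ℝ :=
  ∫ t, min (minSq t * X) Z ∂(angMeasure b e)

theorem integrable_min_minSq (hd : 2 ≤ d) (hb : IsAngularKernel d b) (hA : NonCutoff d b 2) (he : ‖e‖ = 1)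
    {Z : ℝ} (hZ : 0 ≤ Z) (X : ℝ) : Integrable (fun t => min (minSq t * X) Z) (angMeasure b e) := by
  refine ((integrable_minSq hd hb hA he).mul_const |X|).mono'
    ((continuous_minSq.mul continuous_const).min continuous_const).aestronglyMeasurable ?_
  filter_upwards [ae_abs_lt_one hd hb.measurable he] with t ht
  have h0 := minSq_nonneg ht.le
  rw [Real.norm_eq_abs, abs_le]
  have h1 : minSq t * X ≤ minSq t * |X| := by gcongr; exact le_abs_self X
  have h2 : -(minSq t * |X|) ≤ minSq t * X := by rw [← mul_neg]; gcongr; exact neg_abs_le X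
  refine ⟨le_min h2 ?_, (min_le_left _ _).trans h1⟩
  have : 0 ≤ minSq t * |X| := by positivity
  linarith

theorem tailWeight_mono (hd : 2 ≤ d) (hb : IsAngularKernel d b) (hA : NonCutoff d b 2) (he : ‖e‖ = 1)
    {Z : ℝ} (hZ : 0 ≤ Z) : Monotone (tailWeight b e Z) := fun X Y hXY => by
  refine integral_mono_ae (integrable_min_minSq hd hb hA he hZ X) (integrable_min_minSq hd hb hA he hZ Y) ?_
  filter_upwards [ae_abs_lt_one hd hb.measurable he] with t ht
  have h0 := minSq_nonneg ht.le
  gcongr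

theorem tailWeight_nonneg (hd : 2 ≤ d) (hb : IsAngularKernel d b) (he : ‖e‖ = 1)
    {Z X : ℝ} (hZ : 0 ≤ Z) (hX : 0 ≤ X) : 0 ≤ tailWeight b e Z X := by
  refine integral_nonneg_of_ae ?_
  filter_upwards [ae_abs_lt_one hd hb.measurable he] with t ht
  exact le_min (mul_nonneg (minSq_nonneg ht.le) hX) hZ

theorem tailWeight_le (hd : 2 ≤ d) (hb : IsAngularKernel d b) (hA : NonCutoff d b 2) (he : ‖e‖ = 1)
    {Z : ℝ} (hZ : 0 ≤ Z) (X : ℝ) : tailWeight b e Z X ≤ (∫ t, minSq t ∂(angMeasure b e)) * X := by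
  rw [← integral_mul_const]
  exact integral_mono (integrable_min_minSq hd hb hA he hZ X) ((integrable_minSq hd hb hA he).mul_const X)
    fun t => min_le_left _ _

/-- The integrand is positive off the poles and the angular measure is nonzero. This constant is the
source of the loss of energy tails. -/
theorem integral_min_minSq_pos (hd : 2 ≤ d) (hb : IsAngularKernel d b) (hA : NonCutoff d b 2) (he : ‖e‖ = 1) :
    0 < tailWeight b e 1 4 := by
  have hi := integrable_min_minSq hd hb hA he (zero_le_one) 4
  have h0 : 0 ≤ᵐ[angMeasure b e] fun t => min (minSq t * 4) 1 := by
    filter_upwards [ae_abs_lt_one hd hb.measurable he] with t ht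
    exact le_min (mul_nonneg (minSq_nonneg ht.le) (by norm_num)) zero_le_one
  refine lt_of_le_of_ne (integral_nonneg_of_ae h0) fun h => angMeasure_ne_zero hb he ?_
  have h1 := (integral_eq_zero_iff_of_nonneg_ae h0 hi).1 h.symm
  rw [← ae_eq_bot]
  refine Filter.eventually_false_iff_eq_bot.1 ?_
  filter_upwards [h1, ae_abs_lt_one hd hb.measurable he] with t ht1 ht
  have : 0 < min (minSq t * 4) 1 := lt_min (by unfold minSq; linarith) one_pos
  exact this.ne' ht1

theorem mul_le_tailWeight (hd : 2 ≤ d) (hb : IsAngularKernel d b) (hA : NonCutoff d b 2) (he : ‖e‖ = 1)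
    {Z X : ℝ} (hZ : 0 ≤ Z) (hX : 4 * Z ≤ X) : Z * tailWeight b e 1 4 ≤ tailWeight b e Z X := by
  refine le_trans (le_of_eq ?_) (tailWeight_mono hd hb hA he hZ hX)
  rw [tailWeight, tailWeight, ← integral_const_mul]
  congr 1
  funext t
  rw [mul_min_of_nonneg _ _ hZ]
  congr 1 <;> ring

/-- The energy tail, minus its affine part: a compactly supported function of the energy. -/
noncomputable def tailTest (Z r : ℝ) : ℝ := energyTailAt Z r - r + Z * energyTailShift

/-- Affine functions of the energy are collision invariants, so the compactly supported function has
the same collision difference as the tail. -/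
theorem energyDiff_tailTest (Z X Y a h : ℝ) :
    energyDiff (tailTest Z) X Y a h = energyDiff (energyTailAt Z) X Y a h := by
  unfold energyDiff tailTest
  ring

theorem contDiff_tailTest (Z : ℝ) : ContDiff ℝ (⊤ : ℕ∞) fun v : Vel d => tailTest Z (‖v‖ ^ 2) := by
  have h1 : ContDiff ℝ (⊤ : ℕ∞) fun v : Vel d => ‖v‖ ^ 2 := contDiff_norm_sq ℝ
  have h2 : ContDiff ℝ (⊤ : ℕ∞) fun v : Vel d => energyTail (‖v‖ ^ 2 / Z) :=
    contDiff_energyTail.comp (h1.div_const Z)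
  unfold tailTest energyTailAt
  exact ((contDiff_const.mul h2).sub h1).add contDiff_const

theorem hasCompactSupport_tailTest {Z : ℝ} (hZ : 0 < Z) :
    HasCompactSupport fun v : Vel d => tailTest Z (‖v‖ ^ 2) := by
  refine HasCompactSupport.intro (isCompact_closedBall (0 : Vel d) (Real.sqrt (2 * Z))) fun v hv => ?_
  rw [mem_closedBall_zero_iff, not_le] at hv
  have h1 : 2 * Z < ‖v‖ ^ 2 := (Real.sqrt_lt' ((Real.sqrt_nonneg _).trans_lt hv)).1 hv
  have h2 := energyTail_eq (r := ‖v‖ ^ 2 / Z) (by rw [le_div_iff₀ hZ]; linarith)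
  rw [tailTest, energyTailAt, h2]
  field_simp
  ring

/-- Pointwise bound for the collision weight of an energy tail. -/
theorem exists_collWeight_tailTest_le (hd : 2 ≤ d) (hγ₀ : 0 < γ) (hγ₁ : γ ≤ 1) (hb : IsAngularKernel d b)
    (hA : NonCutoff d b 2) (he : ‖e‖ = 1) :
    ∃ C : ℝ, 0 < C ∧ ∀ (Z : ℝ) (v w : Vel d), 0 < Z → ‖w‖ ≤ ‖v‖ →
      collWeight γ b (fun x => tailTest Z (‖x‖ ^ 2)) v w ≤ ‖v‖ ^ γ * tailWeight b e Z (‖v‖ ^ 2) *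
        ((if Z / 2 ≤ ‖v‖ ^ 2 then C * (‖w‖ ^ 2 / Z) else 0) -
          if 4 * Z ≤ ‖v‖ ^ 2 ∧ ‖w‖ ^ 2 ≤ Z then 1 / 4 else 0) := by
  obtain ⟨C, hC, H⟩ := exists_energyDiff_energyTailAt_le
  obtain ⟨M, hM0, hM⟩ := exists_deriv_smoothTransition_le
  refine ⟨2 * C, by positivity, fun Z v w hZ hwv => ?_⟩
  have hm : Measurable (tailTest Z) := by
    have := contDiff_energyTail.continuous.measurable
    unfold tailTest energyTailAt
    fun_prop
  have hd1 : ∀ ξ, HasDerivAt (energyTailAt Z) (Real.smoothTransition (ξ / Z - 1)) ξ := by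
    intro ξ
    have h1 := ((hasDerivAt_energyTail (ξ / Z)).comp ξ ((hasDerivAt_id ξ).div_const Z)).const_mul Z
    refine h1.congr_deriv ?_
    field_simp
  have hd2 : ∀ ξ, HasDerivAt (fun ρ => Real.smoothTransition (ρ / Z - 1))
      (deriv Real.smoothTransition (ξ / Z - 1) / Z) ξ := by
    intro ξ
    have h1 := ((hM (ξ / Z)).1).comp ξ ((hasDerivAt_id ξ).div_const Z)
    refine h1.congr_deriv ?_
    field_simp
  have hX : 0 ≤ ‖v‖ ^ 2 := by positivity
  have hY : 0 ≤ ‖w‖ ^ 2 := by positivity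
  have hwv2 : ‖w‖ ^ 2 ≤ ‖v‖ ^ 2 := by gcongr
  set G : ℝ := (if Z / 2 ≤ ‖v‖ ^ 2 then C * (‖w‖ ^ 2 / Z) else 0) -
          if 4 * Z ≤ ‖v‖ ^ 2 ∧ ‖w‖ ^ 2 ≤ Z then 1 / 2 else 0 with hG
  have hle := collWeight_le (γ := γ) (v := v) (w := w) hb hA hγ₀.ne' he hm
    (C := ‖v‖ ^ 2 * ‖w‖ ^ 2 * (M / Z) + (‖v‖ ^ 2 + ‖w‖ ^ 2) * 1) (F := fun t => min (minSq t * ‖v‖ ^ 2) Z * G)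
    (fun a k ha ha1 hk => by
      rw [energyDiff_tailTest]
      refine abs_energyDiff_le hX hY ha ha1 hk (fun ξ _ => hd1 ξ) (fun ξ _ => hd2 ξ) (fun ξ _ => ?_)
        (fun ξ _ => ?_)
      · rw [abs_of_nonneg (Real.smoothTransition.nonneg _)]
        exact Real.smoothTransition.le_one _
      · rw [abs_div, abs_of_pos hZ]
        have := (hM (ξ / Z)).2
        gcongr)
    (((continuous_minSq.mul continuous_const).min continuous_const).measurable.mul_const _)
    ((integrable_min_minSq hd hb hA he hZ.le _).mul_const _)
    (fun t k ht hk => by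
      rw [energyDiff_tailTest]
      exact H Z _ _ _ _ hZ hY hwv2 (minSq_nonneg ht) (minSq_le_half t) hk)
  rw [integral_mul_const, ← tailWeight, ← mul_assoc] at hle
  refine hle.trans ?_
  have hW := tailWeight_nonneg hd hb he hZ.le hX
  have hu : ‖v - w‖ ^ γ ≤ 2 * ‖v‖ ^ γ := by
    calc ‖v - w‖ ^ γ ≤ (2 * ‖v‖) ^ γ :=
          Real.rpow_le_rpow (norm_nonneg _) ((norm_sub_le v w).trans (by linarith)) hγ₀.le
      _ = 2 ^ γ * ‖v‖ ^ γ := Real.mul_rpow (by norm_num) (norm_nonneg _)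
      _ ≤ 2 ^ (1 : ℝ) * ‖v‖ ^ γ := by
          gcongr
          norm_num
      _ = _ := by rw [Real.rpow_one]
  have hv0 : 0 ≤ ‖v‖ ^ γ := Real.rpow_nonneg (norm_nonneg _) _
  have hu0 : 0 ≤ ‖v - w‖ ^ γ := Real.rpow_nonneg (norm_nonneg _) _
  rw [mul_right_comm, mul_right_comm (‖v‖ ^ γ)]
  refine mul_le_mul_of_nonneg_right ?_ hW
  rw [hG, mul_sub, mul_sub]
  refine sub_le_sub ?_ ?_
  · split_ifs
    · calc ‖v - w‖ ^ γ * (C * (‖w‖ ^ 2 / Z)) ≤ 2 * ‖v‖ ^ γ * (C * (‖w‖ ^ 2 / Z)) := by gcongr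
        _ = _ := by ring
    · simp
  · split_ifs with hc
    -- In the loss region |w|² ≤ Z ≤ |v|²/4, hence |v − w| ≥ |v|/2; as γ ≤ 1 this costs a factor 2
    -- at most, turning 1/2 into 1/4.
    · have h2 : ‖w‖ ≤ ‖v‖ / 2 := by
        refine le_of_sq_le_sq_of_nonneg (by positivity) hc.2 ?_
        nlinarith
      have h3 : ‖v‖ / 2 ≤ ‖v - w‖ := by
        have := norm_sub_norm_le v w
        linarith
      have h4 : ‖v‖ ^ γ * (1 / 2) ≤ ‖v - w‖ ^ γ := by
        calc ‖v‖ ^ γ * (1 / 2) = ‖v‖ ^ γ * (1 / 2) ^ (1 : ℝ) := by rw [Real.rpow_one]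
          _ ≤ ‖v‖ ^ γ * (1 / 2) ^ γ := by
              refine mul_le_mul_of_nonneg_left ?_ hv0
              exact Real.rpow_le_rpow_of_exponent_ge (by norm_num) (by norm_num) hγ₁
          _ = (‖v‖ / 2) ^ γ := by
              rw [← Real.mul_rpow (norm_nonneg _) (by norm_num)]; congr 1; ring
          _ ≤ _ := Real.rpow_le_rpow (by positivity) h3 hγ₀.le
      linarith
    · simp

/-- The rate of `tailWeight` for particles of energy at least `R`. -/
noncomputable def highRate (γ : ℝ) (b : ℝ → ℝ) (e : Vel d) (Z R : ℝ) : Vel d → ℝ :=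
  {x : Vel d | R ≤ ‖x‖ ^ 2}.indicator fun x => ‖x‖ ^ γ * tailWeight b e Z (‖x‖ ^ 2)

/-- A bound for half of the symmetrised collision weight of an energy tail. -/
noncomputable def tailBound (γ : ℝ) (b : ℝ → ℝ) (e : Vel d) (C Z : ℝ) (v w : Vel d) : ℝ :=
  highRate γ b e Z (Z / 2) v * (C * (‖w‖ ^ 2 / Z)) -
    highRate γ b e Z (4 * Z) v * {x : Vel d | ‖x‖ ^ 2 ≤ Z}.indicator (fun _ => 1 / 4) w

/-- Symmetrised form of the bound for the collision weight of an energy tail. -/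
theorem exists_collWeight_tailTest_le_add (hd : 2 ≤ d) (hγ₀ : 0 < γ) (hγ₁ : γ ≤ 1)
    (hb : IsAngularKernel d b) (hA : NonCutoff d b 2) (he : ‖e‖ = 1) :
    ∃ C : ℝ, 0 < C ∧ ∀ (Z : ℝ) (v w : Vel d), 0 < Z →
      collWeight γ b (fun x => tailTest Z (‖x‖ ^ 2)) v w ≤ tailBound γ b e C Z v w + tailBound γ b e C Z w v := by
  obtain ⟨C, hC, H⟩ := exists_collWeight_tailTest_le hd hγ₀ hγ₁ hb hA he
  refine ⟨C, hC, fun Z v w hZ => ?_⟩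
  have key : ∀ v w : Vel d, tailBound γ b e C Z v w = ‖v‖ ^ γ * tailWeight b e Z (‖v‖ ^ 2) *
        ((if Z / 2 ≤ ‖v‖ ^ 2 then C * (‖w‖ ^ 2 / Z) else 0) -
          if 4 * Z ≤ ‖v‖ ^ 2 ∧ ‖w‖ ^ 2 ≤ Z then 1 / 4 else 0) := by
    intro v w
    simp only [tailBound, highRate, indicator, mem_ofPred_eq]
    by_cases h1 : Z / 2 ≤ ‖v‖ ^ 2
    · by_cases h2 : 4 * Z ≤ ‖v‖ ^ 2
      · by_cases h3 : ‖w‖ ^ 2 ≤ Z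
        · simp only [h1, h2, h3, if_true, and_self]; ring
        · simp only [h1, h2, h3, if_true, if_false, and_false]; ring
      · simp only [h1, h2, if_true, if_false, false_and]; ring
    · have h2 : ¬ 4 * Z ≤ ‖v‖ ^ 2 := fun h => h1 (by linarith)
      simp only [h1, h2, if_false, false_and]; ring
  -- With the roles exchanged there is no loss part, since 4Z ≤ |w|² ≤ |v|² ≤ Z is impossible; the
  -- term may be added to make the bound symmetric.
  have hpos : ∀ v w : Vel d, ‖w‖ ≤ ‖v‖ → 0 ≤ tailBound γ b e C Z w v := by
    intro v w hwv
    have hwv2 : ‖w‖ ^ 2 ≤ ‖v‖ ^ 2 := by gcongr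
    rw [key, if_neg (c := 4 * Z ≤ ‖w‖ ^ 2 ∧ ‖v‖ ^ 2 ≤ Z) (by rintro ⟨h1, h2⟩; linarith), sub_zero]
    have hW := tailWeight_nonneg (b := b) hd hb he hZ.le (sq_nonneg ‖w‖)
    refine mul_nonneg (mul_nonneg (Real.rpow_nonneg (norm_nonneg _) _) hW) ?_
    split_ifs <;> positivity
  rcases le_total ‖w‖ ‖v‖ with h | h
  · have := H Z v w hZ h
    rw [← key] at this
    linarith [hpos v w h]
  · have := H Z w v hZ h
    rw [← key] at this
    rw [collWeight_comm]
    linarith [hpos w v h]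

/-- Loss of the energy tail, up to the mass of lower energies. -/
theorem exists_tail_decay (hd : 2 ≤ d) (hγ₀ : 0 < γ) (hγ₁ : γ ≤ 1) (hb : IsAngularKernel d b)
    (hA : NonCutoff d b 2) (he : ‖e‖ = 1) {m E : ℝ} (hm : 0 < m) (hE : 0 ≤ E) :
    ∃ c C Z₀ : ℝ, 0 < c ∧ 0 < C ∧ 0 < Z₀ ∧ ∀ (μ : Measure (Vel d)) [IsFiniteMeasure μ] (Z : ℝ),
      μ.real univ = m → Integrable (fun v => ‖v‖ ^ 2) μ → ∫ v, ‖v‖ ^ 2 ∂μ = E → Z₀ ≤ Z →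
      Integrable (fun p : Vel d × Vel d => collWeight γ b (fun x => tailTest Z (‖x‖ ^ 2)) p.1 p.2) (μ.prod μ) →
      (1 / 2) * (∫ p, collWeight γ b (fun x => tailTest Z (‖x‖ ^ 2)) p.1 p.2 ∂(μ.prod μ)) +
        c * Z * ∫ v in {x | 4 * Z ≤ ‖x‖ ^ 2}, ‖v‖ ^ γ ∂μ ≤ C * Z ^ (γ / 2) * μ.real {x | Z / 2 ≤ ‖x‖ ^ 2} := by
  obtain ⟨C, hC, H⟩ := exists_collWeight_tailTest_le_add hd hγ₀ hγ₁ hb hA he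
  set A := ∫ t, minSq t ∂(angMeasure b e) with hAdef
  have hA0 : 0 ≤ A := integral_nonneg_of_ae (by
    filter_upwards [ae_abs_lt_one hd hb.measurable he] with t ht using minSq_nonneg ht.le)
  have hc0 := integral_min_minSq_pos hd hb hA he
  set c₀ := tailWeight b e 1 4
  -- Z₀ ensures (C + 1)E/Z ≤ m/8: by Chebyshev most of the mass lies below the energy Z, and the
  -- gain from very high energies is weaker than their loss.
  refine ⟨m / 8 * c₀, C * E * (8 * A) + 1, (C + 1) * E * 8 / m + 1, by positivity, by positivity,
    by positivity, fun μ _ Z hμm hμi hμE hZ hG => ?_⟩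
  have hZ1 : 1 ≤ Z := le_trans (by have : 0 ≤ (C + 1) * E * 8 / m := by positivity
                                   linarith) hZ
  have hZ0 : 0 < Z := by linarith
  have hZE : (C + 1) * E / Z ≤ m / 8 := by
    rw [div_le_iff₀ hZ0]
    have : (C + 1) * E * 8 / m ≤ Z := by linarith
    rw [div_le_iff₀ hm] at this
    linarith
  -- The high-energy rate may grow like |v|^{2+γ} up to constants, whose integral is not known to be
  -- finite. Gain and loss are therefore compared on |v|² ≤ j, and j → ∞ only after the
  -- cancellation.
  set S : ℕ → Set (Vel d) := fun j => {x | ‖x‖ ^ 2 ≤ j} with hS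
  have hnm : Measurable fun x : Vel d => ‖x‖ ^ 2 := by fun_prop
  have hSm : ∀ j, MeasurableSet (S j) := fun j => measurableSet_le hnm measurable_const
  have hTm : ∀ R : ℝ, MeasurableSet {x : Vel d | R ≤ ‖x‖ ^ 2} := fun R => measurableSet_le measurable_const hnm
  have hUm : MeasurableSet {x : Vel d | ‖x‖ ^ 2 ≤ Z} := measurableSet_le hnm measurable_const
  have hSmono : Monotone S := fun i j hij x (hx : ‖x‖ ^ 2 ≤ i) => hx.trans (by exact_mod_cast hij)
  have hSU : (⋃ j, S j) = univ := by
    refine eq_univ_of_forall fun x => mem_iUnion.2 ⟨⌈‖x‖ ^ 2⌉₊, Nat.le_ceil (‖x‖ ^ 2)⟩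
  have hWm : Measurable fun x : Vel d => ‖x‖ ^ γ * tailWeight b e Z (‖x‖ ^ 2) := by
    have := (tailWeight_mono hd hb hA he hZ0.le).measurable
    fun_prop
  have hW0 : ∀ x : Vel d, 0 ≤ ‖x‖ ^ γ * tailWeight b e Z (‖x‖ ^ 2) := fun x =>
    mul_nonneg (Real.rpow_nonneg (norm_nonneg _) _) (tailWeight_nonneg hd hb he hZ0.le (sq_nonneg _))
  have hWle : ∀ (j : ℝ) (x : Vel d), 0 ≤ j → ‖x‖ ^ 2 ≤ j → ‖x‖ ^ γ * tailWeight b e Z (‖x‖ ^ 2) ≤ j ^ (γ / 2) * (A * j) := by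
    intro j x hj hx
    have h1 : ‖x‖ ^ γ ≤ j ^ (γ / 2) := by
      have : ‖x‖ ^ γ = (‖x‖ ^ 2) ^ (γ / 2) := by
        rw [← Real.rpow_natCast, ← Real.rpow_mul (norm_nonneg _)]; congr 1; push_cast; ring
      rw [this]
      exact Real.rpow_le_rpow (sq_nonneg _) hx (by positivity)
    have h2 : tailWeight b e Z (‖x‖ ^ 2) ≤ A * j := (tailWeight_le hd hb hA he hZ0.le _).trans (by gcongr)
    exact mul_le_mul h1 h2 (tailWeight_nonneg hd hb he hZ0.le (sq_nonneg _)) (by positivity)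
  have hHi : ∀ (j : ℕ) (R : ℝ), Integrable (highRate γ b e Z R) (μ.restrict (S j)) := by
    intro j R
    refine Integrable.of_bound (C := (j : ℝ) ^ (γ / 2) * (A * j)) ((hWm.indicator (hTm R)).aestronglyMeasurable) ?_
    filter_upwards [ae_restrict_mem (hSm j)] with x hx
    rw [highRate, Real.norm_eq_abs, abs_of_nonneg (indicator_nonneg (fun x _ => hW0 x) x)]
    refine (indicator_le_self' (fun x _ => hW0 x) x).trans (hWle j x (by positivity) hx)
  have hbd : ∀ j : ℕ, Z ≤ j → (1 / 2) * (∫ p in S j ×ˢ S j, collWeight γ b (fun x => tailTest Z (‖x‖ ^ 2)) p.1 p.2 ∂(μ.prod μ)) +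
        m / 8 * c₀ * Z * ∫ v in S j, {x : Vel d | 4 * Z ≤ ‖x‖ ^ 2}.indicator (fun v => ‖v‖ ^ γ) v ∂μ ≤
          (C * E * (8 * A) + 1) * Z ^ (γ / 2) * μ.real {x | Z / 2 ≤ ‖x‖ ^ 2} := by
    intro j hj
    have hν : (μ.prod μ).restrict (S j ×ˢ S j) = (μ.restrict (S j)).prod (μ.restrict (S j)) :=
      (Measure.prod_restrict _ _).symm
    have hb1 : Integrable (fun w : Vel d => C * (‖w‖ ^ 2 / Z)) (μ.restrict (S j)) :=
      ((hμi.div_const Z).const_mul C).restrict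
    have hb2 : Integrable ({x : Vel d | ‖x‖ ^ 2 ≤ Z}.indicator (fun _ => (1 / 4 : ℝ))) (μ.restrict (S j)) :=
      (integrable_const _).indicator hUm
    have hPi : Integrable (fun p : Vel d × Vel d => tailBound γ b e C Z p.1 p.2)
        ((μ.restrict (S j)).prod (μ.restrict (S j))) :=
      ((hHi j (Z / 2)).mul_prod hb1).sub ((hHi j (4 * Z)).mul_prod hb2)
    have hP2 : Integrable (fun p : Vel d × Vel d => tailBound γ b e C Z p.2 p.1)
        ((μ.restrict (S j)).prod (μ.restrict (S j))) := hPi.swap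
    have h1 : ∫ p in S j ×ˢ S j, collWeight γ b (fun x => tailTest Z (‖x‖ ^ 2)) p.1 p.2 ∂(μ.prod μ) ≤
        2 * ∫ p, tailBound γ b e C Z p.1 p.2 ∂((μ.restrict (S j)).prod (μ.restrict (S j))) := by
      have h2 : ∫ p, tailBound γ b e C Z p.2 p.1 ∂((μ.restrict (S j)).prod (μ.restrict (S j))) =
          ∫ p, tailBound γ b e C Z p.1 p.2 ∂((μ.restrict (S j)).prod (μ.restrict (S j))) :=
        integral_prod_swap (fun p : Vel d × Vel d => tailBound γ b e C Z p.1 p.2)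
      rw [two_mul]
      nth_rewrite 2 [← h2]
      rw [← integral_add hPi hP2, hν]
      refine integral_mono (hν ▸ hG.restrict) (hPi.add hP2) fun p => H Z p.1 p.2 hZ0
    have h2 : ∫ p, tailBound γ b e C Z p.1 p.2 ∂((μ.restrict (S j)).prod (μ.restrict (S j))) =
        (∫ v in S j, highRate γ b e Z (Z / 2) v ∂μ) * (∫ w in S j, C * (‖w‖ ^ 2 / Z) ∂μ) -
        (∫ v in S j, highRate γ b e Z (4 * Z) v ∂μ) *
          (∫ w in S j, {x : Vel d | ‖x‖ ^ 2 ≤ Z}.indicator (fun _ => (1 / 4 : ℝ)) w ∂μ) := by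
      rw [← integral_prod_mul, ← integral_prod_mul,
        ← integral_sub ((hHi j (Z / 2)).mul_prod hb1) ((hHi j (4 * Z)).mul_prod hb2)]
      rfl
    have h3 : ∫ w in S j, C * (‖w‖ ^ 2 / Z) ∂μ ≤ C * E / Z := by
      rw [integral_const_mul, integral_div, mul_div_assoc, ← hμE]
      refine mul_le_mul_of_nonneg_left (div_le_div_of_nonneg_right ?_ hZ0.le) hC.le
      exact setIntegral_le_integral hμi (Filter.Eventually.of_forall fun x => sq_nonneg _)
    have h4 : 1 / 4 * (m - E / Z) ≤ ∫ w in S j, {x : Vel d | ‖x‖ ^ 2 ≤ Z}.indicator (fun _ => (1 / 4 : ℝ)) w ∂μ := by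
      rw [setIntegral_indicator hUm, setIntegral_const, smul_eq_mul, mul_comm]
      have : S j ∩ {x : Vel d | ‖x‖ ^ 2 ≤ Z} = {x : Vel d | ‖x‖ ^ 2 ≤ Z} :=
        inter_eq_right.2 fun x (hx : ‖x‖ ^ 2 ≤ Z) => hx.trans hj
      rw [this]
      have h5 : m = μ.real {x : Vel d | ‖x‖ ^ 2 ≤ Z} + μ.real {x : Vel d | ‖x‖ ^ 2 ≤ Z}ᶜ := by
        rw [← hμm, measureReal_add_measureReal_compl hUm]
      have h6 : Z * μ.real {x : Vel d | ‖x‖ ^ 2 ≤ Z}ᶜ ≤ E := by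
        have h7 := mul_meas_ge_le_integral_of_nonneg (μ := μ) (f := fun v : Vel d => ‖v‖ ^ 2)
          (Filter.Eventually.of_forall fun x => sq_nonneg _) hμi Z
        rw [hμE] at h7
        refine le_trans ?_ h7
        refine mul_le_mul_of_nonneg_left (measureReal_mono fun x hx => ?_) hZ0.le
        exact (not_le.1 (show ¬ ‖x‖ ^ 2 ≤ Z from hx)).le
      have h7 : μ.real {x : Vel d | ‖x‖ ^ 2 ≤ Z}ᶜ ≤ E / Z := by rwa [le_div_iff₀ hZ0, mul_comm]
      gcongr
      linarith
    set I1 := ∫ v in S j, highRate γ b e Z (Z / 2) v ∂μ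
    set I2 := ∫ v in S j, highRate γ b e Z (4 * Z) v ∂μ
    have hI2 : 0 ≤ I2 := integral_nonneg fun x => indicator_nonneg (fun x _ => hW0 x) x
    -- The two rates differ only for energies between Z/2 and 4Z, where the rate is of order
    -- Z^{γ/2}·Z at most.
    have hI1 : I1 ≤ I2 + (4 * Z) ^ (γ / 2) * (A * (4 * Z)) * μ.real {x : Vel d | Z / 2 ≤ ‖x‖ ^ 2} := by
      have h5 : Integrable ({x : Vel d | Z / 2 ≤ ‖x‖ ^ 2}.indicator (fun _ => (4 * Z) ^ (γ / 2) * (A * (4 * Z)))) μ :=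
        (integrable_const _).indicator (hTm _)
      calc I1 ≤ ∫ v in S j, (highRate γ b e Z (4 * Z) v +
            {x : Vel d | Z / 2 ≤ ‖x‖ ^ 2}.indicator (fun _ => (4 * Z) ^ (γ / 2) * (A * (4 * Z))) v) ∂μ := by
            refine integral_mono (hHi j _) ((hHi j _).add h5.restrict) fun x => ?_
            have hp : 0 ≤ (4 * Z) ^ (γ / 2) * (A * (4 * Z)) := by positivity
            by_cases h6 : Z / 2 ≤ ‖x‖ ^ 2
            · by_cases h7 : 4 * Z ≤ ‖x‖ ^ 2
              · simp only [highRate, indicator, mem_ofPred_eq, h6, h7, if_true]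
                linarith
              · simp only [highRate, indicator, mem_ofPred_eq, h6, h7, if_true, if_false, zero_add]
                exact hWle _ x (by positivity) (not_le.1 h7).le
            · have h7 : ¬ 4 * Z ≤ ‖x‖ ^ 2 := fun h => h6 (by linarith)
              simp only [highRate, indicator, mem_ofPred_eq, h6, h7, if_false, zero_add, le_refl]
        _ = I2 + ∫ v in S j, {x : Vel d | Z / 2 ≤ ‖x‖ ^ 2}.indicator (fun _ => (4 * Z) ^ (γ / 2) * (A * (4 * Z))) v ∂μ :=
            integral_add (hHi j _) h5.restrict
        _ ≤ I2 + ∫ v, {x : Vel d | Z / 2 ≤ ‖x‖ ^ 2}.indicator (fun _ => (4 * Z) ^ (γ / 2) * (A * (4 * Z))) v ∂μ := by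
            refine add_le_add_right ?_ _
            exact setIntegral_le_integral h5 (Filter.Eventually.of_forall fun x =>
              indicator_nonneg (fun _ _ => by positivity) x)
        _ = _ := by
            rw [integral_indicator (hTm _), setIntegral_const, smul_eq_mul, mul_comm (μ.real _)]
    have hI3 : c₀ * Z * ∫ v in S j, {x : Vel d | 4 * Z ≤ ‖x‖ ^ 2}.indicator (fun v => ‖v‖ ^ γ) v ∂μ ≤ I2 := by
      rw [← integral_const_mul]
      refine integral_mono_of_nonneg (Filter.Eventually.of_forall fun x => mul_nonneg (by positivity)
        (indicator_nonneg (fun _ _ => Real.rpow_nonneg (norm_nonneg _) _) x)) (hHi j _)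
        (Filter.Eventually.of_forall fun x => ?_)
      by_cases h7 : 4 * Z ≤ ‖x‖ ^ 2
      · simp only [highRate, indicator, mem_ofPred_eq, h7, if_true]
        have := mul_le_tailWeight hd hb hA he hZ0.le h7
        rw [mul_comm, mul_comm c₀]
        exact mul_le_mul_of_nonneg_left this (Real.rpow_nonneg (norm_nonneg _) _)
      · simp only [highRate, indicator, mem_ofPred_eq, h7, if_false, mul_zero, le_refl]
    set b1 := ∫ w in S j, C * (‖w‖ ^ 2 / Z) ∂μ
    set b2 := ∫ w in S j, {x : Vel d | ‖x‖ ^ 2 ≤ Z}.indicator (fun _ => (1 / 4 : ℝ)) w ∂μ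
    have hb10 : 0 ≤ b1 := integral_nonneg fun x => by positivity
    set N := μ.real {x : Vel d | Z / 2 ≤ ‖x‖ ^ 2}
    have hN : 0 ≤ N := measureReal_nonneg
    have hpw : (4 * Z) ^ (γ / 2) ≤ 2 * Z ^ (γ / 2) := by
      rw [Real.mul_rpow (by norm_num) hZ0.le]
      gcongr
      calc (4 : ℝ) ^ (γ / 2) ≤ 4 ^ (1 / 2 : ℝ) := by
            apply Real.rpow_le_rpow_of_exponent_le (by norm_num); linarith
        _ = 2 := by rw [← Real.sqrt_eq_rpow, show (4 : ℝ) = 2 ^ 2 by norm_num, Real.sqrt_sq (by norm_num)]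
    -- The coefficient of I2 is at most CE/Z − (m − E/Z)/4 ≤ −m/8: what might diverge as j → ∞ has a
    -- favourable sign.
    have hkey : I1 * b1 - I2 * b2 ≤ -(m / 8) * I2 + C * E * (8 * A) * Z ^ (γ / 2) * N := by
      have h5 : I1 * b1 ≤ (I2 + 2 * Z ^ (γ / 2) * (A * (4 * Z)) * N) * (C * E / Z) := by
        refine mul_le_mul (hI1.trans ?_) h3 hb10 (by positivity)
        gcongr
      have h6 : (I2 + 2 * Z ^ (γ / 2) * (A * (4 * Z)) * N) * (C * E / Z) =
          I2 * (C * E / Z) + C * E * (8 * A) * Z ^ (γ / 2) * N := by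
        field_simp; ring
      have h7 : I2 * (1 / 4 * (m - E / Z)) ≤ I2 * b2 := by gcongr
      have h8 : I2 * (C * E / Z) + I2 * (1 / 4 * (E / Z)) ≤ I2 * (m / 8) := by
        rw [← mul_add]
        refine mul_le_mul_of_nonneg_left (le_trans ?_ hZE) hI2
        have : 0 ≤ E / Z := by positivity
        have : (C + 1) * E / Z = C * E / Z + E / Z := by ring
        linarith
      nlinarith
    have hZp : 0 ≤ Z ^ (γ / 2) * N := by positivity
    have hfin := mul_le_mul_of_nonneg_left hI3 (show 0 ≤ m / 8 by positivity)
    rw [h2] at h1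
    linarith
  have hlim1 := tendsto_setIntegral_of_monotone (μ := μ.prod μ) (fun j => (hSm j).prod (hSm j))
    (fun i j hij => prod_mono (hSmono hij) (hSmono hij)) hG.integrableOn
  have hUU : (⋃ j, S j ×ˢ S j) = univ := by
    rw [iUnion_prod_of_monotone hSmono hSmono, hSU, univ_prod_univ]
  rw [hUU, setIntegral_univ] at hlim1
  have hγi : Integrable (fun v : Vel d => ‖v‖ ^ γ) μ := by
    refine ((integrable_const (1 : ℝ)).add hμi).mono' (by fun_prop (disch := positivity)) (Filter.Eventually.of_forall fun x => ?_)
    rw [Real.norm_eq_abs, abs_of_nonneg (Real.rpow_nonneg (norm_nonneg _) _)]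
    rcases le_total ‖x‖ 1 with h | h
    · have := Real.rpow_le_one (norm_nonneg x) h hγ₀.le
      simp only [Pi.add_apply]
      nlinarith [sq_nonneg ‖x‖]
    · have := Real.rpow_le_rpow_of_exponent_le h (show γ ≤ (2 : ℕ) by push_cast; linarith)
      rw [Real.rpow_natCast] at this
      simp only [Pi.add_apply]
      linarith
  have hlim2 := tendsto_setIntegral_of_monotone (μ := μ) hSm hSmono (hγi.indicator (hTm (4 * Z))).integrableOn
  rw [hSU, setIntegral_univ, integral_indicator (hTm _)] at hlim2
  refine le_of_tendsto ((hlim1.const_mul (1 / 2)).add (hlim2.const_mul (m / 8 * c₀ * Z))) ?_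
  filter_upwards [Filter.eventually_ge_atTop ⌈Z⌉₊] with j hj
  exact hbd j (Nat.ceil_le.1 hj)

end tails

/-! ### Dyadic decompositions of moments -/

section dyadic
variable {d : ℕ}

/-- A geometric sum dominated by its largest term, which needs a > 0. -/
theorem tsum_dyadic_le {a Z : ℝ} (ha : 0 < a) (hZ : 0 < Z) : ∃ C : ℝ, 0 < C ∧ ∀ X : ℝ, 0 ≤ X →
    ∑' i : ℕ, ENNReal.ofReal (if Z * 2 ^ i ≤ X then (Z * 2 ^ i) ^ a else 0) ≤ ENNReal.ofReal (C * X ^ a) := by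
  set r : ℝ := 2 ^ a with hr
  have hr1 : 1 < r := Real.one_lt_rpow (by norm_num) ha
  have hpow : ∀ i : ℕ, (Z * 2 ^ i) ^ a = Z ^ a * r ^ i := by
    intro i
    rw [Real.mul_rpow hZ.le (by positivity), hr, ← Real.rpow_natCast, ← Real.rpow_natCast, ← Real.rpow_mul (by norm_num),
      ← Real.rpow_mul (by norm_num), mul_comm (i : ℝ)]
  have hr0 : 0 < r - 1 := by linarith
  refine ⟨r / (r - 1), by positivity, fun X hX => ?_⟩
  refine ENNReal.tsum_le_of_sum_range_le fun n => ?_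
  rw [← ENNReal.ofReal_sum_of_nonneg (fun i _ => by split_ifs <;> positivity)]
  refine ENNReal.ofReal_le_ofReal ?_
  induction n with
  | zero => rw [Finset.sum_range_zero]; positivity
  | succ n ih =>
    by_cases h : Z * 2 ^ n ≤ X
    · calc ∑ i ∈ Finset.range (n + 1), (if Z * 2 ^ i ≤ X then (Z * 2 ^ i) ^ a else 0)
          ≤ ∑ i ∈ Finset.range (n + 1), Z ^ a * r ^ i := by
            refine Finset.sum_le_sum fun i _ => ?_
            rw [← hpow]
            split_ifs
            · exact le_rfl
            · positivity
        _ = Z ^ a * ((r ^ (n + 1) - 1) / (r - 1)) := by rw [← Finset.mul_sum, geom_sum_eq hr1.ne']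
        _ ≤ Z ^ a * (r ^ (n + 1) / (r - 1)) := by gcongr; linarith
        _ = r / (r - 1) * (Z * 2 ^ n) ^ a := by rw [hpow, pow_succ]; ring
        _ ≤ _ := by gcongr
    · rw [Finset.sum_range_succ, if_neg h, add_zero]
      exact ih

theorem exists_dyadic {Z X : ℝ} (hZ : 0 < Z) (hX : 4 * Z ≤ X) : ∃ i : ℕ, 4 * (Z * 2 ^ i) ≤ X ∧ X ≤ 8 * (Z * 2 ^ i) := by
  obtain ⟨n, h1, h2⟩ := exists_nat_pow_near (x := X / (4 * Z)) (y := 2)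
    (by rw [le_div_iff₀ (by positivity)]; linarith) (by norm_num)
  refine ⟨n, ?_, ?_⟩
  · rw [le_div_iff₀ (by positivity)] at h1; linarith
  · rw [div_lt_iff₀ (by positivity), pow_succ] at h2; linarith

/-- The moment `∫ |v|^{2a} μ(dv)`. -/
noncomputable def normMoment (a : ℝ) (μ : Measure (Vel d)) : ℝ≥0∞ := ∫⁻ v, ENNReal.ofReal ((‖v‖ ^ 2) ^ a) ∂μ

theorem measurable_normMoment (a : ℝ) : Measurable (normMoment (d := d) a) :=
  Measure.measurable_lintegral (by fun_prop)

theorem normMoment_le_add {a a' : ℝ} (ha : 0 ≤ a) (haa' : a ≤ a') (μ : Measure (Vel d)) :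
    normMoment a μ ≤ μ univ + normMoment a' μ := by
  rw [← lintegral_one, normMoment, normMoment, ← lintegral_add_left measurable_const]
  refine lintegral_mono fun v => ?_
  rw [← ENNReal.ofReal_one, ← ENNReal.ofReal_add zero_le_one (by positivity)]
  refine ENNReal.ofReal_le_ofReal ?_
  rcases le_total (‖v‖ ^ 2) 1 with h | h
  · have := Real.rpow_le_one (sq_nonneg ‖v‖) h ha
    have : 0 ≤ (‖v‖ ^ 2) ^ a' := by positivity
    linarith
  · have := Real.rpow_le_rpow_of_exponent_le h haa'
    linarith

/-- The energy tail of a measure. -/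
noncomputable def tailEnergy (Z : ℝ) (μ : Measure (Vel d)) : ℝ≥0∞ :=
  ∫⁻ v, ENNReal.ofReal (energyTailAt Z (‖v‖ ^ 2)) ∂μ

theorem measurable_energyTailAt (Z : ℝ) : Measurable (energyTailAt Z) := by
  have := contDiff_energyTail.continuous.measurable
  unfold energyTailAt
  fun_prop

/-- The high-energy part of the moment of order `γ`. -/
noncomputable def tailMoment (γ Z : ℝ) (μ : Measure (Vel d)) : ℝ≥0∞ :=
  ∫⁻ v, {x : Vel d | 4 * Z ≤ ‖x‖ ^ 2}.indicator (fun x => ENNReal.ofReal (‖x‖ ^ γ)) v ∂μ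

theorem measurable_tailMoment_aux (γ Z : ℝ) : Measurable
    ({x : Vel d | 4 * Z ≤ ‖x‖ ^ 2}.indicator fun x => ENNReal.ofReal (‖x‖ ^ γ)) :=
  Measurable.indicator (by fun_prop) (measurableSet_le measurable_const (by fun_prop))

theorem measurable_tailMoment (γ Z : ℝ) : Measurable (tailMoment (d := d) γ Z) :=
  Measure.measurable_lintegral (measurable_tailMoment_aux γ Z)

variable {a γ Z : ℝ}

theorem energyTailAt_nonneg (hZ : 0 ≤ Z) (r : ℝ) : 0 ≤ energyTailAt Z r :=
  mul_nonneg hZ (energyTail_nonneg _)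

/-- A single scale suffices: if 4z ≤ X ≤ 8z with z = Z2^i, then the tail at z is at least X/2 and
z^{a−1} is comparable to X^{a−1}. Energies below 4Z go into the mass. -/
theorem exists_normMoment_le_tsum_tailEnergy (ha : 1 < a) (hZ : 0 < Z) : ∃ C : ℝ≥0∞, C < ∞ ∧
    ∀ μ : Measure (Vel d), normMoment a μ ≤
      C * ∑' i : ℕ, ENNReal.ofReal ((Z * 2 ^ i) ^ (a - 1)) * tailEnergy (Z * 2 ^ i) μ + C * μ univ := by
  refine ⟨ENNReal.ofReal (2 * 8 ^ (a - 1) + (4 * Z) ^ a), ENNReal.ofReal_lt_top, fun μ => ?_⟩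
  have hm : ∀ i : ℕ, Measurable fun v : Vel d => ENNReal.ofReal (energyTailAt (Z * 2 ^ i) (‖v‖ ^ 2)) := fun i =>
    ((measurable_energyTailAt _).comp (by fun_prop : Measurable fun v : Vel d => ‖v‖ ^ 2)).ennreal_ofReal
  have h1 : ∑' i : ℕ, ENNReal.ofReal ((Z * 2 ^ i) ^ (a - 1)) * tailEnergy (Z * 2 ^ i) μ =
      ∫⁻ v, ∑' i : ℕ, ENNReal.ofReal ((Z * 2 ^ i) ^ (a - 1)) * ENNReal.ofReal (energyTailAt (Z * 2 ^ i) (‖v‖ ^ 2)) ∂μ := by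
    rw [lintegral_tsum fun i => ((hm i).const_mul _).aemeasurable]
    refine tsum_congr fun i => ?_
    rw [lintegral_const_mul _ (hm i), tailEnergy]
  rw [h1, ← lintegral_const_mul' _ _ ENNReal.ofReal_ne_top, ← lintegral_const, ← lintegral_add_right _ measurable_const]
  refine lintegral_mono fun v => ?_
  set X := ‖v‖ ^ 2 with hX
  have hX0 : 0 ≤ X := sq_nonneg _
  rcases lt_or_ge X (4 * Z) with h | h
  · refine le_add_left (ENNReal.ofReal_le_ofReal ?_)
    have := Real.rpow_le_rpow hX0 h.le (by linarith : 0 ≤ a)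
    have : (0 : ℝ) ≤ 2 * 8 ^ (a - 1) := by positivity
    linarith
  · obtain ⟨i, h2, h3⟩ := exists_dyadic hZ h
    refine le_add_right (le_trans ?_ (mul_le_mul_right (ENNReal.le_tsum i) _))
    rw [← ENNReal.ofReal_mul (by positivity), ← ENNReal.ofReal_mul (by positivity)]
    refine ENNReal.ofReal_le_ofReal ?_
    have hz : 0 < Z * 2 ^ i := by positivity
    set z := Z * 2 ^ i
    have h4 : X / 2 ≤ energyTailAt z X := by
      have := sub_two_le_energyTail (X / z)
      have h5 : z * (X / z - 2) ≤ z * energyTail (X / z) := by gcongr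
      rw [energyTailAt]
      have h6 : z * (X / z - 2) = X - 2 * z := by field_simp
      linarith
    have hXp : 0 < X := by linarith
    calc X ^ a = 2 * (X ^ (a - 1) * (X / 2)) := by
          rw [Real.rpow_sub_one hXp.ne']; field_simp
      _ ≤ 2 * ((8 * z) ^ (a - 1) * energyTailAt z X) := by
          have : 0 ≤ a - 1 := by linarith
          gcongr
      _ = 2 * 8 ^ (a - 1) * (z ^ (a - 1) * energyTailAt z X) := by
          rw [Real.mul_rpow (by norm_num) hz.le]; ring
      _ ≤ _ := by
          have := energyTailAt_nonneg hz.le X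
          refine mul_le_mul_of_nonneg_right ?_ (by positivity)
          have : 0 ≤ (4 * Z) ^ a := by positivity
          linarith

/-- The tail at z vanishes unless z ≤ X and never exceeds X; the remaining weights z^{a−1} sum
geometrically because a > 1. -/
theorem exists_tsum_tailEnergy_le (ha : 1 < a) (hZ : 0 < Z) : ∃ C : ℝ≥0∞, C < ∞ ∧
    ∀ μ : Measure (Vel d), ∑' i : ℕ, ENNReal.ofReal ((Z * 2 ^ i) ^ (a - 1)) * tailEnergy (Z * 2 ^ i) μ ≤
      C * normMoment a μ := by
  obtain ⟨C, hC, H⟩ := tsum_dyadic_le (a := a - 1) (Z := Z) (by linarith) hZ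
  refine ⟨ENNReal.ofReal C, ENNReal.ofReal_lt_top, fun μ => ?_⟩
  have hm : ∀ i : ℕ, Measurable fun v : Vel d => ENNReal.ofReal (energyTailAt (Z * 2 ^ i) (‖v‖ ^ 2)) := fun i =>
    ((measurable_energyTailAt _).comp (by fun_prop : Measurable fun v : Vel d => ‖v‖ ^ 2)).ennreal_ofReal
  have h1 : ∑' i : ℕ, ENNReal.ofReal ((Z * 2 ^ i) ^ (a - 1)) * tailEnergy (Z * 2 ^ i) μ =
      ∫⁻ v, ∑' i : ℕ, ENNReal.ofReal ((Z * 2 ^ i) ^ (a - 1)) * ENNReal.ofReal (energyTailAt (Z * 2 ^ i) (‖v‖ ^ 2)) ∂μ := by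
    rw [lintegral_tsum fun i => ((hm i).const_mul _).aemeasurable]
    refine tsum_congr fun i => ?_
    rw [lintegral_const_mul _ (hm i), tailEnergy]
  rw [h1, normMoment, ← lintegral_const_mul' _ _ ENNReal.ofReal_ne_top]
  refine lintegral_mono fun v => ?_
  set X := ‖v‖ ^ 2 with hX
  have hX0 : 0 ≤ X := sq_nonneg _
  calc ∑' i : ℕ, ENNReal.ofReal ((Z * 2 ^ i) ^ (a - 1)) * ENNReal.ofReal (energyTailAt (Z * 2 ^ i) X)
      ≤ ∑' i : ℕ, ENNReal.ofReal (if Z * 2 ^ i ≤ X then (Z * 2 ^ i) ^ (a - 1) else 0) * ENNReal.ofReal X := by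
        refine ENNReal.tsum_le_tsum fun i => ?_
        have hz : 0 < Z * 2 ^ i := by positivity
        split_ifs with h
        · refine mul_le_mul_right (ENNReal.ofReal_le_ofReal ?_) _
          have : energyTail (X / (Z * 2 ^ i)) ≤ X / (Z * 2 ^ i) := energyTail_le (by positivity)
          calc energyTailAt (Z * 2 ^ i) X ≤ (Z * 2 ^ i) * (X / (Z * 2 ^ i)) := by rw [energyTailAt]; gcongr
            _ = X := by field_simp
        · rw [energyTailAt, energyTail_eq_zero ((div_le_one hz).2 (not_le.1 h).le)]
          simp
    _ ≤ ENNReal.ofReal (C * X ^ (a - 1)) * ENNReal.ofReal X := by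
        rw [ENNReal.tsum_mul_right]
        gcongr
        exact H X hX0
    _ = ENNReal.ofReal C * ENNReal.ofReal (X ^ a) := by
        rw [← ENNReal.ofReal_mul (by positivity), ← ENNReal.ofReal_mul hC.le, mul_assoc]
        congr 2
        rcases hX0.eq_or_lt with h | h
        · rw [← h, Real.zero_rpow (by linarith : 0 < a).ne', mul_zero]
        · rw [Real.rpow_sub_one h.ne']; field_simp

/-- The loss carries z|v|^γ where the tail energy carries |v|²: this raises the order by γ/2. -/
theorem exists_normMoment_le_tsum_tailMoment (ha : 0 < a) (hγ : 0 < γ) (hZ : 0 < Z) : ∃ C : ℝ≥0∞, C < ∞ ∧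
    ∀ μ : Measure (Vel d), normMoment (a + γ / 2) μ ≤
      C * ∑' i : ℕ, ENNReal.ofReal ((Z * 2 ^ i) ^ (a - 1)) *
        (ENNReal.ofReal (Z * 2 ^ i) * tailMoment γ (Z * 2 ^ i) μ) + C * μ univ := by
  refine ⟨ENNReal.ofReal (8 ^ a + (4 * Z) ^ (a + γ / 2)), ENNReal.ofReal_lt_top, fun μ => ?_⟩
  have hm : ∀ i : ℕ, Measurable ({x : Vel d | 4 * (Z * 2 ^ i) ≤ ‖x‖ ^ 2}.indicator fun x => ENNReal.ofReal (‖x‖ ^ γ)) :=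
    fun i => measurable_tailMoment_aux γ _
  have h1 : ∑' i : ℕ, ENNReal.ofReal ((Z * 2 ^ i) ^ (a - 1)) *
        (ENNReal.ofReal (Z * 2 ^ i) * tailMoment γ (Z * 2 ^ i) μ) =
      ∫⁻ v, ∑' i : ℕ, ENNReal.ofReal ((Z * 2 ^ i) ^ (a - 1)) * (ENNReal.ofReal (Z * 2 ^ i) *
        {x : Vel d | 4 * (Z * 2 ^ i) ≤ ‖x‖ ^ 2}.indicator (fun x => ENNReal.ofReal (‖x‖ ^ γ)) v) ∂μ := by
    rw [lintegral_tsum fun i => (((hm i).const_mul _).const_mul _).aemeasurable]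
    refine tsum_congr fun i => ?_
    rw [lintegral_const_mul _ ((hm i).const_mul _), lintegral_const_mul _ (hm i), tailMoment]
  rw [h1, ← lintegral_const_mul' _ _ ENNReal.ofReal_ne_top, ← lintegral_const, ← lintegral_add_right _ measurable_const]
  refine lintegral_mono fun v => ?_
  have hv : ‖v‖ ^ γ = (‖v‖ ^ 2) ^ (γ / 2) := by
    rw [← Real.rpow_natCast, ← Real.rpow_mul (norm_nonneg _)]; congr 1; push_cast; ring
  rcases lt_or_ge (‖v‖ ^ 2) (4 * Z) with h | h
  · refine le_add_left (ENNReal.ofReal_le_ofReal ?_)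
    have := Real.rpow_le_rpow (sq_nonneg ‖v‖) h.le (by linarith : 0 ≤ a + γ / 2)
    have : (0 : ℝ) ≤ 8 ^ a := by positivity
    linarith
  · obtain ⟨i, h2, h3⟩ := exists_dyadic hZ h
    refine le_add_right (le_trans ?_ (mul_le_mul_right (ENNReal.le_tsum i) _))
    have h4 : v ∈ {x : Vel d | 4 * (Z * 2 ^ i) ≤ ‖x‖ ^ 2} := h2
    have hz : 0 < Z * 2 ^ i := by positivity
    rw [indicator_of_mem h4, ← ENNReal.ofReal_mul (by positivity), ← ENNReal.ofReal_mul (by positivity),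
      ← ENNReal.ofReal_mul (by positivity), hv]
    refine ENNReal.ofReal_le_ofReal ?_
    set X := ‖v‖ ^ 2
    set z := Z * 2 ^ i
    have hXp : 0 < X := by linarith
    calc X ^ (a + γ / 2) = X ^ a * X ^ (γ / 2) := Real.rpow_add hXp _ _
      _ ≤ (8 * z) ^ a * X ^ (γ / 2) := by gcongr
      _ = 8 ^ a * (z ^ (a - 1) * (z * X ^ (γ / 2))) := by
          rw [Real.mul_rpow (by norm_num) hz.le, Real.rpow_sub_one hz.ne']; field_simp
      _ ≤ _ := by
          refine mul_le_mul_of_nonneg_right ?_ (by positivity)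
          have : 0 ≤ (4 * Z) ^ (a + γ / 2) := by positivity
          linarith

/-- The gain sums to a moment of order a − 1 + γ/2, not above a since γ ≤ 1, hence to something
already controlled. -/
theorem exists_tsum_tail_le (ha : 1 < a) (hγ : 0 < γ) (hγ₁ : γ ≤ 1) (hZ : 0 < Z) : ∃ C : ℝ≥0∞, C < ∞ ∧
    ∀ μ : Measure (Vel d), ∑' i : ℕ, ENNReal.ofReal ((Z * 2 ^ i) ^ (a - 1)) *
        (ENNReal.ofReal ((Z * 2 ^ i) ^ (γ / 2)) * μ {x | Z * 2 ^ i / 2 ≤ ‖x‖ ^ 2}) ≤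
      C * (μ univ + normMoment a μ) := by
  obtain ⟨C, hC, H⟩ := tsum_dyadic_le (a := a - 1 + γ / 2) (Z := Z) (by linarith) hZ
  refine ⟨ENNReal.ofReal (C * 2 ^ (a - 1 + γ / 2)), ENNReal.ofReal_lt_top, fun μ => ?_⟩
  have hm : ∀ i : ℕ, MeasurableSet {x : Vel d | Z * 2 ^ i / 2 ≤ ‖x‖ ^ 2} := fun i =>
    measurableSet_le measurable_const (by fun_prop)
  refine le_trans ?_ (mul_le_mul_right (normMoment_le_add (a := a - 1 + γ / 2) (by linarith) (by linarith) μ) _)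
  calc _ = ∑' i : ℕ, ∫⁻ v, {x : Vel d | Z * 2 ^ i / 2 ≤ ‖x‖ ^ 2}.indicator
          (fun _ => ENNReal.ofReal ((Z * 2 ^ i) ^ (a - 1 + γ / 2))) v ∂μ := by
        refine tsum_congr fun i => ?_
        rw [lintegral_indicator_const (hm i), ← mul_assoc, ← ENNReal.ofReal_mul (by positivity),
          ← Real.rpow_add (by positivity)]
    _ = ∫⁻ v, ∑' i : ℕ, {x : Vel d | Z * 2 ^ i / 2 ≤ ‖x‖ ^ 2}.indicator
          (fun _ => ENNReal.ofReal ((Z * 2 ^ i) ^ (a - 1 + γ / 2))) v ∂μ :=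
        (lintegral_tsum fun i => (measurable_const.indicator (hm i)).aemeasurable).symm
    _ ≤ ∫⁻ v, ENNReal.ofReal (C * 2 ^ (a - 1 + γ / 2)) * ENNReal.ofReal ((‖v‖ ^ 2) ^ (a - 1 + γ / 2)) ∂μ := by
        refine lintegral_mono fun v => ?_
        rw [← ENNReal.ofReal_mul (by positivity), mul_assoc, ← Real.mul_rpow (by norm_num) (sq_nonneg _)]
        refine le_trans (ENNReal.tsum_le_tsum fun i => ?_) (H (2 * ‖v‖ ^ 2) (by positivity))
        by_cases h : Z * 2 ^ i / 2 ≤ ‖v‖ ^ 2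
        · rw [indicator_of_mem (show v ∈ {x : Vel d | Z * 2 ^ i / 2 ≤ ‖x‖ ^ 2} from h), if_pos (by linarith)]
        · rw [indicator_of_notMem (show v ∉ {x : Vel d | Z * 2 ^ i / 2 ≤ ‖x‖ ^ 2} from h)]
          exact zero_le
    _ = _ := by rw [lintegral_const_mul' _ _ ENNReal.ofReal_ne_top, normMoment]

end dyadic

/-! ### Generation and propagation of polynomial moments -/

section moments
variable {d : ℕ} {γ : ℝ} {b : ℝ → ℝ} {F : ℝ → Measure (Vel d)}

theorem IsWeakSolution.congr {G : ℝ → Measure (Vel d)} (h : IsWeakSolution γ b F)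
    (hFG : ∀ t, 0 ≤ t → G t = F t) : IsWeakSolution γ b G where
  mass_lt_top := by rw [hFG 0 le_rfl]; exact h.mass_lt_top
  energy_lt_top := by rw [hFG 0 le_rfl]; exact h.energy_lt_top
  mass_eq t ht := by rw [hFG 0 le_rfl, hFG t ht]; exact h.mass_eq t ht
  energy_eq t ht := by rw [hFG 0 le_rfl, hFG t ht]; exact h.energy_eq t ht
  integrable_weight φ hφ hc := by
    filter_upwards [h.integrable_weight φ hφ hc, ae_restrict_mem measurableSet_Ioi] with τ h1 h2
    rwa [hFG τ (le_of_lt h2)]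
  integrable_time φ hφ hc t ht := by
    refine (h.integrable_time φ hφ hc t ht).congr fun τ hτ => ?_
    rw [uIoc_of_le ht] at hτ
    simp only [hFG τ hτ.1.le]
  weak_form φ hφ hc t ht := by
    rw [hFG 0 le_rfl, hFG t ht, h.weak_form φ hφ hc t ht]
    congr 1
    refine intervalIntegral.integral_congr fun τ hτ => ?_
    rw [uIcc_of_le ht] at hτ
    simp only [hFG τ hτ.1]

theorem integrable_norm_rpow {μ : Measure (Vel d)} [IsFiniteMeasure μ] (hγ₀ : 0 < γ) (hγ₁ : γ ≤ 1)
    (hμ : Integrable (fun v => ‖v‖ ^ 2) μ) : Integrable (fun v : Vel d => ‖v‖ ^ γ) μ := by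
  refine ((integrable_const (1 : ℝ)).add hμ).mono' (by fun_prop (disch := positivity))
    (Filter.Eventually.of_forall fun x => ?_)
  rw [Real.norm_eq_abs, abs_of_nonneg (Real.rpow_nonneg (norm_nonneg _) _)]
  rcases le_total ‖x‖ 1 with h | h
  · have := Real.rpow_le_one (norm_nonneg x) h hγ₀.le
    simp only [Pi.add_apply]
    nlinarith [sq_nonneg ‖x‖]
  · have := Real.rpow_le_rpow_of_exponent_le h (show γ ≤ (2 : ℕ) by push_cast; linarith)
    rw [Real.rpow_natCast] at this
    simp only [Pi.add_apply]
    linarith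

/-- Mass and energy being conserved, the compactly supported test function and the tail have the
same increments in time. -/
theorem IsWeakSolution.integral_tailTest (h : IsWeakSolution γ b F) {Z : ℝ} (hZ : 0 < Z) {t : ℝ} (ht : 0 ≤ t) :
    Integrable (fun v : Vel d => energyTailAt Z (‖v‖ ^ 2)) (F t) ∧
    ∫ v, tailTest Z (‖v‖ ^ 2) ∂(F t) = ∫ v, energyTailAt Z (‖v‖ ^ 2) ∂(F t) - (energy (F 0)).toReal +
      Z * energyTailShift * (mass (F 0)).toReal := by
  have := h.isFiniteMeasure ht
  have h2 := h.integrable_normSq ht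
  have h1 : Integrable (fun v : Vel d => energyTailAt Z (‖v‖ ^ 2)) (F t) := by
    refine h2.mono' ((measurable_energyTailAt Z).comp
      (by fun_prop : Measurable fun v : Vel d => ‖v‖ ^ 2)).aestronglyMeasurable (Filter.Eventually.of_forall fun v => ?_)
    rw [Real.norm_eq_abs, abs_of_nonneg (energyTailAt_nonneg hZ.le _), energyTailAt]
    calc Z * energyTail (‖v‖ ^ 2 / Z) ≤ Z * (‖v‖ ^ 2 / Z) := by
          gcongr
          exact energyTail_le (by positivity)
      _ = _ := by field_simp
  refine ⟨h1, ?_⟩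
  unfold tailTest
  have h3 : Integrable (fun v : Vel d => energyTailAt Z (‖v‖ ^ 2) - ‖v‖ ^ 2) (F t) := h1.sub h2
  rw [integral_add h3 (integrable_const _), MeasureTheory.integral_sub h1 h2, h.integral_normSq ht, integral_const,
    h.real_univ ht, smul_eq_mul]
  ring

/-- Time-integrated balance of the energy tails. -/
theorem IsWeakSolution.exists_tailEnergy_le (hd : 2 ≤ d) (hγ₀ : 0 < γ) (hγ₁ : γ ≤ 1) (hb : IsAngularKernel d b)
    (hA : NonCutoff d b 2) (h : IsWeakSolution γ b F) (hF : Measurable F) (hm : mass (F 0) ≠ 0) :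
    ∃ c C Z₀ : ℝ, 0 < c ∧ 0 < C ∧ 1 ≤ Z₀ ∧ ∀ Z s t : ℝ, Z₀ ≤ Z → 0 ≤ s → s ≤ t →
      tailEnergy Z (F t) + ENNReal.ofReal c * ∫⁻ τ in Ioc s t, ENNReal.ofReal Z * tailMoment γ Z (F τ) ≤
        tailEnergy Z (F s) + ENNReal.ofReal C *
          ∫⁻ τ in Ioc s t, ENNReal.ofReal (Z ^ (γ / 2)) * F τ {x | Z / 2 ≤ ‖x‖ ^ 2} := by
  obtain ⟨e, he⟩ : ∃ e : Vel d, ‖e‖ = 1 := ⟨EuclideanSpace.single ⟨0, by omega⟩ 1, by simp⟩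
  have hm0 : 0 < (mass (F 0)).toReal := ENNReal.toReal_pos hm h.mass_lt_top.ne
  obtain ⟨c, C, Z₀, hc, hC, hZ₀, H⟩ := exists_tail_decay hd hγ₀ hγ₁ hb hA he hm0
    (ENNReal.toReal_nonneg (a := energy (F 0)))
  refine ⟨c, C, max Z₀ 1, hc, hC, le_max_right _ _, fun Z s t hZ hs hst => ?_⟩
  have hZ1 : 1 ≤ Z := (le_max_right _ _).trans hZ
  have hZ0 : 0 < Z := by linarith
  have ht : 0 ≤ t := hs.trans hst
  have hTm : MeasurableSet {x : Vel d | Z / 2 ≤ ‖x‖ ^ 2} := measurableSet_le measurable_const (by fun_prop)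
  have hfin : ∀ τ ∈ Ioc s t, IsFiniteMeasure (F τ) := fun τ hτ => h.isFiniteMeasure (hs.trans hτ.1.le)
  set M : ℝ → ℝ := fun τ => (tailMoment γ Z (F τ)).toReal with hMdef
  set N : ℝ → ℝ := fun τ => (F τ {x : Vel d | Z / 2 ≤ ‖x‖ ^ 2}).toReal with hNdef
  have hMm : Measurable M := ((measurable_tailMoment γ Z).comp hF).ennreal_toReal
  have hNm : Measurable N := ((Measure.measurable_coe hTm).comp hF).ennreal_toReal
  have hMeq : ∀ τ ∈ Ioc s t, tailMoment γ Z (F τ) = ENNReal.ofReal (M τ) ∧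
      M τ = ∫ v in {x | 4 * Z ≤ ‖x‖ ^ 2}, ‖v‖ ^ γ ∂(F τ) ∧
      M τ ≤ (mass (F 0)).toReal + (energy (F 0)).toReal := by
    intro τ hτ
    have hτ0 : 0 ≤ τ := hs.trans hτ.1.le
    have := hfin τ hτ
    have h1 := integrable_norm_rpow hγ₀ hγ₁ (h.integrable_normSq hτ0)
    have h2 : M τ = ∫ v in {x | 4 * Z ≤ ‖x‖ ^ 2}, ‖v‖ ^ γ ∂(F τ) := by
      rw [integral_eq_lintegral_of_nonneg_ae (Filter.Eventually.of_forall fun v => Real.rpow_nonneg (norm_nonneg _) _)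
        h1.aestronglyMeasurable.restrict, ← lintegral_indicator (measurableSet_le measurable_const (by fun_prop))]
      rfl
    refine ⟨?_, h2, ?_⟩
    · rw [ENNReal.ofReal_toReal]
      refine ((lintegral_mono fun v => indicator_le_self' (fun _ _ => zero_le) v).trans_lt ?_).ne
      have := h1.2
      rwa [hasFiniteIntegral_iff_ofReal (Filter.Eventually.of_forall fun v => Real.rpow_nonneg (norm_nonneg _) _)] at this
    · rw [h2]
      refine (setIntegral_le_integral h1 (Filter.Eventually.of_forall fun v => Real.rpow_nonneg (norm_nonneg _) _)).trans ?_
      rw [← h.real_univ hτ0, ← h.integral_normSq hτ0, ← mul_one ((F τ).real univ), ← smul_eq_mul, ← integral_const,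
        ← integral_add (integrable_const _) (h.integrable_normSq hτ0)]
      refine integral_mono h1 ((integrable_const _).add (h.integrable_normSq hτ0)) fun x => ?_
      rcases le_total ‖x‖ 1 with hx | hx
      · have := Real.rpow_le_one (norm_nonneg x) hx hγ₀.le
        simp only
        nlinarith [sq_nonneg ‖x‖]
      · have := Real.rpow_le_rpow_of_exponent_le hx (show γ ≤ (2 : ℕ) by push_cast; linarith)
        rw [Real.rpow_natCast] at this
        simp only
        linarith
  have hNeq : ∀ τ ∈ Ioc s t, F τ {x : Vel d | Z / 2 ≤ ‖x‖ ^ 2} = ENNReal.ofReal (N τ) ∧ N τ ≤ (mass (F 0)).toReal := by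
    intro τ hτ
    have := hfin τ hτ
    refine ⟨(ENNReal.ofReal_toReal (measure_ne_top _ _)).symm, ?_⟩
    rw [← h.real_univ (hs.trans hτ.1.le)]
    exact measureReal_mono (subset_univ _)
  have hM0 : ∀ τ, 0 ≤ M τ := fun τ => ENNReal.toReal_nonneg
  have hN0 : ∀ τ, 0 ≤ N τ := fun τ => ENNReal.toReal_nonneg
  have hMi : IntervalIntegrable M volume s t := by
    rw [intervalIntegrable_iff_integrableOn_Ioc_of_le hst]
    refine Integrable.of_bound (C := (mass (F 0)).toReal + (energy (F 0)).toReal) hMm.aestronglyMeasurable ?_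
    filter_upwards [ae_restrict_mem measurableSet_Ioc] with τ hτ
    rw [Real.norm_eq_abs, abs_of_nonneg (hM0 τ)]
    exact (hMeq τ hτ).2.2
  have hNi : IntervalIntegrable N volume s t := by
    rw [intervalIntegrable_iff_integrableOn_Ioc_of_le hst]
    refine Integrable.of_bound (C := (mass (F 0)).toReal) hNm.aestronglyMeasurable ?_
    filter_upwards [ae_restrict_mem measurableSet_Ioc] with τ hτ
    rw [Real.norm_eq_abs, abs_of_nonneg (hN0 τ)]
    exact (hNeq τ hτ).2
  have hreal : ∫ v, energyTailAt Z (‖v‖ ^ 2) ∂(F t) + c * (∫ τ in s..t, Z * M τ) ≤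
      ∫ v, energyTailAt Z (‖v‖ ^ 2) ∂(F s) + C * ∫ τ in s..t, Z ^ (γ / 2) * N τ := by
    have h1 := h.integral_sub (contDiff_tailTest Z) (hasCompactSupport_tailTest hZ0) hs ht
    rw [(h.integral_tailTest hZ0 hs).2, (h.integral_tailTest hZ0 ht).2] at h1
    have h2 : ∫ τ in s..t, collRate γ b F (fun v => tailTest Z (‖v‖ ^ 2)) τ ≤
        ∫ τ in s..t, (C * (Z ^ (γ / 2) * N τ) - c * (Z * M τ)) := by
      have hi1 := h.intervalIntegrable (contDiff_tailTest Z) (hasCompactSupport_tailTest hZ0) hs ht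
      have hi2 := ((hNi.const_mul (Z ^ (γ / 2))).const_mul C).sub ((hMi.const_mul Z).const_mul c)
      rw [intervalIntegral.integral_of_le hst, intervalIntegral.integral_of_le hst]
      refine setIntegral_mono_ae_restrict ((intervalIntegrable_iff_integrableOn_Ioc_of_le hst).1 hi1)
        ((intervalIntegrable_iff_integrableOn_Ioc_of_le hst).1 hi2) ?_
      have h3 := h.integrable_weight _ (contDiff_tailTest Z) (hasCompactSupport_tailTest hZ0)
      have h4 := ae_restrict_of_ae_restrict_of_subset (fun τ (hτ : τ ∈ Ioc s t) => show τ ∈ Ioi 0 from hs.trans_lt hτ.1) h3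
      filter_upwards [h4, ae_restrict_mem measurableSet_Ioc] with τ hτ hτm
      have hτ0 : 0 ≤ τ := hs.trans hτm.1.le
      have := hfin τ hτm
      have h5 := H (F τ) Z (h.real_univ hτ0) (h.integrable_normSq hτ0) (h.integral_normSq hτ0)
        ((le_max_left _ _).trans hZ) hτ
      rw [← (hMeq τ hτm).2.1] at h5
      rw [collRate]
      have : (F τ).real {x | Z / 2 ≤ ‖x‖ ^ 2} = N τ := rfl
      rw [this] at h5
      linarith
    rw [intervalIntegral.integral_sub ((hNi.const_mul _).const_mul _) ((hMi.const_mul _).const_mul _),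
      intervalIntegral.integral_const_mul C, intervalIntegral.integral_const_mul c] at h2
    linarith
  have hTE : ∀ r, 0 ≤ r → tailEnergy Z (F r) = ENNReal.ofReal (∫ v, energyTailAt Z (‖v‖ ^ 2) ∂(F r)) := fun r hr =>
    (ofReal_integral_eq_lintegral_ofReal (h.integral_tailTest hZ0 hr).1
      (Filter.Eventually.of_forall fun v => energyTailAt_nonneg hZ0.le _)).symm
  have hL1 : ∫⁻ τ in Ioc s t, ENNReal.ofReal Z * tailMoment γ Z (F τ) = ENNReal.ofReal (∫ τ in s..t, Z * M τ) := by
    rw [intervalIntegral.integral_of_le hst, ofReal_integral_eq_lintegral_ofReal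
      ((intervalIntegrable_iff_integrableOn_Ioc_of_le hst).1 (hMi.const_mul Z))
      (Filter.Eventually.of_forall fun τ => mul_nonneg hZ0.le (hM0 τ))]
    refine setLIntegral_congr_fun measurableSet_Ioc fun τ hτ => ?_
    simp only [(hMeq τ hτ).1, ENNReal.ofReal_mul hZ0.le]
  have hL2 : ∫⁻ τ in Ioc s t, ENNReal.ofReal (Z ^ (γ / 2)) * F τ {x | Z / 2 ≤ ‖x‖ ^ 2} =
      ENNReal.ofReal (∫ τ in s..t, Z ^ (γ / 2) * N τ) := by
    rw [intervalIntegral.integral_of_le hst, ofReal_integral_eq_lintegral_ofReal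
      ((intervalIntegrable_iff_integrableOn_Ioc_of_le hst).1 (hNi.const_mul _))
      (Filter.Eventually.of_forall fun τ => mul_nonneg (by positivity) (hN0 τ))]
    refine setLIntegral_congr_fun measurableSet_Ioc fun τ hτ => ?_
    simp only [(hNeq τ hτ).1, ENNReal.ofReal_mul (show 0 ≤ Z ^ (γ / 2) by positivity)]
  have hT0 : ∀ r, 0 ≤ ∫ v, energyTailAt Z (‖v‖ ^ 2) ∂(F r) := fun r =>
    integral_nonneg fun v => energyTailAt_nonneg hZ0.le _
  have hP1 : 0 ≤ ∫ τ in s..t, Z * M τ := intervalIntegral.integral_nonneg hst fun τ _ => mul_nonneg hZ0.le (hM0 τ)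
  have hP2 : 0 ≤ ∫ τ in s..t, Z ^ (γ / 2) * N τ :=
    intervalIntegral.integral_nonneg hst fun τ _ => mul_nonneg (by positivity) (hN0 τ)
  rw [hTE t ht, hTE s hs, hL1, hL2, ← ENNReal.ofReal_mul hc.le, ← ENNReal.ofReal_mul hC.le,
    ← ENNReal.ofReal_add (hT0 t) (by positivity), ← ENNReal.ofReal_add (hT0 s) (by positivity)]
  exact ENNReal.ofReal_le_ofReal hreal

/-- A bounded time integral of a moment propagates the moment and yields a higher one. -/
theorem IsWeakSolution.normMoment_step (hd : 2 ≤ d) (hγ₀ : 0 < γ) (hγ₁ : γ ≤ 1) (hb : IsAngularKernel d b)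
    (hA : NonCutoff d b 2) (h : IsWeakSolution γ b F) (hF : Measurable F) (hm : mass (F 0) ≠ 0)
    {a s T : ℝ} (ha : 1 < a) (hs : 0 ≤ s) (hsT : s ≤ T) (h0 : normMoment a (F s) < ∞)
    (hint : ∫⁻ τ in Ioc s T, normMoment a (F τ) < ∞) :
    (∃ K : ℝ≥0∞, K < ∞ ∧ ∀ t ∈ Icc s T, normMoment a (F t) ≤ K) ∧
      ∫⁻ τ in Ioc s T, normMoment (a + γ / 2) (F τ) < ∞ := by
  obtain ⟨c, C, Z, hc, hC, hZ, H⟩ := h.exists_tailEnergy_le hd hγ₀ hγ₁ hb hA hF hm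
  have hZ0 : 0 < Z := by linarith
  obtain ⟨C₁, hC₁, H₁⟩ := exists_normMoment_le_tsum_tailEnergy (d := d) ha hZ0
  obtain ⟨C₂, hC₂, H₂⟩ := exists_tsum_tailEnergy_le (d := d) ha hZ0
  obtain ⟨C₃, hC₃, H₃⟩ := exists_normMoment_le_tsum_tailMoment (d := d) (a := a) (by linarith) hγ₀ hZ0
  obtain ⟨C₄, hC₄, H₄⟩ := exists_tsum_tail_le (d := d) ha hγ₀ hγ₁ hZ0
  have hle : ∀ i : ℕ, Z ≤ Z * 2 ^ i := fun i => le_mul_of_one_le_right hZ0.le (one_le_pow₀ (by norm_num))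
  -- With these weights the sum of the tail energies controls the moment of order a, and the sum of
  -- the losses that of order a + γ/2, both up to mass.
  set w : ℕ → ℝ≥0∞ := fun i => ENNReal.ofReal ((Z * 2 ^ i) ^ (a - 1)) with hw
  set m := mass (F 0)
  have hmt : ∀ t, 0 ≤ t → F t univ = m := h.mass_eq
  set R : ℝ≥0∞ := C₂ * normMoment a (F s) + ENNReal.ofReal C *
    ∫⁻ τ in Ioc s T, C₄ * (m + normMoment a (F τ)) with hR
  have hRfin : R < ∞ := by
    have h1 : ∫⁻ τ in Ioc s T, C₄ * (m + normMoment a (F τ)) < ∞ := by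
      rw [lintegral_const_mul' _ _ hC₄.ne, lintegral_add_left measurable_const, setLIntegral_const]
      exact ENNReal.mul_lt_top hC₄ (ENNReal.add_lt_top.2
        ⟨ENNReal.mul_lt_top h.mass_lt_top (by simp), hint⟩)
    exact ENNReal.add_lt_top.2 ⟨ENNReal.mul_lt_top hC₂ h0, ENNReal.mul_lt_top ENNReal.ofReal_lt_top h1⟩
  have hsum : ∀ t ∈ Icc s T, ∑' i, w i * tailEnergy (Z * 2 ^ i) (F t) + ENNReal.ofReal c *
      ∫⁻ τ in Ioc s t, ∑' i, w i * (ENNReal.ofReal (Z * 2 ^ i) * tailMoment γ (Z * 2 ^ i) (F τ)) ≤ R := by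
    intro t ht
    have hm1 : ∀ i : ℕ, Measurable fun τ => ENNReal.ofReal (Z * 2 ^ i) * tailMoment γ (Z * 2 ^ i) (F τ) :=
      fun i => ((measurable_tailMoment γ _).comp hF).const_mul _
    have hm2 : ∀ i : ℕ, Measurable fun τ => ENNReal.ofReal ((Z * 2 ^ i) ^ (γ / 2)) * F τ {x | Z * 2 ^ i / 2 ≤ ‖x‖ ^ 2} :=
      fun i => ((Measure.measurable_coe (measurableSet_le measurable_const (by fun_prop))).comp hF).const_mul _
    calc _ = ∑' i, w i * (tailEnergy (Z * 2 ^ i) (F t) + ENNReal.ofReal c *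
            ∫⁻ τ in Ioc s t, ENNReal.ofReal (Z * 2 ^ i) * tailMoment γ (Z * 2 ^ i) (F τ)) := by
          rw [lintegral_tsum fun i => ((hm1 i).const_mul _).aemeasurable, ← ENNReal.tsum_mul_left, ← ENNReal.tsum_add]
          refine tsum_congr fun i => ?_
          rw [lintegral_const_mul _ (hm1 i)]
          ring
      _ ≤ ∑' i, w i * (tailEnergy (Z * 2 ^ i) (F s) + ENNReal.ofReal C *
            ∫⁻ τ in Ioc s t, ENNReal.ofReal ((Z * 2 ^ i) ^ (γ / 2)) * F τ {x | Z * 2 ^ i / 2 ≤ ‖x‖ ^ 2}) :=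
          ENNReal.tsum_le_tsum fun i => mul_le_mul_right (H _ s t (hle i) hs ht.1) _
      _ = ∑' i, w i * tailEnergy (Z * 2 ^ i) (F s) + ENNReal.ofReal C *
            ∫⁻ τ in Ioc s t, ∑' i, w i * (ENNReal.ofReal ((Z * 2 ^ i) ^ (γ / 2)) * F τ {x | Z * 2 ^ i / 2 ≤ ‖x‖ ^ 2}) := by
          rw [lintegral_tsum fun i => ((hm2 i).const_mul _).aemeasurable, ← ENNReal.tsum_mul_left, ← ENNReal.tsum_add]
          refine tsum_congr fun i => ?_
          rw [lintegral_const_mul _ (hm2 i)]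
          ring
      _ ≤ R := by
          refine add_le_add (H₂ _) (mul_le_mul_right ?_ _)
          refine (lintegral_mono_set (Ioc_subset_Ioc_right ht.2)).trans ?_
          refine setLIntegral_mono' measurableSet_Ioc fun τ hτ => ?_
          rw [← hmt τ (hs.trans hτ.1.le)]
          exact H₄ _
  refine ⟨⟨C₁ * R + C₁ * m, ENNReal.add_lt_top.2 ⟨ENNReal.mul_lt_top hC₁ hRfin,
    ENNReal.mul_lt_top hC₁ h.mass_lt_top⟩, fun t ht => ?_⟩, ?_⟩
  · refine (H₁ (F t)).trans ?_
    rw [hmt t (hs.trans ht.1)]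
    gcongr
    exact le_self_add.trans (hsum t ht)
  · have h1 : ∫⁻ τ in Ioc s T, ∑' i, w i * (ENNReal.ofReal (Z * 2 ^ i) * tailMoment γ (Z * 2 ^ i) (F τ)) < ∞ := by
      have h2 := (le_add_self.trans (hsum T ⟨hsT, le_rfl⟩)).trans_lt hRfin
      by_contra h3
      rw [not_lt_top_iff.1 h3, ENNReal.mul_top (ENNReal.ofReal_pos.2 hc).ne'] at h2
      exact lt_irrefl _ h2
    calc ∫⁻ τ in Ioc s T, normMoment (a + γ / 2) (F τ)
        ≤ ∫⁻ τ in Ioc s T, (C₃ * ∑' i, w i * (ENNReal.ofReal (Z * 2 ^ i) * tailMoment γ (Z * 2 ^ i) (F τ)) + C₃ * m) := by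
          refine setLIntegral_mono' measurableSet_Ioc fun τ hτ => ?_
          rw [← hmt τ (hs.trans hτ.1.le)]
          exact H₃ _
      _ < ∞ := by
          rw [lintegral_add_right _ measurable_const, lintegral_const_mul' _ _ hC₃.ne, setLIntegral_const]
          exact ENNReal.add_lt_top.2 ⟨ENNReal.mul_lt_top hC₃ h1,
            ENNReal.mul_lt_top (ENNReal.mul_lt_top hC₃ h.mass_lt_top) (by simp)⟩

/-- Finite energy alone yields a moment of higher order, after integration in time. -/
theorem IsWeakSolution.lintegral_normMoment_lt_top (hd : 2 ≤ d) (hγ₀ : 0 < γ) (hγ₁ : γ ≤ 1)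
    (hb : IsAngularKernel d b) (hA : NonCutoff d b 2) (h : IsWeakSolution γ b F) (hF : Measurable F)
    (hm : mass (F 0) ≠ 0) {T : ℝ} (hT : 0 ≤ T) :
    ∫⁻ τ in Ioc 0 T, normMoment (1 + γ / 4) (F τ) < ∞ := by
  obtain ⟨c, C, Z, hc, hC, hZ, H⟩ := h.exists_tailEnergy_le hd hγ₀ hγ₁ hb hA hF hm
  have hZ0 : 0 < Z := by linarith
  -- With a = 1 − γ/4 the weights (Z2^i)^{−γ/4} are summable, so a bound on each scale by the energy
  -- is enough; the order a + γ/2 = 1 + γ/4 still exceeds that of the energy.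
  obtain ⟨C₃, hC₃, H₃⟩ := exists_normMoment_le_tsum_tailMoment (d := d) (a := 1 - γ / 4) (by linarith) hγ₀ hZ0
  have hle : ∀ i : ℕ, Z ≤ Z * 2 ^ i := fun i => le_mul_of_one_le_right hZ0.le (one_le_pow₀ (by norm_num))
  set w : ℕ → ℝ≥0∞ := fun i => ENNReal.ofReal ((Z * 2 ^ i) ^ (1 - γ / 4 - 1)) with hw
  set E := energy (F 0)
  have hE : E < ∞ := h.energy_lt_top
  have hEt : ∀ t, 0 ≤ t → energy (F t) = E := h.energy_eq
  set R : ℝ≥0∞ := E + ENNReal.ofReal C * (2 * E * ENNReal.ofReal T)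
  have hRfin : R < ∞ := ENNReal.add_lt_top.2 ⟨hE, ENNReal.mul_lt_top ENNReal.ofReal_lt_top
    (ENNReal.mul_lt_top (ENNReal.mul_lt_top (by simp) hE) ENNReal.ofReal_lt_top)⟩
  -- A bound independent of the scale: for z = Z2^i ≥ 1, z^{γ/2} ≤ z, and Chebyshev gives z f{|v|² ≥
  -- z/2} ≤ 2E.
  have hR : ∀ i : ℕ, ENNReal.ofReal c * ∫⁻ τ in Ioc 0 T, ENNReal.ofReal (Z * 2 ^ i) * tailMoment γ (Z * 2 ^ i) (F τ) ≤ R := by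
    intro i
    refine (le_add_self.trans (H (Z * 2 ^ i) 0 T (hle i) le_rfl hT)).trans (add_le_add ?_ (mul_le_mul_right ?_ _))
    · refine lintegral_mono fun v => ENNReal.ofReal_le_ofReal ?_
      have hz : 0 < Z * 2 ^ i := by positivity
      rw [energyTailAt]
      calc Z * 2 ^ i * energyTail (‖v‖ ^ 2 / (Z * 2 ^ i)) ≤ (Z * 2 ^ i) * (‖v‖ ^ 2 / (Z * 2 ^ i)) := by
            gcongr
            exact energyTail_le (by positivity)
        _ = _ := by field_simp
    · calc ∫⁻ τ in Ioc 0 T, ENNReal.ofReal ((Z * 2 ^ i) ^ (γ / 2)) * F τ {x | Z * 2 ^ i / 2 ≤ ‖x‖ ^ 2}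
          ≤ ∫⁻ τ in Ioc 0 T, 2 * E := by
            refine setLIntegral_mono' measurableSet_Ioc fun τ hτ => ?_
            have hz : 1 ≤ Z * 2 ^ i := hZ.trans (hle i)
            have h1 : (Z * 2 ^ i) ^ (γ / 2) ≤ Z * 2 ^ i := by
              calc (Z * 2 ^ i) ^ (γ / 2) ≤ (Z * 2 ^ i) ^ (1 : ℝ) :=
                    Real.rpow_le_rpow_of_exponent_le hz (by linarith)
                _ = _ := Real.rpow_one _
            have h2 := mul_meas_ge_le_lintegral₀ (μ := F τ) (f := fun v : Vel d => ENNReal.ofReal (‖v‖ ^ 2))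
              (by fun_prop) (ENNReal.ofReal (Z * 2 ^ i / 2))
            have h3 : {x : Vel d | ENNReal.ofReal (Z * 2 ^ i / 2) ≤ ENNReal.ofReal (‖x‖ ^ 2)} =
                {x : Vel d | Z * 2 ^ i / 2 ≤ ‖x‖ ^ 2} := by
              ext x
              exact ENNReal.ofReal_le_ofReal_iff (sq_nonneg _)
            rw [h3] at h2
            calc ENNReal.ofReal ((Z * 2 ^ i) ^ (γ / 2)) * F τ {x | Z * 2 ^ i / 2 ≤ ‖x‖ ^ 2}
                ≤ ENNReal.ofReal (2 * (Z * 2 ^ i / 2)) * F τ {x | Z * 2 ^ i / 2 ≤ ‖x‖ ^ 2} := by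
                  gcongr
                  linarith
              _ = 2 * (ENNReal.ofReal (Z * 2 ^ i / 2) * F τ {x | Z * 2 ^ i / 2 ≤ ‖x‖ ^ 2}) := by
                  rw [ENNReal.ofReal_mul (by norm_num), mul_assoc]
                  norm_num
              _ ≤ 2 * E := by
                  rw [← hEt τ hτ.1.le]
                  gcongr
                  exact h2
        _ = 2 * E * ENNReal.ofReal T := by rw [setLIntegral_const, Real.volume_Ioc, sub_zero]
  have hwsum : ∑' i, w i < ∞ := by
    have h1 : ∀ i, w i = ENNReal.ofReal (Z ^ (1 - γ / 4 - 1)) * ENNReal.ofReal (2 ^ (1 - γ / 4 - 1)) ^ i := by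
      intro i
      rw [hw, ← ENNReal.ofReal_pow (by positivity), ← ENNReal.ofReal_mul (by positivity)]
      simp only
      rw [Real.mul_rpow hZ0.le (by positivity), ← Real.rpow_natCast, ← Real.rpow_natCast, ← Real.rpow_mul (by norm_num),
        ← Real.rpow_mul (by norm_num), mul_comm (i : ℝ)]
    simp only [h1]
    rw [ENNReal.tsum_mul_left, ENNReal.tsum_geometric]
    refine ENNReal.mul_lt_top ENNReal.ofReal_lt_top ?_
    rw [ENNReal.inv_lt_top, tsub_pos_iff_lt, ← ENNReal.ofReal_one, ENNReal.ofReal_lt_ofReal_iff one_pos]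
    exact Real.rpow_lt_one_of_one_lt_of_neg (by norm_num) (by linarith)
  have hm1 : ∀ i : ℕ, Measurable fun τ => ENNReal.ofReal (Z * 2 ^ i) * tailMoment γ (Z * 2 ^ i) (F τ) :=
    fun i => ((measurable_tailMoment γ _).comp hF).const_mul _
  have h1 : ∫⁻ τ in Ioc 0 T, ∑' i, w i * (ENNReal.ofReal (Z * 2 ^ i) * tailMoment γ (Z * 2 ^ i) (F τ)) < ∞ := by
    have h2 : ENNReal.ofReal c * ∫⁻ τ in Ioc 0 T,
        ∑' i, w i * (ENNReal.ofReal (Z * 2 ^ i) * tailMoment γ (Z * 2 ^ i) (F τ)) ≤ (∑' i, w i) * R := by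
      rw [lintegral_tsum fun i => ((hm1 i).const_mul _).aemeasurable, ← ENNReal.tsum_mul_left, ← ENNReal.tsum_mul_right]
      refine ENNReal.tsum_le_tsum fun i => ?_
      rw [lintegral_const_mul _ (hm1 i), mul_left_comm]
      exact mul_le_mul_right (hR i) _
    have h2' := h2.trans_lt (ENNReal.mul_lt_top hwsum hRfin)
    by_contra h3
    rw [not_lt_top_iff.1 h3, ENNReal.mul_top (ENNReal.ofReal_pos.2 hc).ne'] at h2'
    exact lt_irrefl _ h2'
  have hg : 1 + γ / 4 = 1 - γ / 4 + γ / 2 := by ring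
  rw [hg]
  calc ∫⁻ τ in Ioc 0 T, normMoment (1 - γ / 4 + γ / 2) (F τ)
      ≤ ∫⁻ τ in Ioc 0 T, (C₃ * ∑' i, w i * (ENNReal.ofReal (Z * 2 ^ i) * tailMoment γ (Z * 2 ^ i) (F τ)) + C₃ * mass (F 0)) := by
        refine setLIntegral_mono' measurableSet_Ioc fun τ hτ => ?_
        rw [← h.mass_eq τ hτ.1.le]
        exact H₃ _
    _ < ∞ := by
        rw [lintegral_add_right _ measurable_const, lintegral_const_mul' _ _ hC₃.ne, setLIntegral_const]
        exact ENNReal.add_lt_top.2 ⟨ENNReal.mul_lt_top hC₃ h1,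
          ENNReal.mul_lt_top (ENNReal.mul_lt_top hC₃ h.mass_lt_top) (by simp)⟩

theorem exists_nat_order (hγ₀ : 0 < γ) (a : ℝ) : ∃ k : ℕ, a ≤ 1 + γ / 4 + k * (γ / 2) := by
  obtain ⟨k, hk⟩ := exists_nat_ge (a / (γ / 2))
  refine ⟨k, ?_⟩
  rw [div_le_iff₀ (by positivity)] at hk
  linarith

/-- Generation of moments of any order. -/
theorem IsWeakSolution.exists_normMoment_le (hd : 2 ≤ d) (hγ₀ : 0 < γ) (hγ₁ : γ ≤ 1) (hb : IsAngularKernel d b)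
    (hA : NonCutoff d b 2) (h : IsWeakSolution γ b F) (hF : Measurable F) (hm : mass (F 0) ≠ 0)
    {a t₀ T : ℝ} (ha : 0 ≤ a) (ht₀ : 0 < t₀) : ∃ K : ℝ≥0∞, K < ∞ ∧ ∀ t ∈ Icc t₀ T, normMoment a (F t) ≤ K := by
  rcases lt_or_ge T t₀ with hT | hT
  · exact ⟨0, by simp, fun t ht => absurd (ht.1.trans ht.2) (not_le.2 hT)⟩
  -- A moment integrable in time is finite at some s in (r/2, r], from which the step to the next
  -- order can start; r is arbitrarily small.
  have key : ∀ (k : ℕ) (r : ℝ), 0 < r → r ≤ T →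
      (∀ r, 0 < r → r ≤ T → ∫⁻ τ in Ioc r T, normMoment (1 + γ / 4 + k * (γ / 2)) (F τ) < ∞) →
      ∃ s, 0 < s ∧ s ≤ r ∧ normMoment (1 + γ / 4 + k * (γ / 2)) (F s) < ∞ := by
    intro k r hr hrT hall
    have h1 := hall (r / 2) (by linarith) (by linarith)
    have h2 : ∀ᵐ τ ∂(volume.restrict (Ioc (r / 2) r)), normMoment (1 + γ / 4 + k * (γ / 2)) (F τ) < ∞ :=
      ae_lt_top ((measurable_normMoment _).comp hF) ((lintegral_mono_set (Ioc_subset_Ioc_right hrT)).trans_lt h1).ne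
    have h3 : (volume.restrict (Ioc (r / 2) r)) ≠ 0 := by
      rw [Ne, Measure.restrict_eq_zero, Real.volume_Ioc, ENNReal.ofReal_eq_zero]
      linarith
    have : (ae (volume.restrict (Ioc (r / 2) r))).NeBot := ae_neBot.2 h3
    obtain ⟨s, hs1, hs2⟩ := (h2.and (ae_restrict_mem measurableSet_Ioc)).exists
    exact ⟨s, by linarith [hs2.1], hs2.2, hs1⟩
  have hall : ∀ k : ℕ, ∀ r, 0 < r → r ≤ T → ∫⁻ τ in Ioc r T, normMoment (1 + γ / 4 + k * (γ / 2)) (F τ) < ∞ := by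
    intro k
    induction k with
    | zero =>
      intro r hr hrT
      simp only [Nat.cast_zero, zero_mul, add_zero]
      exact (lintegral_mono_set (Ioc_subset_Ioc_left hr.le)).trans_lt
        (h.lintegral_normMoment_lt_top hd hγ₀ hγ₁ hb hA hF hm (hr.le.trans hrT))
    | succ k ih =>
      intro r hr hrT
      obtain ⟨s, hs0, hsr, hs⟩ := key k r hr hrT ih
      have h1 := (h.normMoment_step hd hγ₀ hγ₁ hb hA hF hm (a := 1 + γ / 4 + k * (γ / 2))
        (by have : 0 ≤ k * (γ / 2) := by positivity
            linarith) hs0.le (hsr.trans hrT) hs (ih s hs0 (hsr.trans hrT))).2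
      have h2 : 1 + γ / 4 + ((k + 1 : ℕ) : ℝ) * (γ / 2) = 1 + γ / 4 + k * (γ / 2) + γ / 2 := by push_cast; ring
      rw [h2]
      exact (lintegral_mono_set (Ioc_subset_Ioc_left hsr)).trans_lt h1
  obtain ⟨k, hk⟩ := exists_nat_order hγ₀ a
  obtain ⟨s, hs0, hsr, hs⟩ := key k t₀ ht₀ hT (hall k)
  obtain ⟨K, hK, hKs⟩ := (h.normMoment_step hd hγ₀ hγ₁ hb hA hF hm (a := 1 + γ / 4 + k * (γ / 2))
        (by have : 0 ≤ k * (γ / 2) := by positivity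
            linarith) hs0.le (hsr.trans hT) hs (hall k s hs0 (hsr.trans hT))).1
  refine ⟨mass (F 0) + K, ENNReal.add_lt_top.2 ⟨h.mass_lt_top, hK⟩, fun t ht => ?_⟩
  refine (normMoment_le_add ha hk (F t)).trans (add_le_add (h.mass_eq t (ht₀.le.trans ht.1)).le ?_)
  exact hKs t ⟨hsr.trans ht.1, ht.2⟩

/-- Propagation of moments of any order. -/
theorem IsWeakSolution.exists_normMoment_le_of_initial (hd : 2 ≤ d) (hγ₀ : 0 < γ) (hγ₁ : γ ≤ 1)
    (hb : IsAngularKernel d b) (hA : NonCutoff d b 2) (h : IsWeakSolution γ b F) (hF : Measurable F)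
    (hm : mass (F 0) ≠ 0) (h0 : ∀ a, 0 ≤ a → normMoment a (F 0) < ∞) {a T : ℝ} (ha : 0 ≤ a) :
    ∃ K : ℝ≥0∞, K < ∞ ∧ ∀ t ∈ Icc 0 T, normMoment a (F t) ≤ K := by
  rcases lt_or_ge T 0 with hT | hT
  · exact ⟨0, by simp, fun t ht => absurd (ht.1.trans ht.2) (not_le.2 hT)⟩
  have hall : ∀ k : ℕ, ∫⁻ τ in Ioc 0 T, normMoment (1 + γ / 4 + k * (γ / 2)) (F τ) < ∞ := by
    intro k
    induction k with
    | zero =>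
      simp only [Nat.cast_zero, zero_mul, add_zero]
      exact h.lintegral_normMoment_lt_top hd hγ₀ hγ₁ hb hA hF hm hT
    | succ k ih =>
      have h1 := (h.normMoment_step hd hγ₀ hγ₁ hb hA hF hm (a := 1 + γ / 4 + k * (γ / 2))
        (by have : 0 ≤ k * (γ / 2) := by positivity
            linarith) le_rfl hT (h0 _ (by positivity)) ih).2
      have h2 : 1 + γ / 4 + ((k + 1 : ℕ) : ℝ) * (γ / 2) = 1 + γ / 4 + k * (γ / 2) + γ / 2 := by push_cast; ring
      rwa [h2]
  obtain ⟨k, hk⟩ := exists_nat_order hγ₀ a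
  obtain ⟨K, hK, hKs⟩ := (h.normMoment_step hd hγ₀ hγ₁ hb hA hF hm (a := 1 + γ / 4 + k * (γ / 2))
        (by have : 0 ≤ k * (γ / 2) := by positivity
            linarith) le_rfl hT (h0 _ (by positivity)) (hall k)).1
  refine ⟨mass (F 0) + K, ENNReal.add_lt_top.2 ⟨h.mass_lt_top, hK⟩, fun t ht => ?_⟩
  exact (normMoment_le_add ha hk (F t)).trans (add_le_add (h.mass_eq t ht.1).le (hKs t ht))

end moments

/-! ### The weak formulation for radial test functions of polynomial growth -/

/-- Functions of the energy that are smooth, with polynomial bounds up to second order. -/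
structure PolyBound (L : ℝ) (k : ℕ) (g g' g'' : ℝ → ℝ) : Prop where
  measurable : Measurable g
  contDiffAt : ∀ r, 0 ≤ r → ContDiffAt ℝ (⊤ : ℕ∞) g r
  hasDerivAt : ∀ r, 0 ≤ r → HasDerivAt g (g' r) r
  hasDerivAt_deriv : ∀ r, 0 ≤ r → HasDerivAt g' (g'' r) r
  abs_le : ∀ r, 0 ≤ r → |g r| ≤ L * (1 + r) ^ k
  abs_deriv_le : ∀ r, 0 ≤ r → |g' r| ≤ L * (1 + r) ^ k
  abs_deriv2_le : ∀ r, 0 ≤ r → |g'' r| ≤ L * (1 + r) ^ k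

section polyBound
variable {L L₁ : ℝ} {k l : ℕ} {g g' g'' f f' f'' : ℝ → ℝ}

theorem PolyBound.nonneg (h : PolyBound L k g g' g'') : 0 ≤ L := by
  have := (abs_nonneg _).trans (h.abs_le 0 le_rfl)
  simpa using this

theorem PolyBound.mul (h : PolyBound L k g g' g'') (h₁ : PolyBound L₁ l f f' f'') :
    PolyBound (4 * L * L₁) (k + l) (fun r => g r * f r) (fun r => g' r * f r + g r * f' r)
      (fun r => g'' r * f r + 2 * (g' r * f' r) + g r * f'' r) := by
  have hL := h.nonneg
  have hL₁ := h₁.nonneg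
  have key : ∀ r, 0 ≤ r → ∀ x y : ℝ, |x| ≤ L * (1 + r) ^ k → |y| ≤ L₁ * (1 + r) ^ l →
      |x * y| ≤ L * L₁ * (1 + r) ^ (k + l) := by
    intro r hr x y hx hy
    rw [abs_mul, pow_add]
    calc |x| * |y| ≤ (L * (1 + r) ^ k) * (L₁ * (1 + r) ^ l) :=
          mul_le_mul hx hy (abs_nonneg _) (by positivity)
      _ = _ := by ring
  refine ⟨h.measurable.mul h₁.measurable, fun r hr => (h.contDiffAt r hr).mul (h₁.contDiffAt r hr),
    fun r hr => (h.hasDerivAt r hr).mul (h₁.hasDerivAt r hr), fun r hr => ?_, fun r hr => ?_, fun r hr => ?_,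
    fun r hr => ?_⟩
  · refine (((h.hasDerivAt_deriv r hr).fun_mul (h₁.hasDerivAt r hr)).fun_add
      ((h.hasDerivAt r hr).fun_mul (h₁.hasDerivAt_deriv r hr))).congr_deriv ?_
    ring
  · have h2 := key r hr _ _ (h.abs_le r hr) (h₁.abs_le r hr)
    have h0 := (abs_nonneg _).trans h2
    linarith
  · have h2 := key r hr _ _ (h.abs_deriv_le r hr) (h₁.abs_le r hr)
    have h3 := key r hr _ _ (h.abs_le r hr) (h₁.abs_deriv_le r hr)
    have h0 := (abs_nonneg _).trans h2
    refine (abs_add_le _ _).trans ?_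
    linarith
  · have h2 := key r hr _ _ (h.abs_deriv2_le r hr) (h₁.abs_le r hr)
    have h3 := key r hr _ _ (h.abs_deriv_le r hr) (h₁.abs_deriv_le r hr)
    have h4 := key r hr _ _ (h.abs_le r hr) (h₁.abs_deriv2_le r hr)
    refine (abs_add_three _ _ _).trans ?_
    rw [abs_mul 2, abs_two]
    linarith

/-- Smooth cutoff functions of the energy. -/
noncomputable def energyCutoff (j : ℕ) (r : ℝ) : ℝ := Real.smoothTransition (2 - r / (j + 1))

/-- One L serves all j: the derivatives of the transition function are bounded, and the dilation by
j + 1 ≥ 1 only reduces them. -/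
theorem exists_polyBound_energyCutoff : ∃ L : ℝ, ∀ j : ℕ, PolyBound L 0 (energyCutoff j)
    (fun r => -(deriv Real.smoothTransition (2 - r / (j + 1)) / (j + 1)))
    (fun r => deriv (deriv Real.smoothTransition) (2 - r / (j + 1)) / (j + 1) ^ 2) := by
  have hs : ContDiff ℝ 2 Real.smoothTransition := Real.smoothTransition.contDiff
  have hs1 : ContDiff ℝ 1 (deriv Real.smoothTransition) := by
    have : ContDiff ℝ (1 + 1) Real.smoothTransition := hs
    exact (contDiff_succ_iff_deriv.1 this).2.2
  have hd : Continuous (deriv Real.smoothTransition) := hs1.continuous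
  have hd2 : Continuous (deriv (deriv Real.smoothTransition)) := hs1.continuous_deriv le_rfl
  have hout : ∀ r : ℝ, r ∉ Icc (0 : ℝ) 1 → deriv Real.smoothTransition =ᶠ[nhds r] fun _ => 0 := by
    intro r hr
    have hU : IsOpen (Icc (0 : ℝ) 1)ᶜ := isClosed_Icc.isOpen_compl
    filter_upwards [hU.mem_nhds hr] with x hx
    rw [mem_compl_iff, mem_Icc, not_and_or, not_le, not_le] at hx
    rcases hx with hx | hx
    · have : Real.smoothTransition =ᶠ[nhds x] fun _ => 0 := by
        filter_upwards [Iio_mem_nhds hx] with y hy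
        exact Real.smoothTransition.zero_of_nonpos (le_of_lt hy)
      rw [this.deriv_eq, deriv_const]
    · have : Real.smoothTransition =ᶠ[nhds x] fun _ => 1 := by
        filter_upwards [Ioi_mem_nhds hx] with y hy
        exact Real.smoothTransition.one_of_one_le (le_of_lt hy)
      rw [this.deriv_eq, deriv_const]
  obtain ⟨M, hM⟩ := (isCompact_Icc (a := (0 : ℝ)) (b := 1)).exists_bound_of_continuousOn hd.continuousOn
  obtain ⟨M₂, hM₂⟩ := (isCompact_Icc (a := (0 : ℝ)) (b := 1)).exists_bound_of_continuousOn hd2.continuousOn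
  have hM0 : 0 ≤ M := (norm_nonneg _).trans (hM 0 (by simp))
  have hM0₂ : 0 ≤ M₂ := (norm_nonneg _).trans (hM₂ 0 (by simp))
  have hM' : ∀ r, |deriv Real.smoothTransition r| ≤ M := by
    intro r
    by_cases hr : r ∈ Icc (0 : ℝ) 1
    · exact hM r hr
    · rw [(hout r hr).eq_of_nhds, abs_zero]; exact hM0
  have hM'₂ : ∀ r, |deriv (deriv Real.smoothTransition) r| ≤ M₂ := by
    intro r
    by_cases hr : r ∈ Icc (0 : ℝ) 1
    · exact hM₂ r hr
    · rw [(hout r hr).deriv_eq, deriv_const, abs_zero]; exact hM0₂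
  refine ⟨1 + M + M₂, fun j => ?_⟩
  have hj : (1 : ℝ) ≤ (j : ℝ) + 1 := by have : (0 : ℝ) ≤ j := by positivity
                                        linarith
  have hin : ∀ r : ℝ, HasDerivAt (fun r => 2 - r / ((j : ℝ) + 1)) (-(1 / ((j : ℝ) + 1))) r := fun r =>
    ((hasDerivAt_id r).div_const _).const_sub 2
  have hC : ContDiff ℝ (⊤ : ℕ∞) (energyCutoff j) :=
    Real.smoothTransition.contDiff.comp (contDiff_const.sub (contDiff_id.div_const _))
  refine ⟨hC.continuous.measurable, fun r _ => hC.contDiffAt, fun r _ => ?_, fun r _ => ?_, fun r _ => ?_,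
    fun r _ => ?_, fun r _ => ?_⟩
  · have h1 := ((hs.differentiable (by norm_num)).differentiableAt (x := 2 - r / ((j : ℝ) + 1))).hasDerivAt
    refine (h1.comp r (hin r)).congr_deriv ?_
    ring
  · have h1 := ((hs1.differentiable (by norm_num)).differentiableAt (x := 2 - r / ((j : ℝ) + 1))).hasDerivAt
    refine (((h1.comp r (hin r)).div_const ((j : ℝ) + 1)).neg).congr_deriv ?_
    field_simp
  · rw [pow_zero, mul_one, energyCutoff, abs_of_nonneg (Real.smoothTransition.nonneg _)]
    linarith [Real.smoothTransition.le_one (2 - r / ((j : ℝ) + 1))]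
  · rw [pow_zero, mul_one, abs_neg, abs_div, abs_of_pos (by linarith : (0 : ℝ) < j + 1)]
    have := div_le_self (abs_nonneg (deriv Real.smoothTransition (2 - r / (j + 1)))) hj
    linarith [hM' (2 - r / (j + 1))]
  · rw [pow_zero, mul_one, abs_div, abs_of_pos (by positivity : (0 : ℝ) < (j + 1) ^ 2)]
    have := div_le_self (abs_nonneg (deriv (deriv Real.smoothTransition) (2 - r / (j + 1)))) (one_le_pow₀ hj (n := 2))
    linarith [hM'₂ (2 - r / (j + 1))]

variable {d : ℕ} {γ : ℝ} {b : ℝ → ℝ} {e : Vel d}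

theorem PolyBound.contDiff (h : PolyBound L k g g' g'') : ContDiff ℝ (⊤ : ℕ∞) fun v : Vel d => g (‖v‖ ^ 2) := by
  rw [contDiff_iff_contDiffAt]
  intro v
  exact (h.contDiffAt _ (sq_nonneg _)).comp v (contDiff_norm_sq ℝ).contDiffAt

theorem hasCompactSupport_mul_energyCutoff (g : ℝ → ℝ) (j : ℕ) :
    HasCompactSupport fun v : Vel d => g (‖v‖ ^ 2) * energyCutoff j (‖v‖ ^ 2) := by
  refine HasCompactSupport.intro (isCompact_closedBall (0 : Vel d) (Real.sqrt (2 * (j + 1)))) fun v hv => ?_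
  rw [mem_closedBall_zero_iff, not_le] at hv
  have h1 : 2 * ((j : ℝ) + 1) < ‖v‖ ^ 2 := (Real.sqrt_lt' ((Real.sqrt_nonneg _).trans_lt hv)).1 hv
  rw [energyCutoff, Real.smoothTransition.zero_of_nonpos, mul_zero]
  rw [sub_nonpos, le_div_iff₀ (by positivity)]
  exact h1.le

theorem energyCutoff_eq_one {j : ℕ} {r : ℝ} (h : r ≤ j) : energyCutoff j r = 1 := by
  refine Real.smoothTransition.one_of_one_le ?_
  have : r / ((j : ℝ) + 1) ≤ 1 := by rw [div_le_one (by positivity)]; linarith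
  linarith

theorem norm_postVel_sq_add (v w : Vel d) {σ : Vel d} (hσ : ‖σ‖ = 1) :
    ‖postVel v w σ‖ ^ 2 + ‖postVelStar v w σ‖ ^ 2 = ‖v‖ ^ 2 + ‖w‖ ^ 2 := by
  rw [norm_postVel_sq hσ, norm_postVelStar_sq hσ]
  ring

/-- By conservation of energy all four energies are at most |v|² + |w|² ≤ j, where the cutoff is 1.
For fixed v and w the cut-off weights are eventually equal to their limit. -/
theorem collWeight_mul_energyCutoff (hγ : γ ≠ 0) (g : ℝ → ℝ) {j : ℕ} {v w : Vel d} (h : ‖v‖ ^ 2 + ‖w‖ ^ 2 ≤ j) :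
    collWeight γ b (fun x => g (‖x‖ ^ 2) * energyCutoff j (‖x‖ ^ 2)) v w =
      collWeight γ b (fun x => g (‖x‖ ^ 2)) v w := by
  by_cases hvw : v = w
  · rw [hvw, collWeight_self hγ, collWeight_self hγ]
  have key : ∀ σ : Vel d, ‖σ‖ = 1 → collDiff (fun x => g (‖x‖ ^ 2) * energyCutoff j (‖x‖ ^ 2)) v w σ =
      collDiff (fun x => g (‖x‖ ^ 2)) v w σ := by
    intro σ hσ
    have h1 := norm_postVel_sq_add v w hσ
    simp only [collDiff]
    rw [energyCutoff_eq_one (j := j) (by nlinarith [sq_nonneg ‖postVelStar v w σ‖]),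
      energyCutoff_eq_one (j := j) (by nlinarith [sq_nonneg ‖postVel v w σ‖]),
      energyCutoff_eq_one (j := j) (by nlinarith [sq_nonneg ‖w‖]),
      energyCutoff_eq_one (j := j) (by nlinarith [sq_nonneg ‖v‖])]
    ring
  rw [collWeight, collWeight]
  congr 1
  funext σ
  rw [key _ (by simp), key _ (by rw [norm_halfTurn (norm_relDir hvw)]; simp)]

theorem integral_one_sub_sq_nonneg (hb : IsAngularKernel d b) (he : ‖e‖ = 1) :
    0 ≤ ∫ t, (1 - t ^ 2) ∂(angMeasure b e) := by
  rw [integral_angMeasure hb.measurable hb.nonneg _ (by fun_prop)]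
  refine integral_nonneg fun σ => mul_nonneg (hb.nonneg _) ?_
  have := abs_inner_le_one he (σ := (σ : Vel d)) (by simp)
  have := (sq_le_one_iff_abs_le_one _).2 this
  linarith

theorem PolyBound.abs_collWeight_le (h : PolyBound L k g g' g'') (hb : IsAngularKernel d b) (hA : NonCutoff d b 2)
    (hγ₀ : 0 < γ) (hγ₁ : γ ≤ 1) (he : ‖e‖ = 1) (v w : Vel d) :
    |collWeight γ b (fun x => g (‖x‖ ^ 2)) v w| ≤ 2 * (∫ t, (1 - t ^ 2) ∂(angMeasure b e)) * L *
      ((1 + ‖v‖ ^ 2) ^ (k + 2) * (1 + ‖w‖ ^ 2) ^ (k + 2)) := by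
  have hL := h.nonneg
  set X := ‖v‖ ^ 2 with hXdef
  set Y := ‖w‖ ^ 2 with hYdef
  have hX : 0 ≤ X := sq_nonneg _
  have hY : 0 ≤ Y := sq_nonneg _
  set M := L * (1 + (X + Y)) ^ k
  have hle : ∀ ξ ∈ Icc 0 (X + Y), L * (1 + ξ) ^ k ≤ M := by
    intro ξ hξ
    have h0 := hξ.1
    have h1 := hξ.2
    change L * (1 + ξ) ^ k ≤ L * (1 + (X + Y)) ^ k
    gcongr
  have hM : 0 ≤ M := by positivity
  have h1 := Boltzmann.abs_collWeight_le (γ := γ) (v := v) (w := w) (g := g) (C := X * Y * M + (X + Y) * M)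
    hb hA hγ₀.ne' he h.measurable (by positivity) (fun a k ha ha1 hk =>
      abs_energyDiff_le hX hY ha ha1 hk (fun ξ hξ => h.hasDerivAt ξ hξ.1) (fun ξ hξ => h.hasDerivAt_deriv ξ hξ.1)
        (fun ξ hξ => (h.abs_deriv_le ξ hξ.1).trans (hle ξ hξ)) (fun ξ hξ => (h.abs_deriv2_le ξ hξ.1).trans (hle ξ hξ)))
  refine h1.trans ?_
  have hA0 := integral_one_sub_sq_nonneg (b := b) hb he
  set A := ∫ t, (1 - t ^ 2) ∂(angMeasure b e)
  have hu : ‖v - w‖ ^ γ ≤ 2 * ((1 + X) * (1 + Y)) := by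
    have h2 : ‖v - w‖ ^ γ ≤ 1 + ‖v - w‖ ^ 2 := by
      rcases le_total ‖v - w‖ 1 with hx | hx
      · have := Real.rpow_le_one (norm_nonneg (v - w)) hx hγ₀.le
        nlinarith [sq_nonneg ‖v - w‖]
      · have := Real.rpow_le_rpow_of_exponent_le hx (show γ ≤ (2 : ℕ) by push_cast; linarith)
        rw [Real.rpow_natCast] at this
        linarith
    have h3 := norm_add_sq_add_norm_sub_sq v w
    nlinarith [sq_nonneg ‖v + w‖, mul_nonneg hX hY]
  have hXY : X * Y * M + (X + Y) * M ≤ (1 + X) * (1 + Y) * (L * ((1 + X) * (1 + Y)) ^ k) := by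
    have h2 : M ≤ L * ((1 + X) * (1 + Y)) ^ k := by
      have : 1 + (X + Y) ≤ (1 + X) * (1 + Y) := by nlinarith [mul_nonneg hX hY]
      change L * (1 + (X + Y)) ^ k ≤ _
      gcongr
    calc X * Y * M + (X + Y) * M = (X * Y + (X + Y)) * M := by ring
      _ ≤ (1 + X) * (1 + Y) * (L * ((1 + X) * (1 + Y)) ^ k) := by
          refine mul_le_mul ?_ h2 hM (by positivity)
          nlinarith
  calc ‖v - w‖ ^ γ * (A * (X * Y * M + (X + Y) * M))
      ≤ 2 * ((1 + X) * (1 + Y)) * (A * ((1 + X) * (1 + Y) * (L * ((1 + X) * (1 + Y)) ^ k))) := by gcongr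
    _ = _ := by rw [mul_pow, pow_add, pow_add]; ring

/-- Integrals of powers of `1 + |v|^2` are bounded by moments. -/
theorem exists_integral_one_add_pow_le {F : ℝ → Measure (Vel d)} (h : IsWeakSolution γ b F) {s t : ℝ} (hs : 0 ≤ s)
    (hM : ∀ a, 0 ≤ a → ∃ K : ℝ≥0∞, K < ∞ ∧ ∀ τ ∈ Icc s t, normMoment a (F τ) ≤ K) (N : ℕ) :
    ∃ K : ℝ, 0 ≤ K ∧ ∀ τ ∈ Icc s t, Integrable (fun v : Vel d => (1 + ‖v‖ ^ 2) ^ N) (F τ) ∧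
      ∫ v, (1 + ‖v‖ ^ 2) ^ N ∂(F τ) ≤ K := by
  obtain ⟨K, hK, H⟩ := hM N (by positivity)
  set K' : ℝ≥0∞ := ENNReal.ofReal (2 ^ N) * (mass (F 0) + K) with hK'
  have hK'fin : K' < ∞ := ENNReal.mul_lt_top ENNReal.ofReal_lt_top (ENNReal.add_lt_top.2 ⟨h.mass_lt_top, hK⟩)
  have hle : ∀ τ ∈ Icc s t, ∫⁻ v, ENNReal.ofReal ((1 + ‖v‖ ^ 2) ^ N) ∂(F τ) ≤ K' := by
    intro τ hτ
    calc ∫⁻ v, ENNReal.ofReal ((1 + ‖v‖ ^ 2) ^ N) ∂(F τ)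
        ≤ ∫⁻ v, ENNReal.ofReal (2 ^ N) * (1 + ENNReal.ofReal ((‖v‖ ^ 2) ^ (N : ℝ))) ∂(F τ) := by
          refine lintegral_mono fun v => ?_
          rw [← ENNReal.ofReal_one, ← ENNReal.ofReal_add zero_le_one (by positivity), ← ENNReal.ofReal_mul (by positivity)]
          refine ENNReal.ofReal_le_ofReal ?_
          rw [Real.rpow_natCast]
          rcases le_total (‖v‖ ^ 2) 1 with hv | hv
          · calc (1 + ‖v‖ ^ 2) ^ N ≤ (2 : ℝ) ^ N := by gcongr; linarith
              _ ≤ _ := by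
                refine le_mul_of_one_le_right (by positivity) ?_
                have : 0 ≤ (‖v‖ ^ 2) ^ N := by positivity
                linarith
          · calc (1 + ‖v‖ ^ 2) ^ N ≤ (2 * ‖v‖ ^ 2) ^ N := by gcongr; linarith
              _ = 2 ^ N * (‖v‖ ^ 2) ^ N := mul_pow _ _ _
              _ ≤ _ := by gcongr; linarith
      _ ≤ K' := by
          rw [lintegral_const_mul' _ _ ENNReal.ofReal_ne_top, lintegral_add_left measurable_const, lintegral_one]
          exact mul_le_mul_right (add_le_add (h.mass_eq τ (hs.trans hτ.1)).le (H τ hτ)) _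
  refine ⟨K'.toReal, ENNReal.toReal_nonneg, fun τ hτ => ?_⟩
  have h0 : 0 ≤ᵐ[F τ] fun v : Vel d => (1 + ‖v‖ ^ 2) ^ N := Filter.Eventually.of_forall fun v => by positivity
  refine ⟨⟨by fun_prop, ?_⟩, ?_⟩
  · rw [hasFiniteIntegral_iff_ofReal h0]
    exact (hle τ hτ).trans_lt hK'fin
  · rw [integral_eq_lintegral_of_nonneg_ae h0 (by fun_prop)]
    exact ENNReal.toReal_mono hK'fin.ne (hle τ hτ)

set_option maxHeartbeats 400000 in
/-- The weak formulation for radial test functions of polynomial growth. -/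
theorem IsWeakSolution.integral_sub_of_polyBound (hd : 2 ≤ d) (hγ₀ : 0 < γ) (hγ₁ : γ ≤ 1) (hb : IsAngularKernel d b)
    (hA : NonCutoff d b 2) {F : ℝ → Measure (Vel d)} (h : IsWeakSolution γ b F)
    {s t : ℝ} (hs : 0 ≤ s) (hst : s ≤ t)
    (hM : ∀ a, 0 ≤ a → ∃ K : ℝ≥0∞, K < ∞ ∧ ∀ τ ∈ Icc s t, normMoment a (F τ) ≤ K)
    (hg : PolyBound L k g g' g'') :
    (∀ᵐ τ ∂(volume.restrict (Ioc s t)), Integrable (fun p : Vel d × Vel d =>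
      collWeight γ b (fun v => g (‖v‖ ^ 2)) p.1 p.2) ((F τ).prod (F τ))) ∧
    IntervalIntegrable (collRate γ b F fun v => g (‖v‖ ^ 2)) volume s t ∧
    ∫ v, g (‖v‖ ^ 2) ∂(F t) - ∫ v, g (‖v‖ ^ 2) ∂(F s) = ∫ τ in s..t, collRate γ b F (fun v => g (‖v‖ ^ 2)) τ := by
  obtain ⟨e, he⟩ : ∃ e : Vel d, ‖e‖ = 1 := ⟨EuclideanSpace.single ⟨0, by omega⟩ 1, by simp⟩
  have ht : 0 ≤ t := hs.trans hst
  obtain ⟨L₀, hL₀⟩ := exists_polyBound_energyCutoff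
  have hφ : ∀ j, PolyBound (4 * L * L₀) k (fun r => g r * energyCutoff j r) _ _ := fun j => hg.mul (hL₀ j)
  have hφd : ∀ j, ContDiff ℝ (⊤ : ℕ∞) fun v : Vel d => g (‖v‖ ^ 2) * energyCutoff j (‖v‖ ^ 2) := fun j => (hφ j).contDiff
  have hφc : ∀ j, HasCompactSupport fun v : Vel d => g (‖v‖ ^ 2) * energyCutoff j (‖v‖ ^ 2) :=
    hasCompactSupport_mul_energyCutoff g
  set B : ℝ := 2 * (∫ t, (1 - t ^ 2) ∂(angMeasure b e)) * (4 * L * L₀) with hB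
  have hB0 : 0 ≤ B := mul_nonneg (mul_nonneg zero_le_two (integral_one_sub_sq_nonneg hb he)) (hφ 0).nonneg
  obtain ⟨K, hK0, hK⟩ := exists_integral_one_add_pow_le h hs hM (k + 2)
  obtain ⟨K₁, hK₁0, hK₁⟩ := exists_integral_one_add_pow_le h hs hM k
  have hlim : ∀ v w : Vel d, Filter.Tendsto (fun j => collWeight γ b (fun v => g (‖v‖ ^ 2) * energyCutoff j (‖v‖ ^ 2)) v w)
      Filter.atTop (nhds (collWeight γ b (fun v => g (‖v‖ ^ 2)) v w)) := by
    intro v w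
    refine tendsto_const_nhds.congr' ?_
    filter_upwards [Filter.eventually_ge_atTop ⌈‖v‖ ^ 2 + ‖w‖ ^ 2⌉₊] with j hj
    exact (collWeight_mul_energyCutoff hγ₀.ne' g (Nat.ceil_le.1 hj)).symm
  have hbd : ∀ j (v w : Vel d), |collWeight γ b (fun v => g (‖v‖ ^ 2) * energyCutoff j (‖v‖ ^ 2)) v w| ≤
      B * ((1 + ‖v‖ ^ 2) ^ (k + 2) * (1 + ‖w‖ ^ 2) ^ (k + 2)) := fun j v w =>
    (hφ j).abs_collWeight_le hb hA hγ₀ hγ₁ he v w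
  have hint : ∀ᵐ τ ∂(volume.restrict (Ioc s t)), ∀ j, Integrable (fun p : Vel d × Vel d =>
      collWeight γ b (fun v => g (‖v‖ ^ 2) * energyCutoff j (‖v‖ ^ 2)) p.1 p.2) ((F τ).prod (F τ)) := by
    rw [ae_all_iff]
    intro j
    exact ae_restrict_of_ae_restrict_of_subset (fun τ (hτ : τ ∈ Ioc s t) => show τ ∈ Ioi 0 from hs.trans_lt hτ.1)
      (h.integrable_weight _ (hφd j) (hφc j))
  have hae : ∀ᵐ τ ∂(volume.restrict (Ioc s t)), Integrable (fun p : Vel d × Vel d =>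
      collWeight γ b (fun v => g (‖v‖ ^ 2)) p.1 p.2) ((F τ).prod (F τ)) ∧
      Filter.Tendsto (fun j => collRate γ b F (fun v => g (‖v‖ ^ 2) * energyCutoff j (‖v‖ ^ 2)) τ) Filter.atTop
        (nhds (collRate γ b F (fun v => g (‖v‖ ^ 2)) τ)) ∧
      ∀ j, ‖collRate γ b F (fun v => g (‖v‖ ^ 2) * energyCutoff j (‖v‖ ^ 2)) τ‖ ≤ B * K ^ 2 := by
    filter_upwards [hint, ae_restrict_mem measurableSet_Ioc] with τ hτ hτm
    have hτI : τ ∈ Icc s t := ⟨hτm.1.le, hτm.2⟩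
    have := h.isFiniteMeasure (hs.trans hτI.1)
    have hdom : Integrable (fun p : Vel d × Vel d => B * ((1 + ‖p.1‖ ^ 2) ^ (k + 2) * (1 + ‖p.2‖ ^ 2) ^ (k + 2)))
        ((F τ).prod (F τ)) := ((hK τ hτI).1.mul_prod (hK τ hτI).1).const_mul B
    -- The limit weight inherits measurability from the cut-off weights, whose integrability belongs
    -- to the definition of a solution.
    have hmeas := aestronglyMeasurable_of_tendsto_ae Filter.atTop (fun j => (hτ j).aestronglyMeasurable)
      (Filter.Eventually.of_forall fun p : Vel d × Vel d => hlim p.1 p.2)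
    refine ⟨hdom.mono' hmeas (Filter.Eventually.of_forall fun p => ?_), ?_, fun j => ?_⟩
    · exact le_of_tendsto (hlim p.1 p.2).norm (Filter.Eventually.of_forall fun j => hbd j p.1 p.2)
    · exact (tendsto_integral_of_dominated_convergence _ (fun j => (hτ j).aestronglyMeasurable) hdom
        (fun j => Filter.Eventually.of_forall fun p => hbd j p.1 p.2)
        (Filter.Eventually.of_forall fun p => hlim p.1 p.2)).const_mul (1 / 2)
    · rw [collRate, norm_mul]
      have h6 := integral_prod_mul (μ := F τ) (ν := F τ) (fun v : Vel d => (1 + ‖v‖ ^ 2) ^ (k + 2))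
        (fun v : Vel d => (1 + ‖v‖ ^ 2) ^ (k + 2))
      have h1 := norm_integral_le_of_norm_le hdom (f := fun p : Vel d × Vel d =>
        collWeight γ b (fun v => g (‖v‖ ^ 2) * energyCutoff j (‖v‖ ^ 2)) p.1 p.2)
        (Filter.Eventually.of_forall fun p => hbd j p.1 p.2)
      rw [integral_const_mul, h6] at h1
      have h2 := (hK τ hτI).2
      have h3 : 0 ≤ ∫ v, (1 + ‖v‖ ^ 2) ^ (k + 2) ∂(F τ) := integral_nonneg fun v => by positivity
      have h4 : B * ((∫ v, (1 + ‖v‖ ^ 2) ^ (k + 2) ∂(F τ)) * ∫ v, (1 + ‖v‖ ^ 2) ^ (k + 2) ∂(F τ)) ≤ B * K ^ 2 := by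
        rw [sq K]
        exact mul_le_mul_of_nonneg_left (mul_le_mul h2 h2 h3 hK0) hB0
      have h5 : ‖(1 / 2 : ℝ)‖ ≤ 1 := by norm_num
      calc _ ≤ 1 * (B * K ^ 2) := mul_le_mul h5 (h1.trans h4) (norm_nonneg _) zero_le_one
        _ = _ := one_mul _
  have hii : ∀ j, IntervalIntegrable (collRate γ b F fun v => g (‖v‖ ^ 2) * energyCutoff j (‖v‖ ^ 2)) volume s t :=
    fun j => h.intervalIntegrable (hφd j) (hφc j) hs ht
  have hmeas : ∀ j, AEStronglyMeasurable (collRate γ b F fun v => g (‖v‖ ^ 2) * energyCutoff j (‖v‖ ^ 2))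
      (volume.restrict (Ioc s t)) := fun j =>
    ((intervalIntegrable_iff_integrableOn_Ioc_of_le hst).1 (hii j)).aestronglyMeasurable
  have hmeas' := aestronglyMeasurable_of_tendsto_ae Filter.atTop hmeas (hae.mono fun τ hτ => hτ.2.1)
  refine ⟨hae.mono fun τ hτ => hτ.1, ?_, ?_⟩
  · rw [intervalIntegrable_iff_integrableOn_Ioc_of_le hst]
    refine Integrable.of_bound hmeas' (B * K ^ 2) ?_
    filter_upwards [hae] with τ hτ
    exact le_of_tendsto hτ.2.1.norm (Filter.Eventually.of_forall hτ.2.2)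
  · have h1 : Filter.Tendsto (fun j => ∫ τ in s..t, collRate γ b F (fun v => g (‖v‖ ^ 2) * energyCutoff j (‖v‖ ^ 2)) τ)
        Filter.atTop (nhds (∫ τ in s..t, collRate γ b F (fun v => g (‖v‖ ^ 2)) τ)) := by
      simp only [intervalIntegral.integral_of_le hst]
      exact tendsto_integral_of_dominated_convergence (fun _ => B * K ^ 2) hmeas (integrable_const _)
        (fun j => hae.mono fun τ hτ => hτ.2.2 j) (hae.mono fun τ hτ => hτ.2.1)
    have h2 : ∀ τ ∈ Icc s t, Filter.Tendsto (fun j => ∫ v, g (‖v‖ ^ 2) * energyCutoff j (‖v‖ ^ 2) ∂(F τ)) Filter.atTop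
        (nhds (∫ v, g (‖v‖ ^ 2) ∂(F τ))) := by
      intro τ hτ
      refine tendsto_integral_of_dominated_convergence (fun v => 4 * L * L₀ * (1 + ‖v‖ ^ 2) ^ k)
        (fun j => (hφd j).continuous.aestronglyMeasurable) ((hK₁ τ hτ).1.const_mul _)
        (fun j => Filter.Eventually.of_forall fun v => (hφ j).abs_le _ (sq_nonneg _))
        (Filter.Eventually.of_forall fun v => ?_)
      refine tendsto_const_nhds.congr' ?_
      filter_upwards [Filter.eventually_ge_atTop ⌈‖v‖ ^ 2⌉₊] with j hj
      rw [energyCutoff_eq_one (Nat.ceil_le.1 hj), mul_one]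
    refine tendsto_nhds_unique ((h2 t ⟨hst, le_rfl⟩).sub (h2 s ⟨le_rfl, hst⟩)) (h1.congr fun j => ?_)
    exact (h.integral_sub (hφd j) (hφc j) hs ht).symm

end polyBound

/-! ### Collision estimate for truncated exponentials -/

section truncExpTest
variable {L : ℝ} {k n : ℕ} {g g' g'' : ℝ → ℝ} {d : ℕ} {γ : ℝ} {b : ℝ → ℝ} {e : Vel d} {p q K κ : ℝ}

theorem PolyBound.exists_abs_energyDiff_le (h : PolyBound L k g g' g'') {X Y : ℝ} (hX : 0 ≤ X) (hY : 0 ≤ Y) :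
    ∃ C : ℝ, ∀ a r : ℝ, 0 ≤ a → a ≤ 1 → r ^ 2 ≤ 4 * a * (1 - a) * (X * Y) →
      |energyDiff g X Y a r| ≤ 4 * a * (1 - a) * C := by
  have hL := h.nonneg
  have hle : ∀ ξ ∈ Icc 0 (X + Y), L * (1 + ξ) ^ k ≤ L * (1 + (X + Y)) ^ k := by
    intro ξ hξ
    have h0 := hξ.1
    have h1 := hξ.2
    gcongr
  exact ⟨_, fun a r ha ha1 hr =>
    abs_energyDiff_le hX hY ha ha1 hr (fun ξ hξ => h.hasDerivAt ξ hξ.1) (fun ξ hξ => h.hasDerivAt_deriv ξ hξ.1)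
      (fun ξ hξ => (h.abs_deriv_le ξ hξ.1).trans (hle ξ hξ)) (fun ξ hξ => (h.abs_deriv2_le ξ hξ.1).trans (hle ξ hξ))⟩

/-- As K + κr ≥ 1, negative powers are at most 1 and A^p ≤ A, which leaves powers of 1 + r. The
constant depends on n, but it only serves continuity and the validity of the weak form, not the
final bounds. -/
theorem polyBound_truncExp (hp : 0 < p) (hp1 : p ≤ 1) (hn : 2 ≤ n) (hK : 1 ≤ K) (hκ : 0 ≤ κ) (hκ1 : κ ≤ 1) :
    PolyBound ((2 * K) ^ n) n (fun r => truncExp p n (K + κ * r)) (fun r => κ * truncExpDeriv p n (K + κ * r))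
      (fun r => κ ^ 2 * truncExpDeriv2 p n (K + κ * r)) := by
  have hn0 : (0 : ℝ) < n := by positivity
  have hA1 : ∀ r : ℝ, 0 ≤ r → 1 ≤ K + κ * r := fun r hr => by nlinarith [mul_nonneg hκ hr]
  have hin : ∀ r : ℝ, HasDerivAt (fun r => K + κ * r) κ r := fun r => by
    simpa using ((hasDerivAt_id r).const_mul κ).const_add K
  have hbase : ∀ r : ℝ, 0 ≤ r → 1 ≤ 1 + (K + κ * r) ^ p / n ∧ 1 + (K + κ * r) ^ p / n ≤ 2 * K * (1 + r) ∧
      1 + (K + κ * r) ^ p ≤ 2 * K * (1 + r) := by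
    intro r hr
    have h1 := hA1 r hr
    have h2 : (K + κ * r) ^ p ≤ K + κ * r := by
      calc (K + κ * r) ^ p ≤ (K + κ * r) ^ (1 : ℝ) := Real.rpow_le_rpow_of_exponent_le h1 hp1
        _ = _ := Real.rpow_one _
    have h3 : 0 ≤ (K + κ * r) ^ p := by positivity
    have h4 : (K + κ * r) ^ p / n ≤ (K + κ * r) ^ p := div_le_self h3 (by exact_mod_cast (by omega : 1 ≤ n))
    have h5 : 0 ≤ (K + κ * r) ^ p / n := by positivity
    have h6 : κ * r ≤ r := by nlinarith
    refine ⟨by linarith, ?_, ?_⟩ <;> nlinarith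
  refine ⟨?_, fun r hr => ?_, fun r hr => ?_, fun r hr => ?_, fun r hr => ?_, fun r hr => ?_, fun r hr => ?_⟩
  · unfold truncExp expPow
    fun_prop
  · have h1 := hA1 r hr
    unfold truncExp expPow
    have h2 : ContDiffAt ℝ (⊤ : ℕ∞) (fun r => K + κ * r) r :=
      contDiffAt_const.add (contDiffAt_const.mul contDiffAt_id)
    exact (contDiffAt_const.add ((h2.rpow_const_of_ne (by linarith : 0 < K + κ * r).ne').div_const _)).pow _
  · have h1 := hasDerivAt_truncExp (p := p) (n := n) (by omega) (by linarith [hA1 r hr] : 0 < K + κ * r)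
    refine (h1.comp r (hin r)).congr_deriv (mul_comm _ _)
  · have h1 := hasDerivAt_truncExpDeriv (p := p) hn (by linarith [hA1 r hr] : 0 < K + κ * r)
    refine ((h1.comp r (hin r)).const_mul κ).congr_deriv ?_
    ring
  · have h1 := hA1 r hr
    obtain ⟨h2, h3, -⟩ := hbase r hr
    rw [abs_of_nonneg (truncExp_pos (by linarith)).le, truncExp, expPow, ← mul_pow]
    gcongr
  · have h1 := hA1 r hr
    obtain ⟨h2, h3, -⟩ := hbase r hr
    have h4 := truncExpDeriv_nonneg (p := p) (n := n) hp.le (by linarith : 0 ≤ K + κ * r)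
    rw [abs_of_nonneg (mul_nonneg hκ h4), ← mul_pow]
    refine (mul_le_of_le_one_left h4 hκ1).trans ?_
    rw [truncExpDeriv]
    have h5 : (K + κ * r) ^ (p - 1) ≤ 1 := Real.rpow_le_one_of_one_le_of_nonpos h1 (by linarith)
    have h6 : 0 ≤ (K + κ * r) ^ (p - 1) := by positivity
    calc p * (K + κ * r) ^ (p - 1) * (1 + (K + κ * r) ^ p / n) ^ (n - 1)
        ≤ 1 * 1 * (1 + (K + κ * r) ^ p / n) ^ n :=
          mul_le_mul (mul_le_mul hp1 h5 h6 zero_le_one) (pow_le_pow_right₀ h2 (Nat.sub_le n 1))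
            (pow_nonneg (by linarith) _) (by norm_num)
      _ ≤ _ := by rw [one_mul, one_mul]; gcongr
  · have h1 := hA1 r hr
    obtain ⟨h2, h3, h7⟩ := hbase r hr
    rw [abs_mul, abs_of_nonneg (sq_nonneg κ), ← mul_pow]
    refine (mul_le_of_le_one_left (abs_nonneg _) (pow_le_one₀ hκ hκ1)).trans ?_
    have h5 : (K + κ * r) ^ (p - 2) ≤ 1 := Real.rpow_le_one_of_one_le_of_nonpos h1 (by linarith)
    have h6 : 0 ≤ (K + κ * r) ^ (p - 2) := by positivity
    have h8 : 0 ≤ (K + κ * r) ^ p := by positivity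
    have h9 : |(p - 1) + (K + κ * r) ^ p * (p - 1 / n)| ≤ 2 * K * (1 + r) := by
      refine le_trans ?_ h7
      have h10 : 1 / (n : ℝ) ≤ 1 := by rw [div_le_one hn0]; exact_mod_cast (by omega : 1 ≤ n)
      have h11 : 0 ≤ 1 / (n : ℝ) := by positivity
      have h12 : |p - 1 / n| ≤ 1 := by rw [abs_le]; constructor <;> linarith
      have h13 : |p - 1| ≤ 1 := by rw [abs_le]; constructor <;> linarith
      refine (abs_add_le _ _).trans (add_le_add h13 ?_)
      rw [abs_mul, abs_of_nonneg h8]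
      exact mul_le_of_le_one_right h8 h12
    rw [truncExpDeriv2, abs_mul, abs_of_nonneg (by positivity)]
    calc p * (K + κ * r) ^ (p - 2) * (1 + (K + κ * r) ^ p / n) ^ (n - 2) * |p - 1 + (K + κ * r) ^ p * (p - 1 / n)|
        ≤ 1 * 1 * (2 * K * (1 + r)) ^ (n - 2) * (2 * K * (1 + r)) := by gcongr
      _ = (2 * K * (1 + r)) ^ (n - 1) := by
          rw [one_mul, one_mul, ← pow_succ]; congr 1; omega
      _ ≤ _ := pow_le_pow_right₀ (h2.trans h3) (by omega)

theorem energyDiff_comp_affine (g : ℝ → ℝ) (K κ X Y a r : ℝ) :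
    energyDiff (fun r => g (K + κ * r)) X Y a r = energyDiff g (K + κ * X) (K + κ * Y) a (κ * r) := by
  unfold energyDiff
  have h1 : ∀ a, a * (K + κ * X) + (1 - a) * (K + κ * Y) = K + κ * (a * X + (1 - a) * Y) := fun a => by ring
  have h2 : (1 - a) * (K + κ * X) + a * (K + κ * Y) = K + κ * ((1 - a) * X + a * Y) := by ring
  have h3 : ∀ x, K + κ * (x + r) = K + κ * x + κ * r := fun x => by ring
  have h4 : ∀ x, K + κ * (x - r) = K + κ * x - κ * r := fun x => by ring
  rw [h1, h2]
  simp only [h3, h4]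

theorem ae_minSq_pos (hd : 2 ≤ d) (hb : IsAngularKernel d b) (he : ‖e‖ = 1) :
    ∀ᵐ t ∂(angMeasure b e), 0 < minSq t := by
  filter_upwards [ae_abs_lt_one hd hb.measurable he] with t ht
  unfold minSq
  linarith

theorem integrable_minSq_rpow (hd : 2 ≤ d) (hb : IsAngularKernel d b) (hq : 0 ≤ q) (hA : NonCutoff d b (2 * q))
    (he : ‖e‖ = 1) : Integrable (fun t => minSq t ^ q) (angMeasure b e) := by
  have h1 := hA.integrable hb he
  rw [mul_div_cancel_left₀ q two_ne_zero] at h1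
  refine h1.mono' (continuous_minSq.measurable.pow_const q).aestronglyMeasurable ?_
  filter_upwards [ae_abs_lt_one hd hb.measurable he] with t ht
  rw [Real.norm_eq_abs, abs_of_nonneg (Real.rpow_nonneg (minSq_nonneg ht.le) _)]
  exact Real.rpow_le_rpow (minSq_nonneg ht.le) (minSq_le ht.le) hq

/-- The sets {minSq ≤ 1/(k + 1)} decrease to a null set and `minSq ^ q` is integrable. -/
theorem exists_setIntegral_minSq_rpow_le (hd : 2 ≤ d) (hb : IsAngularKernel d b) (hq : 0 ≤ q)
    (hA : NonCutoff d b (2 * q)) (he : ‖e‖ = 1) {ε s₀ : ℝ} (hε : 0 < ε) (hs₀ : 0 < s₀) :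
    ∃ s, 0 < s ∧ s ≤ s₀ ∧ ∫ t in {t | minSq t ≤ s}, minSq t ^ q ∂(angMeasure b e) ≤ ε := by
  have hi := integrable_minSq_rpow hd hb hq hA he
  have hm : ∀ s : ℝ, MeasurableSet {t | minSq t ≤ s} := fun s =>
    measurableSet_le continuous_minSq.measurable measurable_const
  have hanti : Antitone fun k : ℕ => {t : ℝ | minSq t ≤ 1 / ((k : ℝ) + 1)} := by
    intro i j hij t (ht : minSq t ≤ _)
    exact ht.trans (one_div_le_one_div_of_le (by positivity) (by gcongr))
  have h1 := tendsto_setIntegral_of_antitone (μ := angMeasure b e) (fun k : ℕ => hm (1 / ((k : ℝ) + 1))) hanti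
    ⟨0, hi.integrableOn⟩
  have h2 : ∫ t in ⋂ k : ℕ, {t : ℝ | minSq t ≤ 1 / ((k : ℝ) + 1)}, minSq t ^ q ∂(angMeasure b e) = 0 := by
    refine setIntegral_measure_zero _ ?_
    refine measure_mono_null (t := {t | ¬ 0 < minSq t}) (fun t ht => ?_) (ae_iff.1 (ae_minSq_pos hd hb he))
    rw [mem_iInter] at ht
    refine not_lt.2 (ge_of_tendsto tendsto_one_div_add_atTop_nhds_zero_nat (Filter.Eventually.of_forall ht))
  rw [h2] at h1
  have h3 := (h1.eventually (gt_mem_nhds hε)).and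
    (tendsto_one_div_add_atTop_nhds_zero_nat.eventually (gt_mem_nhds hs₀))
  obtain ⟨k, hk1, hk2⟩ := h3.exists
  exact ⟨1 / ((k : ℝ) + 1), by positivity, hk2.le, hk1.le⟩

/-- Countable additivity, as `minSq` is positive almost everywhere and the measure is nonzero. The
loss constant comes from this s, before η is chosen. -/
theorem exists_measure_minSq_pos (hd : 2 ≤ d) (hb : IsAngularKernel d b) (he : ‖e‖ = 1) :
    ∃ s, 0 < s ∧ angMeasure b e {t | s < minSq t} ≠ 0 := by
  by_contra! h
  refine angMeasure_ne_zero hb he ?_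
  have h1 : angMeasure b e (⋃ k : ℕ, {t | 1 / ((k : ℝ) + 1) < minSq t}) = 0 :=
    measure_iUnion_null fun k => h _ (by positivity)
  rw [← ae_eq_bot]
  refine Filter.eventually_false_iff_eq_bot.1 ?_
  filter_upwards [ae_minSq_pos hd hb he, measure_eq_zero_iff_ae_notMem.1 h1] with t ht ht2
  obtain ⟨k, hk⟩ := exists_nat_one_div_lt ht
  exact ht2 (mem_iUnion.2 ⟨k, hk⟩)

set_option maxHeartbeats 400000 in
/-- Collision estimate for truncated exponentials of the energy. -/
theorem exists_collWeight_truncExp_le (hd : 2 ≤ d) (hγ₀ : 0 < γ) (hb : IsAngularKernel d b)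
    (hA : NonCutoff d b 2) (hAq : NonCutoff d b (2 * q)) (he : ‖e‖ = 1) (hp : 0 < p) (hp1 : p < 1) (hq : 0 < q)
    (hq1 : q ≤ 1) (hqp : (1 + q) * p ≤ 1) (hK : 1 ≤ K) (hKp : 2 / p ≤ K ^ p) :
    ∃ c : ℝ, 0 < c ∧ ∀ η : ℝ, 0 < η → ∃ (C : ℝ) (n₀ : ℕ), 0 < C ∧ 2 ≤ n₀ ∧ ∀ (n : ℕ) (κ : ℝ) (v w : Vel d), n₀ ≤ n →
      0 ≤ κ → κ ≤ 1 → ‖w‖ ≤ ‖v‖ →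
      collWeight γ b (fun x => truncExp p n (K + κ * ‖x‖ ^ 2)) v w ≤ ‖v - w‖ ^ γ *
        (-c * truncExp p n (K + κ * ‖v‖ ^ 2) +
          η * (truncExp p n (K + κ * ‖v‖ ^ 2) * truncExp p n (K + κ * ‖w‖ ^ 2)) +
          C * truncExp p n (K + κ * ‖w‖ ^ 2)) := by
  obtain ⟨C₁, s₀, hC₁, hs₀, hs₀1, H₁⟩ := exists_truncExp_grazing_le hp hp1 hq hq1 hqp hK hKp (m := ⌈2 / p⌉₊) (Nat.le_ceil _)
  obtain ⟨s₂, hs₂, hs₂pos⟩ := exists_measure_minSq_pos (b := b) (e := e) hd hb he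
  set ρ := angMeasure b e with hρ
  have hfin : ∀ s : ℝ, 0 < s → ρ {t | s < minSq t} < ∞ := by
    intro s hs
    have h1 := (integrable_minSq hd hb hA he).measure_norm_ge_lt_top hs
    refine (measure_mono fun t ht => ?_).trans_lt h1
    exact (le_of_lt (show s < minSq t from ht)).trans (le_abs_self _)
  have hm : ∀ s : ℝ, MeasurableSet {t | minSq t ≤ s} := fun s =>
    measurableSet_le continuous_minSq.measurable measurable_const
  -- c counts the angles beyond s₂. The grazing threshold s ≤ s₂ chosen next only enlarges the
  -- non-grazing set, so c does not depend on η.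
  refine ⟨ρ.real {t | s₂ < minSq t}, ENNReal.toReal_pos hs₂pos (hfin s₂ hs₂).ne, fun η hη => ?_⟩
  obtain ⟨s, hs, hss, hint⟩ := exists_setIntegral_minSq_rpow_le hd hb hq.le hAq he
    (ε := η / (2 * C₁)) (s₀ := min s₀ s₂) (by positivity) (lt_min hs₀ hs₂)
  set S : Set ℝ := {t | minSq t ≤ s} with hS
  have hSc : Sᶜ = {t | s < minSq t} := by ext t; exact not_le (a := minSq t) (b := s)
  set c₁ := ρ.real Sᶜ with hc₁
  have hc₁0 : 0 ≤ c₁ := measureReal_nonneg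
  have hcc : ρ.real {t | s₂ < minSq t} ≤ c₁ := by
    refine measureReal_mono (fun t ht => ?_) (by rw [hSc]; exact (hfin s hs).ne)
    rw [hSc]
    exact (hss.trans (min_le_right _ _)).trans_lt ht
  obtain ⟨θ, hθ, H₂⟩ := exists_truncExp_nongrazing_le hp hp1 hs
    (hss.trans ((min_le_left _ _).trans (hs₀1.trans (by norm_num))))
  -- δ keeps the non-grazing contribution 2δc₁ below η/2, and T is a rate beyond which the
  -- exponential factor is at most δ. At rates below T the weight of A is bounded by exp(2T),
  -- because n ≥ 2T.
  set δ : ℝ := η / (4 * (c₁ + 1)) with hδ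
  have hδ0 : 0 < δ := by positivity
  set T : ℝ := |Real.log δ| / θ with hT
  have hTδ : Real.exp (-θ * T) ≤ δ := by
    rw [hT, neg_mul, mul_div_cancel₀ _ hθ.ne']
    calc Real.exp (-|Real.log δ|) ≤ Real.exp (Real.log δ) := Real.exp_le_exp.2 (neg_abs_le _)
      _ = δ := Real.exp_log hδ0
  refine ⟨2 * Real.exp (2 * T) * c₁ + 1, ⌈2 / p⌉₊ + ⌈2 * T⌉₊ + 2, by positivity, by omega, fun n κ v w hn hκ hκ1 hwv => ?_⟩
  have hn2 : 2 ≤ n := by omega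
  have hnT : 2 * T ≤ n := (Nat.le_ceil _).trans (by exact_mod_cast (by omega : ⌈2 * T⌉₊ ≤ n))
  have hPB := polyBound_truncExp hp hp1.le hn2 hK hκ hκ1
  have hX : 0 ≤ ‖v‖ ^ 2 := sq_nonneg _
  have hY : 0 ≤ ‖w‖ ^ 2 := sq_nonneg _
  have hYX : ‖w‖ ^ 2 ≤ ‖v‖ ^ 2 := by gcongr
  obtain ⟨C₃, hC₃⟩ := hPB.exists_abs_energyDiff_le hX hY
  have hKA : K ≤ K + κ * ‖v‖ ^ 2 := le_add_of_nonneg_right (by positivity)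
  have hKB : K ≤ K + κ * ‖w‖ ^ 2 := le_add_of_nonneg_right (by positivity)
  have hBA : K + κ * ‖w‖ ^ 2 ≤ K + κ * ‖v‖ ^ 2 := by gcongr
  have hr : ∀ a r : ℝ, r ^ 2 ≤ 4 * a * (1 - a) * (‖v‖ ^ 2 * ‖w‖ ^ 2) →
      (κ * r) ^ 2 ≤ 4 * a * (1 - a) * ((K + κ * ‖v‖ ^ 2 - K) * (K + κ * ‖w‖ ^ 2 - K)) := by
    intro a r h
    calc (κ * r) ^ 2 = κ ^ 2 * r ^ 2 := by ring
      _ ≤ κ ^ 2 * (4 * a * (1 - a) * (‖v‖ ^ 2 * ‖w‖ ^ 2)) := by gcongr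
      _ = _ := by ring
  set A := K + κ * ‖v‖ ^ 2
  set B := K + κ * ‖w‖ ^ 2
  have hgA : 1 ≤ truncExp p n A := one_le_truncExp (by linarith)
  have hgB : 1 ≤ truncExp p n B := one_le_truncExp (by linarith)
  set gA := truncExp p n A
  set gB := truncExp p n B
  have hiS : Integrable (S.indicator fun t => C₁ * minSq t ^ q * (gA * gB)) ρ :=
    (((integrable_minSq_rpow hd hb hq.le hAq he).const_mul C₁).mul_const _).indicator (hm s)
  have hiSc : Integrable (Sᶜ.indicator fun _ => 2 * (δ * gA + Real.exp (2 * T)) * gB - gA) ρ := by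
    rw [integrable_indicator_iff (hm s).compl]
    exact integrableOn_const (by rw [hSc]; exact (hfin s hs).ne)
  have hnon : ∀ a r : ℝ, s ≤ a → a ≤ 1 - s → r ^ 2 ≤ 4 * a * (1 - a) * ((A - K) * (B - K)) →
      truncExp p n (a * A + (1 - a) * B + r) ≤ (δ * gA + Real.exp (2 * T)) * gB := by
    intro a r ha ha1 hr
    have ha' : 0 ≤ 1 - a := by linarith
    have ha0 : 0 ≤ a := by linarith
    have hr' : r ^ 2 ≤ 4 * a * (1 - a) * (A * B) := by
      refine hr.trans (mul_le_mul_of_nonneg_left ?_ (by positivity))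
      exact mul_le_mul (by linarith) (by linarith) (by linarith) (by linarith)
    have hB0 : 0 < B := by linarith
    have hA0 : 0 < A := by linarith
    have hpos : 0 ≤ a * A + (1 - a) * B + r := by
      have h2 : |r| ≤ |a * A + (1 - a) * B| := by
        rw [← sq_le_sq]
        nlinarith [sq_nonneg (a * A - (1 - a) * B)]
      rw [abs_of_nonneg (by positivity : 0 ≤ a * A + (1 - a) * B)] at h2
      linarith [neg_abs_le r]
    refine (H₂ n A B a r (by omega) hB0 hBA ha ha1 hr' hpos).trans ?_
    rw [← mul_assoc]
    refine mul_le_mul_of_nonneg_right ?_ (by linarith)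
    have hAp : 0 ≤ A ^ p := by positivity
    rcases le_total (expRate n (A ^ p)) T with h | h
    · have h2 := le_of_expRate_le hAp h hnT (by omega : n ≠ 0)
      have h3 : gA ≤ Real.exp (2 * T) := (truncExp_le_exp hA0.le).trans (Real.exp_le_exp.2 h2)
      have h4 : Real.exp (-θ * expRate n (A ^ p)) ≤ 1 := by
        rw [Real.exp_le_one_iff]
        have := mul_nonneg hθ.le (expRate_nonneg (n := n) hAp)
        linarith
      have h5 : Real.exp (-θ * expRate n (A ^ p)) * gA ≤ 1 * gA := by gcongr
      have : 0 ≤ δ * gA := by positivity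
      linarith
    · have h4 : Real.exp (-θ * expRate n (A ^ p)) ≤ δ := by
        refine (Real.exp_le_exp.2 ?_).trans hTδ
        have := mul_le_mul_of_nonneg_left h hθ.le
        linarith
      have h5 : Real.exp (-θ * expRate n (A ^ p)) * gA ≤ δ * gA := by gcongr
      linarith [Real.exp_pos (2 * T)]
  have hle := collWeight_le (γ := γ) (v := v) (w := w) hb hA hγ₀.ne' he hPB.measurable hC₃
    (F := fun t => S.indicator (fun t => C₁ * minSq t ^ q * (gA * gB)) t +
      Sᶜ.indicator (fun _ => 2 * (δ * gA + Real.exp (2 * T)) * gB - gA) t)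
    ((((continuous_minSq.measurable.pow_const q).const_mul C₁).mul_const _ |>.indicator (hm s)).add
      (measurable_const.indicator (hm s).compl)) (hiS.add hiSc) (fun t r ht hrt => by
      rw [energyDiff_comp_affine]
      have hs1 := minSq_nonneg ht
      have hs2 := minSq_le_half t
      by_cases htS : t ∈ S
      · rw [indicator_of_mem htS, indicator_of_notMem (notMem_compl_iff.2 htS), add_zero]
        exact H₁ n A B (minSq t) (κ * r) (by omega) hKB hBA hs1
          (le_trans htS (hss.trans (min_le_left _ _))) (hr _ _ hrt)
      · rw [indicator_of_notMem htS, indicator_of_mem (mem_compl htS), zero_add]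
        have hst : s < minSq t := not_le.1 htS
        have hr1 := hr _ _ hrt
        have e1 : 4 * (1 - minSq t) * (1 - (1 - minSq t)) * ((A - K) * (B - K)) =
          4 * minSq t * (1 - minSq t) * ((A - K) * (B - K)) := by ring
        have hr2 : (κ * r) ^ 2 ≤ 4 * (1 - minSq t) * (1 - (1 - minSq t)) * ((A - K) * (B - K)) := by rw [e1]; exact hr1
        -- Four outgoing terms with coefficient 1/2 give 2(δg(A) + exp(2T))g(B); of the losses only
        -- −g(A) is kept.
        have n1 := hnon (1 - minSq t) (κ * r) (by linarith) (by linarith) hr2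
        have n2 := hnon (1 - minSq t) (-(κ * r)) (by linarith) (by linarith) (by rw [neg_sq]; exact hr2)
        have n3 := hnon (minSq t) (κ * r) hst.le (by linarith) hr1
        have n4 := hnon (minSq t) (-(κ * r)) hst.le (by linarith) (by rw [neg_sq]; exact hr1)
        unfold energyDiff
        rw [sub_sub_cancel 1 (minSq t)] at n1 n2 ⊢
        simp only [sub_eq_add_neg] at n1 n2 n3 n4 ⊢
        linarith)
  refine hle.trans (mul_le_mul_of_nonneg_left ?_ (Real.rpow_nonneg (norm_nonneg _) _))
  rw [integral_add hiS hiSc, integral_indicator (hm s), integral_indicator (hm s).compl, integral_mul_const,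
    integral_const_mul, setIntegral_const, smul_eq_mul, ← hc₁]
  have hI : C₁ * (∫ t in S, minSq t ^ q ∂ρ) ≤ η / 2 := by
    calc C₁ * (∫ t in S, minSq t ^ q ∂ρ) ≤ C₁ * (η / (2 * C₁)) := by gcongr
      _ = η / 2 := by field_simp
  have hc₁δ : 2 * δ * c₁ ≤ η / 2 := by
    have : 4 * (c₁ + 1) * δ = η := by rw [hδ]; field_simp
    nlinarith
  have hAB : 0 ≤ gA * gB := by positivity
  have e1 := mul_le_mul_of_nonneg_right hI hAB
  have e2 := mul_le_mul_of_nonneg_right hc₁δ hAB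
  have e3 := mul_le_mul_of_nonneg_right hcc (by linarith : 0 ≤ gA)
  linarith

/-! ### Velocity weights and the estimate integrated over both velocities. -/

/-- The weight `(1 + |v|^2)^{γ/2}`. -/
noncomputable def velWeight (γ : ℝ) (v : Vel d) : ℝ := (1 + ‖v‖ ^ 2) ^ (γ / 2)

theorem one_le_velWeight (hγ₀ : 0 < γ) (v : Vel d) : 1 ≤ velWeight γ v :=
  Real.one_le_rpow (by nlinarith [sq_nonneg ‖v‖]) (by positivity)

theorem velWeight_le (hγ₁ : γ ≤ 1) (v : Vel d) : velWeight γ v ≤ 1 + ‖v‖ ^ 2 := by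
  calc velWeight γ v ≤ (1 + ‖v‖ ^ 2) ^ (1 : ℝ) :=
        Real.rpow_le_rpow_of_exponent_le (by nlinarith [sq_nonneg ‖v‖]) (by linarith)
    _ = _ := Real.rpow_one _

theorem measurable_velWeight : Measurable (velWeight (d := d) γ) := by
  unfold velWeight
  fun_prop

theorem norm_rpow_eq (v : Vel d) : ‖v‖ ^ γ = (‖v‖ ^ 2) ^ (γ / 2) := by
  rw [← Real.rpow_natCast, ← Real.rpow_mul (norm_nonneg _)]; congr 1; push_cast; ring

theorem norm_rpow_le_velWeight (hγ₀ : 0 < γ) (v : Vel d) : ‖v‖ ^ γ ≤ velWeight γ v := by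
  rw [norm_rpow_eq]
  exact Real.rpow_le_rpow (sq_nonneg _) (by linarith) (by positivity)

theorem norm_sub_rpow_le (hγ₀ : 0 < γ) (hγ₁ : γ ≤ 1) {v w : Vel d} (h : ‖w‖ ≤ ‖v‖) :
    ‖v - w‖ ^ γ ≤ 2 * velWeight γ v := by
  calc ‖v - w‖ ^ γ ≤ (2 * ‖v‖) ^ γ :=
        Real.rpow_le_rpow (norm_nonneg _) ((norm_sub_le v w).trans (by linarith)) hγ₀.le
    _ = 2 ^ γ * ‖v‖ ^ γ := Real.mul_rpow (by norm_num) (norm_nonneg _)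
    _ ≤ 2 ^ (1 : ℝ) * velWeight γ v := by
        gcongr
        · norm_num
        · exact norm_rpow_le_velWeight hγ₀ v
    _ = _ := by rw [Real.rpow_one]

/-- Subadditivity of r^{γ/2} and, as γ ≤ 1, of r^γ. It bounds the relative speed in the loss from
below by ⟨v⟩^γ, up to ⟨w⟩^γ, whose integral is at most m + E. -/
theorem velWeight_sub_le (hγ₀ : 0 < γ) (hγ₁ : γ ≤ 1) (v w : Vel d) :
    velWeight γ v - 2 * velWeight γ w ≤ ‖v - w‖ ^ γ := by
  have h1 : velWeight γ v ≤ 1 + ‖v‖ ^ γ := by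
    rw [norm_rpow_eq]
    have := Real.rpow_add_le_add_rpow zero_le_one (sq_nonneg ‖v‖) (by positivity : 0 ≤ γ / 2) (by linarith)
    rwa [Real.one_rpow] at this
  have h2 : ‖v‖ ^ γ ≤ ‖v - w‖ ^ γ + ‖w‖ ^ γ := by
    refine le_trans ?_ (Real.rpow_add_le_add_rpow (norm_nonneg _) (norm_nonneg _) hγ₀.le hγ₁)
    refine Real.rpow_le_rpow (norm_nonneg _) ?_ hγ₀.le
    simpa using norm_add_le (v - w) w
  have h3 := norm_rpow_le_velWeight hγ₀ w
  have h4 := one_le_velWeight hγ₀ w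
  linarith

/-- Collision estimate for truncated exponentials, integrated over both velocities. -/
theorem exists_integral_collWeight_truncExp_le (hd : 2 ≤ d) (hγ₀ : 0 < γ) (hγ₁ : γ ≤ 1) (hb : IsAngularKernel d b)
    (hA : NonCutoff d b 2) (hAq : NonCutoff d b (2 * q)) (hp : 0 < p) (hp1 : p < 1) (hq : 0 < q)
    (hq1 : q ≤ 1) (hqp : (1 + q) * p ≤ 1) (hK : 1 ≤ K) (hKp : 2 / p ≤ K ^ p) {m E : ℝ} (hm : 0 < m) (hE : 0 ≤ E) :
    ∃ c : ℝ, 0 < c ∧ ∀ η : ℝ, 0 < η → ∃ (C : ℝ) (n₀ : ℕ), 0 < C ∧ 2 ≤ n₀ ∧ ∀ (n : ℕ) (κ : ℝ) (μ : Measure (Vel d))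
      [IsFiniteMeasure μ], n₀ ≤ n → 0 ≤ κ → κ ≤ 1 →
      μ.real univ = m → Integrable (fun v => ‖v‖ ^ 2) μ → ∫ v, ‖v‖ ^ 2 ∂μ = E →
      Integrable (fun v => velWeight γ v * truncExp p n (K + κ * ‖v‖ ^ 2)) μ →
      Integrable (fun z : Vel d × Vel d => collWeight γ b (fun v => truncExp p n (K + κ * ‖v‖ ^ 2)) z.1 z.2) (μ.prod μ) →
      (1 / 2) * ∫ z, collWeight γ b (fun v => truncExp p n (K + κ * ‖v‖ ^ 2)) z.1 z.2 ∂(μ.prod μ) ≤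
        -c * (∫ v, velWeight γ v * truncExp p n (K + κ * ‖v‖ ^ 2) ∂μ) +
        C * (∫ v, truncExp p n (K + κ * ‖v‖ ^ 2) ∂μ) +
        η * ((∫ v, velWeight γ v * truncExp p n (K + κ * ‖v‖ ^ 2) ∂μ) * ∫ v, truncExp p n (K + κ * ‖v‖ ^ 2) ∂μ) := by
  obtain ⟨e, he⟩ : ∃ e : Vel d, ‖e‖ = 1 := ⟨EuclideanSpace.single ⟨0, by omega⟩ 1, by simp⟩
  obtain ⟨c, hc, H⟩ := exists_collWeight_truncExp_le hd hγ₀ hb hA hAq he hp hp1 hq hq1 hqp hK hKp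
  refine ⟨c / 2 * m, by positivity, fun η hη => ?_⟩
  obtain ⟨C, n₀, hC, hn₀, H⟩ := H (η / 2) (by positivity)
  refine ⟨(2 * c + 2 * C) * (m + E), n₀, by positivity, hn₀, fun n κ μ _ hn hκ hκ1 hμm hμi hμE hΛi hG => ?_⟩
  set ψ : Vel d → ℝ := fun v => truncExp p n (K + κ * ‖v‖ ^ 2) with hψ
  have hKv : ∀ v : Vel d, 1 ≤ K + κ * ‖v‖ ^ 2 := fun v => by
    have : 0 ≤ κ * ‖v‖ ^ 2 := by positivity
    linarith
  have hψ1 : ∀ v, 1 ≤ ψ v := fun v => one_le_truncExp (by linarith [hKv v])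
  have hψmono : ∀ v w : Vel d, ‖w‖ ≤ ‖v‖ → ψ w ≤ ψ v := fun v w h =>
    truncExp_mono hp.le (by linarith [hKv w]) (by gcongr)
  have hWmono : ∀ v w : Vel d, ‖w‖ ≤ ‖v‖ → velWeight γ w ≤ velWeight γ v := fun v w h => by
    unfold velWeight
    gcongr
  have hW1 := one_le_velWeight (d := d) hγ₀
  have hWi : Integrable (velWeight γ) μ := by
    refine ((integrable_const (1 : ℝ)).add hμi).mono' measurable_velWeight.aestronglyMeasurable
      (Filter.Eventually.of_forall fun v => ?_)
    rw [Real.norm_eq_abs, abs_of_nonneg (by linarith [hW1 v])]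
    exact velWeight_le hγ₁ v
  have hψm : Measurable ψ := by
    have := (polyBound_truncExp hp hp1.le (hn₀.trans hn) hK hκ hκ1).measurable
    exact this.comp (by fun_prop : Measurable fun v : Vel d => ‖v‖ ^ 2)
  have hψi : Integrable ψ μ := by
    refine hΛi.mono' hψm.aestronglyMeasurable (Filter.Eventually.of_forall fun v => ?_)
    rw [Real.norm_eq_abs, abs_of_nonneg (by linarith [hψ1 v])]
    exact le_mul_of_one_le_left (by linarith [hψ1 v]) (hW1 v)
  have hWM : ∫ v, velWeight γ v ∂μ ≤ m + E := by
    rw [← hμE, ← hμm, ← mul_one (μ.real univ), ← smul_eq_mul, ← integral_const, ← integral_add (integrable_const _) hμi]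
    exact integral_mono hWi ((integrable_const _).add hμi) fun v => velWeight_le hγ₁ v
  -- S is a sum of products, so its double integral factorises. The loss of the faster particle is
  -- shared: half is kept and half bounds the smaller weighted term of the slower one, which makes
  -- S(v, w) + S(w, v) a bound for either order of speeds.
  set S : Vel d → Vel d → ℝ := fun v w => -(c / 2) * ((velWeight γ v * ψ v) * 1) + 2 * c * (ψ v * velWeight γ w) +
    η * ((velWeight γ v * ψ v) * ψ w) + 2 * C * (velWeight γ v * ψ w) with hS
  have hpt : ∀ v w : Vel d, ‖w‖ ≤ ‖v‖ → collWeight γ b ψ v w ≤ S v w + S w v := by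
    intro v w h
    refine (H n κ v w hn hκ hκ1 h).trans ?_
    change ‖v - w‖ ^ γ * (-c * ψ v + η / 2 * (ψ v * ψ w) + C * ψ w) ≤ _
    have h1 := norm_sub_rpow_le hγ₀ hγ₁ h
    have h2 := velWeight_sub_le hγ₀ hγ₁ v w
    have h3 : velWeight γ w * ψ w ≤ velWeight γ v * ψ v :=
      mul_le_mul (hWmono v w h) (hψmono v w h) (by linarith [hψ1 w]) (by linarith [hW1 v])
    have a1 := hψ1 v
    have a2 := hψ1 w
    have a3 := hW1 v
    have a4 := hW1 w
    set V := velWeight γ v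
    set W := velWeight γ w
    set U := ‖v - w‖ ^ γ
    have e1 : U * (η / 2 * (ψ v * ψ w) + C * ψ w) ≤ 2 * V * (η / 2 * (ψ v * ψ w) + C * ψ w) := by gcongr
    have e2 : (V - 2 * W) * (c * ψ v) ≤ U * (c * ψ v) := by gcongr
    have e3 : 0 ≤ c * (ψ w * V) := by positivity
    have e4 : 0 ≤ η * ((W * ψ w) * ψ v) := by positivity
    have e5 : 0 ≤ C * (W * ψ v) := by positivity
    have e6 := mul_le_mul_of_nonneg_left h3 (by positivity : 0 ≤ c / 2)
    simp only [hS]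
    linarith
  have hi1 : Integrable (fun z : Vel d × Vel d => (velWeight γ z.1 * ψ z.1) * 1) (μ.prod μ) :=
    hΛi.mul_prod (integrable_const (1 : ℝ))
  have hi2 : Integrable (fun z : Vel d × Vel d => ψ z.1 * velWeight γ z.2) (μ.prod μ) := hψi.mul_prod hWi
  have hi3 : Integrable (fun z : Vel d × Vel d => (velWeight γ z.1 * ψ z.1) * ψ z.2) (μ.prod μ) := hΛi.mul_prod hψi
  have hi4 : Integrable (fun z : Vel d × Vel d => velWeight γ z.1 * ψ z.2) (μ.prod μ) := hWi.mul_prod hψi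
  have hi12 : Integrable (fun z : Vel d × Vel d => -(c / 2) * ((velWeight γ z.1 * ψ z.1) * 1) +
      2 * c * (ψ z.1 * velWeight γ z.2)) (μ.prod μ) := (hi1.const_mul (-(c / 2))).add (hi2.const_mul (2 * c))
  have hi123 : Integrable (fun z : Vel d × Vel d => -(c / 2) * ((velWeight γ z.1 * ψ z.1) * 1) +
      2 * c * (ψ z.1 * velWeight γ z.2) + η * ((velWeight γ z.1 * ψ z.1) * ψ z.2)) (μ.prod μ) :=
    hi12.add (hi3.const_mul η)
  have hSi : Integrable (fun z : Vel d × Vel d => S z.1 z.2) (μ.prod μ) := hi123.add (hi4.const_mul (2 * C))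
  have hSi2 : Integrable (fun z : Vel d × Vel d => S z.2 z.1) (μ.prod μ) := hSi.swap
  have hswap : ∫ z : Vel d × Vel d, S z.2 z.1 ∂(μ.prod μ) = ∫ z : Vel d × Vel d, S z.1 z.2 ∂(μ.prod μ) :=
    integral_prod_swap (fun z : Vel d × Vel d => S z.1 z.2)
  have hle : ∫ z, collWeight γ b ψ z.1 z.2 ∂(μ.prod μ) ≤ 2 * ∫ z : Vel d × Vel d, S z.1 z.2 ∂(μ.prod μ) := by
    rw [two_mul]
    nth_rewrite 2 [← hswap]
    rw [← integral_add hSi hSi2]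
    refine integral_mono hG (hSi.add hSi2) fun z => ?_
    rcases le_total ‖z.2‖ ‖z.1‖ with h | h
    · exact hpt _ _ h
    · change collWeight γ b ψ z.1 z.2 ≤ S z.1 z.2 + S z.2 z.1
      rw [collWeight_comm, add_comm]
      exact hpt _ _ h
  have hSeq : ∫ z : Vel d × Vel d, S z.1 z.2 ∂(μ.prod μ) =
      -(c / 2) * ((∫ v, velWeight γ v * ψ v ∂μ) * m) + 2 * c * ((∫ v, ψ v ∂μ) * ∫ v, velWeight γ v ∂μ) +
      η * ((∫ v, velWeight γ v * ψ v ∂μ) * ∫ v, ψ v ∂μ) + 2 * C * ((∫ v, velWeight γ v ∂μ) * ∫ v, ψ v ∂μ) := by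
    have e0 : ∫ _ : Vel d, (1 : ℝ) ∂μ = m := by rw [integral_const, hμm, smul_eq_mul, mul_one]
    have e1 := integral_prod_mul (μ := μ) (ν := μ) (fun v => velWeight γ v * ψ v) (fun _ => (1 : ℝ))
    have e2 := integral_prod_mul (μ := μ) (ν := μ) ψ (velWeight γ)
    have e3 := integral_prod_mul (μ := μ) (ν := μ) (fun v => velWeight γ v * ψ v) ψ
    have e4 := integral_prod_mul (μ := μ) (ν := μ) (velWeight γ) ψ
    rw [← e0, ← e1, ← e2, ← e3, ← e4, ← integral_const_mul, ← integral_const_mul, ← integral_const_mul,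
      ← integral_const_mul, ← integral_add (hi1.const_mul (-(c / 2))) (hi2.const_mul (2 * c)),
      ← integral_add hi12 (hi3.const_mul η), ← integral_add hi123 (hi4.const_mul (2 * C))]
  rw [hSeq] at hle
  have hM0 : 0 ≤ ∫ v, ψ v ∂μ := integral_nonneg fun v => by
    have := hψ1 v
    simp only [Pi.zero_apply]
    linarith
  have e1 := mul_le_mul_of_nonneg_right hWM hM0
  have e2 := mul_le_mul_of_nonneg_left e1 (by positivity : 0 ≤ 2 * c + 2 * C)
  change _ ≤ -(c / 2 * m) * (∫ v, velWeight γ v * ψ v ∂μ) + (2 * c + 2 * C) * (m + E) * (∫ v, ψ v ∂μ) +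
    η * ((∫ v, velWeight γ v * ψ v ∂μ) * ∫ v, ψ v ∂μ)
  linarith

end truncExpTest

/-! ### Truncated exponential moments as functions of time -/

section expTest
variable {d : ℕ} {γ : ℝ} {b : ℝ → ℝ} {p K θ θ' : ℝ} {n : ℕ}

/-- Minkowski's inequality in ℓ^{1/p} for the vectors (K^p, θX^p) and (0, δX^p). With κ = θ^{1/p}
the exponent is thus Lipschitz in θ with constant X^p, down to θ = 0. -/
theorem add_rpow_mul_rpow_le (hp : 0 < p) (hp1 : p ≤ 1) (hK : 0 ≤ K) {X δ : ℝ} (hX : 0 ≤ X) (hθ : 0 ≤ θ) (hδ : 0 ≤ δ) :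
    (K + (θ + δ) ^ (1 / p) * X) ^ p ≤ (K + θ ^ (1 / p) * X) ^ p + δ * X ^ p := by
  have hp' : 1 ≤ 1 / p := by rw [le_div_iff₀ hp]; linarith
  have hXp : 0 ≤ X ^ p := Real.rpow_nonneg hX _
  have h := Real.Lp_add_le_of_nonneg (s := (Finset.univ : Finset (Fin 2))) (f := ![K ^ p, θ * X ^ p]) (g := ![0, δ * X ^ p]) hp'
    (by intro i _; fin_cases i <;> simp <;> positivity) (by intro i _; fin_cases i <;> simp; positivity)
  have hpow : ∀ y : ℝ, 0 ≤ y → (y ^ p) ^ (1 / p) = y := fun y hy => by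
    rw [← Real.rpow_mul hy, mul_one_div_cancel hp.ne', Real.rpow_one]
  have hpow' : ∀ y : ℝ, 0 ≤ y → (y ^ (1 / p)) ^ p = y := fun y hy => by
    rw [← Real.rpow_mul hy, one_div_mul_cancel hp.ne', Real.rpow_one]
  have h0 : (0 : ℝ) ^ (1 / p) = 0 := Real.zero_rpow (by positivity)
  simp only [Fin.sum_univ_two, Matrix.cons_val_zero, Matrix.cons_val_one, add_zero, one_div_one_div] at h
  rw [← add_mul, Real.mul_rpow (by positivity) hXp, Real.mul_rpow hθ hXp, Real.mul_rpow hδ hXp, hpow K hK, hpow X hX, h0, zero_add,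
    Real.mul_rpow (by positivity) hX, hpow' δ hδ] at h
  exact h

/-- Bernoulli's inequality for the ratio (1 + y/n)/(1 + z/n); it expresses that the derivative of
`expPow n` does not exceed `expPow n`. -/
theorem expPow_le_add {y z : ℝ} (hy : 0 ≤ y) (hyz : y ≤ z) : expPow n z ≤ expPow n y + (z - y) * expPow n z := by
  rcases Nat.eq_zero_or_pos n with rfl | hn
  · simp only [expPow, pow_zero]
    linarith
  have hn' : (0 : ℝ) < n := by exact_mod_cast hn
  have hz : 0 ≤ z := hy.trans hyz
  have hz' : 0 < 1 + z / n := by positivity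
  set a : ℝ := (z - y) / n / (1 + z / n) with ha
  have ha0 : 0 ≤ a := div_nonneg (div_nonneg (by linarith) hn'.le) hz'.le
  have ha2 : n * a ≤ z - y := by
    rw [ha]
    calc n * ((z - y) / n / (1 + z / n)) = (z - y) / (1 + z / n) := by field_simp
      _ ≤ z - y := div_le_self (by linarith) (by linarith [div_nonneg hz hn'.le])
  have ha1 : a ≤ 1 := by
    rw [ha, div_le_one hz', sub_div]
    linarith [div_nonneg hy hn'.le]
  have h1 := one_add_mul_le_pow (a := -a) (by linarith) n
  have h2 : 1 + y / n = (1 + z / n) * (1 + -a) := by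
    rw [ha]; field_simp; ring
  have h3 : expPow n y = expPow n z * (1 + -a) ^ n := by
    rw [expPow, expPow, h2, mul_pow]
  have h4 := (expPow_pos (n := n) hz).le
  have h5 := mul_le_mul_of_nonneg_left h1 h4
  rw [← h3] at h5
  nlinarith

/-- Truncations of `exp ((K + θ^{1/p} |v|^2)^p)`. -/
noncomputable def expTest (p K : ℝ) (n : ℕ) (θ : ℝ) (v : Vel d) : ℝ := truncExp p n (K + θ ^ (1 / p) * ‖v‖ ^ 2)

theorem one_le_expTest (hK : 1 ≤ K) (hθ : 0 ≤ θ) (v : Vel d) : 1 ≤ expTest p K n θ v :=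
  one_le_truncExp (by positivity)

theorem expTest_mono (hp : 0 < p) (hK : 1 ≤ K) (hθ : 0 ≤ θ) (h : θ ≤ θ') (v : Vel d) :
    expTest p K n θ v ≤ expTest p K n θ' v := by
  refine truncExp_mono hp.le (by positivity) ?_
  gcongr

/-- Raising the rate costs |v|^{2p} times the weight; for p ≤ γ/2 the loss, which carries ⟨v⟩^γ, can
absorb this. -/
theorem expTest_le_add (hp : 0 < p) (hp1 : p ≤ 1) (hK : 1 ≤ K) (hθ : 0 ≤ θ) (h : θ ≤ θ') (v : Vel d) :
    expTest p K n θ' v ≤ expTest p K n θ v + (θ' - θ) * ((‖v‖ ^ 2) ^ p * expTest p K n θ' v) := by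
  have hK0 : 0 ≤ K := by linarith
  have h1 := add_rpow_mul_rpow_le (K := K) hp hp1 hK0 (sq_nonneg ‖v‖) hθ (by linarith : 0 ≤ θ' - θ)
  rw [add_sub_cancel] at h1
  have h2 : (K + θ ^ (1 / p) * ‖v‖ ^ 2) ^ p ≤ (K + θ' ^ (1 / p) * ‖v‖ ^ 2) ^ p := by gcongr
  have h3 := expPow_le_add (n := n) (by positivity : 0 ≤ (K + θ ^ (1 / p) * ‖v‖ ^ 2) ^ p) h2
  have h4 := one_le_expTest (p := p) (n := n) hK (hθ.trans h) v
  refine h3.trans (add_le_add le_rfl ?_)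
  rw [← mul_assoc]
  refine mul_le_mul_of_nonneg_right (by linarith) (by unfold expTest truncExp at h4; linarith)

theorem expTest_le (hp : 0 < p) (hp1 : p ≤ 1) (hn : 2 ≤ n) (hK : 1 ≤ K) (hθ : 0 ≤ θ) (hθ1 : θ ≤ 1) (v : Vel d) :
    expTest p K n θ v ≤ (2 * K) ^ n * (1 + ‖v‖ ^ 2) ^ n :=
  (le_abs_self _).trans ((polyBound_truncExp hp hp1 hn hK (Real.rpow_nonneg hθ _)
    (Real.rpow_le_one hθ hθ1 (by positivity))).abs_le _ (sq_nonneg _))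

theorem measurable_expTest : Measurable (expTest (d := d) p K n θ) := by
  unfold expTest truncExp expPow
  fun_prop

theorem polyBound_velWeight (hγ₀ : 0 < γ) (hγ₁ : γ ≤ 1) : PolyBound 1 1 (fun r => (1 + r) ^ (γ / 2))
    (fun r => γ / 2 * (1 + r) ^ (γ / 2 - 1)) (fun r => γ / 2 * ((γ / 2 - 1) * (1 + r) ^ (γ / 2 - 1 - 1))) := by
  have hin : ∀ r : ℝ, HasDerivAt (fun r => 1 + r) 1 r := fun r => (hasDerivAt_id r).const_add 1
  have hle : ∀ (r a : ℝ), 0 ≤ r → a ≤ 0 → 0 ≤ (1 + r) ^ a ∧ (1 + r) ^ a ≤ 1 := fun r a hr ha =>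
    ⟨by positivity, Real.rpow_le_one_of_one_le_of_nonpos (by linarith) ha⟩
  refine ⟨by fun_prop, fun r hr => ?_, fun r hr => ?_, fun r hr => ?_, fun r hr => ?_, fun r hr => ?_, fun r hr => ?_⟩
  · exact (contDiffAt_const.add contDiffAt_id).rpow_const_of_ne (by simp only [id]; linarith : 0 < 1 + id r).ne'
  · refine ((hin r).rpow_const (p := γ / 2) (Or.inl (by linarith : 0 < 1 + r).ne')).congr_deriv (by ring)
  · refine (((hin r).rpow_const (p := γ / 2 - 1) (Or.inl (by linarith : 0 < 1 + r).ne')).const_mul (γ / 2)).congr_deriv (by ring)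
  · rw [abs_of_nonneg (by positivity), one_mul, pow_one]
    calc (1 + r) ^ (γ / 2) ≤ (1 + r) ^ (1 : ℝ) := Real.rpow_le_rpow_of_exponent_le (by linarith) (by linarith)
      _ = _ := Real.rpow_one _
  · obtain ⟨h1, h2⟩ := hle r (γ / 2 - 1) hr (by linarith)
    rw [abs_of_nonneg (by positivity), one_mul, pow_one]
    nlinarith
  · obtain ⟨h1, h2⟩ := hle r (γ / 2 - 1 - 1) hr (by linarith)
    rw [abs_mul, abs_mul, abs_of_nonneg h1, abs_of_pos (by positivity : 0 < γ / 2), one_mul, pow_one,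
      abs_of_nonpos (by linarith : γ / 2 - 1 ≤ 0)]
    have h3 : -(γ / 2 - 1) * (1 + r) ^ (γ / 2 - 1 - 1) ≤ 1 * 1 := by
      apply mul_le_mul (by linarith) h2 h1 zero_le_one
    have h4 : γ / 2 * (-(γ / 2 - 1) * (1 + r) ^ (γ / 2 - 1 - 1)) ≤ 1 * (1 * 1) := by
      apply mul_le_mul (by linarith) h3 (mul_nonneg (by linarith) h1) zero_le_one
    linarith

theorem rpow_le_one_add {X : ℝ} (hp : 0 < p) (hp1 : p ≤ 1) (hX : 0 ≤ X) : X ^ p ≤ 1 + X := by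
  calc X ^ p ≤ (1 + X) ^ p := by gcongr; linarith
    _ ≤ (1 + X) ^ (1 : ℝ) := Real.rpow_le_rpow_of_exponent_le (by linarith) hp1
    _ = _ := Real.rpow_one _

/-- Weighted integrals of `expTest` are Lipschitz in the parameter. -/
theorem abs_integral_expTest_sub_le (hp : 0 < p) (hp1 : p ≤ 1) (hn : 2 ≤ n) (hK : 1 ≤ K) {u : Vel d → ℝ} (hum : Measurable u)
    (hu0 : ∀ v, 0 ≤ u v) (hu : ∀ v, u v ≤ 1 + ‖v‖ ^ 2) {μ : Measure (Vel d)} {R : ℝ}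
    (hi : Integrable (fun v : Vel d => (1 + ‖v‖ ^ 2) ^ (n + 2)) μ) (hR : ∫ v, (1 + ‖v‖ ^ 2) ^ (n + 2) ∂μ ≤ R) :
    (∀ θ, 0 ≤ θ → θ ≤ 1 → Integrable (fun v => u v * expTest p K n θ v) μ) ∧
    ∀ θ θ', 0 ≤ θ → θ ≤ θ' → θ' ≤ 1 → |∫ v, u v * expTest p K n θ' v ∂μ - ∫ v, u v * expTest p K n θ v ∂μ| ≤
      (2 * K) ^ n * R * (θ' - θ) := by
  have hint : ∀ θ, 0 ≤ θ → θ ≤ 1 → Integrable (fun v => u v * expTest p K n θ v) μ := by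
    intro θ hθ hθ1
    refine (hi.const_mul ((2 * K) ^ n)).mono' (hum.mul measurable_expTest).aestronglyMeasurable
      (Filter.Eventually.of_forall fun v => ?_)
    have h1 := one_le_expTest (p := p) (n := n) hK hθ v
    rw [Real.norm_eq_abs, abs_of_nonneg (mul_nonneg (hu0 v) (by linarith))]
    have hv := sq_nonneg ‖v‖
    calc u v * expTest p K n θ v ≤ (1 + ‖v‖ ^ 2) * ((2 * K) ^ n * (1 + ‖v‖ ^ 2) ^ n) :=
          mul_le_mul (hu v) (expTest_le hp hp1 hn hK hθ hθ1 v) (by linarith) (by positivity)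
      _ = (2 * K) ^ n * (1 + ‖v‖ ^ 2) ^ (n + 1) := by ring
      _ ≤ _ := by
          refine mul_le_mul_of_nonneg_left (pow_le_pow_right₀ (by linarith) (by omega)) (by positivity)
  refine ⟨hint, fun θ θ' hθ hθθ' hθ1 => ?_⟩
  have hi1 := hint θ hθ (hθθ'.trans hθ1)
  have hi2 := hint θ' (hθ.trans hθθ') hθ1
  rw [← integral_sub hi2 hi1, ← Real.norm_eq_abs]
  refine (norm_integral_le_of_norm_le (hi.const_mul ((2 * K) ^ n * (θ' - θ))) (Filter.Eventually.of_forall fun v => ?_)).trans ?_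
  · have h1 := expTest_mono (n := n) hp hK hθ hθθ' v
    have h2 := expTest_le_add (n := n) hp hp1 hK hθ hθθ' v
    have h3 := expTest_le hp hp1 hn hK (hθ.trans hθθ') hθ1 v
    have h4 := rpow_le_one_add hp hp1 (sq_nonneg ‖v‖)
    have h5 := one_le_expTest (p := p) (n := n) hK (hθ.trans hθθ') v
    rw [← mul_sub, Real.norm_eq_abs, abs_of_nonneg (mul_nonneg (hu0 v) (by linarith))]
    have hd0 : 0 ≤ θ' - θ := by linarith
    calc u v * (expTest p K n θ' v - expTest p K n θ v)
        ≤ (1 + ‖v‖ ^ 2) * ((θ' - θ) * ((1 + ‖v‖ ^ 2) * ((2 * K) ^ n * (1 + ‖v‖ ^ 2) ^ n))) := by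
          refine mul_le_mul (hu v) ?_ (by linarith) (by positivity)
          refine le_trans (b := (θ' - θ) * ((‖v‖ ^ 2) ^ p * expTest p K n θ' v)) (by linarith) ?_
          gcongr
      _ = _ := by ring
  · rw [integral_const_mul]
    calc (2 * K) ^ n * (θ' - θ) * ∫ v, (1 + ‖v‖ ^ 2) ^ (n + 2) ∂μ ≤ (2 * K) ^ n * (θ' - θ) * R := by
          have hd0 : 0 ≤ θ' - θ := by linarith
          gcongr
      _ = _ := by ring

/-- If `M` is continuous in time and uniformly Lipschitz in the parameter, it is continuous along
a continuous path of parameters. -/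
theorem continuousOn_along {M : ℝ → ℝ → ℝ} {I S : Set ℝ} {R : ℝ} (hR : 0 ≤ R)
    (hc : ∀ θ ∈ I, ContinuousOn (M θ) S)
    (hl : ∀ τ ∈ S, ∀ θ ∈ I, ∀ θ' ∈ I, θ ≤ θ' → |M θ' τ - M θ τ| ≤ R * (θ' - θ)) {f : ℝ → ℝ} (hf : ContinuousOn f S)
    (hfI : MapsTo f S I) : ContinuousOn (fun t => M (f t) t) S := by
  have h1 := continuousOn_prod_of_continuousOn_lipschitzOnWith (fun z : ℝ × ℝ => M z.1 z.2) (s := I) (t := S) R.toNNReal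
    hc (fun τ hτ => by
      refine LipschitzOnWith.of_dist_le_mul fun x hx y hy => ?_
      rw [Real.dist_eq, Real.dist_eq, Real.coe_toNNReal _ hR]
      rcases le_total x y with h | h
      · rw [abs_sub_comm, abs_sub_comm x, abs_of_nonneg (sub_nonneg.2 h)]
        exact hl τ hτ x hx y hy h
      · rw [abs_of_nonneg (sub_nonneg.2 h)]
        exact hl τ hτ y hy x hx h)
  exact h1.comp (hf.prodMk continuousOn_id) fun t ht => ⟨hfI ht, ht⟩

variable {F : ℝ → Measure (Vel d)}

theorem IsWeakSolution.continuousOn_of_polyBound {L : ℝ} {k : ℕ} {g g' g'' : ℝ → ℝ} (hd : 2 ≤ d) (hγ₀ : 0 < γ) (hγ₁ : γ ≤ 1)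
    (hb : IsAngularKernel d b) (hA : NonCutoff d b 2) (h : IsWeakSolution γ b F) {s t : ℝ} (hs : 0 ≤ s)
    (hM : ∀ a, 0 ≤ a → ∃ K : ℝ≥0∞, K < ∞ ∧ ∀ τ ∈ Icc s t, normMoment a (F τ) ≤ K) (hg : PolyBound L k g g' g'') :
    ContinuousOn (fun τ => ∫ v, g (‖v‖ ^ 2) ∂(F τ)) (Icc s t) := by
  rcases lt_or_ge t s with hst | hst
  · rw [Icc_eq_empty (not_le.2 hst)]; exact continuousOn_empty _
  have h1 := (h.integral_sub_of_polyBound hd hγ₀ hγ₁ hb hA hs hst hM hg).2.1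
  have h2 := intervalIntegral.continuousOn_primitive_interval' h1 (left_mem_uIcc (a := s) (b := t))
  rw [uIcc_of_le hst] at h2
  refine (h2.const_add (∫ v, g (‖v‖ ^ 2) ∂(F s))).congr fun r hr => ?_
  have h3 := (h.integral_sub_of_polyBound hd hγ₀ hγ₁ hb hA hs hr.1 (fun a ha => by
    obtain ⟨K, hK, H⟩ := hM a ha
    exact ⟨K, hK, fun τ hτ => H τ ⟨hτ.1, hτ.2.trans hr.2⟩⟩) hg).2.2
  simp only [← h3, add_sub_cancel]

set_option maxHeartbeats 400000 in
/-- Differential inequality for truncated exponential moments with a parameter that grows linearly. -/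
theorem IsWeakSolution.expTest_slope_lt (hd : 2 ≤ d) (hγ₀ : 0 < γ) (hγ₁ : γ ≤ 1) (hb : IsAngularKernel d b)
    (hA : NonCutoff d b 2) (h : IsWeakSolution γ b F) (hp : 0 < p) (hp1 : p ≤ 1) (hn : 2 ≤ n) (hK : 1 ≤ K)
    {t₀ T θ₀ α c C η : ℝ} (ht₀ : 0 ≤ t₀)
    (hM : ∀ a, 0 ≤ a → ∃ K : ℝ≥0∞, K < ∞ ∧ ∀ τ ∈ Icc t₀ T, normMoment a (F τ) ≤ K)
    (hθ₀ : 0 ≤ θ₀) (hα : 0 ≤ α) (hθT : θ₀ + α * (T - t₀) ≤ 1) (hαp : α ≠ 0 → p ≤ γ / 2)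
    (hR : ∀ κ, 0 ≤ κ → κ ≤ 1 → ∀ τ ∈ Icc t₀ T,
      Integrable (fun v => velWeight γ v * truncExp p n (K + κ * ‖v‖ ^ 2)) (F τ) →
      Integrable (fun z : Vel d × Vel d => collWeight γ b (fun v => truncExp p n (K + κ * ‖v‖ ^ 2)) z.1 z.2)
        ((F τ).prod (F τ)) →
      collRate γ b F (fun v => truncExp p n (K + κ * ‖v‖ ^ 2)) τ ≤
        -c * (∫ v, velWeight γ v * truncExp p n (K + κ * ‖v‖ ^ 2) ∂(F τ)) +
        C * (∫ v, truncExp p n (K + κ * ‖v‖ ^ 2) ∂(F τ)) +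
        η * ((∫ v, velWeight γ v * truncExp p n (K + κ * ‖v‖ ^ 2) ∂(F τ)) *
          ∫ v, truncExp p n (K + κ * ‖v‖ ^ 2) ∂(F τ))) :
    ContinuousOn (fun t => ∫ v, expTest p K n (θ₀ + α * (t - t₀)) v ∂(F t)) (Icc t₀ T) ∧
    ∀ t ∈ Ico t₀ T, ∀ r, (α - c) * (∫ v, velWeight γ v * expTest p K n (θ₀ + α * (t - t₀)) v ∂(F t)) +
        C * (∫ v, expTest p K n (θ₀ + α * (t - t₀)) v ∂(F t)) +
        η * ((∫ v, velWeight γ v * expTest p K n (θ₀ + α * (t - t₀)) v ∂(F t)) *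
          ∫ v, expTest p K n (θ₀ + α * (t - t₀)) v ∂(F t)) < r →
      ∃ᶠ z in nhdsWithin t (Ioi t), slope (fun t => ∫ v, expTest p K n (θ₀ + α * (t - t₀)) v ∂(F t)) t z < r := by
  set θ : ℝ → ℝ := fun t => θ₀ + α * (t - t₀) with hθ
  have hθI : MapsTo θ (Icc t₀ T) (Icc 0 1) := by
    intro t ht
    have h1 := mul_nonneg hα (sub_nonneg.2 ht.1)
    have h2 := mul_le_mul_of_nonneg_left ht.2 hα
    constructor <;> simp only [hθ] <;> linarith
  have hθmono : ∀ s t, s ≤ t → θ s ≤ θ t := fun s t hst => by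
    have := mul_le_mul_of_nonneg_left hst hα
    simp only [hθ]; linarith
  have hθc : Continuous θ := by fun_prop
  obtain ⟨R, hR0, hRi⟩ := exists_integral_one_add_pow_le h ht₀ hM (n + 2)
  have hκ : ∀ x ∈ Icc (0 : ℝ) 1, 0 ≤ x ^ (1 / p) ∧ x ^ (1 / p) ≤ 1 := fun x hx =>
    ⟨Real.rpow_nonneg hx.1 _, Real.rpow_le_one hx.1 hx.2 (by positivity)⟩
  set Φ : ℝ → ℝ → ℝ := fun x τ => ∫ v, expTest p K n x v ∂(F τ) with hΦ
  set Λ : ℝ → ℝ → ℝ := fun x τ => ∫ v, velWeight γ v * expTest p K n x v ∂(F τ) with hΛ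
  have hΦ1 : ∀ x τ, Φ x τ = ∫ v, (fun _ => (1 : ℝ)) v * expTest p K n x v ∂(F τ) := fun x τ => by simp [hΦ]
  have hΦlip : ∀ τ ∈ Icc t₀ T, (∀ x, 0 ≤ x → x ≤ 1 → Integrable (expTest p K n x) (F τ)) ∧ ∀ x x', 0 ≤ x → x ≤ x' → x' ≤ 1 →
      |Φ x' τ - Φ x τ| ≤ (2 * K) ^ n * R * (x' - x) := by
    intro τ hτ
    have := abs_integral_expTest_sub_le hp hp1 hn hK (u := fun _ : Vel d => (1 : ℝ)) measurable_const (fun _ => zero_le_one)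
      (fun v => by nlinarith [sq_nonneg ‖v‖]) (hRi τ hτ).1 (hRi τ hτ).2
    simpa [hΦ] using this
  have hΛlip : ∀ τ ∈ Icc t₀ T, (∀ x, 0 ≤ x → x ≤ 1 → Integrable (fun v => velWeight γ v * expTest p K n x v) (F τ)) ∧
      ∀ x x', 0 ≤ x → x ≤ x' → x' ≤ 1 → |Λ x' τ - Λ x τ| ≤ (2 * K) ^ n * R * (x' - x) := fun τ hτ =>
    abs_integral_expTest_sub_le hp hp1 hn hK measurable_velWeight (fun v => by linarith [one_le_velWeight hγ₀ v])
      (velWeight_le hγ₁) (hRi τ hτ).1 (hRi τ hτ).2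
  have hΦc : ∀ x ∈ Icc (0 : ℝ) 1, ContinuousOn (Φ x) (Icc t₀ T) := fun x hx =>
    h.continuousOn_of_polyBound hd hγ₀ hγ₁ hb hA ht₀ hM (polyBound_truncExp hp hp1 hn hK (hκ x hx).1 (hκ x hx).2)
  have hΛc : ∀ x ∈ Icc (0 : ℝ) 1, ContinuousOn (Λ x) (Icc t₀ T) := fun x hx =>
    h.continuousOn_of_polyBound hd hγ₀ hγ₁ hb hA ht₀ hM
      ((polyBound_velWeight hγ₀ hγ₁).mul (polyBound_truncExp hp hp1 hn hK (hκ x hx).1 (hκ x hx).2))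
  have hRnn : 0 ≤ (2 * K) ^ n * R := by positivity
  have hcΦ : ContinuousOn (fun t => Φ (θ t) t) (Icc t₀ T) := continuousOn_along hRnn hΦc
    (fun τ hτ x hx x' hx' hxx' => (hΦlip τ hτ).2 x x' hx.1 hxx' hx'.2) hθc.continuousOn hθI
  have hcΛ : ContinuousOn (fun t => Λ (θ t) t) (Icc t₀ T) := continuousOn_along hRnn hΛc
    (fun τ hτ x hx x' hx' hxx' => (hΛlip τ hτ).2 x x' hx.1 hxx' hx'.2) hθc.continuousOn hθI
  refine ⟨hcΦ, fun t ht r hr => ?_⟩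
  change (α - c) * Λ (θ t) t + C * Φ (θ t) t + η * (Λ (θ t) t * Φ (θ t) t) < r at hr
  have htI : t ∈ Icc t₀ T := ⟨ht.1, ht.2.le⟩
  have hθt := hθI htI
  -- The increment is split at the frozen parameter θ(t): B bounds the collision rate for that
  -- parameter, and αΛ the cost of moving the parameter. Each receives half, ε, of the slack below
  -- r.
  set B : ℝ → ℝ := fun τ => -c * Λ (θ t) τ + C * Φ (θ t) τ + η * (Λ (θ t) τ * Φ (θ t) τ) with hB
  set ε := (r - (α * Λ (θ t) t + B t)) / 2 with hε
  have hε0 : 0 < ε := by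
    simp only [hε, hB]
    linarith
  have hBc : ContinuousOn B (Icc t₀ T) :=
    (((hΛc _ hθt).const_mul (-c)).add ((hΦc _ hθt).const_mul C)).add (((hΛc _ hθt).mul (hΦc _ hθt)).const_mul η)
  have hsub : Ico t T ⊆ Icc t₀ T := fun z hz => ⟨ht.1.trans hz.1, hz.2.le⟩
  have hnhds : Ico t T ∈ nhdsWithin t (Ici t) := Ico_mem_nhdsGE ht.2
  have hev1 : ∀ᶠ z in nhdsWithin t (Ici t), B z < B t + ε := by
    have h1 := (hBc t htI).mono hsub
    have h2 : nhdsWithin t (Ico t T) = nhdsWithin t (Ici t) := nhdsWithin_Ico_eq_nhdsGE ht.2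
    rw [ContinuousWithinAt, h2] at h1
    exact h1.eventually (gt_mem_nhds (by linarith))
  have hev2 : ∀ᶠ z in nhdsWithin t (Ici t), α * Λ (θ z) z < α * Λ (θ t) t + ε := by
    have h1 := ((hcΛ t htI).mono hsub).const_mul α
    have h2 : nhdsWithin t (Ico t T) = nhdsWithin t (Ici t) := nhdsWithin_Ico_eq_nhdsGE ht.2
    rw [ContinuousWithinAt, h2] at h1
    exact h1.eventually (gt_mem_nhds (by linarith))
  obtain ⟨u, hu, hus⟩ := (mem_nhdsGE_iff_exists_Ico_subset' ht.2).1 (Filter.inter_mem (Filter.inter_mem hev1 hev2) hnhds)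
  refine Filter.Eventually.frequently ?_
  filter_upwards [Ioo_mem_nhdsGT hu] with z hz
  have hzI : z ∈ Icc t₀ T := hsub (hus ⟨hz.1.le, hz.2⟩).2
  have hz2 : α * Λ (θ z) z < α * Λ (θ t) t + ε := (hus ⟨hz.1.le, hz.2⟩).1.2
  have hzt : 0 < z - t := sub_pos.2 hz.1
  have hpar : Φ (θ z) z - Φ (θ t) z ≤ α * (z - t) * Λ (θ z) z := by
    rcases eq_or_ne α 0 with h0 | h0
    · have : θ z = θ t := by simp [hθ, h0]
      rw [this, h0]; simp
    · have hle := hθmono t z hz.1.le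
      have hθz := hθI hzI
      have hpγ := hαp h0
      rw [← MeasureTheory.integral_sub ((hΦlip z hzI).1 _ hθz.1 hθz.2) ((hΦlip z hzI).1 _ hθt.1 hθt.2), ← integral_const_mul]
      refine integral_mono (((hΦlip z hzI).1 _ hθz.1 hθz.2).sub ((hΦlip z hzI).1 _ hθt.1 hθt.2))
        (((hΛlip z hzI).1 _ hθz.1 hθz.2).const_mul _) fun v => ?_
      have h1 := expTest_le_add (n := n) hp hp1 hK hθt.1 hle v
      have h2 : θ z - θ t = α * (z - t) := by simp only [hθ]; ring
      rw [h2] at h1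
      have h3 : (‖v‖ ^ 2) ^ p ≤ velWeight γ v := by
        calc (‖v‖ ^ 2) ^ p ≤ (1 + ‖v‖ ^ 2) ^ p := by gcongr; linarith
          _ ≤ velWeight γ v := Real.rpow_le_rpow_of_exponent_le (by nlinarith [sq_nonneg ‖v‖]) hpγ
      have h4 := one_le_expTest (p := p) (n := n) hK hθz.1 v
      have h5 : α * (z - t) * ((‖v‖ ^ 2) ^ p * expTest p K n (θ z) v) ≤
          α * (z - t) * (velWeight γ v * expTest p K n (θ z) v) := by gcongr
      simp only
      linarith
  have htime : Φ (θ t) z - Φ (θ t) t ≤ (B t + ε) * (z - t) := by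
    have hg := polyBound_truncExp (n := n) hp hp1 hn hK (hκ _ hθt).1 (hκ _ hθt).2
    obtain ⟨h1, h2, h3⟩ := h.integral_sub_of_polyBound hd hγ₀ hγ₁ hb hA (ht₀.trans ht.1) hz.1.le (fun a ha => by
      obtain ⟨K, hK, H⟩ := hM a ha
      exact ⟨K, hK, fun τ hτ => H τ ⟨ht.1.trans hτ.1, hτ.2.trans hzI.2⟩⟩) hg
    have h4 : Φ (θ t) z - Φ (θ t) t = ∫ τ in t..z, collRate γ b F (fun v => truncExp p n (K + θ t ^ (1 / p) * ‖v‖ ^ 2)) τ := h3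
    rw [h4, intervalIntegral.integral_of_le hz.1.le]
    calc ∫ τ in Ioc t z, collRate γ b F (fun v => truncExp p n (K + θ t ^ (1 / p) * ‖v‖ ^ 2)) τ
        ≤ ∫ τ in Ioc t z, (B t + ε) := by
          refine setIntegral_mono_ae_restrict ((intervalIntegrable_iff_integrableOn_Ioc_of_le hz.1.le).1 h2)
            (integrableOn_const (by simp)) ?_
          filter_upwards [h1, ae_restrict_mem measurableSet_Ioc] with τ hτ hτm
          have hτu : τ ∈ Ico t u := ⟨hτm.1.le, hτm.2.trans_lt hz.2⟩
          have hτI : τ ∈ Icc t₀ T := hsub (hus hτu).2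
          have hBτ : B τ < B t + ε := (hus hτu).1.1
          refine (hR _ (hκ _ hθt).1 (hκ _ hθt).2 τ hτI ((hΛlip τ hτI).1 _ hθt.1 hθt.2) hτ).trans ?_
          exact hBτ.le
      _ = _ := by
          rw [setIntegral_const, smul_eq_mul, mul_comm, Measure.real, Real.volume_Ioc, ENNReal.toReal_ofReal hzt.le]
  rw [slope_def_field, div_lt_iff₀ hzt]
  change Φ (θ z) z - Φ (θ t) t < r * (z - t)
  have h6 : α * (z - t) * Λ (θ z) z ≤ (α * Λ (θ t) t + ε) * (z - t) := by nlinarith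
  have h7 : r = α * Λ (θ t) t + ε + (B t + ε) := by simp only [hε]; ring
  have h8 : α * Λ (θ z) z * (z - t) < (α * Λ (θ t) t + ε) * (z - t) := by gcongr
  rw [h7]
  nlinarith

end expTest

/-! ### Generation and propagation of exponential moments -/

section expMoments
variable {d : ℕ} {γ : ℝ} {b : ℝ → ℝ} {p q K θ : ℝ} {n : ℕ} {F : ℝ → Measure (Vel d)}

theorem tendsto_expPow (y : ℝ) : Filter.Tendsto (fun n => expPow n y) Filter.atTop (nhds (Real.exp y)) :=
  Real.tendsto_one_add_div_pow_exp y

/-- Fatou's lemma for the truncations of an exponential moment. -/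
theorem lintegral_exp_le_of_expTest {μ : Measure (Vel d)} {N : ℝ} {n₀ : ℕ} (hK : 1 ≤ K) (hθ : 0 ≤ θ)
    (h : ∀ n, n₀ ≤ n → Integrable (expTest p K n θ) μ ∧ ∫ v, expTest p K n θ v ∂μ ≤ N) :
    ∫⁻ v, ENNReal.ofReal (Real.exp ((K + θ ^ (1 / p) * ‖v‖ ^ 2) ^ p)) ∂μ ≤ ENNReal.ofReal N := by
  have hle : ∀ n, n₀ ≤ n → ∫⁻ v, ENNReal.ofReal (expTest p K n θ v) ∂μ ≤ ENNReal.ofReal N := fun n hn => by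
    rw [← ofReal_integral_eq_lintegral_ofReal (h n hn).1
      (Filter.Eventually.of_forall fun v => zero_le_one.trans (one_le_expTest hK hθ v))]
    exact ENNReal.ofReal_le_ofReal (h n hn).2
  calc ∫⁻ v, ENNReal.ofReal (Real.exp ((K + θ ^ (1 / p) * ‖v‖ ^ 2) ^ p)) ∂μ
      = ∫⁻ v, Filter.liminf (fun n => ENNReal.ofReal (expTest p K n θ v)) Filter.atTop ∂μ := by
        refine lintegral_congr fun v => ?_
        exact (ENNReal.tendsto_ofReal (tendsto_expPow _)).liminf_eq.symm
    _ ≤ Filter.liminf (fun n => ∫⁻ v, ENNReal.ofReal (expTest p K n θ v) ∂μ) Filter.atTop :=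
        lintegral_liminf_le fun n => measurable_expTest.ennreal_ofReal
    _ ≤ ENNReal.ofReal N :=
        Filter.liminf_le_of_frequently_le' ((Filter.eventually_ge_atTop n₀).mono hle).frequently

theorem exp_mul_rpow_le (hp : 0 < p) (hK : 0 ≤ K) (hθ : 0 ≤ θ) (v : Vel d) :
    Real.exp (θ * (‖v‖ ^ 2) ^ p) ≤ Real.exp ((K + θ ^ (1 / p) * ‖v‖ ^ 2) ^ p) := by
  have h1 : θ * (‖v‖ ^ 2) ^ p = (θ ^ (1 / p) * ‖v‖ ^ 2) ^ p := by
    rw [Real.mul_rpow (by positivity) (by positivity), ← Real.rpow_mul hθ, one_div_mul_cancel hp.ne', Real.rpow_one]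
  rw [h1, Real.exp_le_exp]
  gcongr
  linarith

theorem rpow_add_mul_le (hp : 0 < p) (hp1 : p ≤ 1) (hK : 0 ≤ K) (hθ : 0 ≤ θ) (v : Vel d) :
    (K + θ ^ (1 / p) * ‖v‖ ^ 2) ^ p ≤ K ^ p + θ * (‖v‖ ^ 2) ^ p := by
  have h := add_rpow_mul_rpow_le hp hp1 hK (sq_nonneg ‖v‖) le_rfl hθ
  rwa [zero_add, Real.zero_rpow (by positivity), zero_mul, add_zero] at h

theorem expTest_le_exp (hp : 0 < p) (hp1 : p ≤ 1) (hK : 1 ≤ K) (hθ : 0 ≤ θ) (v : Vel d) :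
    expTest p K n θ v ≤ Real.exp (K ^ p + θ * (‖v‖ ^ 2) ^ p) :=
  (truncExp_le_exp (by positivity)).trans (Real.exp_le_exp.2 (rpow_add_mul_le hp hp1 (by linarith) hθ v))

theorem IsWeakSolution.integrable_expTest (hp : 0 < p) (hp1 : p ≤ 1) (hn : 2 ≤ n) (hK : 1 ≤ K) (hγ₀ : 0 < γ) (hγ₁ : γ ≤ 1)
    (h : IsWeakSolution γ b F) {s t : ℝ} (hs : 0 ≤ s)
    (hM : ∀ a, 0 ≤ a → ∃ K : ℝ≥0∞, K < ∞ ∧ ∀ τ ∈ Icc s t, normMoment a (F τ) ≤ K) (hθ : 0 ≤ θ) (hθ1 : θ ≤ 1)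
    {τ : ℝ} (hτ : τ ∈ Icc s t) :
    Integrable (expTest p K n θ) (F τ) ∧ Integrable (fun v => velWeight γ v * expTest p K n θ v) (F τ) := by
  obtain ⟨R, hR0, hR⟩ := exists_integral_one_add_pow_le h hs hM (n + 2)
  refine ⟨?_, (abs_integral_expTest_sub_le hp hp1 hn hK measurable_velWeight (fun v => by linarith [one_le_velWeight hγ₀ v])
      (velWeight_le hγ₁) (hR τ hτ).1 (hR τ hτ).2).1 θ hθ hθ1⟩
  simpa using (abs_integral_expTest_sub_le hp hp1 hn hK (u := fun _ : Vel d => (1 : ℝ)) measurable_const (fun _ => zero_le_one)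
      (fun v => by nlinarith [sq_nonneg ‖v‖]) (hR τ hτ).1 (hR τ hτ).2).1 θ hθ hθ1

/-- A constant `K` for which `exp ((K + r)^p)` is convex in a robust way. -/
theorem exists_convexity_shift (hp : 0 < p) : ∃ K : ℝ, 1 ≤ K ∧ 2 / p ≤ K ^ p := by
  refine ⟨max 1 ((2 / p) ^ (1 / p)), le_max_left _ _, ?_⟩
  calc 2 / p = ((2 / p) ^ (1 / p)) ^ p := by
        rw [← Real.rpow_mul (by positivity), one_div_mul_cancel hp.ne', Real.rpow_one]
    _ ≤ _ := by gcongr; exact le_max_right _ _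

/-- Exponential moments appear within a fixed time after any time at which all moments are finite. -/
theorem exists_lintegral_exp_le_of_pos (hd : 2 ≤ d) (hγ₀ : 0 < γ) (hγ₁ : γ ≤ 1) (hb : IsAngularKernel d b)
    (hA : NonCutoff d b 2) {m E : ℝ} (hm : 0 < m) (hE : 0 ≤ E) :
    ∃ N α τ : ℝ, 0 < N ∧ 0 < α ∧ 0 < τ ∧ τ ≤ 1 ∧ ∀ F : ℝ → Measure (Vel d), IsWeakSolution γ b F → Measurable F →
      (mass (F 0)).toReal = m → (energy (F 0)).toReal = E → ∀ t₀, 0 < t₀ → ∀ t ∈ Icc t₀ (t₀ + τ),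
        ∫⁻ v, ENNReal.ofReal (Real.exp (α * (t - t₀) * ‖v‖ ^ γ)) ∂(F t) ≤ ENNReal.ofReal N := by
  have hp : 0 < γ / 2 := by positivity
  have hp1 : γ / 2 < 1 := by linarith
  obtain ⟨K, hK, hKp⟩ := exists_convexity_shift hp
  obtain ⟨c, hc, H⟩ := exists_integral_collWeight_truncExp_le hd hγ₀ hγ₁ hb hA (q := 1) (by simpa using hA) hp hp1 one_pos le_rfl
    (by linarith) hK hKp hm hE
  set N₀ := m * Real.exp (K ^ (γ / 2)) with hN₀
  have hN₀' : 0 < N₀ := by positivity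
  set N := N₀ + 1 with hN
  -- With η = c/(2N) the quadratic term is at most cΛ/2 as long as M ≤ N. The moving rate uses the
  -- other half, α ≤ c/2, and only CM remains.
  obtain ⟨C, n₀, hC, hn₀, H⟩ := H (c / (2 * N)) (by positivity)
  have hCN : 0 < C * N + 1 := by positivity
  have hτ1 : 1 / (C * N + 1) ≤ 1 := by rw [div_le_one hCN]; nlinarith [mul_pos hC (by positivity : 0 < N)]
  refine ⟨N, min (c / 2) 1, 1 / (C * N + 1), by positivity, by positivity, by positivity, hτ1, ?_⟩
  intro F h hF hmF hEF t₀ ht₀ t ht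
  set α := min (c / 2) 1 with hα
  have hα0 : 0 < α := by positivity
  have hα1 : α ≤ 1 := min_le_right _ _
  have hαc : α ≤ c / 2 := min_le_left _ _
  set τ := 1 / (C * N + 1) with hτ
  have hτ0 : 0 < τ := by positivity
  have hm' : mass (F 0) ≠ 0 := fun h0 => by simp [h0] at hmF; linarith
  have hM : ∀ a, 0 ≤ a → ∃ K : ℝ≥0∞, K < ∞ ∧ ∀ r ∈ Icc t₀ (t₀ + τ), normMoment a (F r) ≤ K := fun a ha =>
    h.exists_normMoment_le hd hγ₀ hγ₁ hb hA hF hm' ha ht₀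
  have hθI : ∀ r ∈ Icc t₀ (t₀ + τ), 0 ≤ α * (r - t₀) ∧ α * (r - t₀) ≤ 1 := fun r hr => by
    have h1 : 0 ≤ r - t₀ := by linarith [hr.1]
    have h2 : r - t₀ ≤ 1 := by linarith [hr.2]
    exact ⟨by positivity, by nlinarith⟩
  have hint : ∀ n, 2 ≤ n → ∀ r ∈ Icc t₀ (t₀ + τ), Integrable (expTest (γ / 2) K n (α * (r - t₀))) (F r) ∧
      Integrable (fun v => velWeight γ v * expTest (γ / 2) K n (α * (r - t₀)) v) (F r) := fun n hn r hr =>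
    h.integrable_expTest hp hp1.le hn hK hγ₀ hγ₁ ht₀.le hM (hθI r hr).1 (hθI r hr).2 hr
  have key : ∀ n, n₀ ≤ n → ∫ v, expTest (γ / 2) K n (α * (t - t₀)) v ∂(F t) ≤ N := by
    intro n hn
    obtain ⟨hc1, hs⟩ := h.expTest_slope_lt (n := n) hd hγ₀ hγ₁ hb hA hp hp1.le (hn₀.trans hn) hK (T := t₀ + τ) (θ₀ := 0) (α := α)
      (c := c) (C := C) (η := c / (2 * N)) ht₀.le hM le_rfl hα0.le
      (by rw [zero_add]; exact (hθI _ (right_mem_Icc.2 (by linarith))).2) (fun _ => le_rfl)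
      (fun κ hκ hκ1 r hr h1 h2 => by
        have hr0 : 0 ≤ r := ht₀.le.trans hr.1
        have := h.isFiniteMeasure hr0
        exact H n κ (F r) hn hκ hκ1 ((h.real_univ hr0).trans hmF) (h.integrable_normSq hr0) ((h.integral_normSq hr0).trans hEF)
          h1 h2)
    simp only [zero_add] at hc1 hs
    -- The barrier starts at N₀, the bound for rate zero, and its slope CN + 1 exceeds the bound CN
    -- on M' below N; τ is the time it takes to rise to N = N₀ + 1.
    have hB := image_le_of_liminf_slope_right_lt_deriv_boundary' hc1 hs (B := fun r => N₀ + (C * N + 1) * (r - t₀))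
      (B' := fun _ => C * N + 1) ?_ (by fun_prop) (fun x _ => ?_) (fun x hx hxB => ?_) ht
    · refine hB.trans ?_
      have h1 : (C * N + 1) * (t - t₀) ≤ (C * N + 1) * τ := by
        refine mul_le_mul_of_nonneg_left ?_ hCN.le
        linarith [ht.2]
      have h2 : (C * N + 1) * τ = 1 := mul_one_div_cancel hCN.ne'
      linarith
    · simp only [sub_self, mul_zero, add_zero]
      have hfin := h.isFiniteMeasure ht₀.le
      have h1 : ∀ v : Vel d, expTest (γ / 2) K n 0 v ≤ Real.exp (K ^ (γ / 2)) := fun v => by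
        simpa using expTest_le_exp (n := n) (v := v) hp hp1.le hK (le_refl 0)
      have h2 := (hint n (hn₀.trans hn) t₀ (left_mem_Icc.2 (by linarith))).1
      rw [sub_self, mul_zero] at h2
      calc ∫ v, expTest (γ / 2) K n 0 v ∂(F t₀) ≤ ∫ v, Real.exp (K ^ (γ / 2)) ∂(F t₀) :=
            integral_mono h2 (integrable_const _) h1
        _ = N₀ := by rw [integral_const, smul_eq_mul, h.real_univ ht₀.le, hmF]
    · have := (((hasDerivAt_id x).sub_const t₀).const_mul (C * N + 1)).const_add N₀
      simpa using this.hasDerivWithinAt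
    · have hx' : x ∈ Icc t₀ (t₀ + τ) := ⟨hx.1, hx.2.le⟩
      have h1 : (C * N + 1) * (x - t₀) ≤ (C * N + 1) * τ := by
        refine mul_le_mul_of_nonneg_left ?_ hCN.le
        linarith [hx.2]
      have h2 : (C * N + 1) * τ = 1 := mul_one_div_cancel hCN.ne'
      set f := ∫ v, expTest (γ / 2) K n (α * (x - t₀)) v ∂(F x)
      set Λ := ∫ v, velWeight γ v * expTest (γ / 2) K n (α * (x - t₀)) v ∂(F x) with hΛ
      have hfN : f ≤ N := by linarith
      have hΛ0 : 0 ≤ Λ := integral_nonneg fun v => mul_nonneg (by linarith [one_le_velWeight hγ₀ v])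
        (by linarith [one_le_expTest (p := γ / 2) (n := n) hK (hθI x hx').1 v])
      have h3 : c / (2 * N) * (Λ * f) ≤ c / (2 * N) * (Λ * N) := by gcongr
      have hN1 : 0 < N := by positivity
      have h4 : c / (2 * N) * (Λ * N) = c / 2 * Λ := by field_simp
      have h5 : C * f ≤ C * N := by gcongr
      nlinarith
  refine le_trans (lintegral_mono fun v => ENNReal.ofReal_le_ofReal ?_)
    (lintegral_exp_le_of_expTest (p := γ / 2) (n₀ := n₀) hK (hθI t ht).1 fun n hn => ⟨(hint n (hn₀.trans hn) t ht).1, key n hn⟩)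
  rw [norm_rpow_eq]
  exact exp_mul_rpow_le hp (by linarith) (hθI t ht).1 v

theorem IsWeakSolution.measurable_max (h : IsWeakSolution γ b F) :
    IsWeakSolution γ b (fun t => F (max t 0)) ∧ Measurable fun t => F (max t 0) :=
  ⟨h.congr fun t ht => by rw [max_eq_left ht], h.measurable⟩

/-- Generation of exponential moments, positive mass. -/
theorem exists_lintegral_exp_le (hd : 2 ≤ d) (hγ₀ : 0 < γ) (hγ₁ : γ ≤ 1) (hb : IsAngularKernel d b)
    (hA : NonCutoff d b 2) {m E : ℝ} (hm : 0 < m) (hE : 0 ≤ E) :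
    ∃ N α : ℝ, 0 < N ∧ 0 < α ∧ ∀ F : ℝ → Measure (Vel d), IsWeakSolution γ b F →
      (mass (F 0)).toReal = m → (energy (F 0)).toReal = E → ∀ t, 0 ≤ t →
        ∫⁻ v, ENNReal.ofReal (Real.exp (α * min t 1 * ‖v‖ ^ γ)) ∂(F t) ≤ ENNReal.ofReal N := by
  obtain ⟨N, α, τ, hN, hα, hτ, hτ1, H⟩ := exists_lintegral_exp_le_of_pos hd hγ₀ hγ₁ hb hA hm hE
  -- Fatou along t₀ = t/(k + 1) → 0: finiteness of the polynomial moments needs t₀ > 0, but N, α and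
  -- τ do not depend on t₀.
  have H1 : ∀ F : ℝ → Measure (Vel d), IsWeakSolution γ b F → (mass (F 0)).toReal = m → (energy (F 0)).toReal = E →
      ∀ t, 0 < t → t ≤ τ → ∫⁻ v, ENNReal.ofReal (Real.exp (α * t * ‖v‖ ^ γ)) ∂(F t) ≤ ENNReal.ofReal N := by
    intro F h hmF hEF t ht htτ
    have hu : ∀ k : ℕ, 0 < t / (k + 1) ∧ t / (k + 1) ≤ t := fun k =>
      ⟨by positivity, div_le_self ht.le (by linarith [Nat.cast_nonneg (α := ℝ) k])⟩
    have hlim : Filter.Tendsto (fun k : ℕ => t / (k + 1)) Filter.atTop (nhds 0) := by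
      simpa [div_eq_mul_inv] using (tendsto_one_div_add_atTop_nhds_zero_nat (𝕜 := ℝ)).const_mul t
    calc ∫⁻ v, ENNReal.ofReal (Real.exp (α * t * ‖v‖ ^ γ)) ∂(F t)
        = ∫⁻ v, Filter.liminf (fun k : ℕ => ENNReal.ofReal (Real.exp (α * (t - t / (k + 1)) * ‖v‖ ^ γ))) Filter.atTop ∂(F t) := by
          refine lintegral_congr fun v => ?_
          refine (ENNReal.tendsto_ofReal ((Real.continuous_exp.tendsto _).comp ?_)).liminf_eq.symm
          have := ((hlim.const_sub t).const_mul α).mul_const (‖v‖ ^ γ)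
          rwa [sub_zero] at this
      _ ≤ Filter.liminf (fun k : ℕ => ∫⁻ v, ENNReal.ofReal (Real.exp (α * (t - t / (k + 1)) * ‖v‖ ^ γ)) ∂(F t)) Filter.atTop :=
          lintegral_liminf_le fun k => by fun_prop
      _ ≤ ENNReal.ofReal N := by
          refine Filter.liminf_le_of_frequently_le' (Filter.Eventually.of_forall fun k => ?_).frequently
          have := H _ h.measurable_max.1 h.measurable_max.2 (by simpa using hmF) (by simpa using hEF) _ (hu k).1 t
            ⟨(hu k).2, by linarith [(hu k).1]⟩
          simpa [max_eq_left ht.le] using this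
  refine ⟨max N m, α * τ, by positivity, by positivity, fun F h hmF hEF t ht => ?_⟩
  rcases ht.eq_or_lt with rfl | ht0
  · have h1 : F 0 univ ≠ ∞ := h.mass_lt_top.ne
    have : F 0 univ = ENNReal.ofReal m := by rw [← hmF, mass, ENNReal.ofReal_toReal h1]
    simp only [zero_le_one, min_eq_left, mul_zero, zero_mul, Real.exp_zero, ENNReal.ofReal_one, lintegral_one, this]
    exact ENNReal.ofReal_le_ofReal (le_max_right _ _)
  · have hr0 : 0 < min t τ := lt_min ht0 hτ
    have hs : 0 ≤ t - min t τ := sub_nonneg.2 (min_le_left _ _)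
    -- The solution is restarted at time t − min(t, τ) with the same mass and energy, hence the same
    -- constants. The rate ατ min(t, 1) is admissible since τ min(t, 1) ≤ min(t, τ).
    have h1 := H1 _ (h.shift hs) (by rw [add_zero, h.mass_eq _ hs, hmF]) (by rw [add_zero, h.energy_eq _ hs, hEF]) (min t τ) hr0
      (min_le_right _ _)
    rw [sub_add_cancel] at h1
    refine le_trans (lintegral_mono fun v => ENNReal.ofReal_le_ofReal (Real.exp_le_exp.2 ?_))
      (h1.trans (ENNReal.ofReal_le_ofReal (le_max_left _ _)))
    have h2 : τ * min t 1 ≤ min t τ := by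
      refine le_min ?_ ?_
      · calc τ * min t 1 ≤ 1 * t := mul_le_mul hτ1 (min_le_left _ _) (le_min ht zero_le_one) zero_le_one
          _ = t := one_mul t
      · calc τ * min t 1 ≤ τ * 1 := by gcongr; exact min_le_right _ _
          _ = τ := mul_one τ
    rw [mul_assoc α]
    gcongr

/-- |v|^{2pk} is at most k!/θ^k times the exponential. An initial exponential moment thus gives
polynomial moments from time 0 on. -/
theorem normMoment_lt_top_of_exp (hp : 0 < p) (hθ : 0 < θ) {μ : Measure (Vel d)} (hμ : μ univ < ∞)
    (h : ∫⁻ v, ENNReal.ofReal (Real.exp (θ * (‖v‖ ^ 2) ^ p)) ∂μ < ∞) {a : ℝ} (ha : 0 ≤ a) : normMoment a μ < ∞ := by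
  obtain ⟨k, hk⟩ := exists_nat_ge (a / p)
  have hak : a ≤ p * k := by rw [div_le_iff₀ hp] at hk; linarith
  refine (normMoment_le_add ha hak μ).trans_lt (ENNReal.add_lt_top.2 ⟨hμ, ?_⟩)
  have hpt : ∀ v : Vel d, (‖v‖ ^ 2) ^ (p * k) ≤ k.factorial / θ ^ k * Real.exp (θ * (‖v‖ ^ 2) ^ p) := fun v => by
    have h1 := Real.pow_div_factorial_le_exp (θ * (‖v‖ ^ 2) ^ p) (by positivity) k
    rw [mul_pow, ← Real.rpow_natCast ((‖v‖ ^ 2) ^ p) k, ← Real.rpow_mul (by positivity), div_le_iff₀ (by positivity)] at h1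
    rw [div_mul_eq_mul_div, le_div_iff₀ (by positivity)]
    linarith
  calc normMoment (p * k) μ
      ≤ ∫⁻ v, ENNReal.ofReal (k.factorial / θ ^ k) * ENNReal.ofReal (Real.exp (θ * (‖v‖ ^ 2) ^ p)) ∂μ := by
        refine lintegral_mono fun v => ?_
        rw [← ENNReal.ofReal_mul (by positivity)]
        exact ENNReal.ofReal_le_ofReal (hpt v)
    _ = ENNReal.ofReal (k.factorial / θ ^ k) * ∫⁻ v, ENNReal.ofReal (Real.exp (θ * (‖v‖ ^ 2) ^ p)) ∂μ :=
        lintegral_const_mul' _ _ ENNReal.ofReal_ne_top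
    _ < ∞ := ENNReal.mul_lt_top ENNReal.ofReal_lt_top h

/-- Bernoulli: exp(lz) ≤ 1 + l(exp z − 1) for 0 ≤ l ≤ 1. A small rate brings the moment near the
mass, however large it was at the rate θ'. -/
theorem lintegral_exp_mul_le {f : Vel d → ℝ} (hf : ∀ v, 0 ≤ f v) {μ : Measure (Vel d)} {l θ' : ℝ}
    (hl : 0 ≤ l) (hl1 : l ≤ 1) (hθ : θ ≤ l * θ') :
    ∫⁻ v, ENNReal.ofReal (Real.exp (θ * f v)) ∂μ ≤
      μ univ + ENNReal.ofReal l * ∫⁻ v, ENNReal.ofReal (Real.exp (θ' * f v)) ∂μ := by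
  rw [← lintegral_const_mul' _ _ ENNReal.ofReal_ne_top, ← lintegral_one, ← lintegral_add_left measurable_const]
  refine lintegral_mono fun v => ?_
  rw [← ENNReal.ofReal_mul hl, ← ENNReal.ofReal_one, ← ENNReal.ofReal_add zero_le_one (by positivity)]
  refine ENNReal.ofReal_le_ofReal ?_
  have h1 := rpow_one_add_le_one_add_mul_self (s := Real.exp (θ' * f v) - 1)
    (by linarith [Real.exp_pos (θ' * f v)]) hl hl1
  rw [add_sub_cancel, ← Real.exp_mul] at h1
  have h2 : Real.exp (θ * f v) ≤ Real.exp (θ' * f v * l) := by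
    rw [Real.exp_le_exp]
    nlinarith [hf v]
  nlinarith

set_option maxHeartbeats 400000 in
/-- Propagation of exponential moments, positive mass. -/
theorem exists_lintegral_exp_le_of_initial (hd : 2 ≤ d) (hγ₀ : 0 < γ) (hγ₁ : γ ≤ 1) (hb : IsAngularKernel d b)
    (hA : NonCutoff d b 2) (hAq : NonCutoff d b (2 * q)) (hp : 0 < p) (hp1 : p < 1) (hq : 0 < q)
    (hq1 : q ≤ 1) (hqp : (1 + q) * p ≤ 1) {m E : ℝ} (hm : 0 < m) (hE : 0 ≤ E) {θ₁ : ℝ} (hθ₁ : 0 < θ₁) (M₁ : ℝ) :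
    ∃ N θ : ℝ, 0 < N ∧ 0 < θ ∧ ∀ F : ℝ → Measure (Vel d), IsWeakSolution γ b F →
      (mass (F 0)).toReal = m → (energy (F 0)).toReal = E →
      ∫⁻ v, ENNReal.ofReal (Real.exp (θ₁ * (‖v‖ ^ 2) ^ p)) ∂(F 0) ≤ ENNReal.ofReal M₁ → ∀ t, 0 ≤ t →
        ∫⁻ v, ENNReal.ofReal (Real.exp (θ * (‖v‖ ^ 2) ^ p)) ∂(F t) ≤ ENNReal.ofReal N := by
  obtain ⟨K, hK, hKp⟩ := exists_convexity_shift hp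
  obtain ⟨c, hc, H⟩ := exists_integral_collWeight_truncExp_le hd hγ₀ hγ₁ hb hA hAq hp hp1 hq hq1 hqp hK hKp hm hE
  set L := Real.exp (K ^ p + 1) with hL
  have hL0 : 0 < L := Real.exp_pos _
  set N := 2 * m * L with hN
  have hN0 : 0 < N := by positivity
  obtain ⟨C, n₀, hC, hn₀, H⟩ := H (c / (2 * N)) (by positivity)
  -- Beyond the speed ρ the weight ⟨v⟩^γ is at least 4C/c + 1, enough for cΛ/2 to beat CM on the
  -- barrier.
  set ρ := (4 * C / c + 1) ^ (1 / γ) with hρ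
  have hρ0 : 0 < ρ := by positivity
  have hργ : ρ ^ γ = 4 * C / c + 1 := by
    rw [hρ, ← Real.rpow_mul (by positivity), one_div_mul_cancel hγ₀.ne', Real.rpow_one]
  set l := min 1 (m / max M₁ 1) with hl
  have hM1 : 0 < max M₁ 1 := by positivity
  have hl0 : 0 < l := by positivity
  -- Besides θ ≤ 1: θ|v|^{2p} ≤ 1 for |v| ≤ ρ, so that the weight is at most L there, and θ ≤ lθ₁,
  -- which with l·max(M₁, 1) ≤ m puts the initial exponential moment below 2m.
  set θ := min 1 (min ((ρ ^ 2) ^ p)⁻¹ (l * θ₁)) with hθ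
  have hθ0 : 0 < θ := by positivity
  have hθ1 : θ ≤ 1 := min_le_left _ _
  have hθρ : θ * (ρ ^ 2) ^ p ≤ 1 := by
    rw [← le_div_iff₀ (by positivity), one_div]
    exact (min_le_right _ _).trans (min_le_left _ _)
  have hθl : θ ≤ l * θ₁ := (min_le_right _ _).trans (min_le_right _ _)
  refine ⟨N, θ, hN0, hθ0, ?_⟩
  intro F' h' hmF' hEF' hI' t ht
  obtain ⟨h, hF⟩ := h'.measurable_max
  set F : ℝ → Measure (Vel d) := fun t => F' (max t 0) with hFdef
  have hF0 : F 0 = F' 0 := by simp [hFdef]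
  rw [← hF0] at hmF' hEF' hI'
  have hFt : F t = F' t := by simp [hFdef, ht]
  rw [← hFt]
  have hm' : mass (F 0) ≠ 0 := fun h0 => by simp [h0] at hmF'; linarith
  have hmu : (F 0) univ = ENNReal.ofReal m := by rw [← hmF', ENNReal.ofReal_toReal h.mass_lt_top.ne, mass]
  have hM : ∀ a, 0 ≤ a → ∃ K : ℝ≥0∞, K < ∞ ∧ ∀ r ∈ Icc 0 (t + 1), normMoment a (F r) ≤ K := fun a ha =>
    h.exists_normMoment_le_of_initial hd hγ₀ hγ₁ hb hA hF hm' (fun a ha =>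
      normMoment_lt_top_of_exp hp hθ₁ h.mass_lt_top (hI'.trans_lt ENNReal.ofReal_lt_top) ha) ha
  have hint : ∀ n, 2 ≤ n → ∀ r ∈ Icc 0 (t + 1), Integrable (expTest p K n θ) (F r) ∧
      Integrable (fun v => velWeight γ v * expTest p K n θ v) (F r) := fun n hn r hr =>
    h.integrable_expTest hp hp1.le hn hK hγ₀ hγ₁ le_rfl hM hθ0.le hθ1 hr
  have hinit : ∫⁻ v, ENNReal.ofReal (Real.exp (θ * (‖v‖ ^ 2) ^ p)) ∂(F 0) ≤ ENNReal.ofReal (2 * m) := by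
    refine (lintegral_exp_mul_le (f := fun v => (‖v‖ ^ 2) ^ p) (fun v => by positivity) hl0.le (min_le_left _ _) hθl).trans ?_
    rw [hmu, two_mul, ENNReal.ofReal_add hm.le hm.le]
    refine add_le_add le_rfl ?_
    calc ENNReal.ofReal l * ∫⁻ v, ENNReal.ofReal (Real.exp (θ₁ * (‖v‖ ^ 2) ^ p)) ∂(F 0)
        ≤ ENNReal.ofReal l * ENNReal.ofReal (max M₁ 1) := by
          gcongr
          exact hI'.trans (ENNReal.ofReal_le_ofReal (le_max_left _ _))
      _ = ENNReal.ofReal (l * max M₁ 1) := (ENNReal.ofReal_mul hl0.le).symm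
      _ ≤ ENNReal.ofReal m := by
          refine ENNReal.ofReal_le_ofReal ?_
          rw [← le_div_iff₀ hM1]
          exact min_le_right _ _
  -- The weight is at most L at slow velocities, and ⟨v⟩^γ ≥ ρ^γ at fast ones; integrated, this
  -- reads Λ ≥ ρ^γ(M − mL).
  have hlow : ∀ (n : ℕ) (v : Vel d), ρ ^ γ * (expTest p K n θ v - L) ≤ velWeight γ v * expTest p K n θ v := by
    intro n v
    have h1 := one_le_expTest (p := p) (n := n) hK hθ0.le v
    rcases le_or_gt ρ ‖v‖ with hv | hv
    · have h2 : ρ ^ γ ≤ velWeight γ v := (Real.rpow_le_rpow hρ0.le hv hγ₀.le).trans (norm_rpow_le_velWeight hγ₀ v)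
      calc ρ ^ γ * (expTest p K n θ v - L) ≤ ρ ^ γ * expTest p K n θ v := by
            gcongr; linarith
        _ ≤ _ := by gcongr
    · have h2 : expTest p K n θ v ≤ L := by
        refine (expTest_le_exp hp hp1.le hK hθ0.le v).trans (Real.exp_le_exp.2 ?_)
        have h3 : θ * (‖v‖ ^ 2) ^ p ≤ θ * (ρ ^ 2) ^ p := by gcongr
        linarith
      have h3 : 0 ≤ velWeight γ v * expTest p K n θ v :=
        mul_nonneg (by linarith [one_le_velWeight hγ₀ v]) (by linarith)
      have h4 : 0 ≤ ρ ^ γ := by positivity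
      nlinarith
  have key : ∀ n, n₀ ≤ n → ∫ v, expTest p K n θ v ∂(F t) ≤ N := by
    intro n hn
    have hn2 := hn₀.trans hn
    obtain ⟨hc1, hs⟩ := h.expTest_slope_lt (n := n) hd hγ₀ hγ₁ hb hA hp hp1.le hn2 hK (t₀ := 0) (T := t + 1) (θ₀ := θ) (α := 0)
      (c := c) (C := C) (η := c / (2 * N)) le_rfl hM hθ0.le le_rfl
      (by rwa [zero_mul, add_zero]) (fun h => absurd rfl h)
      (fun κ hκ hκ1 r hr h1 h2 => by
        have := h.isFiniteMeasure hr.1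
        exact H n κ (F r) hn hκ hκ1 ((h.real_univ hr.1).trans hmF') (h.integrable_normSq hr.1)
          ((h.integral_normSq hr.1).trans hEF') h1 h2)
    simp only [zero_mul, add_zero, zero_sub] at hc1 hs
    -- The barrier is the constant N = 2mL. Where M = N one has Λ ≥ (4C/c + 1)N/2, so that −cΛ + CN
    -- + ηΛN = −cΛ/2 + CN ≤ −cN/4 < 0.
    refine image_le_of_liminf_slope_right_lt_deriv_boundary' hc1 hs (B := fun _ => N)
      (B' := fun _ => 0) ?_ continuousOn_const (fun x _ => hasDerivWithinAt_const _ _ _) (fun x hx hxB => ?_)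
      ⟨ht, by linarith⟩
    · have h0 := (hint n hn2 0 ⟨le_rfl, by linarith⟩).1
      have h1 : ENNReal.ofReal (∫ v, expTest p K n θ v ∂(F 0)) ≤ ENNReal.ofReal N := by
        rw [ofReal_integral_eq_lintegral_ofReal h0
          (Filter.Eventually.of_forall fun v => zero_le_one.trans (one_le_expTest hK hθ0.le v))]
        calc ∫⁻ v, ENNReal.ofReal (expTest p K n θ v) ∂(F 0)
            ≤ ∫⁻ v, ENNReal.ofReal (Real.exp (K ^ p)) * ENNReal.ofReal (Real.exp (θ * (‖v‖ ^ 2) ^ p)) ∂(F 0) := by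
              refine lintegral_mono fun v => ?_
              rw [← ENNReal.ofReal_mul (by positivity), ← Real.exp_add]
              exact ENNReal.ofReal_le_ofReal (expTest_le_exp hp hp1.le hK hθ0.le v)
          _ ≤ ENNReal.ofReal (Real.exp (K ^ p)) * ENNReal.ofReal (2 * m) := by
              rw [lintegral_const_mul' _ _ ENNReal.ofReal_ne_top]
              gcongr
          _ = ENNReal.ofReal (Real.exp (K ^ p) * (2 * m)) := (ENNReal.ofReal_mul (by positivity)).symm
          _ ≤ ENNReal.ofReal N := by
              refine ENNReal.ofReal_le_ofReal ?_
              rw [hN, hL, mul_comm]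
              gcongr
              linarith
      exact (ENNReal.ofReal_le_ofReal_iff hN0.le).1 h1
    · have hx' : x ∈ Icc 0 (t + 1) := ⟨hx.1, hx.2.le⟩
      obtain ⟨hi1, hi2⟩ := hint n hn2 x hx'
      have := h.isFiniteMeasure hx.1
      have h1 : ρ ^ γ * (∫ v, expTest p K n θ v ∂(F x) - m * L) ≤ ∫ v, velWeight γ v * expTest p K n θ v ∂(F x) := by
        have h2 : ∫ v, ρ ^ γ * (expTest p K n θ v - L) ∂(F x) = ρ ^ γ * (∫ v, expTest p K n θ v ∂(F x) - m * L) := by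
          rw [integral_const_mul, integral_sub hi1 (integrable_const _), integral_const, smul_eq_mul, h.real_univ hx.1, hmF']
        rw [← h2]
        exact integral_mono ((hi1.sub (integrable_const _)).const_mul _) hi2 (hlow n)
      rw [hxB, hργ] at h1
      rw [hxB]
      set Λ := ∫ v, velWeight γ v * expTest p K n θ v ∂(F x)
      have h2 : N - m * L = N / 2 := by rw [hN]; ring
      rw [h2] at h1
      have h4 : c / (2 * N) * (Λ * N) = c / 2 * Λ := by field_simp
      rw [h4]
      have h5 : c / 2 * ((4 * C / c + 1) * (N / 2)) ≤ c / 2 * Λ := by gcongr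
      have h6 : c / 2 * ((4 * C / c + 1) * (N / 2)) = C * N + c * N / 4 := by
        field_simp
        norm_num
      have h7 : 0 < c * N := by positivity
      linarith
  refine le_trans (lintegral_mono fun v => ENNReal.ofReal_le_ofReal ?_)
    (lintegral_exp_le_of_expTest (p := p) (n₀ := n₀) hK hθ0.le fun n hn =>
      ⟨(hint n (hn₀.trans hn) t ⟨ht, by linarith⟩).1, key n hn⟩)
  exact exp_mul_rpow_le hp (by linarith) hθ0.le v

end expMoments

/-! ### Mittag-Leffler functions and exponentials -/

section mittagLeffler
variable {d : ℕ} {a x y : ℝ}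

theorem rpow_le_one_add_pow {u : ℝ} {k : ℕ} (hy : 0 ≤ y) (hu : 0 ≤ u) (huk : u ≤ k) : y ^ u ≤ 1 + y ^ k := by
  rcases le_total y 1 with h | h
  · linarith [Real.rpow_le_one hy h hu, pow_nonneg hy k]
  · have := Real.rpow_le_rpow_of_exponent_le h huk
    rw [Real.rpow_natCast] at this
    linarith

theorem Gamma_mono {u w : ℝ} (hu : 2 ≤ u) (huw : u ≤ w) : Real.Gamma u ≤ Real.Gamma w :=
  Real.Gamma_strictMonoOn_Ici.monotoneOn hu (hu.trans huw) huw

/-- Γ(aq + 1) ≥ k! for k = ⌊aq⌋, while y^{k+1} ≤ (k + 1)! e^y. The spare factor k + 1 ≤ 2^{aq} is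
beaten by the 4^{−aq} that the constant 4 in y provides, and a geometric series remains. -/
theorem mittagLeffler_term_le (ha : 1 ≤ a) (hx : 0 ≤ x) (q : ℕ) :
    x ^ q / Real.Gamma (a * q + 1) ≤ 2 * Real.exp (4 * x ^ (1 / a)) * (1 / 2) ^ q := by
  have ha0 : 0 < a := by linarith
  set y := 4 * x ^ (1 / a) with hy
  have hy0 : 0 ≤ y := by positivity
  set k := ⌊a * q⌋₊ with hk
  have hkq : (k : ℝ) ≤ a * q := Nat.floor_le (by positivity)
  have hkq' : a * q ≤ (k + 1 : ℕ) := by push_cast; exact (Nat.lt_floor_add_one _).le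
  have hG0 : 0 < Real.Gamma (a * q + 1) := Real.Gamma_pos_of_pos (by positivity)
  have hG : (k.factorial : ℝ) ≤ Real.Gamma (a * q + 1) := by
    rcases Nat.eq_zero_or_pos q with rfl | hq
    · simp [hk]
    · have hq1 : (1 : ℝ) ≤ q := by exact_mod_cast hq
      have hk1 : 1 ≤ k := Nat.le_floor (by push_cast; nlinarith)
      have hk1' : (1 : ℝ) ≤ k := by exact_mod_cast hk1
      rw [← Real.Gamma_nat_eq_factorial]
      exact Gamma_mono (by linarith) (by linarith)
  have hxy : x ^ q = y ^ (a * q) * (1 / 4) ^ (a * q) := by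
    rw [← Real.mul_rpow hy0 (by norm_num), Real.rpow_mul (by positivity)]
    have : y * (1 / 4) = x ^ (1 / a) := by rw [hy]; ring
    rw [this, ← Real.rpow_mul hx, one_div_mul_cancel ha0.ne', Real.rpow_one, Real.rpow_natCast]
  have hy1 : y ^ (a * q) ≤ 1 + y ^ (k + 1) := rpow_le_one_add_pow hy0 (by positivity) hkq'
  have hfac : (0 : ℝ) < k.factorial := by positivity
  have h1 : y ^ (k + 1) ≤ (k + 1) * k.factorial * Real.exp y := by
    have := Real.pow_div_factorial_le_exp y hy0 (k + 1)
    rw [div_le_iff₀ (by positivity), Nat.factorial_succ] at this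
    push_cast at this
    linarith
  have h2 : (k : ℝ) + 1 ≤ 2 ^ (a * q) := by
    calc (k : ℝ) + 1 ≤ (2 : ℝ) ^ k := by exact_mod_cast Nat.lt_two_pow_self (n := k)
      _ = (2 : ℝ) ^ (k : ℝ) := (Real.rpow_natCast _ _).symm
      _ ≤ _ := Real.rpow_le_rpow_of_exponent_le (by norm_num) hkq
  have he : 1 ≤ Real.exp y := Real.one_le_exp hy0
  have h3 : y ^ (a * q) / Real.Gamma (a * q + 1) ≤ 2 * Real.exp y * 2 ^ (a * q) := by
    calc y ^ (a * q) / Real.Gamma (a * q + 1) ≤ (1 + y ^ (k + 1)) / k.factorial := by gcongr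
      _ ≤ (k.factorial + (k + 1) * k.factorial * Real.exp y) / k.factorial := by
          gcongr
          exact_mod_cast Nat.one_le_iff_ne_zero.2 (Nat.factorial_ne_zero k)
      _ = 1 + (k + 1) * Real.exp y := by field_simp
      _ ≤ 2 * Real.exp y * ((k : ℝ) + 1) := by nlinarith [mul_nonneg (Nat.cast_nonneg (α := ℝ) k) (by linarith : 0 ≤ Real.exp y)]
      _ ≤ _ := by gcongr
  calc x ^ q / Real.Gamma (a * q + 1) = y ^ (a * q) / Real.Gamma (a * q + 1) * (1 / 4) ^ (a * q) := by rw [hxy]; ring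
    _ ≤ 2 * Real.exp y * 2 ^ (a * q) * (1 / 4) ^ (a * q) := by gcongr
    _ = 2 * Real.exp y * (1 / 2) ^ (a * q) := by
        rw [mul_assoc (2 * Real.exp y), ← Real.mul_rpow (by norm_num) (by norm_num)]
        norm_num
    _ ≤ 2 * Real.exp y * (1 / 2) ^ q := by
        refine mul_le_mul_of_nonneg_left ?_ (by positivity)
        rw [← Real.rpow_natCast]
        exact Real.rpow_le_rpow_of_exponent_ge (by norm_num) (by norm_num) (le_mul_of_one_le_left (by positivity) ha)

theorem mittagLeffler_term_nonneg (ha : 1 ≤ a) (hx : 0 ≤ x) (q : ℕ) : 0 ≤ x ^ q / Real.Gamma (a * q + 1) :=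
  div_nonneg (pow_nonneg hx _) (Real.Gamma_pos_of_pos (by positivity)).le

theorem summable_mittagLeffler (ha : 1 ≤ a) (hx : 0 ≤ x) : Summable fun q : ℕ => x ^ q / Real.Gamma (a * q + 1) :=
  Summable.of_nonneg_of_le (mittagLeffler_term_nonneg ha hx) (mittagLeffler_term_le ha hx)
    (summable_geometric_two.mul_left _)

theorem mittagLeffler_le_exp (ha : 1 ≤ a) (hx : 0 ≤ x) : mittagLeffler a x ≤ 4 * Real.exp (4 * x ^ (1 / a)) := by
  calc mittagLeffler a x ≤ ∑' q : ℕ, 2 * Real.exp (4 * x ^ (1 / a)) * (1 / 2) ^ q :=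
        (summable_mittagLeffler ha hx).tsum_le_tsum (mittagLeffler_term_le ha hx) (summable_geometric_two.mul_left _)
    _ = _ := by rw [tsum_mul_left, tsum_geometric_two]; ring

theorem one_le_mittagLeffler (ha : 1 ≤ a) (hx : 0 ≤ x) : 1 ≤ mittagLeffler a x := by
  have := (summable_mittagLeffler ha hx).le_tsum 0 fun q _ => mittagLeffler_term_nonneg ha hx q
  simpa [mittagLeffler] using this

/-- The k-th term of the exponential series is compared with the Mittag-Leffler term of index j =
⌈k/a⌉. There aj ≤ k + N with N ≥ a, so Γ(aj + 1) ≤ (k + N)! ≤ 2^{k+N} k! N!, and the rate 1/4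
absorbs 2^k. -/
theorem exists_exp_le_mittagLeffler (ha : 1 ≤ a) :
    ∃ C : ℝ, 0 < C ∧ ∀ x, 0 ≤ x → Real.exp (1 / 4 * x ^ (1 / a)) ≤ C * mittagLeffler a x := by
  have ha0 : 0 < a := by linarith
  obtain ⟨N, hN⟩ := exists_nat_ge a
  refine ⟨Real.exp (1 / 4) + 2 * (2 ^ N * N.factorial), by positivity, fun x hx => ?_⟩
  have hE := one_le_mittagLeffler ha hx
  set y := x ^ (1 / a) with hy
  have hy0 : 0 ≤ y := by positivity
  have hterm : ∀ k : ℕ, (1 / 4 * y) ^ k / k.factorial ≤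
      (1 / 4) ^ k / k.factorial + 2 ^ N * N.factorial * mittagLeffler a x * (1 / 2) ^ k := by
    intro k
    set j := ⌈(k : ℝ) / a⌉₊ with hj
    have hj1 : (k : ℝ) / a ≤ j := Nat.le_ceil _
    have hj2 : a * j ≤ k + N := by
      have := (Nat.ceil_lt_add_one (a := (k : ℝ) / a) (by positivity)).le
      calc a * j ≤ a * (k / a + 1) := by gcongr
        _ = k + a := by field_simp
        _ ≤ _ := by linarith
    have hG0 : 0 < Real.Gamma (a * j + 1) := Real.Gamma_pos_of_pos (by positivity)
    have hG : Real.Gamma (a * j + 1) ≤ 2 ^ (k + N) * (k.factorial * N.factorial) := by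
      have h1 : Real.Gamma (a * j + 1) ≤ (k + N).factorial := by
        rcases Nat.eq_zero_or_pos j with h0 | h0
        · rw [h0]
          simp only [Nat.cast_zero, mul_zero, zero_add, Real.Gamma_one]
          exact_mod_cast Nat.one_le_iff_ne_zero.2 (Nat.factorial_ne_zero _)
        · have h0' : (1 : ℝ) ≤ j := by exact_mod_cast h0
          rw [← Real.Gamma_nat_eq_factorial]
          push_cast
          exact Gamma_mono (by nlinarith) (by linarith)
      refine h1.trans ?_
      have h2 : (k + N).factorial ≤ 2 ^ (k + N) * (k.factorial * N.factorial) := by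
        rw [← Nat.add_choose_mul_factorial_mul_factorial k N, mul_assoc]
        exact Nat.mul_le_mul_right _ (Nat.choose_le_two_pow _ _)
      exact_mod_cast h2
    have hyk : y ^ k ≤ 1 + x ^ j := by
      have : y ^ k = x ^ ((k : ℝ) / a) := by
        rw [hy, ← Real.rpow_natCast, ← Real.rpow_mul hx]
        congr 1; ring
      rw [this]
      exact rpow_le_one_add_pow hx (by positivity) hj1
    have hxj : x ^ j ≤ Real.Gamma (a * j + 1) * mittagLeffler a x := by
      have := (summable_mittagLeffler ha hx).le_tsum j fun q _ => mittagLeffler_term_nonneg ha hx q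
      rw [div_le_iff₀ hG0] at this
      exact this.trans_eq (mul_comm _ _)
    have hfac : (0 : ℝ) < k.factorial := by positivity
    calc (1 / 4 * y) ^ k / k.factorial = (1 / 4) ^ k * y ^ k / k.factorial := by rw [mul_pow]
      _ ≤ (1 / 4) ^ k * (1 + 2 ^ (k + N) * (k.factorial * N.factorial) * mittagLeffler a x) / k.factorial := by
          gcongr
          refine hyk.trans (add_le_add le_rfl (hxj.trans ?_))
          gcongr
      _ = (1 / 4) ^ k / k.factorial + 2 ^ N * N.factorial * mittagLeffler a x * ((1 / 4) ^ k * 2 ^ k) := by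
          rw [pow_add]; field_simp
      _ = _ := by rw [← mul_pow]; norm_num
  have hs1 := Real.summable_pow_div_factorial (1 / 4)
  have hs2 := (summable_geometric_two.mul_left (2 ^ N * N.factorial * mittagLeffler a x))
  have hexp : ∀ z : ℝ, Real.exp z = ∑' k : ℕ, z ^ k / k.factorial := fun z => by
    rw [Real.exp_eq_exp_ℝ, NormedSpace.exp_eq_tsum_div]
  calc Real.exp (1 / 4 * y) = ∑' k : ℕ, (1 / 4 * y) ^ k / k.factorial := hexp _
    _ ≤ ∑' k : ℕ, ((1 / 4) ^ k / k.factorial + 2 ^ N * N.factorial * mittagLeffler a x * (1 / 2) ^ k) :=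
        (Real.summable_pow_div_factorial _).tsum_le_tsum hterm (hs1.add hs2)
    _ = Real.exp (1 / 4) + 2 ^ N * N.factorial * mittagLeffler a x * 2 := by
        rw [hs1.tsum_add hs2, ← hexp, tsum_mul_left, tsum_geometric_two]
    _ ≤ _ := by nlinarith [Real.exp_pos (1 / 4)]

theorem bracket_sq (v : Vel d) : bracket v ^ 2 = 1 + ‖v‖ ^ 2 := Real.sq_sqrt (by positivity)

theorem exists_lintegral_exp_le_mlMoment {s α : ℝ} (hs : 0 < s) (hs2 : s < 2) (hα : 0 < α) :
    ∃ C : ℝ, 0 < C ∧ ∀ μ : Measure (Vel d),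
      ∫⁻ v, ENNReal.ofReal (Real.exp (α / 4 * (‖v‖ ^ 2) ^ (s / 2))) ∂μ ≤ ENNReal.ofReal C * mlMoment s α μ := by
  obtain ⟨C, hC, H⟩ := exists_exp_le_mittagLeffler (a := 2 / s) (by rw [le_div_iff₀ hs]; linarith)
  refine ⟨C, hC, fun μ => ?_⟩
  rw [mlMoment, ← lintegral_const_mul' _ _ ENNReal.ofReal_ne_top]
  refine lintegral_mono fun v => ?_
  rw [← ENNReal.ofReal_mul hC.le]
  refine ENNReal.ofReal_le_ofReal (le_trans (Real.exp_le_exp.2 ?_) (H _ (by positivity)))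
  rw [bracket_sq, one_div_div, Real.mul_rpow (by positivity) (by positivity), ← Real.rpow_mul hα.le,
    div_mul_div_cancel₀' (by norm_num), div_self hs.ne', Real.rpow_one]
  have : (‖v‖ ^ 2) ^ (s / 2) ≤ (1 + ‖v‖ ^ 2) ^ (s / 2) := by gcongr; linarith
  nlinarith

theorem mlMoment_le_lintegral_exp {s α : ℝ} (hs : 0 < s) (hs2 : s < 2) (hα : 0 < α) (μ : Measure (Vel d)) :
    mlMoment s α μ ≤ ENNReal.ofReal (4 * Real.exp (4 * α)) *
      ∫⁻ v, ENNReal.ofReal (Real.exp (4 * α * (‖v‖ ^ 2) ^ (s / 2))) ∂μ := by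
  rw [mlMoment, ← lintegral_const_mul' _ _ ENNReal.ofReal_ne_top]
  refine lintegral_mono fun v => ?_
  rw [← ENNReal.ofReal_mul (by positivity)]
  refine ENNReal.ofReal_le_ofReal ((mittagLeffler_le_exp (by rw [le_div_iff₀ hs]; linarith) (by positivity)).trans ?_)
  rw [mul_assoc, ← Real.exp_add]
  gcongr
  rw [bracket_sq, one_div_div, Real.mul_rpow (by positivity) (by positivity), ← Real.rpow_mul hα.le,
    div_mul_div_cancel₀' (by norm_num), div_self hs.ne', Real.rpow_one]
  have : (1 + ‖v‖ ^ 2) ^ (s / 2) ≤ 1 ^ (s / 2) + (‖v‖ ^ 2) ^ (s / 2) :=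
    Real.rpow_add_le_add_rpow zero_le_one (by positivity) (by positivity) (by linarith)
  rw [Real.one_rpow] at this
  nlinarith

end mittagLeffler

end Boltzmann

/-! ### Conclusion: vanishing mass and the choice of exponents. -/

theorem theorem2p1 (d : ℕ) (hd : 2 ≤ d) (γ : ℝ) (hγ₀ : 0 < γ) (hγ₁ : γ ≤ 1)
    (b : ℝ → ℝ) (hb : IsAngularKernel d b) :
    -- (a) generation of exponential moments
    (NonCutoff d b 2 → ∀ m E : ℝ≥0, ∃ C α : ℝ, 0 < C ∧ 0 < α ∧
      ∀ F : ℝ → Measure (Vel d), IsWeakSolution γ b F → mass (F 0) = m → energy (F 0) = E →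
        ∀ t : ℝ, 0 ≤ t →
          ∫⁻ v, ENNReal.ofReal (Real.exp (α * min t 1 * ‖v‖ ^ γ)) ∂(F t) ≤ ENNReal.ofReal C) ∧
    -- (b) propagation of Mittag-Leffler moments
    (∀ s : ℝ, 0 < s → s < 2 → NonCutoff d b (if s ≤ 1 then 2 else 4 / s - 2) →
      ∀ m E : ℝ≥0, ∀ α₀ M₀ : ℝ, 0 < α₀ → ∃ C α : ℝ, 0 < C ∧ 0 < α ∧
        ∀ F : ℝ → Measure (Vel d), IsWeakSolution γ b F → mass (F 0) = m → energy (F 0) = E →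
          mlMoment s α₀ (F 0) < ENNReal.ofReal M₀ →
          ∀ t : ℝ, 0 ≤ t → mlMoment s α (F t) < ENNReal.ofReal C) := by
  -- The estimates require m > 0; for m = 0 the solution is the zero measure at all times.
  have zero : ∀ F : ℝ → Measure (Vel d), IsWeakSolution γ b F → mass (F 0) = 0 → ∀ t, 0 ≤ t → F t = 0 :=
    fun F h h0 t ht => Measure.measure_univ_eq_zero.1 ((h.mass_eq t ht).trans h0)
  refine ⟨fun hA m E => ?_, fun s hs hs2 hA m E α₀ M₀ hα₀ => ?_⟩
  · rcases eq_or_ne m 0 with rfl | hm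
    · refine ⟨1, 1, one_pos, one_pos, fun F h hmF _ t ht => ?_⟩
      simp [zero F h (by simpa using hmF) t ht]
    · obtain ⟨N, α, hN, hα, H⟩ := exists_lintegral_exp_le hd hγ₀ hγ₁ hb hA (m := m) (E := E)
        (NNReal.coe_pos.2 (pos_iff_ne_zero.2 hm)) E.coe_nonneg
      exact ⟨N, α, hN, hα, fun F h hmF hEF => H F h (by simp [hmF]) (by simp [hEF])⟩
  · rcases eq_or_ne m 0 with rfl | hm
    · refine ⟨1, 1, one_pos, one_pos, fun F h hmF _ _ t ht => ?_⟩
      simp [zero F h (by simpa using hmF) t ht, mlMoment]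
    -- p = s/2 and q = β/2. For s ≤ 1 the value q = 1 satisfies (1 + q)p ≤ 1; for s > 1, q = 2/s − 1
    -- is the value with equality, and β < 2 makes A_2 finite as well.
    · obtain ⟨q, hq, hq1, hqs, hA2, hAq⟩ : ∃ q : ℝ, 0 < q ∧ q ≤ 1 ∧ (1 + q) * (s / 2) ≤ 1 ∧ NonCutoff d b 2 ∧
          NonCutoff d b (2 * q) := by
        rcases le_or_gt s 1 with h1 | h1
        · rw [if_pos h1] at hA
          exact ⟨1, one_pos, le_rfl, by linarith, hA, by rwa [mul_one]⟩
        · rw [if_neg (not_le.2 h1)] at hA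
          have h3 : 1 < 2 / s := (one_lt_div hs).2 hs2
          have h4 : 2 / s < 2 := by rw [div_lt_iff₀ hs]; linarith
          have h5 : 4 / s - 2 = 2 * (2 / s - 1) := by ring
          rw [h5] at hA
          refine ⟨2 / s - 1, by linarith, by linarith, le_of_eq ?_, hA.mono hb (by linarith) (by linarith), hA⟩
          rw [add_sub_cancel, div_mul_div_cancel₀' (by norm_num), div_self hs.ne']
      obtain ⟨C, hC, hCμ⟩ := exists_lintegral_exp_le_mlMoment (d := d) hs hs2 hα₀
      obtain ⟨N, θ, hN, hθ, H⟩ := exists_lintegral_exp_le_of_initial hd hγ₀ hγ₁ hb hA2 hAq (p := s / 2) (by positivity)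
        (by linarith) hq hq1 hqs (m := m) (E := E) (NNReal.coe_pos.2 (pos_iff_ne_zero.2 hm)) E.coe_nonneg
        (θ₁ := α₀ / 4) (by positivity) (C * M₀)
      -- The comparison with the exponential multiplies the rate by 4, whence θ/4; the summand 1
      -- makes the final inequality strict.
      refine ⟨4 * Real.exp θ * N + 1, θ / 4, by positivity, by positivity, fun F h hmF hEF hI t ht => ?_⟩
      have h1 := H F h (by simp [hmF]) (by simp [hEF]) ((hCμ _).trans (by
        rw [ENNReal.ofReal_mul hC.le]
        gcongr)) t ht
      have h2 := mlMoment_le_lintegral_exp hs hs2 (α := θ / 4) (by positivity) (F t)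
      rw [mul_div_cancel₀ θ (by norm_num : (4 : ℝ) ≠ 0)] at h2
      calc mlMoment s (θ / 4) (F t) ≤ ENNReal.ofReal (4 * Real.exp θ) * ENNReal.ofReal N := h2.trans (by gcongr)
        _ = ENNReal.ofReal (4 * Real.exp θ * N) := (ENNReal.ofReal_mul (by positivity)).symm
        _ < _ := (ENNReal.ofReal_lt_ofReal_iff (by positivity)).2 (by linarith)
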